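/- **Conventions.** A *gate set* $\mathcal G$ is a finite set of unitary gates on finitely many qubits with algebraic entries, possibly together with the preparation of a qubit in state $|0\rangle$ and the single-qubit trace. An $(a,b)$-circuit built from $\mathcal G$ is a finite sequence of gates of $\mathcal G$, each applied to chosen wires (the identity acting on the others), taking $a$ qubits to $b$ qubits; it is identified with the channel it implements. A circuit family $(C_n)_{n\in\mathbb N}$ over one gate set is *polynomial-time* (resp. *exponential-time*) if there are a Turing machine and a polynomial $p$ such that the machine outputs, on input $1^n$, a description of $C_n$ within $p(n)$ (resp. $2^{p(n)}$) steps. Unless a gate set is named, circuits are built from state preparation, single-qubit trace, Toffoli, Hadamard and the phase-shift gate $\mathrm{diag}(1,i)$. A function $\eta:\mathbb N\to\mathbb R$ is *negligible* if for every $c\in\mathbb N$, $\eta(n)\le n^{-c}$ for all sufficiently large $n$. A bit string $x$ is identified with $|x\rangle\langle x|$, and $x\cdot y$ is the inner product modulo $2$. **Ingenerable sequences.** For $\ell:\mathbb N\to\mathbb N$, a sequence $(s_n)_{n\in\mathbb N}$ with $s_n\in\{0,1\}^{\ell(n)}$ is *exponential-time ingenerable* if for every gate set $\mathcal G$ there is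 a polynomial $p_{\mathcal G}$ such that for every exponential-time family of $(0,\ell(n))$-circuits $C_n$ built from $\mathcal G$, $\langle s_n|C_n(\varepsilon)|s_n\rangle<p_{\mathcal G}(n)\,2^{-\ell(n)}$ for all but finitely many $n$. **Uncloneable advice.** For a promise problem $P=(P_0,P_1)$ (disjoint subsets of $\{0,1\}^*$), let $P^n_b=P_b\cap\{0,1\}^n$, $P^n=P_0^n\cup P_1^n$, and let $P(x)=b$ for $x\in P_b$. Whenever $P^n\neq\varnothing$, let $D_n$ be the distribution on $P^n$ with $\Pr[D_n=x]=k_n/|P_b^n|$ for $x\in P_b^n$, where $k_n=1$ if $P_0^n$ or $P_1^n$ is empty and $k_n=\frac12$ otherwise. A sequence of states $(\rho_n)_{n\in\mathbb N}$, with $\rho_n$ on $q(n)$ qubits and $q$ polynomially bounded, is *uncloneable advice* for $P$ if: 1. (*Correctness*) there are a polynomial-time family of $(q(n)+n,1)$-circuits $C_n$ and a negligible $\eta$ such that $\langle P(x)|C_{|x|}(\rho_{|x|}\otimes x)|P(x)\rangle\ge 1-\eta(|x|)$ for all $x\in P_0\cup P_1$; 2. (*Uncloneability*) for all $q_B,q_C:\mathbb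 N\to\mathbb N$ and all polynomial-time families $A,B,C$ of $(q(n),q_B(n)+q_C(n))$-, $(n+q_B(n),1)$- and $(q_C(n)+n,1)$-circuits, there is a negligible $\eta'$ such that for all $n$ with $P^n\ne\varnothing$, $$\mathop{\mathbb E}_{(x_B,x_C)\leftarrow D_n\times D_n}\langle P(x_B),P(x_C)|(B_n\otimes C_n)(x_B\otimes A_n(\rho_n)\otimes x_C)|P(x_B),P(x_C)\rangle\le\tfrac12+\eta'(n).$$ The class $\mathbf{neglQP}/\mathrm{upoly}$ consists of the promise problems that admit uncloneable advice. **Theorem.** Let $(s_\lambda)_{\lambda\in\mathbb N}$, $s_\lambda=(x_\lambda,\theta_\lambda)$ with $x_\lambda,\theta_\lambda\in\{0,1\}^\lambda$, be an exponential-time ingenerable $2\lambda$-sequence. For $b\in\{0,1\}$ let $$P_b=\bigcup_{\lambda\in\mathbb N}\{(\theta_\lambda,y): y\in\{0,1\}^\lambda,\ x_\lambda\cdot y=b\}.$$ Then the promise problem $P=(P_0,P_1)$ is in $\mathbf{neglQP}/\mathrm{upoly}$. Moreover, uncloneable advice for $P$ is given by the Wiesner states: $\rho_{2\lambda}=|x_\lambda^{\theta_\lambda}\rangle\langle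 x_\lambda^{\theta_\lambda}|$, where $|x^\theta\rangle=H^{\theta_1}|x_1\rangle\otimes\cdots\otimes H^{\theta_\lambda}|x_\lambda\rangle$, and $\rho_\nu$ the state on zero qubits for odd $\nu$. -/

import Mathlib

namespace QAdvice

open Filter Turing
open scoped ComplexOrder

noncomputable section

/-! ### Bit strings, states and operators on qubits -/

/-- `{0,1}^n`. -/
abbrev Bits (n : ℕ) : Type := Fin n → Bool

/-- Linear operators on `n` qubits, as matrices in the computational basis `|x⟩`, `x ∈ {0,1}^n`. -/
abbrev Op (n : ℕ) : Type := Matrix (Bits n) (Bits n) ℂ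

/-- The density operator `|x⟩⟨x|` of a bit string. -/
def proj {n : ℕ} (x : Bits n) : Op n := Matrix.single x x 1

/-- `⟨x| ρ |x⟩`, the probability of observing `x` when measuring `ρ` in the computational basis. -/
def prob {n : ℕ} (ρ : Op n) (x : Bits n) : ℝ := (ρ x x).re

/-- The tensor product of operators; the wires of `σ` come first. -/
def tensorOp {a b : ℕ} (σ : Op a) (τ : Op b) : Op (a + b) := Matrix.of fun x y =>
  σ (fun i => x (Fin.castAdd b i)) (fun i => y (Fin.castAdd b i)) *
    τ (fun i => x (Fin.natAdd a i)) (fun i => y (Fin.natAdd a i))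

/-- Transport of an operator along an equality of numbers of qubits. -/
def castOp {a b : ℕ} (h : a = b) (ρ : Op a) : Op b := Matrix.of fun x y =>
  ρ (fun i => x (Fin.cast h i)) (fun i => y (Fin.cast h i))

/-- The tensor product `Φ ⊗ Ψ` of two linear maps on operators, applied to `ρ`: expand `ρ` in the
matrix units `|i⟩⟨k| ⊗ |j⟩⟨l|` and map each of them to `Φ(|i⟩⟨k|) ⊗ Ψ(|j⟩⟨l|)`. -/
def tensorMap {a b c d : ℕ} (Φ : Op a →ₗ[ℂ] Op b) (Ψ : Op c →ₗ[ℂ] Op d) (ρ : Op (a + c)) :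
    Op (b + d) :=
  ∑ i : Bits a, ∑ j : Bits c, ∑ k : Bits a, ∑ l : Bits c,
    ρ (Fin.append i j) (Fin.append k l) •
      tensorOp (Φ (Matrix.single i k 1)) (Ψ (Matrix.single j l 1))

/-- A state (density operator) on some number of qubits. -/
structure QState where
  qubits : ℕ
  op : Op qubits
  posSemidef : op.PosSemidef
  trace_eq_one : op.trace = 1

/-! ### Gate sets and circuits -/

/-- A unitary gate on `arity` qubits with algebraic entries. -/
structure UnitaryGate where
  arity : ℕ
  mat : Matrix (Bits arity) (Bits arity) ℂ
  unitary : mat ∈ Matrix.unitaryGroup (Bits arity) ℂ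
  algebraic : ∀ x y, IsAlgebraic ℚ (mat x y)

/-- A gate set: finitely many unitary gates with algebraic entries, and possibly the preparation of
a qubit in the state `|0⟩` and the single-qubit trace. -/
structure GateSet where
  unitaries : List UnitaryGate
  hasPrep : Prop
  hasTrace : Prop

/-- The matrix on `n` qubits of a gate `U` acting on the wires `w 0, w 1, …` and as the identity on
all the other wires. -/
def onWires {k n : ℕ} (U : Matrix (Bits k) (Bits k) ℂ) (w : Fin k ↪ Fin n) : Op n :=
  Matrix.of fun x y => open Classical in
    if ∀ i, i ∉ Set.range w → x i = y i then U (fun j => x (w j)) (fun j => y (w j)) else 0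

/-- The channel `ρ ↦ U ρ U†`. -/
def conjMap {n : ℕ} (U : Op n) : Op n →ₗ[ℂ] Op n where
  toFun ρ := U * ρ * U.conjTranspose
  map_add' _ _ := by rw [Matrix.mul_add, Matrix.add_mul]
  map_smul' _ _ := by simp

/-- Insert, at position `p`, a new wire in the state `|0⟩`. -/
def prepMap {n : ℕ} (p : Fin (n + 1)) : Op n →ₗ[ℂ] Op (n + 1) where
  toFun ρ := Matrix.of fun x y =>
    if x p = false ∧ y p = false then
      ρ (fun i => x (p.succAbove i)) (fun i => y (p.succAbove i)) else 0
  map_add' _ _ := by ext x y; by_cases h : x p = false ∧ y p = false <;> simp [h]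
  map_smul' _ _ := by ext x y; by_cases h : x p = false ∧ y p = false <;> simp [h]

/-- Trace out the wire at position `p`. -/
def traceMap {n : ℕ} (p : Fin (n + 1)) : Op (n + 1) →ₗ[ℂ] Op n where
  toFun ρ := Matrix.of fun x y => ∑ b : Bool,
    ρ (p.insertNth (α := fun _ => Bool) b x) (p.insertNth (α := fun _ => Bool) b y)
  map_add' _ _ := by ext x y; simp [add_add_add_comm]
  map_smul' _ _ := by ext x y; simp [mul_add]

/-- `Circuit G a b` is the type of `(a,b)`-circuits built from the gate set `G`: sequences of gates
of `G`, each acting on chosen (distinct) wires and leaving the other wires idle. The first gate is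
outermost. -/
inductive Circuit (G : GateSet) : ℕ → ℕ → Type
  | nil (n : ℕ) : Circuit G n n
  | gate {n m : ℕ} (g : Fin G.unitaries.length) (w : Fin (G.unitaries.get g).arity ↪ Fin n)
      (rest : Circuit G n m) : Circuit G n m
  | prep {n m : ℕ} (h : G.hasPrep) (p : Fin (n + 1)) (rest : Circuit G (n + 1) m) : Circuit G n m
  | trace {n m : ℕ} (h : G.hasTrace) (p : Fin (n + 1)) (rest : Circuit G n m) :
      Circuit G (n + 1) m

/-- The channel implemented by a circuit. -/
def Circuit.eval {G : GateSet} : {a b : ℕ} → Circuit G a b → (Op a →ₗ[ℂ] Op b)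
  | _, _, .nil _ => LinearMap.id
  | _, _, .gate g w rest => rest.eval ∘ₗ conjMap (onWires (G.unitaries.get g).mat w)
  | _, _, .prep _ p rest => rest.eval ∘ₗ prepMap p
  | _, _, .trace _ p rest => rest.eval ∘ₗ traceMap p

/-- `1^k 0`. -/
def unary (k : ℕ) : List Bool := List.replicate k true ++ [false]

/-- The list of gates of a circuit as a bit string. Each gate is an operation code (`1` for a
preparation, `2` for a trace, `3 + g` for the `g`-th unitary gate) followed by its wires, and code
`0` ends the list; all numbers are written in unary. -/
def Circuit.encodeGates {G : GateSet} : {a b : ℕ} → Circuit G a b → List Bool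
  | _, _, .nil _ => unary 0
  | _, _, .gate g w rest =>
      unary (3 + (g : ℕ)) ++ ((List.ofFn w).flatMap fun i : Fin _ => unary i) ++ rest.encodeGates
  | _, _, .prep _ p rest => unary 1 ++ unary p ++ rest.encodeGates
  | _, _, .trace _ p rest => unary 2 ++ unary p ++ rest.encodeGates

/-- The description of a circuit: its number of input wires and its list of gates. -/
def Circuit.encode {G : GateSet} {a b : ℕ} (C : Circuit G a b) : List Bool :=
  unary a ++ C.encodeGates

theorem unary_append_inj {k l : ℕ} {r t : List Bool} (h : unary k ++ r = unary l ++ t) :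
    k = l ∧ r = t := by
  induction k generalizing l with
  | zero => cases l <;> simp_all [unary, List.replicate_succ]
  | succ k ih =>
    cases l with
    | zero => simp [unary, List.replicate_succ] at h
    | succ l =>
      have h' : unary k ++ r = unary l ++ t := by
        simpa [unary, List.replicate_succ] using h
      simpa using ih h'

theorem flatMap_unary_append_inj {n : ℕ} (k l : List (Fin n)) {r t : List Bool}
    (hl : k.length = l.length)
    (h : (k.flatMap fun i : Fin _ => unary i) ++ r = (l.flatMap fun i : Fin _ => unary i) ++ t) :
    k = l ∧ r = t := by
  induction k generalizing l with
  | nil => cases l <;> simp_all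
  | cons i k ih =>
    cases l with
    | nil => simp at hl
    | cons j l =>
      rw [List.flatMap_cons, List.flatMap_cons, List.append_assoc, List.append_assoc] at h
      obtain ⟨h₁, h₂⟩ := unary_append_inj h
      obtain ⟨h₃, h₄⟩ := ih l (by simpa using hl) h₂
      exact ⟨by rw [Fin.ext h₁, h₃], h₄⟩

theorem Circuit.encodeGates_append_inj {G : GateSet} {a b c : ℕ} (C : Circuit G a b)
    (D : Circuit G a c) {r t : List Bool} (h : C.encodeGates ++ r = D.encodeGates ++ t) :
    b = c ∧ HEq C D ∧ r = t := by
  induction C generalizing c with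
  | nil n =>
    cases D <;> simp only [encodeGates, List.append_assoc] at h <;>
      obtain ⟨h₁, h₂⟩ := unary_append_inj h
    · exact ⟨rfl, HEq.rfl, h₂⟩
    all_goals omega
  | gate g w rest ih =>
    cases D <;> simp only [encodeGates, List.append_assoc] at h <;>
      obtain ⟨h₁, h₂⟩ := unary_append_inj h
    · omega
    · rename_i g' w' rest'
      obtain rfl : g = g' := Fin.ext (by omega)
      obtain ⟨h₃, h₄⟩ := flatMap_unary_append_inj _ _ (by simp) h₂
      obtain rfl : w = w' := DFunLike.coe_injective (List.ofFn_injective h₃)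
      obtain ⟨rfl, h₅, h₆⟩ := ih rest' h₄
      exact ⟨rfl, by rw [eq_of_heq h₅], h₆⟩
    all_goals omega
  | prep hp p rest ih =>
    cases D <;> simp only [encodeGates, List.append_assoc] at h <;>
      obtain ⟨h₁, h₂⟩ := unary_append_inj h
    · omega
    · omega
    · rename_i p' rest'
      obtain ⟨h₃, h₄⟩ := unary_append_inj h₂
      obtain rfl : p = p' := Fin.ext h₃
      obtain ⟨rfl, h₅, h₆⟩ := ih rest' h₄
      exact ⟨rfl, by rw [eq_of_heq h₅], h₆⟩
    · omega
  | trace hp p rest ih =>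
    cases D <;> simp only [encodeGates, List.append_assoc] at h <;>
      obtain ⟨h₁, h₂⟩ := unary_append_inj h
    · omega
    · omega
    · omega
    · rename_i p' rest'
      obtain ⟨h₃, h₄⟩ := unary_append_inj h₂
      obtain rfl : p = p' := Fin.ext h₃
      obtain ⟨rfl, h₅, h₆⟩ := ih rest' h₄
      exact ⟨rfl, by rw [eq_of_heq h₅], h₆⟩

/-- A bit string describes at most one circuit. -/
theorem Circuit.encode_inj {G : GateSet} {a b a₁ b₁ : ℕ} (C : Circuit G a b)
    (D : Circuit G a₁ b₁) (h : C.encode = D.encode) : a = a₁ ∧ b = b₁ ∧ HEq C D := by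
  obtain ⟨rfl, h₁⟩ := unary_append_inj h
  obtain ⟨rfl, h₂, -⟩ := C.encodeGates_append_inj D (r := []) (t := []) (by rw [h₁])
  exact ⟨rfl, rfl, h₂⟩

/-- A circuit family is polynomial-time if a Turing machine outputs, on input `1^n`, the
description of the `n`-th circuit in time polynomial in `n`. -/
def PolyTime {G : GateSet} {a b : ℕ → ℕ} (C : ∀ n, Circuit G (a n) (b n)) : Prop :=
  Nonempty (TM2ComputableInPolyTime Computability.unaryEncodeNat id fun n => (C n).encode)

/-- A circuit family is exponential-time if a Turing machine outputs, on input `1^n`, the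
description of the `n`-th circuit in time `2^p(n)`, for some polynomial `p`. -/
def ExpTime {G : GateSet} {a b : ℕ → ℕ} (C : ∀ n, Circuit G (a n) (b n)) : Prop :=
  ∃ (p : Polynomial ℕ)
    (M : TM2ComputableInTime Computability.unaryEncodeNat id fun n => (C n).encode),
    ∀ n, M.time n ≤ 2 ^ p.eval n

/-! ### The working gate set -/

/-- The action of the Toffoli gate on basis states. -/
def toffoliFun (x : Bits 3) : Bits 3 := Function.update x 2 (xor (x 2) (x 0 && x 1))

theorem toffoliFun_toffoliFun (x : Bits 3) : toffoliFun (toffoliFun x) = x := by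
  revert x; decide

/-- The Toffoli gate. -/
def toffoli : UnitaryGate where
  arity := 3
  mat := Matrix.of fun x y => if x = toffoliFun y then 1 else 0
  unitary := by
    rw [Matrix.mem_unitaryGroup_iff']
    ext x y
    have h : toffoliFun y = toffoliFun x ↔ x = y :=
      (Function.LeftInverse.injective toffoliFun_toffoliFun).eq_iff.trans eq_comm
    simp [Matrix.mul_apply, Matrix.star_apply, Matrix.one_apply, h]
  algebraic := by
    intro x y
    rw [Matrix.of_apply]
    split_ifs
    · exact isAlgebraic_one
    · exact isAlgebraic_zero

theorem inv_sqrt_two_mul_self :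
    ((Real.sqrt 2 : ℝ) : ℂ)⁻¹ * ((Real.sqrt 2 : ℝ) : ℂ)⁻¹ = 1 / 2 := by
  rw [← mul_inv, ← Complex.ofReal_mul, Real.mul_self_sqrt (by norm_num)]
  norm_num

theorem isAlgebraic_inv_sqrt_two : IsAlgebraic ℚ ((Real.sqrt 2 : ℝ) : ℂ)⁻¹ := by
  refine IsAlgebraic.of_pow (n := 2) (by norm_num) ?_
  rw [pow_two, inv_sqrt_two_mul_self]
  simpa using isAlgebraic_algebraMap (A := ℂ) (1 / 2 : ℚ)

/-- The Hadamard matrix. -/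
def hadamardMat : Matrix (Bits 1) (Bits 1) ℂ := Matrix.of fun x y =>
  (if x 0 && y 0 then -1 else 1) * ((Real.sqrt 2 : ℝ) : ℂ)⁻¹

/-- The Hadamard gate. -/
def hadamard : UnitaryGate where
  arity := 1
  mat := hadamardMat
  unitary := by
    rw [Matrix.mem_unitaryGroup_iff']
    ext x y
    have hs := inv_sqrt_two_mul_self
    have hxy : x = y ↔ x 0 = y 0 := by simp [funext_iff, Fin.forall_fin_one]
    rw [Matrix.mul_apply, ← (Equiv.funUnique (Fin 1) Bool).symm.sum_comp]
    cases hx : x 0 <;> cases hy : y 0 <;>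
      simp [hadamardMat, Matrix.star_apply, Matrix.one_apply, hxy, hx, hy, hs]
    all_goals norm_num
  algebraic := by
    intro x y
    rw [hadamardMat, Matrix.of_apply]
    refine IsAlgebraic.mul ?_ isAlgebraic_inv_sqrt_two
    split_ifs
    · exact isAlgebraic_one.neg
    · exact isAlgebraic_one

/-- The phase-shift gate `diag(1, i)`. -/
def phaseShift : UnitaryGate where
  arity := 1
  mat := Matrix.diagonal fun x => if x 0 then Complex.I else 1
  unitary := by
    rw [Matrix.mem_unitaryGroup_iff', Matrix.star_eq_conjTranspose, Matrix.diagonal_conjTranspose,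
      Matrix.diagonal_mul_diagonal, ← Matrix.diagonal_one]
    congr 1
    ext x
    by_cases h : x 0 <;> simp [h]
  algebraic := by
    intro x y
    have hI : IsAlgebraic ℚ Complex.I :=
      IsAlgebraic.of_pow (n := 2) (by norm_num) (by
        rw [Complex.I_sq]; exact isAlgebraic_one.neg)
    rw [Matrix.diagonal_apply]
    split_ifs
    · exact hI
    · exact isAlgebraic_one
    · exact isAlgebraic_zero

/-- The universal gate set composed of state preparation, single-qubit trace, and the Toffoli,
Hadamard and phase-shift gates. -/
def stdGates : GateSet where
  unitaries := [toffoli, hadamard, phaseShift]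
  hasPrep := True
  hasTrace := True

/-! ### Ingenerable sequences -/

/-- An `ℓ`-sequence `s` is exponential-time ingenerable: for every gate set `G` there is a
polynomial `p` such that every exponential-time family of `(0,ℓ)`-circuits built from `G` outputs
`s n` with probability less than `p(n) * 2^(-ℓ(n))`, for all but finitely many `n`. -/
def ExpTimeIngenerable (ℓ : ℕ → ℕ) (s : ∀ n, Bits (ℓ n)) : Prop :=
  ∀ G : GateSet, ∃ p : Polynomial ℝ, ∀ C : ∀ n, Circuit G 0 (ℓ n), ExpTime C →
    ∀ᶠ n in atTop,
      prob ((C n).eval (proj (Fin.elim0 : Bits 0))) (s n) < p.eval (n : ℝ) * ((2 : ℝ) ^ ℓ n)⁻¹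

/-! ### Promise problems and uncloneable advice -/

/-- `{0,1}^*`, a bit string together with its length. -/
abbrev BitString : Type := Σ n : ℕ, Bits n

/-- A promise problem: disjoint sets of no instances and yes instances. -/
structure PromiseProblem where
  no : Set BitString
  yes : Set BitString
  disjoint : Disjoint no yes

namespace PromiseProblem

variable (P : PromiseProblem)

/-- The set of all problem instances. -/
def instances : Set BitString := P.no ∪ P.yes

/-- The instances of length `n` whose answer is `b`. -/
def slice (b : Bool) (n : ℕ) : Set (Bits n) :=
  {x | (⟨n, x⟩ : BitString) ∈ if b then P.yes else P.no}

/-- The correct answer on an instance. -/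
def answer (z : BitString) : Bool := open Classical in decide (z ∈ P.yes)

/-- The normalization: `1` if all the instances of length `n` have the same answer, else `1/2`. -/
def balance (n : ℕ) : ℝ := open Classical in
  if P.slice false n = ∅ ∨ P.slice true n = ∅ then 1 else 1 / 2

/-- The challenge distribution on `{0,1}^n` (a probability distribution if there are instances of
length `n`): both answers equally likely, when possible, and uniform for each answer. -/
def challenge (n : ℕ) (x : Bits n) : ℝ := open Classical in
  if x ∈ P.slice false n then P.balance n * (1 / ((P.slice false n).ncard : ℝ))
  else if x ∈ P.slice true n then P.balance n * (1 / ((P.slice true n).ncard : ℝ))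
  else 0

end PromiseProblem

/-- A function is negligible if it is eventually smaller than `n ↦ n^(-c)` for all `c`. -/
def Negligible (f : ℕ → ℝ) : Prop := ∀ c : ℕ, ∀ᶠ n : ℕ in atTop, f n ≤ ((n : ℝ) ^ c)⁻¹

/-- One output qubit carrying the answer to an instance. -/
def PromiseProblem.answerBit (P : PromiseProblem) {n : ℕ} (x : Bits n) : Bits 1 :=
  fun _ => P.answer ⟨n, x⟩

/-- The probability that both `B` and `C` answer correctly when the state `ρ` is split by `A`
between them and they receive independent challenges `x_B` and `x_C`. -/
def splitSuccess (P : PromiseProblem) {G : GateSet} (ρ : QState) (n b c : ℕ)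
    (A : Circuit G ρ.qubits (b + c)) (B : Circuit G (n + b) 1) (C : Circuit G (c + n) 1) : ℝ :=
  ∑ xB : Bits n, ∑ xC : Bits n, P.challenge n xB * P.challenge n xC *
    prob
      (tensorMap B.eval C.eval
        (castOp (by omega : n + (b + c) + n = (n + b) + (c + n))
          (tensorOp (tensorOp (proj xB) (A.eval ρ.op)) (proj xC))))
      (Fin.append (P.answerBit xB) (P.answerBit xC))

/-- The sequence of states `ρ` is uncloneable advice with which polynomial-time quantum computations
solve `P` with negligible error. -/
structure IsUncloneableAdvice (P : PromiseProblem) (ρ : ℕ → QState) : Prop where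
  /-- The number of qubits is polynomially bounded. -/
  poly_size : ∃ p : Polynomial ℕ, ∀ n, (ρ n).qubits ≤ p.eval n
  correct : ∃ C : ∀ n, Circuit stdGates ((ρ n).qubits + n) 1, PolyTime C ∧
    ∃ η : ℕ → ℝ, Negligible η ∧ ∀ (n : ℕ) (x : Bits n), (⟨n, x⟩ : BitString) ∈ P.instances →
      1 - η n ≤ prob ((C n).eval (tensorOp (ρ n).op (proj x))) (P.answerBit x)
  uncloneable : ∀ (b c : ℕ → ℕ)
    (A : ∀ n, Circuit stdGates (ρ n).qubits (b n + c n))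
    (B : ∀ n, Circuit stdGates (n + b n) 1)
    (C : ∀ n, Circuit stdGates (c n + n) 1),
    PolyTime A → PolyTime B → PolyTime C →
    ∃ η : ℕ → ℝ, Negligible η ∧ ∀ n : ℕ, (∃ x : Bits n, (⟨n, x⟩ : BitString) ∈ P.instances) →
      splitSuccess P (ρ n) n (b n) (c n) (A n) (B n) (C n) ≤ 1 / 2 + η n

/-- The complexity class `neglQP/upoly`. -/
def NeglQPUpoly : Set PromiseProblem := {P | ∃ ρ : ℕ → QState, IsUncloneableAdvice P ρ}

/-! ### The promise problem and its advice -/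

/-- The inner product modulo `2`. -/
def dot {n : ℕ} (x y : Bits n) : Bool := decide (Odd (Finset.univ.filter fun i => x i && y i).card)

/-- The first half `x` of a string `(x, θ)`. -/
def fstHalf {n : ℕ} (s : Bits (n + n)) : Bits n := fun i => s (Fin.castAdd n i)

/-- The second half `θ` of a string `(x, θ)`. -/
def sndHalf {n : ℕ} (s : Bits (n + n)) : Bits n := fun i => s (Fin.natAdd n i)

/-- For `s l = (x_l, θ_l)`, the set of all strings `(θ_l, y)` with `x_l ⬝ y = b`. -/
def halfInstances (s : ∀ l : ℕ, Bits (l + l)) (b : Bool) : Set BitString :=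
  {z | ∃ (l : ℕ) (y : Bits l), dot (fstHalf (s l)) y = b ∧
    z = ⟨l + l, Fin.append (sndHalf (s l)) y⟩}

/-- The promise problem defined by a sequence `s l = (x_l, θ_l)`. -/
def ipProblem (s : ∀ l : ℕ, Bits (l + l)) : PromiseProblem where
  no := halfInstances s false
  yes := halfInstances s true
  disjoint := by
    rw [Set.disjoint_left]
    rintro z ⟨l, y, hy, rfl⟩ ⟨m, y₁, hy₁, h⟩
    have hl : l = m := by have := congrArg Sigma.fst h; simp only at this; omega
    subst hl
    have h₁ := eq_of_heq (Sigma.mk.inj h).2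
    have h₂ : y = y₁ := by
      ext i
      have := congrFun h₁ (Fin.natAdd l i)
      rwa [Fin.append_right, Fin.append_right] at this
    subst h₂
    rw [hy] at hy₁
    exact absurd hy₁ (by decide)

/-- The amplitude `⟨z| H^θ |x⟩` for single bits. -/
def wiesnerAmp (x θ z : Bool) : ℂ :=
  if θ then (if x && z then -1 else 1) * ((Real.sqrt 2 : ℝ) : ℂ)⁻¹ else if z = x then 1 else 0

/-- The Wiesner vector `|x^θ⟩`, the tensor product of the vectors `H^(θ i) |x i⟩`. -/
def wiesnerVec {n : ℕ} (x θ : Bits n) : Bits n → ℂ := fun z => ∏ i, wiesnerAmp (x i) (θ i) (z i)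

/-- The Wiesner state `|x^θ⟩⟨x^θ|`. -/
def wiesner {n : ℕ} (x θ : Bits n) : QState where
  qubits := n
  op := Matrix.vecMulVec (wiesnerVec x θ) (star (wiesnerVec x θ))
  posSemidef := Matrix.posSemidef_vecMulVec_self_star (wiesnerVec x θ)
  trace_eq_one := by
    have key : ∀ a t : Bool, ∑ z : Bool, wiesnerAmp a t z * star (wiesnerAmp a t z) = 1 := by
      have hs := inv_sqrt_two_mul_self
      intro a t
      cases a <;> cases t <;> simp [wiesnerAmp, hs]
      all_goals norm_num
    have h : ∀ z : Bits n, wiesnerVec x θ z * star (wiesnerVec x θ z) =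
        ∏ i, wiesnerAmp (x i) (θ i) (z i) * star (wiesnerAmp (x i) (θ i) (z i)) := by
      intro z
      rw [wiesnerVec, star_prod, ← Finset.prod_mul_distrib]
    rw [Matrix.trace]
    simp only [Matrix.diag_apply, Matrix.vecMulVec_apply, Pi.star_apply, h]
    rw [← Fintype.prod_sum (fun (i : Fin n) (z : Bool) =>
      wiesnerAmp (x i) (θ i) z * star (wiesnerAmp (x i) (θ i) z))]
    simp only [key, Finset.prod_const_one]

/-- The advice: the Wiesner state of `s l = (x_l, θ_l)` for instances of length `2 l`, and the state
on no qubits for instances of odd length. -/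
def wiesnerAdvice (s : ∀ l : ℕ, Bits (l + l)) (n : ℕ) : QState :=
  if Even n then wiesner (fstHalf (s (n / 2))) (sndHalf (s (n / 2)))
  else wiesner (Fin.elim0 : Bits 0) Fin.elim0

end

end QAdvice

/-! Correctness. Once `θ` is known, every qubit of the Wiesner state can be read without error in
its own basis: directly if `θ i = false`, after a Hadamard gate if `θ i = true`. A fixed circuit
adds the bits `x i && y i` to an output qubit (`rawEval_decideStep`), so instances are decided with
probability one.

Uncloneability. A good splitting attack on the state of `s l = (x, θ)` would be a test that `s l`
passes and almost no other string does. Drawing random strings until one passes the test would then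
generate `s l` too often.

In detail, fix circuits `A`, `B`, `C` and consider the parity game: on uniform `y`, `y'` it is won
if the number of wrong answers is even. Its bias is `gameBias`. The challenge distribution is
uniform in `y`, and winning both answers is harder than getting the parity right, so twice the
success probability minus one is at most the bias (`splitSuccess_le`). The average of `|gameBias|`
over all `(x, θ)` is at most `decayRate ^ l`, where `decayRate` is `cos (π / 8)`
(`sum_abs_gameBias_le`). Indeed, the Fourier transforms in `y` of the two parties' observables are
commuting families of operators indexed by `x`, whose squares sum to at most one by Parseval. Such
families cannot both be correlated with the outcome of a measurement in a random Wiesner basis,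
because outcomes for different bases have small overlap (`monogamy_bound`, a double use of
Cauchy–Schwarz).

The generator draws a uniform candidate `(x, θ)`, plays the parity game many times with simulated
`A`, `B`, `C`, and keeps the candidate if few plays are lost. It does this for `N` rounds and
outputs the last candidate kept. By Chebyshev's inequality a string of bias at least `l ^ (-a)` is
kept with probability at least `1 / 2`. By the average bound and Markov's inequality a uniform
candidate is kept with probability `Q ≤ 7 / l ^ (d + 2)`. For `N = l ^ (d + 1)` a kept candidate is
unlikely to be replaced, and a string of large bias is output with probability at least `N / 4 * 2 ^
(-2 * l)` (`eventually_le_generator`). This eventually exceeds `p(l) * 2 ^ (-2 * l)` for every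
polynomial `p` of degree at most `d`. The polynomial of an ingenerable sequence depends on the gate
set only, and `genGates` is fixed once and for all; so `d` may be taken to be its degree, and
`eventually_gameBias_lt` follows.

Two formal devices carry this. The description of the generator has to be written by a Turing
machine that calls the machines for `A`, `B` and `C`: expressions with loops (`CircExpr`, `StrExpr`)
are compiled to stack programs with subroutine calls, and these to `TM2` machines with exact step
counts (`StackProg.Run.steps`). The channels are computed on untyped lists of gates that act on
formal combinations of matrix units `|u⟩⟨v|` of bit lists, where idle wires are a mere suffix of `u`
and `v` (`Circuit.rawEval_raw`). -/

namespace QAdvice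

open Turing

set_option linter.unusedSectionVars false

noncomputable section

/-! ### Stack programs and their compilation to Turing machines -/

open Function (update)

/-- Structured programs over stacks of bits named by `V`, which may call subroutines named by
`ι`. -/
inductive StackProg (V ι : Type) : Type
  | push (v : V) (b : Bool)
  | skip
  | seq (p q : StackProg V ι)
  | loop (v : V) (p q : StackProg V ι)
  | loopTrue (v : V) (p : StackProg V ι)
  | ifPop (v : V) (p q : StackProg V ι)
  | call (i : ι) (v w : V)

namespace StackProg

variable {V ι : Type} [DecidableEq V] [DecidableEq ι]

/-- Big-step semantics with running time: `loop v p q` pops `v` until it is empty and runs `p` or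
`q` after each pop, according to the bit; `loopTrue v p` stops at the first `false`; `ifPop v p q`
pops once and runs `p` if there was a bit, else `q`; `call i v w` empties the unary number in `v`
and pushes the output of the `i`-th subroutine to `w`. -/
inductive Run (f : ι → ℕ → List Bool) (T : ι → ℕ → ℕ) :
    StackProg V ι → (V → List Bool) → (V → List Bool) → ℕ → Prop
  | push (v : V) (b : Bool) (S : V → List Bool) : Run f T (.push v b) S (update S v (b :: S v)) 1
  | skip (S : V → List Bool) : Run f T .skip S S 1
  | seq {p q : StackProg V ι} {S S₁ S₂ : V → List Bool} {t₁ t₂ : ℕ} (h₁ : Run f T p S S₁ t₁)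
      (h₂ : Run f T q S₁ S₂ t₂) : Run f T (.seq p q) S S₂ (t₁ + t₂)
  | loop_nil {v : V} {p q : StackProg V ι} {S : V → List Bool} (h : S v = []) :
      Run f T (.loop v p q) S S 1
  | loop_cons {v : V} {p q : StackProg V ι} {S S₁ S₂ : V → List Bool} {b : Bool} {l : List Bool}
      {t₁ t₂ : ℕ} (h : S v = b :: l) (h₁ : Run f T (if b then p else q) (update S v l) S₁ t₁)
      (h₂ : Run f T (.loop v p q) S₁ S₂ t₂) : Run f T (.loop v p q) S S₂ (1 + t₁ + t₂)
  | loopTrue_false {v : V} {p : StackProg V ι} {S : V → List Bool} {l : List Bool}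
      (h : S v = false :: l) : Run f T (.loopTrue v p) S (update S v l) 1
  | loopTrue_true {v : V} {p : StackProg V ι} {S S₁ S₂ : V → List Bool} {l : List Bool}
      {t₁ t₂ : ℕ} (h : S v = true :: l) (h₁ : Run f T p (update S v l) S₁ t₁)
      (h₂ : Run f T (.loopTrue v p) S₁ S₂ t₂) : Run f T (.loopTrue v p) S S₂ (1 + t₁ + t₂)
  | ifPop_nil {v : V} {p q : StackProg V ι} {S S₁ : V → List Bool} {t : ℕ} (h : S v = [])
      (h₁ : Run f T q S S₁ t) : Run f T (.ifPop v p q) S S₁ (1 + t)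
  | ifPop_cons {v : V} {p q : StackProg V ι} {S S₁ : V → List Bool} {b : Bool} {l : List Bool}
      {t : ℕ} (h : S v = b :: l) (h₁ : Run f T p (update S v l) S₁ t) :
      Run f T (.ifPop v p q) S S₁ (1 + t)
  | call {i : ι} {v w : V} {S : V → List Bool} {n : ℕ} (hvw : v ≠ w)
      (h : S v = List.replicate n true) :
      Run f T (.call i v w) S (update (update S v []) w ((f i n).reverse ++ S w))
        ((n + 1) + T i n + ((f i n).length + 1))

variable {f : ι → ℕ → List Bool}
  (c : ∀ i, TM2ComputableInPolyTime Computability.unaryEncodeNat id (f i))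

/-- The stacks of the compiled machine: those of the program and those of the subroutines. -/
abbrev Stk (V : Type) (c : ∀ i, TM2ComputableInPolyTime Computability.unaryEncodeNat id (f i)) :
    Type := V ⊕ (Σ i, (c i).tm.K)

/-- The stack alphabets of the compiled machine. -/
abbrev Alph : Stk V c → Type
  | .inl _ => Bool
  | .inr p => (c p.1).tm.Γ p.2

/-- The internal states of the compiled machine. -/
abbrev St : Type := Option Bool × ∀ i, (c i).tm.σ

/-- The initial state of the compiled machine. -/
def st₀ : St c := (none, fun i => (c i).tm.initialState)

/-- The labels of a compiled program. -/
def Lab : StackProg V ι → Type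
  | .push _ _ => Unit
  | .skip => Unit
  | .seq p q => Lab p ⊕ Lab q
  | .loop _ p q => Option (Lab p ⊕ Lab q)
  | .loopTrue _ p => Option (Lab p)
  | .ifPop _ p q => Option (Lab p ⊕ Lab q)
  | .call i _ _ => Bool ⊕ (c i).tm.Λ

theorem finite_lab (p : StackProg V ι) : Finite (Lab c p) := by
  induction p with
  | push v b => exact inferInstanceAs (Finite Unit)
  | skip => exact inferInstanceAs (Finite Unit)
  | seq p q hp hq => exact inferInstanceAs (Finite (Lab c p ⊕ Lab c q))
  | loop v p q hp hq => exact inferInstanceAs (Finite (Option (Lab c p ⊕ Lab c q)))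
  | loopTrue v p hp => exact inferInstanceAs (Finite (Option (Lab c p)))
  | ifPop v p q hp hq => exact inferInstanceAs (Finite (Option (Lab c p ⊕ Lab c q)))
  | call i v w =>
    have : Finite (c i).tm.Λ := @Finite.of_fintype _ (c i).tm.ΛFin
    exact inferInstanceAs (Finite (Bool ⊕ (c i).tm.Λ))

/-- The entry point of a compiled program. -/
def entry : (p : StackProg V ι) → Lab c p
  | .push _ _ => ()
  | .skip => ()
  | .seq p _ => Sum.inl (entry p)
  | .loop _ _ _ => none
  | .loopTrue _ _ => none
  | .ifPop _ _ _ => none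
  | .call _ _ _ => Sum.inl false

/-- The code of a subroutine inside the compiled machine. -/
def embed (i : ι) {Λ' : Type} (emb : (c i).tm.Λ → Λ') (exit : Λ') :
    TM2.Stmt (c i).tm.Γ (c i).tm.Λ (c i).tm.σ → TM2.Stmt (Alph (V := V) c) Λ' (St c)
  | .push k g q => .push (Sum.inr ⟨i, k⟩) (fun v => g (v.2 i)) (embed i emb exit q)
  | .peek k g q => .peek (Sum.inr ⟨i, k⟩)
      (fun v o => (v.1, update v.2 i (g (v.2 i) o))) (embed i emb exit q)
  | .pop k g q => .pop (Sum.inr ⟨i, k⟩)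
      (fun v o => (v.1, update v.2 i (g (v.2 i) o))) (embed i emb exit q)
  | .load g q => .load (fun v => (v.1, update v.2 i (g (v.2 i)))) (embed i emb exit q)
  | .branch g q₁ q₂ => .branch (fun v => g (v.2 i)) (embed i emb exit q₁) (embed i emb exit q₂)
  | .goto l => .goto fun v => emb (l (v.2 i))
  | .halt => .goto fun _ => exit

/-- The code of a program. -/
def code : (p : StackProg V ι) → {Λ' : Type} → (Lab c p → Λ') → Λ' → Lab c p →
    TM2.Stmt (Alph (V := V) c) Λ' (St c)
  | .push v b, _, _, exit, _ => .push (Sum.inl v) (fun _ => b) (.goto fun _ => exit)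
  | .skip, _, _, exit, _ => .goto fun _ => exit
  | .seq p _, _, emb, _, Sum.inl l => code p (emb ∘ Sum.inl) (emb (Sum.inr (entry c _))) l
  | .seq _ q, _, emb, exit, Sum.inr l => code q (emb ∘ Sum.inr) exit l
  | .loop v p q, _, emb, exit, none => .pop (Sum.inl v) (fun s o => (o, s.2))
      (.branch (fun s => s.1 = none) (.goto fun _ => exit)
        (.branch (fun s => s.1 = some true)
          (.load (fun s => (none, s.2)) (.goto fun _ => emb (some (Sum.inl (entry c p)))))
          (.load (fun s => (none, s.2)) (.goto fun _ => emb (some (Sum.inr (entry c q)))))))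
  | .loop _ p _, _, emb, _, some (Sum.inl l) => code p (emb ∘ some ∘ Sum.inl) (emb none) l
  | .loop _ _ q, _, emb, _, some (Sum.inr l) => code q (emb ∘ some ∘ Sum.inr) (emb none) l
  | .loopTrue v p, _, emb, exit, none => .pop (Sum.inl v) (fun s o => (o, s.2))
      (.branch (fun s => s.1 = some true)
        (.load (fun s => (none, s.2)) (.goto fun _ => emb (some (entry c p))))
        (.load (fun s => (none, s.2)) (.goto fun _ => exit)))
  | .loopTrue _ p, _, emb, _, some l => code p (emb ∘ some) (emb none) l
  | .ifPop v p q, _, emb, _, none => .pop (Sum.inl v) (fun s o => (o, s.2))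
      (.branch (fun s => s.1 = none) (.goto fun _ => emb (some (Sum.inr (entry c q))))
        (.load (fun s => (none, s.2)) (.goto fun _ => emb (some (Sum.inl (entry c p))))))
  | .ifPop _ p _, _, emb, exit, some (Sum.inl l) => code p (emb ∘ some ∘ Sum.inl) exit l
  | .ifPop _ _ q, _, emb, exit, some (Sum.inr l) => code q (emb ∘ some ∘ Sum.inr) exit l
  | .call i v _, _, emb, _, Sum.inl false => .pop (Sum.inl v) (fun s o => (o, s.2))
      (.branch (fun s => s.1 = none) (.goto fun _ => emb (Sum.inr (c i).tm.main))
        (.push (Sum.inr ⟨i, (c i).tm.k₀⟩) (fun s => (c i).inputAlphabet.symm (s.1.getD true))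
          (.load (fun s => (none, s.2)) (.goto fun _ => emb (Sum.inl false)))))
  | .call i _ w, _, emb, exit, Sum.inl true => .pop (Sum.inr ⟨i, (c i).tm.k₁⟩)
      (fun s o => (o.map (c i).outputAlphabet, s.2))
      (.branch (fun s => s.1 = none) (.goto fun _ => exit)
        (.push (Sum.inl w) (fun s => s.1.getD true)
          (.load (fun s => (none, s.2)) (.goto fun _ => emb (Sum.inl true)))))
  | .call i _ _, _, emb, _, Sum.inr l =>
      embed c i (emb ∘ Sum.inr) (emb (Sum.inl true)) ((c i).tm.m l)

/-- The stacks of the compiled machine, when those of the subroutines are empty. -/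
def full (S : V → List Bool) : ∀ k, List (Alph (V := V) c k)
  | .inl v => S v
  | .inr _ => []

/-- The stacks of the compiled machine, when a single subroutine is active. -/
def fullAt (S : V → List Bool) (i : ι) (R : ∀ k, List ((c i).tm.Γ k)) :
    ∀ k, List (Alph (V := V) c k)
  | .inl v => S v
  | .inr p => update (β := fun j => ∀ k, List ((c j).tm.Γ k)) (fun _ _ => []) i R p.1 p.2

theorem fullAt_nil (S : V → List Bool) (i : ι) : fullAt c S i (fun _ => []) = full c S := by
  funext k
  rcases k with v | ⟨j, k⟩
  · rfl
  · simp only [fullAt, full]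
    rcases eq_or_ne j i with rfl | h
    · simp
    · simp [Function.update_of_ne h]

theorem update_full (S : V → List Bool) (v : V) (l : List Bool) :
    update (full c S) (Sum.inl v) l = full c (update S v l) := by
  funext k
  rcases k with w | p
  · rcases eq_or_ne w v with rfl | h
    · simp [full]
    · simp [full, h]
  · simp [full]

theorem update_fullAt_inl (S : V → List Bool) (i : ι) (R : ∀ k, List ((c i).tm.Γ k)) (v : V)
    (l : List Bool) :
    update (fullAt c S i R) (Sum.inl v) l = fullAt c (update S v l) i R := by
  funext k
  rcases k with w | p
  · rcases eq_or_ne w v with rfl | h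
    · simp [fullAt]
    · simp [fullAt, h]
  · simp [fullAt]

theorem fullAt_inr (S : V → List Bool) (i : ι) (R : ∀ k, List ((c i).tm.Γ k)) (k : (c i).tm.K) :
    fullAt c S i R (Sum.inr ⟨i, k⟩) = R k := by
  simp [fullAt]

theorem update_fullAt_inr (S : V → List Bool) (i : ι) (R : ∀ k, List ((c i).tm.Γ k))
    (k : (c i).tm.K) (l : List ((c i).tm.Γ k)) :
    update (fullAt c S i R) (Sum.inr ⟨i, k⟩) l = fullAt c S i (update R k l) := by
  funext k'
  rcases k' with w | ⟨j, k'⟩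
  · simp [fullAt]
  · rcases eq_or_ne j i with rfl | h
    · rcases eq_or_ne k' k with rfl | h'
      · simp [fullAt]
      · have : (Sum.inr ⟨j, k'⟩ : Stk V c) ≠ Sum.inr ⟨j, k⟩ := by
          intro e; simp at e; exact h' e
        rw [Function.update_of_ne this]
        simp [fullAt, h']
    · have : (Sum.inr ⟨j, k'⟩ : Stk V c) ≠ Sum.inr ⟨i, k⟩ := by
        intro e; simp at e; exact h e.1
      rw [Function.update_of_ne this]
      simp [fullAt, Function.update_of_ne h]

/-- The machine `m` passes from one configuration to another in exactly `t` steps. -/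
def Steps {K : Type} [DecidableEq K] {Γ : K → Type} {Λ σ : Type} (m : Λ → TM2.Stmt Γ Λ σ) (t : ℕ)
    (a b : TM2.Cfg Γ Λ σ) : Prop :=
  (flip bind (TM2.step m))^[t] (some a) = some b

section Steps

variable {K : Type} [DecidableEq K] {Γ : K → Type} {Λ σ : Type} {m : Λ → TM2.Stmt Γ Λ σ}

theorem Steps.trans {s t : ℕ} {a b d : TM2.Cfg Γ Λ σ} (h₁ : Steps m s a b) (h₂ : Steps m t b d) :
    Steps m (s + t) a d := by
  unfold Steps at *
  rw [add_comm, Function.iterate_add_apply, h₁, h₂]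

theorem Steps.single {l : Λ} {q : TM2.Stmt Γ Λ σ} {v : σ} {S : ∀ k, List (Γ k)}
    {b : TM2.Cfg Γ Λ σ} (hq : m l = q) (h : TM2.stepAux q v S = b) :
    Steps m 1 ⟨some l, v, S⟩ b := by
  subst hq
  unfold Steps
  simp [flip, h]

end Steps

/-- The state of the compiled machine while a subroutine is in state `v`. -/
def stAt (i : ι) (v : (c i).tm.σ) : St c :=
  (none, update (fun j => (c j).tm.initialState) i v)

/-- The configuration of the compiled machine while a subroutine is running. -/
def cfgAt {Λ' : Type} (S : V → List Bool) (i : ι) (emb : (c i).tm.Λ → Λ') (exit : Λ')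
    (x : TM2.Cfg (c i).tm.Γ (c i).tm.Λ (c i).tm.σ) : TM2.Cfg (Alph (V := V) c) Λ' (St c) :=
  ⟨some (x.l.elim exit emb), stAt c i x.var, fullAt c S i x.stk⟩

/-- Halting of the subroutine is a jump to `exit`: `cfgAt` reads the absent label as `exit`, so the
simulation includes the last step. -/
theorem stepAux_embed {Λ' : Type} (S : V → List Bool) (i : ι) (emb : (c i).tm.Λ → Λ') (exit : Λ')
    (q : TM2.Stmt (c i).tm.Γ (c i).tm.Λ (c i).tm.σ) (v : (c i).tm.σ)
    (R : ∀ k, List ((c i).tm.Γ k)) :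
    TM2.stepAux (embed c i emb exit q) (stAt c i v) (fullAt c S i R) =
      cfgAt c S i emb exit (TM2.stepAux q v R) := by
  induction q generalizing v R with
  | push k g q ih =>
    simp only [embed, TM2.stepAux, fullAt_inr, update_fullAt_inr, ← ih]
    simp [stAt]
  | peek k g q ih =>
    simp only [embed, TM2.stepAux, fullAt_inr, ← ih]
    simp [stAt]
  | pop k g q ih =>
    simp only [embed, TM2.stepAux, fullAt_inr, update_fullAt_inr, ← ih]
    simp [stAt]
  | load g q ih =>
    simp only [embed, TM2.stepAux, ← ih]
    simp [stAt]
  | branch g q₁ q₂ ih₁ ih₂ =>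
    simp only [embed, TM2.stepAux]
    have : (stAt c i v).2 i = v := by simp [stAt]
    rw [this]
    cases g v <;> simp [ih₁, ih₂]
  | goto l => simp [embed, TM2.stepAux, cfgAt, stAt]
  | halt => simp [embed, TM2.stepAux, cfgAt, stAt]

theorem steps_embed {Λ' : Type} (S : V → List Bool) (i : ι) (emb : (c i).tm.Λ → Λ') (exit : Λ')
    (m : Λ' → TM2.Stmt (Alph (V := V) c) Λ' (St c))
    (hm : ∀ l, m (emb l) = embed c i emb exit ((c i).tm.m l)) (t : ℕ)
    (x y : TM2.Cfg (c i).tm.Γ (c i).tm.Λ (c i).tm.σ) (h : Steps (c i).tm.m t x y) :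
    Steps m t (cfgAt c S i emb exit x) (cfgAt c S i emb exit y) := by
  induction t generalizing x with
  | zero =>
    simp only [Steps, Function.iterate_zero, id_eq, Option.some.injEq] at h ⊢
    rw [h]
  | succ t ih =>
    unfold Steps at h
    rw [Function.iterate_succ_apply] at h
    rcases x with ⟨_ | l, v, R⟩
    -- A halted configuration has no successor and `none` is absorbing, so a run of positive length
    -- cannot start there.
    · exfalso
      have : ∀ t, (flip bind (TM2.step (c i).tm.m))^[t] none = none := by
        intro t
        induction t with
        | zero => rfl
        | succ t ih => rw [Function.iterate_succ_apply]; exact ih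
      simp only [flip, Option.bind_eq_bind, Option.bind_some, TM2.step] at h
      erw [this] at h
      cases h
    · rw [add_comm]
      refine Steps.trans (b := cfgAt c S i emb exit (TM2.stepAux ((c i).tm.m l) v R)) ?_ (ih _ ?_)
      · exact Steps.single (hm l) (stepAux_embed c S i emb exit _ v R)
      · simpa [flip, Steps] using h

/-- The running times of the subroutines. -/
def callTime (i : ι) (n : ℕ) : ℕ := ((c i).outputsFun n).steps

theorem unaryEncodeNat_eq (n : ℕ) : Computability.unaryEncodeNat n = List.replicate n true := by
  induction n with
  | zero => rfl
  | succ n ih => rw [Computability.unaryEncodeNat, ih, List.replicate_succ]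

/-- Induction needs the number `k` of symbols already handed over. The order in which popping
transfers them is irrelevant, as the input is unary. -/
theorem steps_call_in {i : ι} {v w : V} {Λ' : Type} (emb : Lab c (.call i v w) → Λ') (exit : Λ')
    (m : Λ' → TM2.Stmt (Alph (V := V) c) Λ' (St c))
    (hm : ∀ l, m (emb l) = code c (.call i v w) emb exit l) (n k : ℕ) (S : V → List Bool)
    (h : S v = List.replicate n true) :
    Steps m (n + 1)
      ⟨some (emb (Sum.inl false)), st₀ c, fullAt c S i (update (fun _ => []) (c i).tm.k₀
        (List.replicate k ((c i).inputAlphabet.symm true)))⟩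
      ⟨some (emb (Sum.inr (c i).tm.main)), st₀ c, fullAt c (update S v []) i
        (update (fun _ => []) (c i).tm.k₀
          (List.replicate (n + k) ((c i).inputAlphabet.symm true)))⟩ := by
  induction n generalizing k S with
  | zero =>
    refine Steps.single (hm _) ?_
    have h' : S v = [] := h
    have hv : update S v [] = S := by rw [← h']; exact Function.update_eq_self v S
    simp [code, st₀, fullAt, h', update_fullAt_inl, hv]
  | succ n ih =>
    have h' : S v = true :: List.replicate n true := h
    have h₁ := ih (k + 1) (update S v (List.replicate n true)) (by simp)
    rw [Function.update_idem] at h₁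
    rw [show n + 1 + k = n + (k + 1) by ring, show n + 1 + 1 = 1 + (n + 1) by ring]
    refine Steps.trans (Steps.single (hm _) ?_) h₁
    simp only [code, TM2.stepAux]
    rw [update_fullAt_inl, fullAt_inr, update_fullAt_inr]
    simp [st₀, fullAt, h', List.replicate_succ]

/-- The result is popped from one stack and pushed to another, hence its reversal. -/
theorem steps_call_out {i : ι} {v w : V} {Λ' : Type} (emb : Lab c (.call i v w) → Λ') (exit : Λ')
    (m : Λ' → TM2.Stmt (Alph (V := V) c) Λ' (St c))
    (hm : ∀ l, m (emb l) = code c (.call i v w) emb exit l) (o : List Bool) (S : V → List Bool) :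
    Steps m (o.length + 1)
      ⟨some (emb (Sum.inl true)), st₀ c, fullAt c S i (update (fun _ => []) (c i).tm.k₁
        (o.map (c i).outputAlphabet.symm))⟩
      ⟨some exit, st₀ c, full c (update S w (o.reverse ++ S w))⟩ := by
  induction o generalizing S with
  | nil =>
    refine Steps.single (hm _) ?_
    simp only [code, TM2.stepAux, fullAt_inr, update_fullAt_inr]
    simp [st₀, ← fullAt_nil c _ i]
  | cons b o ih =>
    have h₁ := ih (update S w (b :: S w))
    rw [Function.update_idem, Function.update_self] at h₁
    rw [List.length_cons, show o.length + 1 + 1 = 1 + (o.length + 1) by ring, List.reverse_cons,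
      List.append_assoc, List.singleton_append]
    refine Steps.trans (Steps.single (hm _) ?_) h₁
    simp only [code, TM2.stepAux, fullAt_inr, update_fullAt_inr]
    simp [st₀, fullAt, update_fullAt_inl]

theorem initList_eq (M : FinTM2) (l : List (M.Γ M.k₀)) :
    initList M l = ⟨some M.main, M.initialState, update (fun _ => []) M.k₀ l⟩ := by
  unfold initList
  congr 1
  funext k
  by_cases h : k = M.k₀
  · subst h; simp
  · simp [h]

theorem haltList_eq (M : FinTM2) (l : List (M.Γ M.k₁)) :
    haltList M l = ⟨none, M.initialState, update (fun _ => []) M.k₁ l⟩ := by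
  unfold haltList
  congr 1
  funext k
  by_cases h : k = M.k₁
  · subst h; simp
  · simp [h]

/-- A `TM2` step executes a whole statement up to the next jump, so popping, testing and jumping
cost one step together and the counts of `Run` are exact. Between commands the bit register is
`none` and all subroutines are in their initial state with empty stacks; a halting machine leaves
nothing but its output, so a call restores this situation. -/
theorem Run.steps {p : StackProg V ι} {S S' : V → List Bool} {t : ℕ}
    (h : Run f (callTime c) p S S' t) {Λ' : Type} (emb : Lab c p → Λ') (exit : Λ')
    (m : Λ' → TM2.Stmt (Alph (V := V) c) Λ' (St c)) (hm : ∀ l, m (emb l) = code c p emb exit l) :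
    Steps m t ⟨some (emb (entry c p)), st₀ c, full c S⟩ ⟨some exit, st₀ c, full c S'⟩ := by
  induction h generalizing Λ' with
  | push v b S =>
    refine Steps.single (hm _) ?_
    simp [code, update_full, full]
  | skip S =>
    refine Steps.single (hm _) ?_
    simp [code]
  | seq h₁ h₂ ih₁ ih₂ =>
    exact (ih₁ (emb ∘ Sum.inl) _ m fun l => hm _).trans (ih₂ (emb ∘ Sum.inr) exit m fun l => hm _)
  | @loop_nil v p q S h =>
    refine Steps.single (hm none) ?_
    have hv : update S v [] = S := by rw [← h]; exact Function.update_eq_self v S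
    simp [code, st₀, full, h, update_full, hv]
  | @loop_cons v p q S S₁ S₂ b l t₁ t₂ h h₁ h₂ ih₁ ih₂ =>
    cases b
    · refine Steps.trans (Steps.trans (Steps.single (hm none) ?_)
        (ih₁ (emb ∘ some ∘ Sum.inr) (emb none) m fun l => hm _)) (ih₂ emb exit m hm)
      simp [code, st₀, full, h, update_full]
      rfl
    · refine Steps.trans (Steps.trans (Steps.single (hm none) ?_)
        (ih₁ (emb ∘ some ∘ Sum.inl) (emb none) m fun l => hm _)) (ih₂ emb exit m hm)
      simp [code, st₀, full, h, update_full]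
      rfl
  | @loopTrue_false v p S l h =>
    refine Steps.single (hm none) ?_
    simp [code, st₀, full, h, update_full]
  | @loopTrue_true v p S S₁ S₂ l t₁ t₂ h h₁ h₂ ih₁ ih₂ =>
    refine Steps.trans (Steps.trans (Steps.single (hm none) ?_)
      (ih₁ (emb ∘ some) (emb none) m fun l => hm _)) (ih₂ emb exit m hm)
    simp [code, st₀, full, h, update_full]
    rfl
  | @ifPop_nil v p q S S₁ t h h₁ ih₁ =>
    refine Steps.trans (Steps.single (hm none) ?_) (ih₁ (emb ∘ some ∘ Sum.inr) exit m fun l => hm _)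
    have hv : update S v [] = S := by rw [← h]; exact Function.update_eq_self v S
    simp [code, st₀, full, h, update_full, hv]
    rfl
  | @ifPop_cons v p q S S₁ b l t h h₁ ih₁ =>
    refine Steps.trans (Steps.single (hm none) ?_) (ih₁ (emb ∘ some ∘ Sum.inl) exit m fun l => hm _)
    simp [code, st₀, full, h, update_full]
    rfl
  | @call i v w S n hvw h =>
    have h₁ := steps_call_in c emb exit m hm n 0 S h
    have h₃ := steps_call_out c emb exit m hm (f i n) (update S v [])
    have key : ∀ t, (flip bind (c i).tm.step)^[t] (some (initList (c i).tm
          ((Computability.unaryEncodeNat n).map (c i).inputAlphabet.invFun))) =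
        some (haltList (c i).tm ((f i n).map (c i).outputAlphabet.invFun)) →
        Steps (c i).tm.m t
          ⟨some (c i).tm.main, (c i).tm.initialState, update (fun _ => []) (c i).tm.k₀
            ((Computability.unaryEncodeNat n).map (c i).inputAlphabet.invFun)⟩
          ⟨none, (c i).tm.initialState, update (fun _ => []) (c i).tm.k₁
            ((f i n).map (c i).outputAlphabet.invFun)⟩ := by
      intro t ht
      rw [initList_eq, haltList_eq] at ht
      exact ht
    have hout := key _ ((c i).outputsFun n).evals_in_steps
    have h₂ := steps_embed c (update S v []) i (emb ∘ Sum.inr) (emb (Sum.inl true)) m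
      (fun l => hm _) _ _ _ hout
    rw [Function.update_of_ne hvw.symm] at h₃
    have e : stAt c i (c i).tm.initialState = st₀ c := by simp [stAt, st₀]
    simp only [cfgAt, e, Option.elim, unaryEncodeNat_eq, List.map_replicate] at h₂
    refine Steps.trans (Steps.trans ?_ h₂) h₃
    simp only [List.replicate_zero, Function.update_eq_self, add_zero] at h₁
    rw [fullAt_nil] at h₁
    exact h₁

/-- The machine has one more label, `none`, at which it halts; this costs the additional step in the
time bound. -/
theorem polyTime_of_run [Fintype V] [Fintype ι] (p : StackProg V ι) (vin vout : V)
    (g : ℕ → List Bool) (P : Polynomial ℕ)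
    (h : ∀ n, ∃ t ≤ P.eval n, Run f (callTime c) p
      (update (fun _ => []) vin (List.replicate n true)) (update (fun _ => []) vout (g n)) t) :
    Nonempty (TM2ComputableInPolyTime Computability.unaryEncodeNat id g) := by
  have := finite_lab c p
  have : Fintype (Lab c p) := Fintype.ofFinite _
  have : ∀ i, Fintype (c i).tm.K := fun i => (c i).tm.kFin
  have : ∀ i, Fintype (c i).tm.σ := fun i => (c i).tm.σFin
  let M : FinTM2 :=
    { K := Stk V c
      k₀ := Sum.inl vin
      k₁ := Sum.inl vout
      Γ := Alph c
      Λ := Option (Lab c p)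
      main := some (entry c p)
      σ := St c
      initialState := st₀ c
      Γk₀Fin := inferInstanceAs (Fintype Bool)
      m := fun l => l.elim .halt (code c p some none) }
  have full_update : ∀ (v : V) (l : List Bool),
      (update (fun _ => []) (Sum.inl v) l : ∀ k, List (Alph (V := V) c k)) =
        full c (update (fun _ => []) v l) := by
    intro v l
    rw [← update_full]
    congr 1
    funext k
    rcases k with v | p <;> rfl
  choose t ht hr using h
  refine ⟨{ tm := M, inputAlphabet := Equiv.refl Bool, outputAlphabet := Equiv.refl Bool,
            time := P + 1, outputsFun := fun n => ⟨⟨t n + 1, ?_⟩, ?_⟩ }⟩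
  · have h₁ := (hr n).steps c (Λ' := Option (Lab c p)) some none M.m fun l => rfl
    have h₂ : Steps M.m 1 ⟨some none, st₀ c, full c (update (fun _ => []) vout (g n))⟩
        ⟨none, st₀ c, full c (update (fun _ => []) vout (g n))⟩ := Steps.single rfl rfl
    have h₃ := h₁.trans h₂
    have e₁ : initList M ((Computability.unaryEncodeNat n).map (Equiv.refl Bool).invFun) =
        ⟨some (some (entry c p)), st₀ c,
          full c (update (fun _ => []) vin (List.replicate n true))⟩ := by
      rw [initList_eq, unaryEncodeNat_eq]
      congr 1
      refine (full_update vin _).trans ?_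
      simp
    have e₂ : haltList M ((g n).map (Equiv.refl Bool).invFun) =
        ⟨none, st₀ c, full c (update (fun _ => []) vout (g n))⟩ := by
      rw [haltList_eq]
      congr 1
      refine (full_update vout _).trans ?_
      simp
    change (flip bind (TM2.step M.m))^[t n + 1] (some (initList M _)) = some (haltList M _)
    rw [e₁]
    exact Eq.trans h₃ (congrArg some e₂.symm)
  · simp only [Polynomial.eval_add, Polynomial.eval_one, unaryEncodeNat_eq, List.length_replicate]
    have := ht n
    omega

end StackProg

end

noncomputable section

/-! ### String expressions -/

open Function (update)

/-- Expressions for strings, over variables named by `X`: `forIn i v g` is the concatenation of `g`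
over all `j < |v|`, where `i` is `1^j` in the `j`-th copy. -/
inductive StrExpr (X : Type) : Type
  | bit (b : Bool)
  | var (v : X)
  | app (g h : StrExpr X)
  | forIn (i v : X) (g : StrExpr X)
  | letIn (i : X) (g h : StrExpr X)

namespace StrExpr

variable {X ι : Type} [DecidableEq X] [DecidableEq ι]

/-- The value of an expression. -/
def val : StrExpr X → (X → List Bool) → List Bool
  | .bit b, _ => [b]
  | .var v, e => e v
  | .app g h, e => g.val e ++ h.val e
  | .forIn i v g, e =>
      (List.range (e v).length).flatMap fun j => g.val (update e i (List.replicate j true))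
  | .letIn i g h, e => h.val (update e i (g.val e))

/-- The running time of the compiled expression. -/
def cost : StrExpr X → (X → List Bool) → ℕ
  | .bit _, _ => 1
  | .var v, e => (2 * (e v).length + 1) + (3 * (e v).length + 1)
  | .app g h, e => g.cost e + h.cost e
  | .forIn i v g, e => (2 * (e v).length + 1) + (3 * (e v).length + 1) +
      ((((List.range (e v).length).map fun j =>
        1 + (g.cost (update e i (List.replicate j true)) + 1)).sum + 1) + (2 * (e v).length + 1))
  | .letIn i g h, e => g.cost e + (h.cost (update e i (g.val e)) + (2 * (g.val e).length + 1))

/-- The expression reads only variables in `R` and binds no variable in `F`. -/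
def WF : List X → List X → StrExpr X → Prop
  | _, _, .bit _ => True
  | R, _, .var v => v ∈ R
  | R, F, .app g h => WF R F g ∧ WF R F h
  | R, F, .forIn i v g => v ∈ R ∧ i ∉ F ∧ WF (i :: R) (i :: F) g
  | R, F, .letIn i g h => i ∉ F ∧ WF R (i :: F) g ∧ WF (i :: R) (i :: F) h

instance decidableWF : (R F : List X) → (g : StrExpr X) → Decidable (WF R F g)
  | _, _, .bit _ => inferInstanceAs (Decidable True)
  | R, _, .var v => inferInstanceAs (Decidable (v ∈ R))
  | R, F, .app g h =>
    have := decidableWF R F g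
    have := decidableWF R F h
    inferInstanceAs (Decidable (WF R F g ∧ WF R F h))
  | R, F, .forIn i v g =>
    have := decidableWF (i :: R) (i :: F) g
    inferInstanceAs (Decidable (v ∈ R ∧ i ∉ F ∧ WF (i :: R) (i :: F) g))
  | R, F, .letIn i g h =>
    have := decidableWF R (i :: F) g
    have := decidableWF (i :: R) (i :: F) h
    inferInstanceAs (Decidable (i ∉ F ∧ WF R (i :: F) g ∧ WF (i :: R) (i :: F) h))

/-- The stacks used by a compiled expression: three global ones and two for each variable. -/
abbrev Reg (X : Type) : Type := Fin 3 ⊕ X × Bool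

/-- The input and output stack. -/
abbrev io : Reg X := Sum.inl 0

/-- A stack for temporary use. -/
abbrev tmp : Reg X := Sum.inl 1

/-- The stack that collects the output. -/
abbrev acc : Reg X := Sum.inl 2

/-- The stack of a variable, holding its value with the last bit on top. -/
abbrev vreg (v : X) : Reg X := Sum.inr (v, false)

/-- The stack that counts the remaining iterations of a loop. -/
abbrev rreg (v : X) : Reg X := Sum.inr (v, true)

end StrExpr

/-! ### Moving, copying and emptying stacks. -/

namespace StackProg

variable {V ι : Type} [DecidableEq V] [DecidableEq ι] {f : ι → ℕ → List Bool} {T : ι → ℕ → ℕ}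

theorem Run.congr {p : StackProg V ι} {S S₁ S₂ : V → List Bool} {t₁ t₂ : ℕ}
    (h : Run f T p S S₁ t₁) (hS : S₂ = S₁) (ht : t₂ = t₁) : Run f T p S S₂ t₂ := by
  subst hS ht
  exact h

/-- Move a stack to another one. -/
def move (a b : V) : StackProg V ι := .loop a (.push b true) (.push b false)

/-- Move a stack to two other ones. -/
def move₂ (a b d : V) : StackProg V ι :=
  .loop a (.seq (.push b true) (.push d true)) (.seq (.push b false) (.push d false))

/-- Empty a stack. -/
def clear (a : V) : StackProg V ι := .loop a .skip .skip

theorem run_move {a b : V} (hab : a ≠ b) {S : V → List Bool} (l : List Bool) (h : S a = l) :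
    Run f T (move (ι := ι) a b) S (update (update S a []) b (l.reverse ++ S b))
      (2 * l.length + 1) := by
  induction l generalizing S with
  | nil =>
    refine (Run.loop_nil h).congr ?_ rfl
    rw [← h, Function.update_eq_self, h, List.reverse_nil, List.nil_append,
      Function.update_eq_self]
  | cons x l ih =>
    have h₁ := ih (S := update (update S a l) b (x :: S b)) (by
      rw [Function.update_of_ne hab, Function.update_self])
    have hp : Run f T (ι := ι) (if x then .push b true else .push b false) (update S a l)
        (update (update S a l) b (x :: S b)) 1 := by
      have := Run.push (f := f) (T := T) b x (update S a l)
      rw [Function.update_of_ne hab.symm] at this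
      cases x <;> exact this
    refine (Run.loop_cons h hp h₁).congr ?_ ?_
    · funext k
      simp only [Function.update_apply, List.reverse_cons, List.append_assoc,
        List.singleton_append]
      split_ifs <;> simp_all
    · simp only [List.length_cons]; ring

theorem run_move₂ {a b d : V} (hab : a ≠ b) (had : a ≠ d) (hbd : b ≠ d) {S : V → List Bool}
    (l : List Bool) (h : S a = l) :
    Run f T (move₂ (ι := ι) a b d) S
      (update (update (update S a []) b (l.reverse ++ S b)) d (l.reverse ++ S d))
      (3 * l.length + 1) := by
  induction l generalizing S with
  | nil =>
    refine (Run.loop_nil h).congr ?_ rfl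
    rw [← h, Function.update_eq_self, h, List.reverse_nil, List.nil_append, List.nil_append,
      Function.update_eq_self, Function.update_eq_self]
  | cons x l ih =>
    have h₁ := ih (S := update (update (update S a l) b (x :: S b)) d (x :: S d)) (by
      rw [Function.update_of_ne had, Function.update_of_ne hab, Function.update_self])
    have hp : Run f T (ι := ι) (if x then .seq (.push b true) (.push d true)
        else .seq (.push b false) (.push d false)) (update S a l)
        (update (update (update S a l) b (x :: S b)) d (x :: S d)) 2 := by
      have h₂ := Run.push (f := f) (T := T) b x (update S a l)
      rw [Function.update_of_ne hab.symm] at h₂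
      have h₃ := Run.push (f := f) (T := T) d x (update (update S a l) b (x :: S b))
      rw [Function.update_of_ne hbd.symm, Function.update_of_ne had.symm] at h₃
      cases x <;> exact h₂.seq h₃
    refine (Run.loop_cons h hp h₁).congr ?_ ?_
    · funext k
      simp only [Function.update_apply, List.reverse_cons, List.append_assoc,
        List.singleton_append]
      split_ifs <;> simp_all
    · simp only [List.length_cons]; ring

theorem run_clear {a : V} {S : V → List Bool} (l : List Bool) (h : S a = l) :
    Run f T (clear (ι := ι) a) S (update S a []) (2 * l.length + 1) := by
  induction l generalizing S with
  | nil =>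
    refine (Run.loop_nil h).congr ?_ rfl
    rw [← h, Function.update_eq_self]
  | cons x l ih =>
    have h₁ := ih (S := update S a l) (by rw [Function.update_self])
    have hp : Run f T (ι := ι) (if x then .skip else .skip) (update S a l) (update S a l) 1 := by
      cases x <;> exact Run.skip _
    refine (Run.loop_cons h hp h₁).congr ?_ ?_
    · rw [Function.update_idem]
    · simp only [List.length_cons]; ring

end StackProg

/-! ### Compilation of string expressions to stack programs. -/

namespace StrExpr

open StackProg

variable {X ι : Type} [DecidableEq X] [DecidableEq ι] {f : ι → ℕ → List Bool} {T : ι → ℕ → ℕ}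

/-- The program that pushes the value of an expression to a stack. -/
def compile : StrExpr X → Reg X → StackProg (Reg X) ι
  | .bit b, o => .push o b
  | .var v, o => .seq (move (vreg v) tmp) (move₂ tmp (vreg v) o)
  | .app g h, o => .seq (g.compile o) (h.compile o)
  | .forIn i v g, o =>
      .seq (.seq (move (vreg v) tmp) (move₂ tmp (vreg v) (rreg i)))
        (.seq (.loop (rreg i) (.seq (g.compile o) (.push (vreg i) true))
          (.seq (g.compile o) (.push (vreg i) true))) (clear (vreg i)))
  | .letIn i g h, o => .seq (g.compile (vreg i)) (.seq (h.compile o) (clear (vreg i)))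

/-- The stacks hold the values of the variables in `R`, and the stacks of variables outside `F` are
empty. -/
structure Good (R F : List X) (e : X → List Bool) (S : Reg X → List Bool) : Prop where
  read : ∀ v ∈ R, S (vreg v) = (e v).reverse
  fresh : ∀ i ∉ F, S (vreg i) = [] ∧ S (rreg i) = []
  tmp_nil : S tmp = []
  sub : R ⊆ F

/-- The stack `o` can receive output: it is not in use otherwise. -/
def Target (R F : List X) (o : Reg X) : Prop := o = acc ∨ ∃ i ∈ F, i ∉ R ∧ o = vreg i

theorem Target.ne_vreg {R F : List X} {o : Reg X} (h : Target R F o) {v : X} (hv : v ∈ R) :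
    vreg v ≠ o := by
  rcases h with rfl | ⟨i, -, hi, rfl⟩
  · simp
  · rintro h; simp at h; exact hi (h ▸ hv)

theorem Target.ne_of_notMem {R F : List X} {o : Reg X} (h : Target R F o) {v : X} (hv : v ∉ F)
    (b : Bool) : (Sum.inr (v, b) : Reg X) ≠ o := by
  rcases h with rfl | ⟨i, hi, -, rfl⟩
  · simp
  · rintro h; simp at h; exact hv (h.1 ▸ hi)

theorem Target.ne_tmp {R F : List X} {o : Reg X} (h : Target R F o) : tmp ≠ o := by
  rcases h with rfl | ⟨i, hi, -, rfl⟩ <;> simp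

theorem Good.update {R F : List X} {e : X → List Bool} {S : Reg X → List Bool}
    (h : Good R F e S) {o : Reg X} (ho : Target R F o) (l : List Bool) :
    Good R F e (update S o l) where
  read v hv := by rw [Function.update_of_ne (ho.ne_vreg hv)]; exact h.read v hv
  fresh i hi := by
    rw [Function.update_of_ne (ho.ne_of_notMem hi _), Function.update_of_ne (ho.ne_of_notMem hi _)]
    exact h.fresh i hi
  tmp_nil := by rw [Function.update_of_ne ho.ne_tmp]; exact h.tmp_nil
  sub := h.sub

/-- Each transfer reverses the string: the detour through `tmp` restores the source and leaves a
copy in the same order on `d`. -/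
theorem run_copy {v : X} {d : Reg X} {S : Reg X → List Bool} (l : List Bool)
    (h : S (vreg v) = l.reverse) (ht : S tmp = []) (hv : vreg v ≠ d) (htd : tmp ≠ d) :
    Run f T (ι := ι) (.seq (move (vreg v) tmp) (move₂ tmp (vreg v) d)) S
      (update S d (l.reverse ++ S d)) ((2 * l.length + 1) + (3 * l.length + 1)) := by
  have hvt : (vreg v : Reg X) ≠ tmp := by simp
  have h₁ := run_move (f := f) (T := T) (ι := ι) hvt _ h
  rw [ht, List.append_nil, List.reverse_reverse, List.length_reverse] at h₁
  have h₂ := run_move₂ (f := f) (T := T) (ι := ι) hvt.symm htd hv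
    (S := update (update S (vreg v) []) tmp l) l (by rw [Function.update_self])
  refine (h₁.seq h₂).congr ?_ rfl
  funext k
  simp only [Function.update_apply]
  split_ifs <;> simp_all

/-- Induction on the expression. The invariant `Good` survives output because a `Target` is neither
readable, nor fresh, nor `tmp`; bound variables are fresh, so their stacks are empty before and are
emptied again afterwards. -/
theorem run_compile {R F : List X} {e : X → List Bool} {S : Reg X → List Bool} {o : Reg X}
    (g : StrExpr X) (hg : g.WF R F) (hS : Good R F e S) (ho : Target R F o) :
    Run f T (ι := ι) (g.compile o) S (update S o ((g.val e).reverse ++ S o)) (g.cost e) := by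
  induction g generalizing R F e S o with
  | bit b => exact Run.push _ _ _
  | var v => exact run_copy (e v) (hS.read v hg) hS.tmp_nil (ho.ne_vreg hg) ho.ne_tmp
  | app g h ihg ihh =>
    have h₁ := ihg hg.1 hS ho
    have h₂ := ihh hg.2 (hS.update ho ((g.val e).reverse ++ S o)) ho
    rw [Function.update_self, Function.update_idem, ← List.append_assoc, ← List.reverse_append]
      at h₂
    exact h₁.seq h₂
  | forIn i v g ih =>
    obtain ⟨hv, hi, hg⟩ := hg
    have hvi : v ≠ i := fun h => hi (h ▸ hS.sub hv)
    have ho' : Target (i :: R) (i :: F) o := by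
      rcases ho with rfl | ⟨j, hj, hj', rfl⟩
      · exact Or.inl rfl
      · refine Or.inr ⟨j, List.mem_cons_of_mem _ hj, ?_, rfl⟩
        rintro (_ | ⟨_, h⟩)
        · exact hi hj
        · exact hj' h
    have hio : vreg i ≠ o := ho.ne_of_notMem hi _
    have hro : rreg i ≠ o := ho.ne_of_notMem hi _
    have hri : (rreg i : Reg X) ≠ vreg i := by simp
    have h₁ := run_copy (f := f) (T := T) (ι := ι) (d := rreg i) (e v) (hS.read v hv) hS.tmp_nil
      (by simp) (by simp)
    rw [(hS.fresh i hi).2, List.append_nil] at h₁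
    -- Only the length of `rreg i` matters, since both branches of the loop coincide. The stack
    -- `vreg i` grows by one bit per iteration, so it always holds the value `1^j` of the loop
    -- variable.
    have hloop : ∀ (l : List Bool) (j : ℕ) (w : List Bool), j + l.length = (e v).length →
        Run f T (ι := ι) (.loop (rreg i) (.seq (g.compile o) (.push (vreg i) true))
            (.seq (g.compile o) (.push (vreg i) true)))
          (update (update (update S (rreg i) l) (vreg i) (List.replicate j true)) o w)
          (update (update (update S (rreg i) []) (vreg i)
            (List.replicate (e v).length true)) o
              (((List.range' j l.length).flatMap fun j =>
                g.val (update e i (List.replicate j true))).reverse ++ w))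
          (((List.range' j l.length).map fun j =>
            1 + (g.cost (update e i (List.replicate j true)) + 1)).sum + 1) := by
      intro l
      induction l with
      | nil =>
        intro j w hj
        simp only [List.length_nil, add_zero] at hj
        subst hj
        refine (Run.loop_nil ?_).congr ?_ ?_
        · simp [hro, hri]
        · simp
        · simp
      | cons x l ihl =>
        intro j w hj
        have hgood : Good (i :: R) (i :: F) (update e i (List.replicate j true))
            (update (update (update S (rreg i) l) (vreg i) (List.replicate j true)) o w) := by
          refine Good.update ⟨?_, ?_, ?_, ?_⟩ ho' w
          · intro u hu
            rcases eq_or_ne u i with rfl | hui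
            · simp
            · have hu' : u ∈ R := by simpa [hui] using hu
              simp [hui, hS.read u hu']
          · intro u hu
            simp only [List.mem_cons, not_or] at hu
            simp [hu.1, hS.fresh u hu.2]
          · simp [hS.tmp_nil]
          · exact List.cons_subset_cons _ hS.sub
        have h₂ := (ih hg hgood ho').seq (Run.push (vreg i) true _)
        rw [Function.update_self, Function.update_idem, Function.update_of_ne hio,
          Function.update_self, ← List.replicate_succ] at h₂
        have h₃ := ihl (j + 1) ((g.val (update e i (List.replicate j true))).reverse ++ w)
          (by simp only [List.length_cons] at hj; omega)
        have e₁ : update (update (update (update S (rreg i) (x :: l)) (vreg i)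
            (List.replicate j true)) o w) (rreg i) l =
            update (update (update S (rreg i) l) (vreg i) (List.replicate j true)) o w := by
          rw [Function.update_comm hro.symm, Function.update_comm hri.symm, Function.update_idem]
        have e₂ : update (update (update (update S (rreg i) l) (vreg i) (List.replicate j true)) o
            ((g.val (update e i (List.replicate j true))).reverse ++ w)) (vreg i)
              (List.replicate (j + 1) true) =
            update (update (update S (rreg i) l) (vreg i) (List.replicate (j + 1) true)) o
              ((g.val (update e i (List.replicate j true))).reverse ++ w) := by
          rw [Function.update_comm hio.symm, Function.update_idem]
        rw [e₂] at h₂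
        refine (Run.loop_cons (b := x) (l := l)
          (t₁ := g.cost (update e i (List.replicate j true)) + 1) (q := .seq (g.compile o) (.push (vreg i) true))
          ?_ ?_ h₃).congr ?_ ?_
        rotate_left 2
        · simp [List.range'_succ]
        · simp only [List.length_cons, List.range'_succ, List.map_cons, List.sum_cons]
          ring
        · rw [Function.update_of_ne hro, Function.update_of_ne hri, Function.update_self]
        · rw [e₁]
          cases x <;> exact h₂
    have h₂ := hloop (e v).reverse 0 (S o) (by simp)
    have e₁ : update (update (update S (rreg i) (e v).reverse) (vreg i) (List.replicate 0 true)) o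
        (S o) = update S (rreg i) (e v).reverse := by
      funext k
      simp only [Function.update_apply, List.replicate_zero]
      have := (hS.fresh i hi).1
      split_ifs <;> simp_all
    rw [e₁, List.length_reverse, ← List.range_eq_range'] at h₂
    have h₃ := run_clear (f := f) (T := T) (ι := ι) (a := vreg i)
      (S := update (update (update S (rreg i) []) (vreg i) (List.replicate (e v).length true)) o
        ((((List.range (e v).length).flatMap fun j =>
          g.val (update e i (List.replicate j true))).reverse ++ S o))) _
      (by rw [Function.update_of_ne hio, Function.update_self])
    rw [List.length_replicate] at h₃
    refine (h₁.seq (h₂.seq h₃)).congr ?_ rfl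
    funext k
    simp only [Function.update_apply, val]
    have := hS.fresh i hi
    split_ifs <;> simp_all
  | letIn i g h ihg ihh =>
    obtain ⟨hi, hg, hh⟩ := hg
    have hio : vreg i ≠ o := ho.ne_of_notMem hi _
    have hiR : i ∉ R := fun h => hi (hS.sub h)
    have ho' : Target (i :: R) (i :: F) o := by
      rcases ho with rfl | ⟨j, hj, hj', rfl⟩
      · exact Or.inl rfl
      · refine Or.inr ⟨j, List.mem_cons_of_mem _ hj, ?_, rfl⟩
        rintro (_ | ⟨_, h⟩)
        · exact hi hj
        · exact hj' h
    -- During the evaluation of `g` the variable `i` is in use but not yet readable, which makes its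
    -- own stack a legitimate target.
    have h₁ := ihg (S := S) (o := vreg i) (e := e) hg
      ⟨hS.read, fun u hu => hS.fresh u fun h => hu (List.mem_cons_of_mem _ h), hS.tmp_nil,
        fun u hu => List.mem_cons_of_mem _ (hS.sub hu)⟩ (Or.inr ⟨i, by simp, hiR, rfl⟩)
    rw [(hS.fresh i hi).1, List.append_nil] at h₁
    have h₂ := ihh (S := update S (vreg i) (g.val e).reverse) (o := o)
      (e := update e i (g.val e)) hh (by
        refine ⟨?_, ?_, ?_, ?_⟩
        · intro u hu
          rcases eq_or_ne u i with rfl | hui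
          · simp
          · have hu' : u ∈ R := by simpa [hui] using hu
            simp [hui, hS.read u hu']
        · intro u hu
          simp only [List.mem_cons, not_or] at hu
          simp [hu.1, hS.fresh u hu.2]
        · simp [hS.tmp_nil]
        · exact List.cons_subset_cons _ hS.sub) ho'
    rw [Function.update_of_ne hio.symm] at h₂
    have h₃ := run_clear (f := f) (T := T) (ι := ι) (a := vreg i)
      (S := update (update S (vreg i) (g.val e).reverse) o
        ((h.val (update e i (g.val e))).reverse ++ S o)) _
      (by rw [Function.update_of_ne hio, Function.update_self])
    rw [List.length_reverse] at h₃
    refine (h₁.seq (h₂.seq h₃)).congr ?_ rfl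
    funext k
    simp only [Function.update_apply, val]
    have := hS.fresh i hi
    split_ifs <;> simp_all

end StrExpr

end

noncomputable section

open Function (update)

/-! ### Polynomial-time evaluation of string expressions -/

namespace StackProg

variable {V ι : Type} [DecidableEq V] [DecidableEq ι] {f : ι → ℕ → List Bool}
  (c : ∀ i, TM2ComputableInPolyTime Computability.unaryEncodeNat id (f i))

/-- The number of `push` commands in a statement. -/
def numPush {K : Type} {Γ : K → Type} {Λ σ : Type} : TM2.Stmt Γ Λ σ → ℕ
  | .push _ _ q => 1 + numPush q
  | .peek _ _ q => numPush q
  | .pop _ _ q => numPush q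
  | .load _ q => numPush q
  | .branch _ q₁ q₂ => numPush q₁ + numPush q₂
  | .goto _ => 0
  | .halt => 0

theorem length_stepAux_le {K : Type} [DecidableEq K] {Γ : K → Type} {Λ σ : Type}
    (q : TM2.Stmt Γ Λ σ) (v : σ) (S : ∀ k, List (Γ k)) (k : K) :
    ((TM2.stepAux q v S).stk k).length ≤ (S k).length + numPush q := by
  induction q generalizing v S with
  | push k' g q ih =>
    refine (ih _ _).trans ?_
    rcases eq_or_ne k k' with rfl | h
    · simp [numPush]; omega
    · simp [numPush, h]
  | peek k' g q ih => exact ih _ _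
  | pop k' g q ih =>
    refine (ih _ _).trans ?_
    rcases eq_or_ne k k' with rfl | h
    · simp [numPush]
    · simp [numPush, h]
  | load g q ih => exact ih _ _
  | branch g q₁ q₂ ih₁ ih₂ =>
    simp only [TM2.stepAux, numPush]
    cases g v
    · exact (ih₂ v S).trans (by omega)
    · exact (ih₁ v S).trans (by omega)
  | goto l => simp [TM2.stepAux, numPush]
  | halt => simp [TM2.stepAux, numPush]

theorem length_steps_le {K : Type} [DecidableEq K] {Γ : K → Type} {Λ σ : Type}
    (m : Λ → TM2.Stmt Γ Λ σ) (N : ℕ) (hN : ∀ l, numPush (m l) ≤ N) (t : ℕ) (x y : TM2.Cfg Γ Λ σ)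
    (h : (flip bind (TM2.step m))^[t] (some x) = some y) (k : K) :
    (y.stk k).length ≤ (x.stk k).length + t * N := by
  induction t generalizing y with
  | zero =>
    simp only [Function.iterate_zero, id_eq, Option.some.injEq] at h
    simp [h]
  | succ t ih =>
    rw [Function.iterate_succ_apply'] at h
    cases hz : (flip bind (TM2.step m))^[t] (some x) with
    | none => rw [hz] at h; simp [flip] at h
    | some z =>
      rw [hz] at h
      have h₁ := ih z hz
      rcases z with ⟨_ | l, v, S⟩
      · simp [flip] at h
      · simp only [flip, Option.bind_eq_bind, Option.bind_some, TM2.step, Option.some.injEq] at h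
        subst h
        have h₂ := length_stepAux_le (m l) v S k
        have h₃ := hN l
        simp only at h₁
        calc _ ≤ (S k).length + numPush (m l) := h₂
          _ ≤ (x.stk k).length + t * N + N := by omega
          _ = _ := by ring

theorem callTime_le (i : ι) (n : ℕ) : callTime c i n ≤ (c i).time.eval n := by
  refine ((c i).outputsFun n).steps_le_m.trans (le_of_eq ?_)
  rw [unaryEncodeNat_eq, List.length_replicate]

/-- A machine writes no more than it pushes: in each step at most `N` symbols, the number of `push`
commands in its whole code. The bound is needed because the cost of a call includes reading its
output. -/
theorem exists_length_le
    (c : ∀ i, TM2ComputableInPolyTime Computability.unaryEncodeNat id (f i)) (i : ι) : ∃ P : Polynomial ℕ, ∀ n, (f i n).length ≤ P.eval n := by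
  have : Fintype (c i).tm.Λ := (c i).tm.ΛFin
  let N := ∑ l, numPush ((c i).tm.m l)
  refine ⟨Polynomial.X + (c i).time * Polynomial.C N, fun n => ?_⟩
  have key : ∀ t, (flip bind (c i).tm.step)^[t] (some (initList (c i).tm
        ((Computability.unaryEncodeNat n).map (c i).inputAlphabet.invFun))) =
      some (haltList (c i).tm ((f i n).map (c i).outputAlphabet.invFun)) →
      (f i n).length ≤ n + t * N := by
    intro t ht
    rw [initList_eq, haltList_eq] at ht
    have h := length_steps_le (c i).tm.m N
      (fun l => Finset.single_le_sum (f := fun l => numPush ((c i).tm.m l)) (by simp)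
        (Finset.mem_univ l)) t _ _ ht (c i).tm.k₁
    simp only [Function.update_self, List.length_map] at h
    refine h.trans ?_
    gcongr
    -- If input and output share a stack, the `n` input symbols are there from the start; otherwise
    -- that stack starts empty.
    by_cases h : (c i).tm.k₁ = (c i).tm.k₀
    · have : ∀ k, k = (c i).tm.k₀ → (update (fun k => ([] : List ((c i).tm.Γ k))) (c i).tm.k₀
          ((Computability.unaryEncodeNat n).map (c i).inputAlphabet.invFun) k).length = n := by
        rintro k rfl
        simp [unaryEncodeNat_eq]
      exact (this _ h).le
    · rw [Function.update_of_ne h]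
      simp
  have h₁ := key _ ((c i).outputsFun n).evals_in_steps
  have h₂ := callTime_le c i n
  simp only [Polynomial.eval_add, Polynomial.eval_X, Polynomial.eval_mul, Polynomial.eval_C]
  refine h₁.trans ?_
  gcongr
  exact h₂

end StackProg

namespace StrExpr

open StackProg

variable {X ι : Type} [DecidableEq X] [DecidableEq ι]

theorem length_update_le {e : X → List Bool} {B C : ℕ} (h : ∀ v, (e v).length ≤ B) (hBC : B ≤ C)
    (i : X) {l : List Bool} (hl : l.length ≤ C) (v : X) : (update e i l v).length ≤ C := by
  rcases eq_or_ne v i with rfl | hv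
  · simpa using hl
  · simpa [hv] using (h v).trans hBC

theorem exists_length_val_le (g : StrExpr X) : ∃ P : Polynomial ℕ, ∀ (B : ℕ) (e : X → List Bool),
    (∀ v, (e v).length ≤ B) → (g.val e).length ≤ P.eval B := by
  induction g with
  | bit b => exact ⟨1, fun B e h => by simp [val]⟩
  | var v => exact ⟨Polynomial.X, fun B e h => by simpa [val] using h v⟩
  | app g h ihg ihh =>
    obtain ⟨P, hP⟩ := ihg
    obtain ⟨Q, hQ⟩ := ihh
    refine ⟨P + Q, fun B e h => ?_⟩
    have := hP B e h
    have := hQ B e h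
    simp only [val, List.length_append, Polynomial.eval_add]
    omega
  | forIn i v g ih =>
    obtain ⟨P, hP⟩ := ih
    refine ⟨Polynomial.X * P, fun B e h => ?_⟩
    simp only [val, List.length_flatMap, Polynomial.eval_mul, Polynomial.eval_X]
    have h₁ := List.sum_le_card_nsmul ((List.range (e v).length).map fun j =>
      (g.val (update e i (List.replicate j true))).length) (P.eval B) (by
        intro x hx
        simp only [List.mem_map, List.mem_range] at hx
        obtain ⟨j, hj, rfl⟩ := hx
        have := h v
        exact hP B _ (length_update_le h le_rfl i (by simp; omega)))
    refine h₁.trans ?_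
    simp only [List.length_map, List.length_range, smul_eq_mul]
    gcongr
    exact h v
  | letIn i g h ihg ihh =>
    obtain ⟨P, hP⟩ := ihg
    obtain ⟨Q, hQ⟩ := ihh
    -- The bound variable may have length `P(B)`, so `h` is evaluated where all lengths are at most
    -- `B + P(B)`.
    refine ⟨Q.comp (Polynomial.X + P), fun B e h => ?_⟩
    have h₁ := hP B e h
    have h₂ := hQ (B + P.eval B) _ (length_update_le h (by omega) i (l := g.val e) (by omega))
    simpa [val, Polynomial.eval_comp] using h₂

theorem exists_cost_le (g : StrExpr X) : ∃ P : Polynomial ℕ, ∀ (B : ℕ) (e : X → List Bool),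
    (∀ v, (e v).length ≤ B) → g.cost e ≤ P.eval B := by
  induction g with
  | bit b => exact ⟨1, fun B e h => by simp [cost]⟩
  | var v =>
    refine ⟨5 * Polynomial.X + 2, fun B e h => ?_⟩
    have := h v
    simp [cost]
    omega
  | app g h ihg ihh =>
    obtain ⟨P, hP⟩ := ihg
    obtain ⟨Q, hQ⟩ := ihh
    refine ⟨P + Q, fun B e h => ?_⟩
    have := hP B e h
    have := hQ B e h
    simp only [cost, Polynomial.eval_add]
    omega
  | forIn i v g ih =>
    obtain ⟨P, hP⟩ := ih
    refine ⟨7 * Polynomial.X + 4 + Polynomial.X * (P + 2), fun B e h => ?_⟩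
    simp only [cost, Polynomial.eval_mul, Polynomial.eval_add, Polynomial.eval_X,
      Polynomial.eval_ofNat]
    have hv := h v
    have h₁ := List.sum_le_card_nsmul ((List.range (e v).length).map fun j =>
      1 + (g.cost (update e i (List.replicate j true)) + 1)) (P.eval B + 2) (by
        intro x hx
        simp only [List.mem_map, List.mem_range] at hx
        obtain ⟨j, hj, rfl⟩ := hx
        have := hP B _ (length_update_le h le_rfl i (l := List.replicate j true) (by simp; omega))
        omega)
    simp only [List.length_map, List.length_range, smul_eq_mul] at h₁
    have h₂ : (e v).length * (P.eval B + 2) ≤ B * (P.eval B + 2) := by gcongr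
    omega
  | letIn i g h ihg ihh =>
    obtain ⟨P, hP⟩ := ihg
    obtain ⟨Q, hQ⟩ := ihh
    obtain ⟨P', hP'⟩ := exists_length_val_le g
    refine ⟨P + Q.comp (Polynomial.X + P') + 2 * P' + 1, fun B e h => ?_⟩
    have h₀ := hP B e h
    have h₁ := hP' B e h
    have h₂ := hQ (B + P'.eval B) _ (length_update_le h (by omega) i (l := g.val e) (by omega))
    simp only [cost, Polynomial.eval_mul, Polynomial.eval_add, Polynomial.eval_X,
      Polynomial.eval_ofNat, Polynomial.eval_comp, Polynomial.eval_one]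
    omega

/-- The stacks when the variables in `R` are loaded with their values. -/
def loaded (R : List X) (e : X → List Bool) : Reg X → List Bool
  | .inl _ => []
  | .inr (v, b) => if b = false ∧ v ∈ R then (e v).reverse else []

/-- Empty the stacks of the given variables. -/
def clearAll (R : List X) : StackProg (Reg X) ι :=
  R.foldr (fun v p => .seq (clear (vreg v)) p) .skip

theorem run_clearAll {f : ι → ℕ → List Bool} {T : ι → ℕ → ℕ} (R : List X)
    (S : Reg X → List Bool) (B : ℕ) (hB : ∀ v, (S (vreg v)).length ≤ B) :
    ∃ t ≤ R.length * (2 * B + 1) + 1, Run f T (clearAll (ι := ι) R) S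
      (fun k => if ∃ v ∈ R, k = vreg v then [] else S k) t := by
  induction R generalizing S with
  | nil => exact ⟨1, by simp, (Run.skip S).congr (by simp) rfl⟩
  | cons v R ih =>
    obtain ⟨t, ht, h⟩ := ih (update S (vreg v) []) (by
      intro w
      rcases eq_or_ne w v with rfl | hw
      · simp
      · simpa [hw] using hB w)
    refine ⟨_, ?_, ((run_clear _ rfl).seq h).congr ?_ rfl⟩
    · have := hB v
      simp only [List.length_cons]
      ring_nf at ht ⊢
      omega
    · funext k
      simp only [Function.update_apply, List.mem_cons, exists_eq_or_imp]
      split_ifs <;> simp_all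

/-- The value arrives in `acc` with its last bit on top; the final move to `io` turns it round. The
variables are cleared because a machine has to halt with its output alone. -/
theorem polyTime_val [Fintype X] [Fintype ι] {f : ι → ℕ → List Bool}
    (c : ∀ i, TM2ComputableInPolyTime Computability.unaryEncodeNat id (f i))
    (p : StackProg (Reg X) ι) (R : List X) (e : ℕ → X → List Bool) (g : StrExpr X)
    (hg : g.WF R R) (P : Polynomial ℕ)
    (hp : ∀ n, ∃ t ≤ P.eval n, Run f (callTime c) p
      (update (fun _ => []) io (List.replicate n true)) (loaded R (e n)) t)
    (B : Polynomial ℕ) (hB : ∀ n v, (e n v).length ≤ B.eval n) :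
    Nonempty (TM2ComputableInPolyTime Computability.unaryEncodeNat id fun n => g.val (e n)) := by
  obtain ⟨L, hL⟩ := exists_length_val_le g
  obtain ⟨Q, hQ⟩ := exists_cost_le g
  refine polyTime_of_run c (.seq p (.seq (g.compile acc) (.seq (clearAll R) (move acc io)))) io io _
    (P + Q.comp B + (Polynomial.C R.length * (2 * B + 1) + 1) + 2 * L.comp B + 1) fun n => ?_
  obtain ⟨t, ht, h₁⟩ := hp n
  have h₂ := run_compile (f := f) (T := callTime c) (ι := ι) (e := e n) (o := acc) g hg
    (S := loaded R (e n)) ⟨fun v hv => by simp [loaded, hv], fun v hv => by simp [loaded, hv], rfl,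
      fun v h => h⟩ (Or.inl rfl)
  obtain ⟨t', ht', h₃⟩ := run_clearAll (ι := ι) (f := f) (T := callTime c) R
    (update (loaded R (e n)) acc ((g.val (e n)).reverse ++ loaded R (e n) acc)) (B.eval n) (by
      intro v
      have := hB n v
      rw [Function.update_of_ne (by simp)]
      simp only [loaded]
      split_ifs <;> simp [this])
  have h₄ := run_move (f := f) (T := callTime c) (ι := ι) (a := acc) (b := io)
    (S := fun k => if ∃ v ∈ R, k = vreg v then [] else
      update (loaded R (e n)) acc ((g.val (e n)).reverse ++ loaded R (e n) acc) k) (by simp)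
    (g.val (e n)).reverse (by simp [loaded])
  refine ⟨_, ?_, (h₁.seq (h₂.seq (h₃.seq h₄))).congr ?_ rfl⟩
  · have h₅ := hQ _ (e n) (hB n)
    have h₆ := hL _ (e n) (hB n)
    simp only [Polynomial.eval_mul, Polynomial.eval_add, Polynomial.eval_C,
      Polynomial.eval_ofNat, Polynomial.eval_comp, Polynomial.eval_one, List.length_reverse]
    omega
  · funext k
    rcases k with k | ⟨v, b⟩
    · fin_cases k <;> simp [loaded, Function.update_apply]
    · cases b <;> simp +contextual [loaded]

/-! ### Loading the variables from the input and from the outputs of subroutines. -/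

/-- Store half of the unary number in `io`, its parity and the opposite of its parity. -/
def halve (h o e : X) : StackProg (Reg X) ι :=
  .seq (.loop io (.ifPop (vreg o) (.push (vreg h) true) (.push (vreg o) true)) .skip)
    (.ifPop (vreg o) (.push (vreg o) true) (.push (vreg e) true))

theorem run_halve {f : ι → ℕ → List Bool} {T : ι → ℕ → ℕ} {h o e : X} (hho : h ≠ o) (hhe : h ≠ e)
    (hoe : o ≠ e) (n : ℕ) :
    Run f T (halve (ι := ι) h o e) (update (fun _ => []) io (List.replicate n true))
      (update (update (update (fun _ => []) (vreg h) (List.replicate (n / 2) true)) (vreg o)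
        (List.replicate (n % 2) true)) (vreg e) (List.replicate (1 - n % 2) true))
      ((3 * n + 1) + 2) := by
  -- The stack of `o` toggles between empty and one bit, and `h` receives a bit whenever `o` is
  -- emptied: `a` counts the completed pairs and `b` is the running parity.
  have key : ∀ (n a b : ℕ) (S : Reg X → List Bool), b < 2 →
      S io = List.replicate n true → S (vreg h) = List.replicate a true →
      S (vreg o) = List.replicate b true →
      Run f T (ι := ι)
        (.loop io (.ifPop (vreg o) (.push (vreg h) true) (.push (vreg o) true)) .skip) S
        (update (update (update S io []) (vreg h) (List.replicate (a + (n + b) / 2) true)) (vreg o)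
          (List.replicate ((n + b) % 2) true)) (3 * n + 1) := by
    intro n
    induction n with
    | zero =>
      intro a b S hb h₁ h₂ h₃
      refine (Run.loop_nil h₁).congr ?_ rfl
      funext k
      have : b / 2 = 0 := by omega
      have : b % 2 = b := by omega
      simp only [Function.update_apply]
      split_ifs <;> simp_all
    | succ n ih =>
      intro a b S hb h₁ h₂ h₃
      obtain rfl | rfl : b = 0 ∨ b = 1 := by omega
      · have h₄ := ih a 1 (update (update S io (List.replicate n true)) (vreg o) [true])
          (by omega) (by simp) (by simp [hho, h₂]) (by simp)
        refine (Run.loop_cons (b := true) h₁ ((Run.ifPop_nil (by simpa using h₃)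
          (Run.push _ _ _)).congr (by simp [h₃]) rfl) h₄).congr ?_ ?_
        · funext k
          simp only [Function.update_apply]
          split_ifs <;> simp_all
        · ring
      · have h₄ := ih (a + 1) 0 (update (update (update S io (List.replicate n true))
          (vreg o) []) (vreg h) (List.replicate (a + 1) true))
          (by omega) (by simp) (by simp) (by simp [hho.symm])
        refine (Run.loop_cons (b := true) h₁ ((Run.ifPop_cons (b := true) (l := [])
          (by simpa using h₃) (Run.push _ _ _)).congr
            (by simp [h₂, hho, List.replicate_succ]) rfl) h₄).congr ?_ ?_
        · funext k
          have e₁ : a + (n + 1 + 1) / 2 = a + 1 + n / 2 := by omega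
          have e₂ : (n + 1 + 1) % 2 = n % 2 := by omega
          simp only [Function.update_apply, e₁, e₂]
          split_ifs <;> simp_all
        · ring
  have h₁ := key n 0 0 (update (fun _ => []) io (List.replicate n true)) (by omega) (by simp)
    (by simp) (by simp)
  rw [zero_add, add_zero, Function.update_idem] at h₁
  obtain hn | hn : n % 2 = 0 ∨ n % 2 = 1 := by omega
  · refine (h₁.seq (Run.ifPop_nil (by simp [hn]) (Run.push _ _ _))).congr ?_ rfl
    funext k
    simp only [Function.update_apply, hn]
    split_ifs <;> simp_all
  · refine (h₁.seq (Run.ifPop_cons (b := true) (l := []) (by simp [hn]) (Run.push _ _ _))).congr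
      ?_ rfl
    funext k
    simp only [Function.update_apply, hn]
    split_ifs <;> simp_all

/-- Run a subroutine on twice the number `n` and store the number at the beginning of its output and
the rest of the output, without its last bit. -/
def fetch (i : ι) (n a s : X) : StackProg (Reg X) ι :=
  .seq (move (vreg n) tmp) (.seq
    (.loop tmp (.seq (.push (vreg n) true) (.seq (.push io true) (.push io true))) .skip)
    (.seq (.call i io tmp) (.seq (move tmp io) (.seq (.loopTrue io (.push (vreg a) true))
      (.seq (move io (vreg s)) (.ifPop (vreg s) .skip .skip))))))

/-- The output has the form of a circuit description: the number of input wires in unary, the gates,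
and the bit `false` that ends the list of gates. Without this last bit the gates can be spliced into
a longer description. The input `n` is restored while it is doubled, so that it can be used for the
next call. -/
theorem run_fetch {f : ι → ℕ → List Bool} {T : ι → ℕ → ℕ} {n a s : X} (i : ι)
    (has : a ≠ s) {S : Reg X → List Bool} (hio : S io = []) (htmp : S tmp = [])
    (k : ℕ) (hn : S (vreg n) = List.replicate k true) (ha : S (vreg a) = [])
    (hs : S (vreg s) = []) {b : ℕ} {l : List Bool}
    (hf : f i (k + k) = unary b ++ (l ++ [false])) :
    ∃ t ≤ 20 * (k + T i (k + k) + (f i (k + k)).length + 1),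
      Run f T (fetch i n a s) S
        (update (update S (vreg a) (List.replicate b true)) (vreg s) l.reverse) t := by
  have hdouble : ∀ (m : ℕ) (S : Reg X → List Bool), S tmp = List.replicate m true →
      Run f T (ι := ι)
        (.loop tmp (.seq (.push (vreg n) true) (.seq (.push io true) (.push io true))) .skip) S
        (update (update (update S tmp []) (vreg n) (List.replicate m true ++ S (vreg n))) io
          (List.replicate (m + m) true ++ S io)) (4 * m + 1) := by
    intro m
    induction m with
    | zero =>
      intro S h
      refine (Run.loop_nil h).congr ?_ rfl
      funext k
      simp only [Function.update_apply]
      split_ifs <;> simp_all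
    | succ m ih =>
      intro S h
      have h₁ := ih (update (update (update S tmp (List.replicate m true)) (vreg n)
        (true :: S (vreg n))) io (true :: true :: S io)) (by simp)
      refine (Run.loop_cons (b := true) h
        (((Run.push _ _ _).seq ((Run.push _ _ _).seq (Run.push _ _ _))).congr (by simp) rfl)
        h₁).congr ?_ ?_
      · funext k
        have e₁ : ∀ l : List Bool, List.replicate (m + 1) true ++ l =
            List.replicate m true ++ true :: l := by
          intro l; rw [List.replicate_succ']; simp
        have e₂ : ∀ l : List Bool, List.replicate (m + 1 + (m + 1)) true ++ l =
            List.replicate (m + m) true ++ true :: true :: l := by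
          intro l
          rw [show m + 1 + (m + 1) = m + m + 1 + 1 by ring, List.replicate_succ',
            List.replicate_succ']
          simp
        simp only [Function.update_apply, e₁, e₂]
        split_ifs <;> simp_all
      · ring
  have hhead : ∀ (b : ℕ) (l : List Bool) (S : Reg X → List Bool), S io = unary b ++ l →
      Run f T (ι := ι) (.loopTrue io (.push (vreg a) true)) S
        (update (update S io l) (vreg a) (List.replicate b true ++ S (vreg a))) (2 * b + 1) := by
    intro b
    induction b with
    | zero =>
      intro l S h
      refine (Run.loopTrue_false h).congr ?_ rfl
      funext k
      simp only [Function.update_apply]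
      split_ifs <;> simp_all
    | succ b ih =>
      intro l S h
      have h₁ := ih l (update (update S io (unary b ++ l)) (vreg a) (true :: S (vreg a))) (by simp)
      refine (Run.loopTrue_true (l := unary b ++ l) (by
        rw [h]; simp [unary, List.replicate_succ]) ((Run.push _ _ _).congr (by simp) rfl)
        h₁).congr ?_ ?_
      · funext k
        have e₁ : ∀ l : List Bool, List.replicate (b + 1) true ++ l =
            List.replicate b true ++ true :: l := by
          intro l; rw [List.replicate_succ']; simp
        simp only [Function.update_apply, e₁]
        split_ifs <;> simp_all
      · ring
  have h₁ := run_move (f := f) (T := T) (ι := ι) (a := vreg n) (b := tmp) (by simp) _ hn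
  rw [List.reverse_replicate, htmp, List.append_nil, List.length_replicate] at h₁
  have h₂ := hdouble k (update (update S (vreg n) []) tmp (List.replicate k true)) (by simp)
  have e₂ : update (update (update (update (update S (vreg n) []) tmp (List.replicate k true))
      tmp []) (vreg n) (List.replicate k true ++
        update (update S (vreg n) []) tmp (List.replicate k true) (vreg n))) io
      (List.replicate (k + k) true ++ update (update S (vreg n) []) tmp
        (List.replicate k true) io) = update S io (List.replicate (k + k) true) := by
    funext k
    simp only [Function.update_apply]
    split_ifs <;> simp_all
  rw [e₂] at h₂
  have h₃ := Run.call (f := f) (T := T) (i := i) (v := io) (w := tmp)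
    (S := update S io (List.replicate (k + k) true)) (n := k + k) (by simp) (by simp)
  rw [Function.update_idem, Function.update_of_ne (by simp), htmp, List.append_nil] at h₃
  have h₄ := run_move (f := f) (T := T) (ι := ι) (a := tmp) (b := io)
    (S := update (update S io []) tmp (f i (k + k)).reverse) (by simp) (f i (k + k)).reverse
    (by simp)
  have e₄ : update (update (update (update S io []) tmp (f i (k + k)).reverse) tmp []) io
      ((f i (k + k)).reverse.reverse ++ update (update S io []) tmp (f i (k + k)).reverse io) =
      update S io (f i (k + k)) := by
    funext k
    simp only [Function.update_apply]
    split_ifs <;> simp_all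
  rw [e₄] at h₄
  have h₅ := hhead b (l ++ [false]) (update S io (f i (k + k))) (by simp [hf])
  rw [Function.update_idem, Function.update_of_ne (by simp), ha, List.append_nil] at h₅
  have h₆ := run_move (f := f) (T := T) (ι := ι) (a := io) (b := vreg s)
    (S := update (update S io (l ++ [false])) (vreg a) (List.replicate b true)) (by simp)
    (l ++ [false]) (by simp)
  have h₇ : Run f T (ι := ι) (.ifPop (vreg s) .skip .skip) _ _ _ := Run.ifPop_cons (b := false)
    (l := l.reverse) (S := update (update (update (update S io (l ++ [false])) (vreg a)
      (List.replicate b true)) io []) (vreg s) ((l ++ [false]).reverse ++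
        update (update S io (l ++ [false])) (vreg a) (List.replicate b true) (vreg s)))
    (by simp [has.symm, hs]) (Run.skip _)
  refine ⟨_, ?_, (h₁.seq (h₂.seq (h₃.seq (h₄.seq (h₅.seq (h₆.seq h₇)))))).congr ?_ rfl⟩
  · have : (f i (k + k)).length = b + 1 + (l.length + 1) := by
      simp [hf, unary]; omega
    simp only [List.length_append, List.length_reverse, List.length_cons, List.length_nil]
    omega
  · funext k
    simp only [Function.update_apply]
    split_ifs <;> simp_all

theorem polyTime_val_halve [Fintype X] {h o e : X} (hho : h ≠ o) (hhe : h ≠ e) (hoe : o ≠ e)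
    (g : StrExpr X) (hg : g.WF [h, o, e] [h, o, e]) :
    Nonempty (TM2ComputableInPolyTime Computability.unaryEncodeNat id fun n =>
      g.val (update (update (update (fun _ => []) h (List.replicate (n / 2) true)) o
        (List.replicate (n % 2) true)) e (List.replicate (1 - n % 2) true))) := by
  refine polyTime_val (ι := Empty) (f := fun i => i.elim) (fun i => i.elim) (halve h o e) [h, o, e]
    _ g hg (3 * Polynomial.X + 3) (fun n => ⟨_, ?_, (run_halve hho hhe hoe n).congr ?_ rfl⟩)
    (Polynomial.X + 1) fun n v => ?_
  · simp
  · funext k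
    rcases k with k | ⟨v, b⟩
    · simp [loaded]
    · cases b
      · simp only [loaded, Function.update_apply, Sum.inr.injEq, Prod.mk.injEq, List.mem_cons,
          List.not_mem_nil, or_false, and_true, true_and]
        split_ifs <;> simp_all
      · simp [loaded]
  · simp only [Function.update_apply, Polynomial.eval_add, Polynomial.eval_X, Polynomial.eval_one]
    split_ifs <;> simp <;> omega

theorem run_fetch_loaded {f : ι → ℕ → List Bool} {T : ι → ℕ → ℕ} {n a s : X} (i : ι) {R : List X}
    (hn : n ∈ R) (ha : a ∉ R) (hs : s ∉ R) (has : a ≠ s) {e : X → List Bool} {k : ℕ}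
    (hk : e n = List.replicate k true) {b : ℕ} {l : List Bool}
    (hf : f i (k + k) = unary b ++ (l ++ [false])) :
    ∃ t ≤ 20 * (k + T i (k + k) + (f i (k + k)).length + 1),
      Run f T (fetch i n a s) (loaded R e)
        (loaded (s :: a :: R) (update (update e a (List.replicate b true)) s l)) t := by
  obtain ⟨t, ht, h⟩ := run_fetch (f := f) (T := T) (n := n) (a := a) (s := s) i
    has (S := loaded R e) rfl rfl k (by simp [loaded, hn, hk]) (by simp [loaded, ha])
    (by simp [loaded, hs]) hf
  refine ⟨t, ht, h.congr ?_ rfl⟩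
  funext r
  rcases r with r | ⟨v, d⟩
  · simp [loaded]
  · rcases eq_or_ne v s with rfl | hvs
    · cases d <;> simp [loaded]
    · rcases eq_or_ne v a with rfl | hva
      · cases d <;> simp [loaded, hvs]
      · cases d <;> simp [loaded, hvs, hva]

/-- The values of variables loaded from the output of three subroutines. -/
def fetchedEnv (n a₀ s₀ a₁ s₁ a₂ s₂ : X) (b : Fin 3 → ℕ → ℕ) (l : Fin 3 → ℕ → List Bool) (m : ℕ) :
    X → List Bool :=
  update (update (update (update (update (update (update (fun _ => [])
    n (List.replicate m true)) a₀ (List.replicate (b 0 (m + m)) true)) s₀ (l 0 (m + m)))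
    a₁ (List.replicate (b 1 (m + m)) true)) s₁ (l 1 (m + m)))
    a₂ (List.replicate (b 2 (m + m)) true)) s₂ (l 2 (m + m))

theorem polyTime_val_fetch [Fintype X] {n a₀ s₀ a₁ s₁ a₂ s₂ : X}
    (hR : [s₂, a₂, s₁, a₁, s₀, a₀, n].Nodup) {f : Fin 3 → ℕ → List Bool}
    (c : ∀ i, TM2ComputableInPolyTime Computability.unaryEncodeNat id (f i)) (b : Fin 3 → ℕ → ℕ)
    (l : Fin 3 → ℕ → List Bool) (hf : ∀ i m, f i m = unary (b i m) ++ (l i m ++ [false]))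
    (g : StrExpr X)
    (hg : g.WF [s₂, a₂, s₁, a₁, s₀, a₀, n] [s₂, a₂, s₁, a₁, s₀, a₀, n]) :
    Nonempty (TM2ComputableInPolyTime Computability.unaryEncodeNat id fun m =>
      g.val (fetchedEnv n a₀ s₀ a₁ s₁ a₂ s₂ b l m)) := by
  choose L hL using fun i => exists_length_le c i
  obtain ⟨hs₂, ha₂, hs₁, ha₁, hs₀, ha₀, -⟩ := by simpa only [List.nodup_cons] using hR
  let W : Polynomial ℕ := ∑ i, (L i + (c i).time)
  have hW : ∀ i m, callTime c i m + (f i m).length ≤ W.eval m := by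
    intro i m
    have h₁ := callTime_le c i m
    have h₂ := hL i m
    have h₃ : (L i + (c i).time).eval m ≤ W.eval m := by
      simp only [W, Polynomial.eval_finsetSum]
      exact Finset.single_le_sum (f := fun i => (L i + (c i).time).eval m) (by simp)
        (Finset.mem_univ i)
    rw [Polynomial.eval_add] at h₃
    omega
  refine polyTime_val c (.seq (move io (vreg n)) (.seq (fetch 0 n a₀ s₀)
    (.seq (fetch 1 n a₁ s₁) (fetch 2 n a₂ s₂)))) [s₂, a₂, s₁, a₁, s₀, a₀, n] _ g hg
    (2 * Polynomial.X + 1 + 60 * (Polynomial.X + 1 + W.comp (2 * Polynomial.X))) (fun m => ?_)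
    (Polynomial.X + W.comp (2 * Polynomial.X)) fun m v => ?_
  · have r₀ : Run f (callTime c) (move io (vreg n))
        (update (fun _ => []) io (List.replicate m true))
        (loaded [n] (update (fun _ => []) n (List.replicate m true))) (2 * m + 1) := by
      refine (run_move (a := io) (b := vreg n) (by simp) (List.replicate m true)
        (by simp)).congr ?_ (by simp)
      funext k
      rcases k with k | ⟨v, d⟩
      · fin_cases k <;> simp [loaded]
      · rcases eq_or_ne v n with rfl | hv
        · cases d <;> simp [loaded]
        · simp [loaded, hv]
    obtain ⟨t₁, ht₁, r₁⟩ := run_fetch_loaded (f := f) (T := callTime c) (n := n) (a := a₀)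
      (s := s₀) 0 (R := [n]) (by simp) ha₀ (fun h => hs₀ (List.mem_cons_of_mem _ h))
      (fun h => hs₀ (h ▸ List.mem_cons_self))
      (e := update (fun _ => []) n (List.replicate m true)) (k := m) (by simp) (hf 0 _)
    have hn : ∀ {x : X} {R : List X}, x ∉ R → n ∈ R → n ≠ x := fun h h' h'' => h (h'' ▸ h')
    have e₁ : (update (update (update (fun _ => []) n (List.replicate m true)) a₀
        (List.replicate (b 0 (m + m)) true)) s₀ (l 0 (m + m))) n = List.replicate m true := by
      rw [Function.update_of_ne (hn hs₀ (by simp)), Function.update_of_ne (hn ha₀ (by simp)),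
        Function.update_self]
    obtain ⟨t₂, ht₂, r₂⟩ := run_fetch_loaded (f := f) (T := callTime c) (n := n) (a := a₁)
      (s := s₁) 1 (R := [s₀, a₀, n]) (by simp) ha₁ (fun h => hs₁ (List.mem_cons_of_mem _ h))
      (fun h => hs₁ (h ▸ List.mem_cons_self)) e₁ (hf 1 _)
    obtain ⟨t₃, ht₃, r₃⟩ := run_fetch_loaded (f := f) (T := callTime c) (n := n) (a := a₂)
      (s := s₂) 2 (R := [s₁, a₁, s₀, a₀, n]) (by simp) ha₂
      (fun h => hs₂ (List.mem_cons_of_mem _ h)) (fun h => hs₂ (h ▸ List.mem_cons_self))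
      (e := update (update (update (update (update (fun _ => []) n (List.replicate m true)) a₀
        (List.replicate (b 0 (m + m)) true)) s₀ (l 0 (m + m))) a₁
        (List.replicate (b 1 (m + m)) true)) s₁ (l 1 (m + m))) (k := m) (by
        rw [Function.update_of_ne (hn hs₁ (by simp)), Function.update_of_ne (hn ha₁ (by simp)), e₁])
      (hf 2 _)
    refine ⟨_, ?_, r₀.seq (r₁.seq (r₂.seq r₃))⟩
    have := hW 0 (m + m)
    have := hW 1 (m + m)
    have := hW 2 (m + m)
    simp only [Polynomial.eval_mul, Polynomial.eval_add, Polynomial.eval_X,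
      Polynomial.eval_ofNat, Polynomial.eval_comp, Polynomial.eval_one, two_mul m]
    omega
  · have hlen : ∀ i, (b i (m + m)) ≤ W.eval (m + m) ∧ (l i (m + m)).length ≤ W.eval (m + m) := by
      intro i
      have h := hW i (m + m)
      rw [hf i (m + m)] at h
      simp only [unary, List.length_append, List.length_replicate, List.length_cons,
        List.length_nil] at h
      omega
    have := hlen 0
    have := hlen 1
    have := hlen 2
    simp only [Polynomial.eval_add, Polynomial.eval_X, Polynomial.eval_comp, Polynomial.eval_mul,
      Polynomial.eval_ofNat, two_mul m]
    simp only [fetchedEnv, Function.update_apply]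
    split_ifs <;> (try simp only [List.length_replicate, List.length_nil]) <;> omega

end StrExpr

end

noncomputable section

open Function (update)

/-! ### Circuits as lists of gates with natural numbers as wires -/

/-- Formal combinations of the matrix units `|x⟩⟨y|`, where `x` and `y` may have any length. -/
abbrev FreeOp : Type := (List Bool × List Bool) →₀ ℂ

/-- The matrix unit `|x⟩⟨y|`. -/
def ket (x y : List Bool) : FreeOp := Finsupp.single (x, y) 1

/-- The linear extension of a map on matrix units. -/
def liftKet (f : List Bool → List Bool → FreeOp) : FreeOp →ₗ[ℂ] FreeOp :=
  Finsupp.linearCombination ℂ fun p : List Bool × List Bool => f p.1 p.2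

@[simp] theorem liftKet_ket (f : List Bool → List Bool → FreeOp) (x y : List Bool) :
    liftKet f (ket x y) = f x y := by
  simp [liftKet, ket]

/-- A gate of an untyped circuit. -/
inductive RawGate : Type
  | gate (g : ℕ) (w : List ℕ)
  | prep (p : ℕ)
  | trace (p : ℕ)

/-- The bits of `x` on the wires `w`. -/
def readWires (x : List Bool) (w : List ℕ) (k : ℕ) : Bits k :=
  fun j => x.getD (w.getD j 0) false

/-- Overwrite the bits of `x` on the wires `w` by those of `u`. -/
def writeWires (x : List Bool) (w : List ℕ) {k : ℕ} (u : Bits k) : List Bool :=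
  (w.zip (List.ofFn u)).foldl (fun l p => l.set p.1 p.2) x

/-- The channel of a unitary gate on the wires `w`. -/
def gateKet (U : UnitaryGate) (w : List ℕ) : FreeOp →ₗ[ℂ] FreeOp :=
  liftKet fun x y => ∑ u : Bits U.arity, ∑ v : Bits U.arity,
    (U.mat u (readWires x w _) * star (U.mat v (readWires y w _))) •
      ket (writeWires x w u) (writeWires y w v)

/-- The channel of a gate. -/
def RawGate.eval (G : GateSet) : RawGate → (FreeOp →ₗ[ℂ] FreeOp)
  | gate g w => (G.unitaries[g]?).elim 0 fun U => gateKet U w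
  | prep p => liftKet fun x y => ket (x.insertIdx p false) (y.insertIdx p false)
  | trace p => liftKet fun x y =>
      if x[p]? = y[p]? then ket (x.eraseIdx p) (y.eraseIdx p) else 0

/-- The channel of an untyped circuit. -/
def rawEval (G : GateSet) : List RawGate → (FreeOp →ₗ[ℂ] FreeOp)
  | [] => LinearMap.id
  | g :: c => rawEval G c ∘ₗ g.eval G

@[simp] theorem rawEval_nil (G : GateSet) (ρ : FreeOp) : rawEval G [] ρ = ρ := rfl

@[simp] theorem rawEval_cons (G : GateSet) (g : RawGate) (c : List RawGate) (ρ : FreeOp) :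
    rawEval G (g :: c) ρ = rawEval G c (g.eval G ρ) := rfl

theorem rawEval_append (G : GateSet) (c d : List RawGate) (ρ : FreeOp) :
    rawEval G (c ++ d) ρ = rawEval G d (rawEval G c ρ) := by
  induction c generalizing ρ with
  | nil => rfl
  | cons g c ih => simp [ih]

/-- An untyped circuit from `a` to `b` wires. -/
def RawValid (G : GateSet) : ℕ → List RawGate → ℕ → Prop
  | a, [], b => a = b
  | a, .gate g w :: c, b => (∃ U, G.unitaries[g]? = some U ∧ w.length = U.arity ∧ w.Nodup ∧
      ∀ i ∈ w, i < a) ∧ RawValid G a c b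
  | a, .prep p :: c, b => (G.hasPrep ∧ p ≤ a) ∧ RawValid G (a + 1) c b
  | a, .trace p :: c, b => (G.hasTrace ∧ p < a) ∧ RawValid G (a - 1) c b

theorem RawValid.append {G : GateSet} {c d : List RawGate} {a b e : ℕ}
    (hc : RawValid G a c b) (hd : RawValid G b d e) : RawValid G a (c ++ d) e := by
  induction c generalizing a with
  | nil => obtain rfl : a = b := hc; exact hd
  | cons g c ih => cases g <;> exact ⟨hc.1, ih hc.2⟩

theorem RawValid.add_right {G : GateSet} {c : List RawGate} {a b : ℕ}
    (hc : RawValid G a c b) (k : ℕ) : RawValid G (a + k) c (b + k) := by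
  induction c generalizing a with
  | nil => exact congrArg (· + k) hc
  | cons g c ih =>
    cases g with
    | gate g w =>
      obtain ⟨⟨U, h₁, h₂, h₃, h₄⟩, h⟩ := hc
      exact ⟨⟨U, h₁, h₂, h₃, fun i hi => (h₄ i hi).trans_le (Nat.le_add_right _ _)⟩, ih h⟩
    | prep p =>
      have := ih hc.2
      rw [Nat.add_right_comm] at this
      exact ⟨⟨hc.1.1, hc.1.2.trans (Nat.le_add_right _ _)⟩, this⟩
    | trace p =>
      have := ih hc.2
      have hp := hc.1.2
      rw [show a - 1 + k = a + k - 1 by omega] at this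
      exact ⟨⟨hc.1.1, hc.1.2.trans_le (Nat.le_add_right _ _)⟩, this⟩

/-- `G'` starts with the unitary gates of `G`. -/
structure GateSet.Extends (G' G : GateSet) : Prop where
  unitaries : ∀ (g : ℕ) (U : UnitaryGate), G.unitaries[g]? = some U → G'.unitaries[g]? = some U
  prep : G.hasPrep → G'.hasPrep
  trace : G.hasTrace → G'.hasTrace

theorem RawValid.extends {G G' : GateSet} (hG : G'.Extends G) {c : List RawGate} {a b : ℕ}
    (hc : RawValid G a c b) : RawValid G' a c b := by
  induction c generalizing a with
  | nil => exact hc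
  | cons g c ih =>
    cases g with
    | gate g w =>
      obtain ⟨⟨U, h₁, h⟩, h'⟩ := hc
      exact ⟨⟨U, hG.1 _ _ h₁, h⟩, ih h'⟩
    | prep p => exact ⟨⟨hG.2 hc.1.1, hc.1.2⟩, ih hc.2⟩
    | trace p => exact ⟨⟨hG.3 hc.1.1, hc.1.2⟩, ih hc.2⟩

theorem rawEval_extends {G G' : GateSet} (hG : G'.Extends G) {c : List RawGate} {a b : ℕ}
    (hc : RawValid G a c b) : rawEval G' c = rawEval G c := by
  induction c generalizing a with
  | nil => rfl
  | cons g c ih =>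
    cases g with
    | gate g w =>
      obtain ⟨⟨U, h₁, h⟩, h'⟩ := hc
      simp only [rawEval, RawGate.eval, ih h', h₁, hG.1 _ _ h₁]
    | prep p => simp only [rawEval, RawGate.eval, ih hc.2]
    | trace p => simp only [rawEval, RawGate.eval, ih hc.2]

/-- The description of a gate. -/
def RawGate.encode : RawGate → List Bool
  | gate g w => unary (3 + g) ++ w.flatMap unary
  | prep p => unary 1 ++ unary p
  | trace p => unary 2 ++ unary p

/-- The list of gates of a circuit. -/
def Circuit.raw {G : GateSet} : {a b : ℕ} → Circuit G a b → List RawGate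
  | _, _, .nil _ => []
  | _, _, .gate g w rest => .gate g (List.ofFn fun j => (w j : ℕ)) :: rest.raw
  | _, _, .prep _ p rest => .prep p :: rest.raw
  | _, _, .trace _ p rest => .trace p :: rest.raw

theorem Circuit.encodeGates_eq {G : GateSet} {a b : ℕ} (C : Circuit G a b) :
    C.encodeGates = C.raw.flatMap RawGate.encode ++ [false] := by
  induction C with
  | nil => rfl
  | gate g w rest ih =>
    have : (List.ofFn fun j => (w j : ℕ)) = (List.ofFn w).map (fun i : Fin _ => (i : ℕ)) := by
      simp [List.map_ofFn, Function.comp_def]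
    rw [encodeGates, raw, List.flatMap_cons, RawGate.encode, ih, this, List.flatMap_map]
    simp
  | prep h p rest ih => simp [encodeGates, raw, RawGate.encode, ih]
  | trace h p rest ih => simp [encodeGates, raw, RawGate.encode, ih]

theorem Circuit.encode_eq {G : GateSet} {a b : ℕ} (C : Circuit G a b) :
    C.encode = unary a ++ (C.raw.flatMap RawGate.encode ++ [false]) := by
  rw [encode, encodeGates_eq]

theorem Circuit.rawValid {G : GateSet} {a b : ℕ} (C : Circuit G a b) :
    RawValid G a C.raw b := by
  induction C with
  | nil => rfl
  | gate g w rest ih =>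
    refine ⟨⟨G.unitaries.get g, by simp, by simp, ?_, ?_⟩, ih⟩
    · rw [List.nodup_ofFn]
      exact fun i j h => w.injective (Fin.ext h)
    · intro i hi
      obtain ⟨j, rfl⟩ := List.mem_ofFn.1 hi
      exact (w j).2
  | prep h p rest ih => exact ⟨⟨h, Nat.lt_succ_iff.1 p.2⟩, ih⟩
  | trace h p rest ih => exact ⟨⟨h, p.2⟩, ih⟩

/-- Circuits are built as untyped lists, whose wires are plain numbers computable by loops. This
result returns to typed circuits without changing the list, hence without changing the encoded
gates. -/
theorem RawValid.exists_circuit {G : GateSet} {c : List RawGate} {a b : ℕ}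
    (hc : RawValid G a c b) : ∃ C : Circuit G a b, C.raw = c := by
  induction c generalizing a with
  | nil => obtain rfl : a = b := hc; exact ⟨.nil a, rfl⟩
  | cons g c ih =>
    cases g with
    | gate g w =>
      obtain ⟨⟨U, h₁, h₂, h₃, h₄⟩, h⟩ := hc
      obtain ⟨C, rfl⟩ := ih h
      obtain ⟨hg, rfl⟩ := List.getElem?_eq_some_iff.1 h₁
      refine ⟨.gate ⟨g, hg⟩ ⟨fun j => ⟨w[(j : ℕ)]'(j.2.trans_eq h₂.symm), h₄ _ (List.getElem_mem _)⟩, ?_⟩ C, ?_⟩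
      · intro i j hij
        exact Fin.ext ((List.Nodup.getElem_inj_iff h₃).1 (Fin.mk.inj hij))
      · simp only [Circuit.raw, List.cons.injEq, RawGate.gate.injEq, true_and, and_true]
        refine List.ext_getElem (by simp [h₂]) fun i hi hi' => by simp
    | prep p =>
      obtain ⟨C, rfl⟩ := ih hc.2
      exact ⟨.prep hc.1.1 ⟨p, Nat.lt_succ_iff.2 hc.1.2⟩ C, rfl⟩
    | trace p =>
      obtain ⟨hp, h⟩ := hc
      cases a with
      | zero => exact absurd hp.2 (Nat.not_lt_zero _)
      | succ a =>
        obtain ⟨C, rfl⟩ := ih h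
        exact ⟨.trace hp.1 ⟨p, hp.2⟩ C, rfl⟩

/-! ### Operators as formal combinations -/

/-- An operator as a combination of matrix units, tensored with `|t⟩⟨t'|`. -/
def toFree {n : ℕ} (t t' : List Bool) : Op n →ₗ[ℂ] FreeOp where
  toFun ρ := ∑ x : Bits n, ∑ y : Bits n, ρ x y • ket (List.ofFn x ++ t) (List.ofFn y ++ t')
  map_add' ρ σ := by simp [add_smul, Finset.sum_add_distrib]
  map_smul' c ρ := by simp [mul_smul, Finset.smul_sum]

theorem toFree_apply {n : ℕ} (t t' : List Bool) (ρ : Op n) :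
    toFree t t' ρ = ∑ x : Bits n, ∑ y : Bits n, ρ x y • ket (List.ofFn x ++ t) (List.ofFn y ++ t') :=
  rfl

@[simp] theorem toFree_single {n : ℕ} (t t' : List Bool) (x y : Bits n) (z : ℂ) :
    toFree t t' (Matrix.single x y z) = z • ket (List.ofFn x ++ t) (List.ofFn y ++ t') := by
  rw [toFree_apply, Finset.sum_eq_single x, Finset.sum_eq_single y]
  · simp
  · intro y' _ h; simp [Matrix.single, h.symm]
  · simp
  · intro x' _ h; simp [Matrix.single, h.symm]
  · simp

theorem toFree_coeff {n : ℕ} (ρ : Op n) (x y : Bits n) :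
    toFree [] [] ρ (List.ofFn x, List.ofFn y) = ρ x y := by
  rw [toFree_apply]
  simp only [Finsupp.coe_finsetSum, Finset.sum_apply, Finsupp.smul_apply, ket, List.append_nil,
    Finsupp.single_apply, Prod.mk.injEq, List.ofFn_injective.eq_iff, smul_eq_mul, mul_ite, mul_one,
    mul_zero]
  rw [Finset.sum_eq_single x, Finset.sum_eq_single y]
  · simp
  · intro y' _ h; simp [h]
  · simp
  · intro x' _ h; simp [h]
  · simp

theorem op_linearMap_ext {n : ℕ} {M : Type*} [AddCommMonoid M] [Module ℂ M] {F F' : Op n →ₗ[ℂ] M}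
    (h : ∀ x y, F (Matrix.single x y 1) = F' (Matrix.single x y 1)) : F = F' := by
  refine LinearMap.ext fun ρ => ?_
  rw [Matrix.matrix_eq_sum_single ρ]
  simp only [map_sum]
  refine Finset.sum_congr rfl fun x _ => Finset.sum_congr rfl fun y _ => ?_
  have : Matrix.single x y (ρ x y) = ρ x y • Matrix.single x y (1 : ℂ) := by simp
  rw [this, map_smul, map_smul, h]

theorem getElem?_foldl_set_of_notMem {l : List Bool} (ps : List (ℕ × Bool)) {i : ℕ}
    (h : i ∉ ps.map Prod.fst) : (ps.foldl (fun l p => l.set p.1 p.2) l)[i]? = l[i]? := by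
  induction ps generalizing l with
  | nil => rfl
  | cons p ps ih =>
    simp only [List.map_cons, List.mem_cons, not_or] at h
    rw [List.foldl_cons, ih h.2, List.getElem?_set_ne (Ne.symm h.1)]

theorem getElem?_foldl_set_of_mem {l : List Bool} (ps : List (ℕ × Bool)) {i : ℕ} {b : Bool}
    (hps : (ps.map Prod.fst).Nodup) (h : (i, b) ∈ ps) (hi : i < l.length) :
    (ps.foldl (fun l p => l.set p.1 p.2) l)[i]? = some b := by
  induction ps generalizing l with
  | nil => simp at h
  | cons p ps ih =>
    simp only [List.map_cons, List.nodup_cons] at hps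
    rw [List.foldl_cons]
    rcases List.mem_cons.1 h with rfl | h
    · rw [getElem?_foldl_set_of_notMem _ hps.1, List.getElem?_set_self hi]
    · exact ih hps.2 h (by simpa using hi)

theorem readWires_ofFn {n k : ℕ} (x : Bits n) (t : List Bool) (w : Fin k ↪ Fin n) :
    readWires (List.ofFn x ++ t) (List.ofFn fun j => (w j : ℕ)) k = fun j => x (w j) := by
  funext j
  have hw : (List.ofFn fun j => (w j : ℕ)).getD j 0 = w j := by
    rw [List.getD_eq_getElem _ _ (by simp), List.getElem_ofFn]
  have hx : (w j : ℕ) < (List.ofFn x).length := by rw [List.length_ofFn]; exact (w j).2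
  rw [readWires, hw, List.getD_append _ _ _ _ hx, List.getD_eq_getElem _ _ hx, List.getElem_ofFn]

theorem writeWires_ofFn {n k : ℕ} (x : Bits n) (t : List Bool) (w : Fin k ↪ Fin n) (u : Bits k) :
    writeWires (List.ofFn x ++ t) (List.ofFn fun j => (w j : ℕ)) u =
      List.ofFn (Function.extend w u x) ++ t := by
  have hkeys : (((List.ofFn fun j => (w j : ℕ)).zip (List.ofFn u)).map Prod.fst) =
      List.ofFn fun j => (w j : ℕ) := by
    rw [List.map_fst_zip]; simp
  have hnodup : (List.ofFn fun j => (w j : ℕ)).Nodup := by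
    rw [List.nodup_ofFn]; exact fun i j h => w.injective (Fin.ext h)
  refine List.ext_getElem? fun i => ?_
  rw [writeWires]
  by_cases hi : i < n
  · have hr : (List.ofFn (Function.extend w u x) ++ t)[i]? =
        some (Function.extend w u x ⟨i, hi⟩) := by
      rw [List.getElem?_append_left (by simpa using hi),
        List.getElem?_eq_getElem (by simpa using hi), List.getElem_ofFn]
    rw [hr]
    by_cases hw : ∃ j, w j = ⟨i, hi⟩
    · obtain ⟨j, hj⟩ := hw
      rw [← hj, w.injective.extend_apply]
      refine getElem?_foldl_set_of_mem _ (by rwa [hkeys]) ?_ (by simp; omega)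
      rw [List.mem_iff_getElem]
      exact ⟨j, by simp, by simp [hj]⟩
    · rw [Function.extend_apply' _ _ _ hw, getElem?_foldl_set_of_notMem]
      · rw [List.getElem?_append_left (by simpa using hi),
          List.getElem?_eq_getElem (by simpa using hi), List.getElem_ofFn]
      · rw [hkeys, List.mem_ofFn]
        rintro ⟨j, hj⟩
        exact hw ⟨j, Fin.ext hj⟩
  · rw [getElem?_foldl_set_of_notMem]
    · rw [List.getElem?_append_right (by simpa using hi),
        List.getElem?_append_right (by simpa using hi)]
      simp
    · rw [hkeys, List.mem_ofFn]
      rintro ⟨j, hj⟩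
      exact hi (hj ▸ (w j).2)

/-- Only the basis states that agree with `x` off the wires `w` contribute, and these are
parametrized by their bits `u` on the wires. The general `c` allows entries of the matrix to occur
conjugated. -/
theorem sum_onWires_smul {n k : ℕ} {M : Type*} [AddCommMonoid M] [Module ℂ M]
    (U : Matrix (Bits k) (Bits k) ℂ) (w : Fin k ↪ Fin n) (x : Bits n) (c : Bits n → ℂ → M)
    (hc : ∀ z, c z 0 = 0) :
    ∑ z, c z (onWires U w z x) =
      ∑ u, c (Function.extend w u x) (U u fun j => x (w j)) := by
  symm
  refine Fintype.sum_of_injective (fun u => Function.extend w u x) ?_ _ _ ?_ ?_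
  · intro u v h
    funext j
    have := congrFun h (w j)
    simpa [w.injective.extend_apply] using this
  · intro z hz
    rw [onWires, Matrix.of_apply, if_neg, hc]
    intro h
    refine hz ⟨fun j => z (w j), funext fun i => ?_⟩
    by_cases hi : ∃ j, w j = i
    · obtain ⟨j, rfl⟩ := hi
      exact w.injective.extend_apply _ _ _
    · simp only [Function.extend_apply' _ _ _ hi]
      exact (h i (by simpa using hi)).symm
  · intro u
    rw [onWires, Matrix.of_apply, if_pos]
    · simp [w.injective.extend_apply]
    · intro i hi
      exact Function.extend_apply' _ _ _ (by simpa using hi)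

theorem gateKet_toFree {n : ℕ} (U : UnitaryGate) (w : Fin U.arity ↪ Fin n) (t t' : List Bool)
    (ρ : Op n) : gateKet U (List.ofFn fun j => (w j : ℕ)) (toFree t t' ρ) =
      toFree t t' (conjMap (onWires U.mat w) ρ) := by
  revert ρ
  suffices h : gateKet U (List.ofFn fun j => (w j : ℕ)) ∘ₗ toFree t t' =
      toFree t t' ∘ₗ conjMap (onWires U.mat w) from LinearMap.congr_fun h
  refine op_linearMap_ext fun x y => ?_
  simp only [LinearMap.comp_apply, toFree_single, one_smul, gateKet, liftKet_ket, readWires_ofFn,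
    writeWires_ofFn]
  have : ∀ z z', conjMap (onWires U.mat w) (Matrix.single x y 1) z z' =
      onWires U.mat w z x * star (onWires U.mat w z' y) := by
    intro z z'
    simp [conjMap, Matrix.mul_apply, Matrix.single, Matrix.conjTranspose_apply, ite_and]
  simp only [toFree_apply, this]
  rw [sum_onWires_smul U.mat w x fun z a => ∑ z', (a * star (onWires U.mat w z' y)) •
    ket (List.ofFn z ++ t) (List.ofFn z' ++ t')]
  · refine Finset.sum_congr rfl fun u _ => ?_
    rw [sum_onWires_smul U.mat w y fun z' a => (U.mat u (fun j => x (w j)) * star a) •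
      ket (List.ofFn (Function.extend w u x) ++ t) (List.ofFn z' ++ t')]
    simp
  · simp

theorem insertIdx_ofFn {n : ℕ} (p : Fin (n + 1)) (x : Bits n) (b : Bool) (t : List Bool) :
    (List.ofFn x ++ t).insertIdx p b =
      List.ofFn (p.insertNth (α := fun _ => Bool) b x) ++ t := by
  induction n with
  | zero =>
    obtain rfl : p = 0 := Fin.fin_one_eq_zero p
    simp [List.ofFn_succ]
  | succ n ih =>
    refine Fin.cases ?_ (fun q => ?_) p
    · simp
    · rw [List.ofFn_succ, List.cons_append, Fin.val_succ, List.insertIdx_succ_cons, ih q,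
        List.ofFn_succ (n := n + 1), List.cons_append]
      refine congrArg₂ List.cons ?_ ?_
      · have : q.succ.succAbove 0 = 0 := Fin.succ_succAbove_zero q
        have h := Fin.insertNth_apply_succAbove (α := fun _ => Bool) q.succ b x 0
        rw [this] at h
        exact h.symm
      · refine congrArg (List.ofFn · ++ t) (funext fun i => ?_)
        refine Fin.succAboveCases q ?_ (fun j => ?_) i
        · simp
        · rw [Fin.insertNth_apply_succAbove, ← Fin.succ_succAbove_succ,
            Fin.insertNth_apply_succAbove]

theorem getElem?_ofFn_append {n : ℕ} (p : Fin (n + 1)) (x : Bits (n + 1)) (t : List Bool) :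
    (List.ofFn x ++ t)[(p : ℕ)]? = some (x p) := by
  have hp : (p : ℕ) < (List.ofFn x).length := by rw [List.length_ofFn]; exact p.2
  rw [List.getElem?_append_left hp, List.getElem?_eq_getElem hp, List.getElem_ofFn]

theorem eraseIdx_ofFn {n : ℕ} (p : Fin (n + 1)) (x : Bits (n + 1)) (t : List Bool) :
    (List.ofFn x ++ t).eraseIdx p = List.ofFn (fun i => x (p.succAbove i)) ++ t := by
  have h := insertIdx_ofFn p (fun i => x (p.succAbove i)) (x p) t
  have hx : p.insertNth (α := fun _ => Bool) (x p) (fun i => x (p.succAbove i)) = x := by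
    funext i
    refine Fin.succAboveCases p ?_ (fun j => ?_) i <;> simp
  rw [hx] at h
  rw [← h, List.eraseIdx_insertIdx_self]

theorem RawGate.eval_prep_toFree (G : GateSet) {n : ℕ} (p : Fin (n + 1)) (t t' : List Bool)
    (ρ : Op n) : (RawGate.prep p).eval G (toFree t t' ρ) = toFree t t' (prepMap p ρ) := by
  revert ρ
  suffices h : (RawGate.prep p).eval G ∘ₗ toFree t t' = toFree t t' ∘ₗ prepMap p from
    LinearMap.congr_fun h
  refine op_linearMap_ext fun x y => ?_
  have : prepMap p (Matrix.single x y 1) = Matrix.single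
      (p.insertNth (α := fun _ => Bool) false x) (p.insertNth (α := fun _ => Bool) false y) 1 := by
    ext z z'
    have key : ∀ x z : _, p.insertNth (α := fun _ => Bool) false x = z ↔
        z p = false ∧ x = fun i => z (p.succAbove i) := by
      intro x z
      rw [Fin.insertNth_eq_iff, eq_comm]
      rfl
    simp only [prepMap, LinearMap.coe_mk, AddHom.coe_mk, Matrix.of_apply, Matrix.single, key]
    by_cases h₁ : z p = false <;> by_cases h₂ : z' p = false <;> simp [h₁, h₂]
  simp only [LinearMap.comp_apply, this, toFree_single, one_smul, RawGate.eval, liftKet_ket,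
    insertIdx_ofFn]

theorem RawGate.eval_trace_toFree (G : GateSet) {n : ℕ} (p : Fin (n + 1)) (t t' : List Bool)
    (ρ : Op (n + 1)) :
    (RawGate.trace p).eval G (toFree t t' ρ) = toFree t t' (traceMap p ρ) := by
  revert ρ
  suffices h : (RawGate.trace p).eval G ∘ₗ toFree t t' = toFree t t' ∘ₗ traceMap p from
    LinearMap.congr_fun h
  refine op_linearMap_ext fun x y => ?_
  have : traceMap p (Matrix.single x y 1) = if x p = y p then Matrix.single
      (fun i => x (p.succAbove i)) (fun i => y (p.succAbove i)) 1 else 0 := by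
    ext z z'
    have key : ∀ (b : Bool) (x : Bits (n + 1)) z, x = p.insertNth (α := fun _ => Bool) b z ↔
        b = x p ∧ (fun i => x (p.succAbove i)) = z := by
      intro b x z
      rw [eq_comm, Fin.insertNth_eq_iff, @eq_comm _ z]
      rfl
    simp only [traceMap, LinearMap.coe_mk, AddHom.coe_mk, Matrix.of_apply, Matrix.single, key]
    rw [Fintype.sum_bool]
    rcases hx : x p <;> rcases hy : y p <;> simp
  simp only [LinearMap.comp_apply, this, toFree_single, one_smul, RawGate.eval, liftKet_ket,
    getElem?_ofFn_append, Option.some.injEq, eraseIdx_ofFn]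
  split_ifs
  · simp
  · simp

/-- The untyped semantics agrees with the typed one, with idle wires behind. -/
theorem Circuit.rawEval_raw {G : GateSet} {a b : ℕ} (C : Circuit G a b) (t t' : List Bool)
    (ρ : Op a) : rawEval G C.raw (toFree t t' ρ) = toFree t t' (C.eval ρ) := by
  induction C with
  | nil => rfl
  | gate g w rest ih =>
    have : G.unitaries[(g : ℕ)]? = some (G.unitaries.get g) := by simp
    rw [raw, rawEval_cons, RawGate.eval, this, Option.elim_some, gateKet_toFree, ih]
    rfl
  | prep h p rest ih => rw [raw, rawEval_cons, RawGate.eval_prep_toFree, ih]; rfl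
  | trace h p rest ih => rw [raw, rawEval_cons, RawGate.eval_trace_toFree, ih]; rfl

end

noncomputable section

open Function (update)

/-! ### The action of gates on matrix units -/

theorem set_getD_self (x : List Bool) (i : ℕ) : x.set i (x.getD i false) = x := by
  by_cases h : i < x.length
  · rw [List.getD_eq_getElem _ _ h, List.set_getElem_self]
  · exact List.set_eq_of_length_le (not_lt.1 h)

/-- The gate of an involution of the basis states. -/
def involutionGate (k : ℕ) (f : Bits k → Bits k) (hf : ∀ x, f (f x) = x) : UnitaryGate where
  arity := k
  mat := Matrix.of fun x y => if x = f y then 1 else 0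
  unitary := by
    rw [Matrix.mem_unitaryGroup_iff']
    ext x y
    have h : f y = f x ↔ x = y := (Function.LeftInverse.injective hf).eq_iff.trans eq_comm
    simp [Matrix.mul_apply, Matrix.star_apply, Matrix.one_apply, h]
  algebraic := by
    intro x y
    rw [Matrix.of_apply]
    split_ifs
    · exact isAlgebraic_one
    · exact isAlgebraic_zero

theorem gateKet_involutionGate (k : ℕ) (f : Bits k → Bits k) (hf : ∀ x, f (f x) = x) (w : List ℕ)
    (x y : List Bool) : gateKet (involutionGate k f hf) w (ket x y) =
      ket (writeWires x w (f (readWires x w k))) (writeWires y w (f (readWires y w k))) := by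
  rw [gateKet, liftKet_ket]
  refine (Finset.sum_eq_single (f (readWires x w k)) ?_ ?_).trans
    ((Finset.sum_eq_single (f (readWires y w k)) ?_ ?_).trans ?_)
  · intro u _ hu
    simp [involutionGate, hu]
  · exact fun h => absurd (Finset.mem_univ _) h
  · intro v _ hv
    simp [involutionGate, hv]
  · exact fun h => absurd (Finset.mem_univ _) h
  · simp [involutionGate]

theorem gateKet_toffoli (i j k : ℕ) (x y : List Bool) : gateKet toffoli [i, j, k] (ket x y) =
    ket (x.set k (xor (x.getD k false) (x.getD i false && x.getD j false)))
      (y.set k (xor (y.getD k false) (y.getD i false && y.getD j false))) := by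
  rw [show toffoli = involutionGate 3 toffoliFun toffoliFun_toffoliFun from rfl,
    gateKet_involutionGate]
  have h : ∀ x : List Bool, writeWires x [i, j, k] (toffoliFun (readWires x [i, j, k] 3)) =
      x.set k (xor (x.getD k false) (x.getD i false && x.getD j false)) := by
    intro x
    have h₀ := set_getD_self x i
    have h₁ := set_getD_self x j
    simp only [List.getD_eq_getElem?_getD] at h₀ h₁
    simp [writeWires, toffoliFun, readWires, List.ofFn_succ, h₀, h₁, Function.update]
  rw [h, h]

theorem sum_bits_one {M : Type*} [AddCommMonoid M] (F : Bits 1 → M) :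
    ∑ u, F u = ∑ a : Bool, F fun _ => a :=
  ((Equiv.funUnique (Fin 1) Bool).symm.sum_comp F).symm

theorem gateKet_hadamard (i : ℕ) (x y : List Bool) : gateKet hadamard [i] (ket x y) =
    ∑ a : Bool, ∑ b : Bool, (wiesnerAmp (x.getD i false) true a *
      star (wiesnerAmp (y.getD i false) true b)) • ket (x.set i a) (y.set i b) := by
  rw [gateKet, liftKet_ket]
  refine (sum_bits_one _).trans (Finset.sum_congr rfl fun a _ =>
    (sum_bits_one _).trans (Finset.sum_congr rfl fun b _ => ?_))
  simp [hadamard, hadamardMat, wiesnerAmp, readWires, writeWires, List.ofFn_succ, and_comm]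

/-! ### Expressions for circuits -/

/-- A number `k + v₁ + v₂ + ⋯` with variables `vᵢ`. -/
structure LinExpr (N : Type) : Type where
  const : ℕ
  vars : List N

/-- The value of a linear expression. -/
def LinExpr.val {N : Type} (l : LinExpr N) (e : N → ℕ) : ℕ := (l.vars.map e).sum + l.const

/-- Expressions for lists of gates: `rep i v c` consists of copies of `c` for `i = 0, …, v - 1`, and
`code k` is one of three given lists of gates. -/
inductive CircExpr (N : Type) : Type
  | gate (g : ℕ) (w : List (LinExpr N))
  | prep (p : LinExpr N)
  | trace (p : LinExpr N)
  | code (k : Fin 3)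
  | seq (c d : CircExpr N)
  | rep (i v : N) (c : CircExpr N)

namespace CircExpr

variable {N : Type} [DecidableEq N]

/-- The list of gates given by an expression. -/
def val (κ : Fin 3 → List RawGate) : CircExpr N → (N → ℕ) → List RawGate
  | .gate g w, e => [.gate g (w.map fun l => l.val e)]
  | .prep p, e => [.prep (p.val e)]
  | .trace p, e => [.trace (p.val e)]
  | .code k, _ => κ k
  | .seq c d, e => c.val κ e ++ d.val κ e
  | .rep i v c, e => (List.range (e v)).flatMap fun j => c.val κ (update e i j)

/-- The string values of variables. -/
def strEnv (κ : Fin 3 → List RawGate) (e : N → ℕ) : N ⊕ Fin 3 → List Bool :=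
  Sum.elim (fun v => List.replicate (e v) true) fun k => (κ k).flatMap RawGate.encode

theorem update_strEnv (κ : Fin 3 → List RawGate) (e : N → ℕ) (i : N) (j : ℕ) :
    update (strEnv κ e) (Sum.inl i) (List.replicate j true) = strEnv κ (update e i j) := by
  funext v
  rcases v with v | k
  · rcases eq_or_ne v i with rfl | h
    · simp [strEnv]
    · simp [strEnv, h]
  · simp [strEnv]

/-- The unary description of a number. -/
def linStr (l : LinExpr N) : StrExpr (N ⊕ Fin 3) :=
  l.vars.foldr (fun v g => .app (.var (Sum.inl v)) g)
    ((List.range l.const).foldr (fun _ g => .app (.bit true) g) (.bit false))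

theorem val_linStr (κ : Fin 3 → List RawGate) (e : N → ℕ) (l : LinExpr N) :
    (linStr l).val (strEnv κ e) = unary (l.val e) := by
  obtain ⟨c, vs⟩ := l
  have h : ∀ l : List ℕ, (l.foldr (fun _ g => StrExpr.app (.bit true) g)
      (.bit false : StrExpr (N ⊕ Fin 3))).val (strEnv κ e) = unary l.length := by
    intro l
    induction l with
    | nil => rfl
    | cons j l ih => simp [StrExpr.val, ih, unary, List.replicate_succ]
  induction vs with
  | nil => simpa [linStr, LinExpr.val] using h (List.range c)
  | cons v vs ih =>
    have ih' : (linStr ⟨c, vs⟩).val (strEnv κ e) = unary ((vs.map e).sum + c) := ih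
    have : linStr ⟨c, v :: vs⟩ = .app (.var (Sum.inl v)) (linStr ⟨c, vs⟩) := rfl
    rw [this, StrExpr.val, ih', StrExpr.val]
    simp only [strEnv, Sum.elim_inl, LinExpr.val, unary, List.map_cons, List.sum_cons]
    rw [← List.append_assoc, ← List.replicate_add, add_assoc]

/-- The string expression for the description of a list of gates. -/
def toStr : CircExpr N → StrExpr (N ⊕ Fin 3)
  | .gate g w => (w.foldl (fun h l => .app h (linStr l)) (linStr ⟨3 + g, []⟩))
  | .prep p => .app (linStr ⟨1, []⟩) (linStr p)
  | .trace p => .app (linStr ⟨2, []⟩) (linStr p)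
  | .code k => .var (Sum.inr k)
  | .seq c d => .app c.toStr d.toStr
  | .rep i v c => .forIn (Sum.inl i) (Sum.inl v) c.toStr

theorem val_toStr (κ : Fin 3 → List RawGate) (c : CircExpr N) (e : N → ℕ) :
    c.toStr.val (strEnv κ e) = (c.val κ e).flatMap RawGate.encode := by
  induction c generalizing e with
  | gate g w =>
    have h : ∀ (w : List (LinExpr N)) (h : StrExpr (N ⊕ Fin 3)),
        (w.foldl (fun h l => StrExpr.app h (linStr l)) h).val (strEnv κ e) =
          h.val (strEnv κ e) ++ (w.map fun l => l.val e).flatMap unary := by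
      intro w
      induction w with
      | nil => simp
      | cons l w ih => intro h; simp [ih, StrExpr.val, val_linStr]
    simp [toStr, val, h, val_linStr, RawGate.encode, LinExpr.val]
  | prep p => simp [toStr, StrExpr.val, val_linStr, val, RawGate.encode, LinExpr.val]
  | trace p => simp [toStr, StrExpr.val, val_linStr, val, RawGate.encode, LinExpr.val]
  | code k => simp [toStr, StrExpr.val, val, strEnv]
  | seq c d hc hd => simp [toStr, StrExpr.val, val, hc, hd]
  | rep i v c ih =>
    simp only [toStr, StrExpr.val, val, update_strEnv, ih, List.flatMap_assoc]
    simp [strEnv]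

end CircExpr

/-! ### Deciding the inner product with the help of a Wiesner state -/

theorem dot_zero (x y : Bits 0) : dot x y = false := by simp [dot]

theorem dot_cons {n : ℕ} (x y : Bits (n + 1)) :
    dot x y = xor (x 0 && y 0) (dot (fun i => x i.succ) fun i => y i.succ) := by
  unfold dot
  rw [Fin.card_filter_univ_succ]
  cases h : x 0 && y 0
  · simp
  · simp only [if_true, Bool.true_xor, Nat.odd_add_one, decide_not]

/-- Add the inner product of the first remaining qubit to the output wire, for `l` qubits. -/
def decideStep (l : ℕ) : List RawGate :=
  [.prep 0, .gate 0 [2 + l, 2 + l + l, 0], .gate 0 [2, 2 + l + l, 1], .gate 0 [2, 0, 1],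
    .gate 1 [2], .gate 0 [2, 0, 1], .trace 2, .trace 0]

/-- The auxiliary wire `0` holds `θ && y`. The output wire receives `a && y` and then `a && (θ &&
y)`; these cancel if `θ` is set, so the computational bit counts only for `θ = false`. After the
Hadamard gate a qubit with `θ` set is back in `|x⟩`, and the last Toffoli gate adds `x && y` in this
case only. For `θ = false` that Hadamard gate is harmless, because the qubit is then traced out. -/
theorem rawEval_decideStep {G : GateSet} (hG : G.Extends stdGates) (l : ℕ) (hl : 1 ≤ l)
    (o x θ y : Bool) (u v : List Bool)
    (hu : u.getD (l - 1) false = θ) (hv : v.getD (l - 1) false = θ)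
    (hu' : u.getD (l + l - 1) false = y) (hv' : v.getD (l + l - 1) false = y) :
    rawEval G (decideStep l) (∑ a : Bool, ∑ b : Bool,
      (wiesnerAmp x θ a * star (wiesnerAmp x θ b)) • ket (o :: a :: u) (o :: b :: v)) =
      ket ((xor o (x && y)) :: u) ((xor o (x && y)) :: v) := by
  have h0 : G.unitaries[0]? = some toffoli := hG.1 0 _ rfl
  have h1 : G.unitaries[1]? = some hadamard := hG.1 1 _ rfl
  obtain ⟨l, rfl⟩ : ∃ m, l = m + 1 := ⟨l - 1, by omega⟩
  have e₁ : 2 + (l + 1) = l + 1 + 1 + 1 := by omega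
  have e₂ : l + 1 + 1 + 1 + (l + 1) = (l + 1 + l) + 1 + 1 + 1 := by omega
  have e₃ : l + 1 + (l + 1) - 1 = l + 1 + l := by omega
  rw [Nat.add_sub_cancel] at hu hv
  rw [e₃] at hu' hv'
  have key : ∀ a b : Bool, rawEval G (decideStep (l + 1)) (ket (o :: a :: u) (o :: b :: v)) =
      ∑ d : Bool, (wiesnerAmp a true d * star (wiesnerAmp b true d)) •
        ket ((xor (xor (xor o (a && y)) (a && (θ && y))) (d && (θ && y))) :: u)
          ((xor (xor (xor o (b && y)) (b && (θ && y))) (d && (θ && y))) :: v) := by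
    intro a b
    simp only [decideStep, rawEval_cons, rawEval_nil, RawGate.eval, h0, h1, Option.elim_some,
      liftKet_ket, List.insertIdx_zero, gateKet_toffoli, e₁, e₂]
    simp only [List.getD_cons_succ, List.getD_cons_zero, List.set_cons_zero, List.set_cons_succ,
      hu, hv, hu', hv', gateKet_hadamard, map_sum, map_smul, Bool.false_xor, gateKet_toffoli,
      liftKet_ket]
    cases θ <;> cases y <;> simp
  simp only [map_add, map_smul, key, Fintype.sum_bool]
  have hs := inv_sqrt_two_mul_self
  cases x <;> cases θ <;> cases y <;> cases o <;> simp [wiesnerAmp]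
  all_goals rw [hs]; module

theorem sum_bits_succ {n : ℕ} {M : Type*} [AddCommMonoid M] (F : Bits (n + 1) → M) :
    ∑ u, F u = ∑ a : Bool, ∑ u : Bits n, F (Fin.cons a u) := by
  rw [← (Fin.consEquiv fun _ => Bool).sum_comp, Fintype.sum_prod_type]
  rfl

/-- The Wiesner state `|x^θ⟩⟨x^θ|`, with a function of the basis vectors. -/
def wiesnerSum {n : ℕ} (x θ : Bits n) (F : List Bool → List Bool → FreeOp) : FreeOp :=
  ∑ u : Bits n, ∑ v : Bits n, (wiesnerVec x θ u * star (wiesnerVec x θ v)) •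
    F (List.ofFn u) (List.ofFn v)

theorem wiesnerSum_zero (x θ : Bits 0) (F : List Bool → List Bool → FreeOp) :
    wiesnerSum x θ F = F [] [] := by
  simp [wiesnerSum, wiesnerVec]

theorem wiesnerSum_succ {n : ℕ} (x θ : Bits (n + 1)) (F : List Bool → List Bool → FreeOp) :
    wiesnerSum x θ F = wiesnerSum (fun i => x i.succ) (fun i => θ i.succ) fun u v =>
      ∑ a : Bool, ∑ b : Bool, (wiesnerAmp (x 0) (θ 0) a * star (wiesnerAmp (x 0) (θ 0) b)) •
        F (a :: u) (b :: v) := by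
  have h : ∀ (a : Bool) (u : Bits n), wiesnerVec x θ (Fin.cons a u) =
      wiesnerAmp (x 0) (θ 0) a * wiesnerVec (fun i => x i.succ) (fun i => θ i.succ) u := by
    intro a u
    simp [wiesnerVec, Fin.prod_univ_succ]
  have e : ∀ (a : Bool) (u : Bits n), List.ofFn (Fin.cons a u : Bits (n + 1)) =
      a :: List.ofFn u := by
    intro a u
    simp [List.ofFn_succ]
  simp only [wiesnerSum, sum_bits_succ, h, e, Finset.smul_sum, smul_smul]
  rw [Finset.sum_comm]
  refine Finset.sum_congr rfl fun u _ => ?_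
  rw [Finset.sum_comm' (t' := Finset.univ) (s' := fun _ => Finset.univ) (by simp)]
  have : ∀ a : Bool, (∑ b : Bool, ∑ v : Bits n, (wiesnerAmp (x 0) (θ 0) a *
      wiesnerVec (fun i => x i.succ) (fun i => θ i.succ) u * star (wiesnerAmp (x 0) (θ 0) b *
      wiesnerVec (fun i => x i.succ) (fun i => θ i.succ) v)) • F (a :: List.ofFn u)
      (b :: List.ofFn v)) = ∑ v : Bits n, ∑ b : Bool,
      (wiesnerVec (fun i => x i.succ) (fun i => θ i.succ) u *
      star (wiesnerVec (fun i => x i.succ) (fun i => θ i.succ) v) *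
      (wiesnerAmp (x 0) (θ 0) a * star (wiesnerAmp (x 0) (θ 0) b))) • F (a :: List.ofFn u)
      (b :: List.ofFn v) := by
    intro a
    rw [Finset.sum_comm]
    refine Finset.sum_congr rfl fun v _ => Finset.sum_congr rfl fun b _ => ?_
    rw [star_mul']
    congr 1
    ring
  rw [Finset.sum_comm]
  simp only [this]
  rw [Finset.sum_comm]

theorem map_wiesnerSum {n : ℕ} (x θ : Bits n) (F : List Bool → List Bool → FreeOp)
    (Φ : FreeOp →ₗ[ℂ] FreeOp) :
    Φ (wiesnerSum x θ F) = wiesnerSum x θ fun u v => Φ (F u v) := by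
  simp [wiesnerSum]

theorem wiesnerSum_congr {n : ℕ} (x θ : Bits n) {F F' : List Bool → List Bool → FreeOp}
    (h : ∀ u v, u.length = n → v.length = n → F u v = F' u v) :
    wiesnerSum x θ F = wiesnerSum x θ F' := by
  refine Finset.sum_congr rfl fun u _ => Finset.sum_congr rfl fun v _ => ?_
  rw [h _ _ (by simp) (by simp)]

theorem toFree_wiesner {n : ℕ} (x θ : Bits n) (t t' : List Bool) :
    toFree t t' (wiesner x θ).op = wiesnerSum x θ fun u v => ket (u ++ t) (v ++ t') := by
  rfl

theorem flatMap_range_succ_const (n : ℕ) (c : List RawGate) :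
    ((List.range (n + 1)).flatMap fun _ => c) = c ++ (List.range n).flatMap fun _ => c := by
  rw [List.range_succ_eq_map, List.flatMap_cons, List.flatMap_map]

/-- The `n` remaining qubits stand in front of `t`. Each step consumes the first of them, which
moves the bits of `θ` and `y` needed next to the fixed wires `2 + l` and `2 + l + l`; therefore one
and the same list of gates can be repeated. -/
theorem rawEval_decideSteps {G : GateSet} (hG : G.Extends stdGates) {l n : ℕ} (hn : n ≤ l)
    (o : Bool) (x θ y : Bits n) (t : List Bool)
    (hθ : ∀ i : Fin n, t.getD (l - n + i) false = θ i)
    (hy : ∀ i : Fin n, t.getD (l + l - n + i) false = y i) :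
    rawEval G ((List.range n).flatMap fun _ => decideStep l)
      (wiesnerSum x θ fun u v => ket (o :: u ++ t) (o :: v ++ t)) =
      ket ((xor o (dot x y)) :: t) ((xor o (dot x y)) :: t) := by
  induction n generalizing o with
  | zero => simp [wiesnerSum_zero, dot_zero]
  | succ n ih =>
    have hread : ∀ (u : List Bool) (k : ℕ), u.length = n → n ≤ k →
        (u ++ t).getD k false = t.getD (k - n) false := by
      intro u k hu hk
      rw [List.getD_append_right _ _ _ _ (by omega), hu]
    rw [flatMap_range_succ_const, rawEval_append, wiesnerSum_succ, map_wiesnerSum]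
    have h := ih (by omega) (xor o (x 0 && y 0)) (fun i => x i.succ) (fun i => θ i.succ)
      (fun i => y i.succ) (fun i => by
        rw [← hθ i.succ, Fin.val_succ]; congr 1; omega) (fun i => by
        rw [← hy i.succ, Fin.val_succ]; congr 1; omega)
    rw [dot_cons, ← Bool.xor_assoc, ← h]
    congr 1
    refine wiesnerSum_congr _ _ fun u v hu hv => ?_
    have h₀ : t.getD (l - 1 - n) false = θ 0 := by
      rw [← hθ 0]; congr 1; simp only [Fin.val_zero]; omega
    have h₁ : t.getD (l + l - 1 - n) false = y 0 := by
      rw [← hy 0]; congr 1; simp only [Fin.val_zero]; omega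
    exact rawEval_decideStep hG l (by omega) o (x 0) (θ 0) (y 0) (u ++ t) (v ++ t)
      (by rw [hread _ _ hu (by omega), h₀]) (by rw [hread _ _ hv (by omega), h₀])
      (by rw [hread _ _ hu (by omega), h₁]) (by rw [hread _ _ hv (by omega), h₁])

theorem rawEval_trace_one (G : GateSet) (l : ℕ) (o : Bool) (t : List Bool)
    (ht : t.length = l + l) :
    rawEval G ((List.range l).flatMap fun _ => [.trace 1, .trace 1]) (ket (o :: t) (o :: t)) =
      ket [o] [o] := by
  induction l generalizing t with
  | zero => simp [List.length_eq_zero_iff.1 ht]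
  | succ l ih =>
    obtain ⟨a, b, t, rfl⟩ : ∃ a b t', t = a :: b :: t' := by
      match t, ht with
      | a :: b :: t', _ => exact ⟨a, b, t', rfl⟩
      | [_], h => simp at h; omega
      | [], h => simp at h
    rw [flatMap_range_succ_const, rawEval_append]
    simp only [rawEval_cons, RawGate.eval, liftKet_ket, if_true, List.eraseIdx_cons_succ,
      List.eraseIdx_cons_zero, rawEval_nil]
    exact ih t (by simp at ht; omega)

/-- The circuit that decides instances of length `l + l`. -/
def decideEven (l : ℕ) : List RawGate :=
  [.prep 0] ++ (((List.range l).flatMap fun _ => decideStep l) ++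
    (List.range l).flatMap fun _ => [.trace 1, .trace 1])

/-- A circuit from `l + l + 1` wires to one wire. -/
def decideOdd (l : ℕ) : List RawGate :=
  ((List.range l).flatMap fun _ => [.trace 0, .trace 0]) ++ [.trace 0, .prep 0]

theorem rawEval_decideEven {G : GateSet} (hG : G.Extends stdGates) {l : ℕ} (x θ y : Bits l) :
    rawEval G (decideEven l) (toFree (List.ofFn θ ++ List.ofFn y) (List.ofFn θ ++ List.ofFn y)
      (wiesner x θ).op) = ket [dot x y] [dot x y] := by
  rw [decideEven, rawEval_append, rawEval_append, toFree_wiesner, rawEval_cons, rawEval_nil,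
    map_wiesnerSum]
  have := rawEval_decideSteps hG le_rfl false x θ y (List.ofFn θ ++ List.ofFn y)
    (fun i => by
      rw [List.getD_append _ _ _ _ (by simp), List.getD_eq_getElem _ _ (by simp)]
      simp)
    (fun i => by
      rw [List.getD_append_right _ _ _ _ (by simp), List.getD_eq_getElem _ _ (by simp)]
      simp)
  simp only [RawGate.eval, liftKet_ket, List.insertIdx_zero]
  refine (congrArg _ this).trans ?_
  rw [Bool.false_xor, rawEval_trace_one _ _ _ _ (by simp)]

theorem rawValid_flatMap_range {G : GateSet} {c : ℕ → List RawGate} {a : ℕ → ℕ} (n : ℕ)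
    (h : ∀ i < n, RawValid G (a i) (c i) (a (i + 1))) :
    RawValid G (a 0) ((List.range n).flatMap c) (a n) := by
  induction n with
  | zero => rfl
  | succ n ih =>
    rw [List.range_succ, List.flatMap_append]
    refine (ih fun i hi => h i (by omega)).append ?_
    simpa using h n (by omega)

theorem rawValid_decideEven (l : ℕ) : RawValid stdGates (l + (l + l)) (decideEven l) 1 := by
  refine RawValid.append (b := l + (l + l) + 1) ⟨⟨trivial, Nat.zero_le _⟩, rfl⟩
    (RawValid.append (b := (l + l) + 1) ?_ ?_)
  · have h : ∀ i < l, RawValid stdGates (l - i + (l + l) + 1) (decideStep l)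
        (l - (i + 1) + (l + l) + 1) := by
      intro i hi
      refine ⟨⟨trivial, Nat.zero_le _⟩, ⟨toffoli, rfl, rfl, ?_, ?_⟩, ⟨toffoli, rfl, rfl, ?_, ?_⟩,
        ⟨toffoli, rfl, rfl, ?_, ?_⟩, ⟨hadamard, rfl, rfl, ?_, ?_⟩, ⟨toffoli, rfl, rfl, ?_, ?_⟩,
        ⟨trivial, ?_⟩, ⟨trivial, ?_⟩, ?_⟩
      all_goals simp [RawValid]
      all_goals omega
    simpa using rawValid_flatMap_range (a := fun i => l - i + (l + l) + 1) l h
  · have h : ∀ i < l, RawValid stdGates (l - i + (l - i) + 1) [.trace 1, .trace 1]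
        (l - (i + 1) + (l - (i + 1)) + 1) := fun i hi =>
      ⟨⟨trivial, by omega⟩, ⟨trivial, by omega⟩, by simp only [RawValid]; omega⟩
    simpa using rawValid_flatMap_range (a := fun i => l - i + (l - i) + 1) l h

theorem rawValid_decideOdd (l : ℕ) : RawValid stdGates (l + l + 1) (decideOdd l) 1 := by
  refine RawValid.append (b := 1) ?_ ⟨⟨trivial, by omega⟩, ⟨trivial, by omega⟩, rfl⟩
  have h : ∀ i < l, RawValid stdGates (l - i + (l - i) + 1) [.trace 0, .trace 0]
      (l - (i + 1) + (l - (i + 1)) + 1) := fun i hi =>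
    ⟨⟨trivial, by omega⟩, ⟨trivial, by omega⟩, by simp only [RawValid]; omega⟩
  simpa using rawValid_flatMap_range (a := fun i => l - i + (l - i) + 1) l h

/-! ### Classical inputs, and the uniform family of deciding circuits. -/

theorem sum_bits_append {a b : ℕ} {M : Type*} [AddCommMonoid M] (F : Bits (a + b) → M) :
    ∑ u, F u = ∑ i : Bits a, ∑ j : Bits b, F (Fin.append i j) := by
  rw [← (Fin.appendEquiv a b).sum_comp, Fintype.sum_prod_type]
  rfl

/-- Wires at the end of an operator as idle wires. -/
theorem toFree_append {a b : ℕ} (t t' : List Bool) (σ : Op (a + b)) :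
    toFree t t' σ = ∑ j : Bits b, ∑ l : Bits b,
      toFree (List.ofFn j ++ t) (List.ofFn l ++ t') (Matrix.of fun i k =>
        σ (Fin.append i j) (Fin.append k l)) := by
  simp only [toFree_apply, sum_bits_append, Matrix.of_apply, List.ofFn_fin_append,
    List.append_assoc]
  rw [Finset.sum_comm]
  refine Finset.sum_congr rfl fun j _ => ?_
  rw [Finset.sum_comm' (t' := Finset.univ) (s' := fun _ => Finset.univ) (by simp)]
  refine (Finset.sum_congr rfl fun i _ => Finset.sum_comm).trans ?_
  rw [Finset.sum_comm]
  exact Finset.sum_congr rfl fun l _ => Finset.sum_comm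

/-- A classical register contributes a single matrix unit, which becomes a suffix common to all
terms. -/
theorem toFree_tensorOp_proj {a b : ℕ} (t t' : List Bool) (σ : Op a) (z : Bits b) :
    toFree t t' (tensorOp σ (proj z)) = toFree (List.ofFn z ++ t) (List.ofFn z ++ t') σ := by
  rw [toFree_append, Finset.sum_eq_single z, Finset.sum_eq_single z]
  · congr 1
    ext i k
    simp [tensorOp, proj]
  · intro l _ hl
    convert map_zero (toFree (n := a) (List.ofFn z ++ t) (List.ofFn l ++ t')) using 2
    ext i k
    simp [tensorOp, proj, Matrix.single, hl.symm]
  · simp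
  · intro j _ hj
    refine Finset.sum_eq_zero fun l _ => ?_
    convert map_zero (toFree (n := a) (List.ofFn j ++ t) (List.ofFn l ++ t')) using 2
    ext i k
    simp [tensorOp, proj, Matrix.single, hj.symm]
  · simp

theorem prob_decideEven {l : ℕ} (x θ y : Bits l) (σ : QState) (hσ : σ = wiesner x θ)
    (C : Circuit stdGates (σ.qubits + (l + l)) 1) (hC : C.raw = decideEven l) :
    prob (C.eval (tensorOp σ.op (proj (Fin.append θ y)))) (fun _ => dot x y) = 1 := by
  subst hσ
  have h := C.rawEval_raw [] [] (tensorOp (wiesner x θ).op (proj (Fin.append θ y)))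
  rw [toFree_tensorOp_proj, hC, List.ofFn_fin_append, List.append_nil,
    rawEval_decideEven ⟨fun _ _ h => h, id, id⟩] at h
  have h' := toFree_coeff (C.eval (tensorOp (wiesner x θ).op (proj (Fin.append θ y))))
    (fun _ => dot x y) (fun _ => dot x y)
  rw [prob, ← h', ← h, ket]
  simp [List.ofFn_succ]

theorem wiesnerAdvice_double (s : ∀ l : ℕ, Bits (l + l)) (l : ℕ) :
    wiesnerAdvice s (l + l) = wiesner (fstHalf (s l)) (sndHalf (s l)) := by
  have h : (l + l) / 2 = l := by omega
  rw [wiesnerAdvice, if_pos ⟨l, rfl⟩, h]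

theorem wiesnerAdvice_qubits_odd (s : ∀ l : ℕ, Bits (l + l)) (l : ℕ) :
    (wiesnerAdvice s (l + l + 1)).qubits = 0 := by
  rw [wiesnerAdvice, if_neg (by rw [Nat.not_even_iff_odd]; exact ⟨l, by ring⟩)]
  rfl

/-- The circuit for instances of length `n`. -/
def decideCircuit (n : ℕ) : List RawGate :=
  if n % 2 = 0 then decideEven (n / 2) else decideOdd (n / 2)

theorem rawValid_decideCircuit (s : ∀ l : ℕ, Bits (l + l)) (n : ℕ) :
    RawValid stdGates ((wiesnerAdvice s n).qubits + n) (decideCircuit n) 1 := by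
  obtain ⟨l, rfl | rfl⟩ : ∃ l, n = l + l ∨ n = l + l + 1 := ⟨n / 2, by omega⟩
  · rw [wiesnerAdvice_double, decideCircuit, if_pos (by omega), show (l + l) / 2 = l by omega]
    exact rawValid_decideEven l
  · rw [wiesnerAdvice_qubits_odd, decideCircuit, if_neg (by omega),
      show (l + l + 1) / 2 = l by omega, Nat.zero_add]
    exact rawValid_decideOdd l

/-- The expression for the circuits that decide instances; the variables `0`, `1`, `2` are the half
of the length, its parity, and the complement of its parity. -/
def decideExpr : CircExpr (Fin 5) :=
  .seq
    (.rep 3 2 (.seq (.prep ⟨0, []⟩) (.seq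
      (.rep 4 0 (.seq (.prep ⟨0, []⟩) (.seq (.gate 0 [⟨2, [0]⟩, ⟨2, [0, 0]⟩, ⟨0, []⟩])
        (.seq (.gate 0 [⟨2, []⟩, ⟨2, [0, 0]⟩, ⟨1, []⟩]) (.seq (.gate 0 [⟨2, []⟩, ⟨0, []⟩, ⟨1, []⟩])
        (.seq (.gate 1 [⟨2, []⟩]) (.seq (.gate 0 [⟨2, []⟩, ⟨0, []⟩, ⟨1, []⟩])
        (.seq (.trace ⟨2, []⟩) (.trace ⟨0, []⟩)))))))))
      (.rep 4 0 (.seq (.trace ⟨1, []⟩) (.trace ⟨1, []⟩))))))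
    (.rep 3 1 (.seq (.rep 4 0 (.seq (.trace ⟨0, []⟩) (.trace ⟨0, []⟩)))
      (.seq (.trace ⟨0, []⟩) (.prep ⟨0, []⟩))))

/-- The values of the variables of `decideExpr`. -/
def halfEnv (n : ℕ) : Fin 5 → ℕ := ![n / 2, n % 2, 1 - n % 2, 0, 0]

/-- The parity and its complement are `0` or `1`, so loops over them act as a case distinction, for
which the expressions have no other means. -/
theorem val_decideExpr (κ : Fin 3 → List RawGate) (n : ℕ) :
    decideExpr.val κ (halfEnv n) = decideCircuit n := by
  rcases Nat.mod_two_eq_zero_or_one n with h | h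
  · have e : n / 2 + 2 + n / 2 = n / 2 + n / 2 + 2 := by omega
    simp [decideExpr, CircExpr.val, halfEnv, decideCircuit, decideEven, decideStep, LinExpr.val, h,
      Function.update, e, Nat.add_comm 2]
  · simp [decideExpr, CircExpr.val, halfEnv, decideCircuit, decideOdd, LinExpr.val, h]

/-- The expression for the description of the circuits that decide instances. -/
def decideStr : StrExpr (Fin 5 ⊕ Fin 3) :=
  .app (.app (.forIn (.inl 3) (.inl 2) (.app (.var (.inl 0)) (.app (.var (.inl 0))
    (.var (.inl 0))))) (.app (.forIn (.inl 3) (.inl 1) (.app (.var (.inl 0)) (.app (.var (.inl 0))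
    (.bit true)))) (.bit false))) (.app decideExpr.toStr (.bit false))

theorem wf_decideStr : decideStr.WF [.inl 0, .inl 1, .inl 2] [.inl 0, .inl 1, .inl 2] := by
  decide

theorem exists_polyTime_decide (s : ∀ l : ℕ, Bits (l + l)) :
    ∃ C : ∀ n, Circuit stdGates ((wiesnerAdvice s n).qubits + n) 1, PolyTime C ∧
      ∀ n, (C n).raw = decideCircuit n := by
  choose C hC using fun n => (rawValid_decideCircuit s n).exists_circuit
  refine ⟨C, ?_, hC⟩
  have h := StrExpr.polyTime_val_halve (X := Fin 5 ⊕ Fin 3) (h := .inl 0) (o := .inl 1)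
    (e := .inl 2) (by simp) (by simp) (by simp) decideStr wf_decideStr
  have he : ∀ n, (update (update (update (fun _ => []) (.inl 0) (List.replicate (n / 2) true))
      (.inl 1) (List.replicate (n % 2) true)) (.inl 2) (List.replicate (1 - n % 2) true) :
      Fin 5 ⊕ Fin 3 → List Bool) = CircExpr.strEnv (fun _ => []) (halfEnv n) := by
    intro n
    funext v
    rcases v with v | k
    · fin_cases v <;> simp [CircExpr.strEnv, halfEnv]
    · simp [CircExpr.strEnv]
  suffices hval : ∀ n, decideStr.val (CircExpr.strEnv (fun _ => []) (halfEnv n)) =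
      (C n).encode by
    simp only [he, hval] at h
    exact h
  intro n
  have happ : ∀ g h : StrExpr (Fin 5 ⊕ Fin 3), ∀ σ, (g.app h).val σ = g.val σ ++ h.val σ :=
    fun _ _ _ => rfl
  rw [Circuit.encode_eq, hC, decideStr, happ, happ decideExpr.toStr, CircExpr.val_toStr,
    val_decideExpr]
  congr 1
  simp only [StrExpr.val, CircExpr.update_strEnv]
  obtain ⟨l, rfl | rfl⟩ : ∃ l, n = l + l ∨ n = l + l + 1 := ⟨n / 2, by omega⟩
  · have h₂ : (l + l) / 2 = l := by omega
    have h₃ : (l + l) % 2 = 0 := by omega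
    rw [wiesnerAdvice_double]
    simp [CircExpr.strEnv, halfEnv, h₂, h₃, unary, wiesner]
  · have h₂ : (l + l + 1) / 2 = l := by omega
    have h₃ : (l + l + 1) % 2 = 1 := by omega
    rw [wiesnerAdvice_qubits_odd]
    have hr : List.replicate (l + l + 1) true =
        List.replicate l true ++ (List.replicate l true ++ [true]) := by
      rw [List.replicate_add, List.replicate_add, List.append_assoc]
      rfl
    simp [CircExpr.strEnv, halfEnv, h₂, h₃, unary, hr]

theorem correct_wiesnerAdvice (s : ∀ l : ℕ, Bits (l + l)) :
    ∃ C : ∀ n, Circuit stdGates ((wiesnerAdvice s n).qubits + n) 1, PolyTime C ∧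
    ∃ η : ℕ → ℝ, Negligible η ∧ ∀ (n : ℕ) (x : Bits n), (⟨n, x⟩ : BitString) ∈
      (ipProblem s).instances → 1 - η n ≤ prob ((C n).eval (tensorOp (wiesnerAdvice s n).op
        (proj x))) ((ipProblem s).answerBit x) := by
  obtain ⟨C, hC, h⟩ := exists_polyTime_decide s
  -- The decision is exact, so no error has to be allowed for.
  refine ⟨C, hC, fun _ => 0, fun c => Filter.Eventually.of_forall fun n => by positivity, ?_⟩
  intro n z hz
  have key : ∀ (l : ℕ) (y : Bits l) (b : Bool), dot (fstHalf (s l)) y = b →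
      (⟨n, z⟩ : BitString) = ⟨l + l, Fin.append (sndHalf (s l)) y⟩ →
      (ipProblem s).answer ⟨n, z⟩ = b → 1 - 0 ≤ prob ((C n).eval (tensorOp (wiesnerAdvice s n).op
        (proj z))) ((ipProblem s).answerBit z) := by
    intro l y b hb hz hans
    obtain rfl : n = l + l := congrArg Sigma.fst hz
    obtain rfl : z = _ := eq_of_heq (Sigma.mk.inj hz).2
    have := prob_decideEven (fstHalf (s l)) (sndHalf (s l)) y _ (wiesnerAdvice_double s l)
      (C (l + l)) (by rw [h, decideCircuit, if_pos (by omega), show (l + l) / 2 = l by omega])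
    have hbit : (ipProblem s).answerBit (Fin.append (sndHalf (s l)) y) =
        fun _ => dot (fstHalf (s l)) y := funext fun _ => hans.trans hb.symm
    rw [hbit, this, sub_zero]
  rcases hz with hz | hz
  · obtain ⟨l, y, hy, e⟩ := hz
    refine key l y false hy e ?_
    refine @decide_eq_false _ (Classical.propDecidable _) ?_
    exact Set.disjoint_left.1 (ipProblem s).disjoint ⟨l, y, hy, e⟩
  · obtain ⟨l, y, hy, e⟩ := hz
    exact key l y true hy e (@decide_eq_true _ (Classical.propDecidable _) ⟨l, y, hy, e⟩)

end

open scoped ComplexOrder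

noncomputable section

open Function (update)

/-! ### Kraus decompositions of circuits -/

/-- A linear map of the form `ρ ↦ ∑ K ρ K†` with `∑ K† K = 1`. -/
def IsChannel {a b : ℕ} (Φ : Op a →ₗ[ℂ] Op b) : Prop :=
  ∃ (ι : Type) (_ : Fintype ι) (K : ι → Matrix (Bits b) (Bits a) ℂ),
    (∀ ρ, Φ ρ = ∑ k, K k * ρ * (K k).conjTranspose) ∧ ∑ k, (K k).conjTranspose * K k = 1

theorem IsChannel.id (a : ℕ) : IsChannel (LinearMap.id : Op a →ₗ[ℂ] Op a) :=
  ⟨Unit, inferInstance, fun _ => 1, by simp, by simp⟩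

theorem IsChannel.comp {a b c : ℕ} {Φ : Op a →ₗ[ℂ] Op b} {Ψ : Op b →ₗ[ℂ] Op c}
    (hΨ : IsChannel Ψ) (hΦ : IsChannel Φ) : IsChannel (Ψ ∘ₗ Φ) := by
  obtain ⟨ι, _, K, hK, hK'⟩ := hΦ
  obtain ⟨κ, _, L, hL, hL'⟩ := hΨ
  refine ⟨ι × κ, inferInstance, fun p => L p.2 * K p.1, fun ρ => ?_, ?_⟩
  · rw [LinearMap.comp_apply, hK, hL, Fintype.sum_prod_type, Finset.sum_comm]
    refine Finset.sum_congr rfl fun l _ => ?_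
    rw [Matrix.mul_sum, Matrix.sum_mul]
    refine Finset.sum_congr rfl fun k _ => ?_
    simp only [Matrix.conjTranspose_mul, Matrix.mul_assoc]
  · rw [Fintype.sum_prod_type, ← hK']
    refine Finset.sum_congr rfl fun k _ => ?_
    have : ∀ l, (L l * K k).conjTranspose * (L l * K k) =
        (K k).conjTranspose * ((L l).conjTranspose * L l) * K k := by
      intro l
      simp only [Matrix.conjTranspose_mul, Matrix.mul_assoc]
    simp only [this]
    rw [← Matrix.sum_mul, ← Matrix.mul_sum, hL', Matrix.mul_one]

/-- For a fixed column only the rows that agree with it off the wires contribute. This reduces the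
product to the unitarity of `U` if `x` and `y` agree off the wires, and to zero otherwise. -/
theorem onWires_conjTranspose_mul_self {k n : ℕ} {U : Matrix (Bits k) (Bits k) ℂ}
    (hU : U ∈ Matrix.unitaryGroup (Bits k) ℂ) (w : Fin k ↪ Fin n) :
    (onWires U w).conjTranspose * onWires U w = 1 := by
  rw [Matrix.mem_unitaryGroup_iff'] at hU
  ext x y
  rw [Matrix.mul_apply]
  simp only [Matrix.conjTranspose_apply]
  rw [sum_onWires_smul U w y fun z a => star (onWires U w z x) * a]
  swap
  · simp
  have hx : ∀ u, onWires U w (Function.extend w u y) x =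
      if (∀ i, i ∉ Set.range w → y i = x i) then U u (fun j => x (w j)) else 0 := by
    intro u
    rw [onWires, Matrix.of_apply]
    have : (∀ i, i ∉ Set.range w → Function.extend w u y i = x i) ↔
        ∀ i, i ∉ Set.range w → y i = x i := by
      refine forall_congr' fun i => forall_congr' fun hi => ?_
      rw [Function.extend_apply' _ _ _ (by simpa using hi)]
    simp only [this, w.injective.extend_apply]
  simp only [hx]
  have hm := congrFun (congrFun hU fun j => x (w j)) fun j => y (w j)
  rw [Matrix.mul_apply] at hm
  simp only [Matrix.star_apply] at hm
  by_cases h : ∀ i, i ∉ Set.range w → y i = x i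
  · simp only [if_pos h, hm, Matrix.one_apply]
    congr 1
    refine propext ⟨fun he => funext fun i => ?_, fun he => by rw [he]⟩
    by_cases hi : i ∈ Set.range w
    · obtain ⟨j, rfl⟩ := hi
      exact congrFun he j
    · exact (h i hi).symm
  · simp only [if_neg h, star_zero, zero_mul, Finset.sum_const_zero]
    rw [Matrix.one_apply_ne]
    rintro rfl
    exact h fun _ _ => rfl

theorem isChannel_conjMap {n : ℕ} {U : Op n} (hU : U.conjTranspose * U = 1) :
    IsChannel (conjMap U) :=
  ⟨Unit, inferInstance, fun _ => U, by simp [conjMap], by simpa using hU⟩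

theorem isChannel_prepMap {n : ℕ} (p : Fin (n + 1)) : IsChannel (prepMap p) := by
  have key : ∀ (x : Bits n) (z : Bits (n + 1)), z = p.insertNth (α := fun _ => Bool) false x ↔
      z p = false ∧ (fun i => z (p.succAbove i)) = x := by
    intro x z
    rw [eq_comm, Fin.insertNth_eq_iff, @eq_comm _ x, @eq_comm _ false]
    rfl
  refine ⟨Unit, inferInstance, fun _ => Matrix.of fun x y =>
    if x = p.insertNth (α := fun _ => Bool) false y then 1 else 0, fun ρ => ?_, ?_⟩
  · ext x y
    simp only [Finset.univ_unique, Finset.sum_singleton, Matrix.mul_apply, Matrix.of_apply,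
      Matrix.conjTranspose_apply, prepMap, LinearMap.coe_mk, AddHom.coe_mk, key]
    by_cases h₁ : x p = false <;> by_cases h₂ : y p = false <;>
      simp [h₁, h₂, Finset.sum_ite_eq]
  · ext x y
    simp [Matrix.mul_apply, Matrix.one_apply, @eq_comm _ x]

theorem isChannel_traceMap {n : ℕ} (p : Fin (n + 1)) : IsChannel (traceMap p) := by
  refine ⟨Bool, inferInstance, fun b => Matrix.of fun x y =>
    if y = p.insertNth (α := fun _ => Bool) b x then 1 else 0, fun ρ => ?_, ?_⟩
  · ext x y
    rw [Matrix.sum_apply]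
    simp [Matrix.mul_apply, traceMap]
  · ext x y
    have key : ∀ (b : Bool) (z : Bits n) (x : Bits (n + 1)),
        x = p.insertNth (α := fun _ => Bool) b z ↔
        b = x p ∧ z = (fun i => x (p.succAbove i)) := by
      intro b z x
      rw [eq_comm, Fin.insertNth_eq_iff]
      rfl
    have hxy : x = y ↔ x p = y p ∧ (fun i => x (p.succAbove i)) = fun i => y (p.succAbove i) := by
      constructor
      · rintro rfl; exact ⟨rfl, rfl⟩
      · rintro ⟨h₁, h₂⟩
        funext i
        refine Fin.succAboveCases p h₁ (fun j => congrFun h₂ j) i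
    rw [Matrix.sum_apply, Matrix.one_apply]
    simp only [Matrix.mul_apply, Matrix.conjTranspose_apply, Matrix.of_apply, key, Fintype.sum_bool,
      hxy]
    rcases hx : x p <;> rcases hy : y p <;> simp [eq_comm]

theorem Circuit.isChannel_eval {G : GateSet} {a b : ℕ} (C : Circuit G a b) :
    IsChannel C.eval := by
  induction C with
  | nil n => exact IsChannel.id n
  | gate g w rest ih =>
    exact ih.comp (isChannel_conjMap (onWires_conjTranspose_mul_self (G.unitaries.get g).unitary w))
  | prep h p rest ih => exact ih.comp (isChannel_prepMap p)
  | trace h p rest ih => exact ih.comp (isChannel_traceMap p)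

/-- The effects of a measurement of the output of a channel. -/
theorem IsChannel.exists_effect {a b : ℕ} {Φ : Op a →ₗ[ℂ] Op b} (hΦ : IsChannel Φ) :
    ∃ E : Bits b → Op a, (∀ o, (E o).PosSemidef) ∧ ∑ o, E o = 1 ∧
      ∀ o i k, Φ (Matrix.single i k 1) o o = E o k i := by
  obtain ⟨ι, _, K, hK, hK'⟩ := hΦ
  refine ⟨fun o => ∑ κ, (K κ).conjTranspose * Matrix.single o o (1 : ℂ) * K κ, fun o => ?_, ?_, ?_⟩
  · refine Matrix.posSemidef_sum _ fun κ _ => ?_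
    have : (Matrix.single o o (1 : ℂ)).PosSemidef := by
      have h : Matrix.single o o (1 : ℂ) =
          Matrix.vecMulVec (Pi.single o 1) (star (Pi.single o 1)) := by
        ext i j
        by_cases hi : i = o <;> by_cases hj : j = o <;>
          simp [Matrix.vecMulVec_apply, Matrix.single, hi, hj, @eq_comm _ o]
      rw [h]
      exact Matrix.posSemidef_vecMulVec_self_star _
    exact this.conjTranspose_mul_mul_same (K κ)
  · rw [Finset.sum_comm, ← hK']
    refine Finset.sum_congr rfl fun κ _ => ?_
    rw [← Matrix.sum_mul, ← Matrix.mul_sum]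
    have : ∑ o : Bits b, Matrix.single o o (1 : ℂ) = 1 := by
      ext i j
      simp [Matrix.sum_apply, Matrix.single, Matrix.one_apply, ite_and]
    rw [this, Matrix.mul_one]
  · intro o i k
    simp only [hK, Matrix.sum_apply]
    refine Finset.sum_congr rfl fun κ _ => ?_
    simp [Matrix.mul_apply, Matrix.single, ite_and, mul_comm]

end

noncomputable section

open Function (update)

/-! ### The monogamy bound -/

section Monogamy

variable {H Θ X Z : Type*} [NormedAddCommGroup H] [InnerProductSpace ℂ H] [Fintype Θ] [Fintype X]
  [Fintype Z] [DecidableEq Z]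

/-- Expanding the squares gives the Gram matrix of `Ω`, of which the orthonormality of the columns
of `φ` retains the diagonal. -/
theorem sum_norm_sq_rotate (Ω : Z → H) (φ : X → Z → ℝ)
    (hφ : ∀ z z', ∑ x, φ x z * φ x z' = if z = z' then 1 else 0) :
    ∑ x, ‖∑ z, (φ x z : ℂ) • Ω z‖ ^ 2 = ∑ z, ‖Ω z‖ ^ 2 := by
  have h : ∀ v : H, (‖v‖ ^ 2 : ℝ) = (inner ℂ v v).re := fun v => by
    rw [inner_self_eq_norm_sq_to_K]; norm_cast
  have e : ∀ x, ‖∑ z, (φ x z : ℂ) • Ω z‖ ^ 2 =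
      ∑ z, ∑ z', (φ x z * φ x z') * (inner ℂ (Ω z) (Ω z')).re := by
    intro x
    rw [h, sum_inner, Complex.re_sum]
    refine Finset.sum_congr rfl fun z _ => ?_
    rw [inner_sum, Complex.re_sum]
    refine Finset.sum_congr rfl fun z' _ => ?_
    rw [inner_smul_left, inner_smul_right, Complex.conj_ofReal, Complex.re_ofReal_mul,
      Complex.re_ofReal_mul, mul_assoc]
  simp only [e]
  rw [Finset.sum_comm]
  refine Finset.sum_congr rfl fun z _ => ?_
  rw [Finset.sum_comm]
  simp only [← Finset.sum_mul, hφ, ite_mul, one_mul, zero_mul, Finset.sum_ite_eq, Finset.mem_univ,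
    if_true, h]

/-- Since both sums of squares have the same bound, `2fg ≤ f² + g²` does the work of Cauchy–Schwarz.
-/
theorem sum_mul_le_of_sum_sq_le {ι : Type*} (s : Finset ι) (f g : ι → ℝ) {W : ℝ}
    (hf : ∑ i ∈ s, f i ^ 2 ≤ W) (hg : ∑ i ∈ s, g i ^ 2 ≤ W) : ∑ i ∈ s, f i * g i ≤ W := by
  have h := Finset.sum_le_sum fun i (_ : i ∈ s) => two_mul_le_add_sq (f i) (g i)
  rw [Finset.sum_add_distrib] at h
  have : ∑ i ∈ s, 2 * f i * g i = 2 * ∑ i ∈ s, f i * g i := by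
    rw [Finset.mul_sum]
    exact Finset.sum_congr rfl fun i _ => mul_assoc _ _ _
  linarith

/-- Two commuting families of measurements cannot both be correlated with the outcomes of random
measurements, if these have small overlaps. -/
theorem monogamy_bound (Ω : Z → H) (φ : Θ → X → Z → ℝ)
    (hφ : ∀ θ z z', ∑ x, φ θ x z * φ θ x z' = if z = z' then 1 else 0)
    (κ : Θ → Θ → ℝ) (hκ : ∀ θ θ' x x', |∑ z, φ θ x z * φ θ' x' z| ≤ κ θ θ')
    (hκ' : ∀ θ θ', 0 ≤ κ θ θ') (B C : Θ → X → H →ₗ[ℂ] H) (hB : ∀ θ x, (B θ x).IsSymmetric)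
    (hC : ∀ θ x, (C θ x).IsSymmetric)
    (hBC : ∀ θ x θ' x' v, B θ x (C θ' x' v) = C θ' x' (B θ x v))
    (pB : ∀ θ v, ∑ x, ‖B θ x v‖ ^ 2 ≤ ‖v‖ ^ 2) (pC : ∀ θ v, ∑ x, ‖C θ x v‖ ^ 2 ≤ ‖v‖ ^ 2)
    (s : Θ → X → ℝ) (hs : ∀ θ x, |s θ x| ≤ 1) :
    ∑ θ, ∑ x, s θ x * (inner ℂ (∑ z, (φ θ x z : ℂ) • Ω z)
      (B θ x (C θ x (∑ z, (φ θ x z : ℂ) • Ω z)))).re ≤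
      (∑ z, ‖Ω z‖ ^ 2) * Real.sqrt (∑ θ, ∑ θ', κ θ θ') := by
  set w : Θ → X → H := fun θ x => ∑ z, (φ θ x z : ℂ) • Ω z with hw
  set W := ∑ z, ‖Ω z‖ ^ 2 with hW
  have hW0 : 0 ≤ W := Finset.sum_nonneg fun _ _ => sq_nonneg _
  have hwW : ∀ θ, ∑ x, ‖w θ x‖ ^ 2 = W := fun θ => sum_norm_sq_rotate Ω (φ θ) (hφ θ)
  set m : Θ → X → H := fun θ x => (s θ x : ℂ) • B θ x (C θ x (w θ x)) with hm
  -- Expanding the rotated vectors on the left in the fixed family `Ω` collects the whole sum into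
  -- inner products of `Ω z` with `Ψ z`. One use of Cauchy–Schwarz then leaves only the norm of `Ψ`
  -- to be estimated.
  set Ψ : Z → H := fun z => ∑ θ, ∑ x, (φ θ x z : ℂ) • m θ x with hΨ
  have h1 : ∑ θ, ∑ x, s θ x * (inner ℂ (w θ x) (B θ x (C θ x (w θ x)))).re =
      ∑ z, (inner ℂ (Ω z) (Ψ z)).re := by
    have : ∀ z, (inner ℂ (Ω z) (Ψ z)).re =
        ∑ θ, ∑ x, s θ x * (φ θ x z * (inner ℂ (Ω z) (B θ x (C θ x (w θ x)))).re) := by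
      intro z
      simp only [hΨ, hm, inner_sum, Complex.re_sum, inner_smul_right, Complex.re_ofReal_mul]
      exact Finset.sum_congr rfl fun θ _ => Finset.sum_congr rfl fun x _ => by ring
    simp only [this]
    symm
    rw [Finset.sum_comm]
    refine Finset.sum_congr rfl fun θ _ => ?_
    rw [Finset.sum_comm]
    refine Finset.sum_congr rfl fun x _ => ?_
    rw [← Finset.mul_sum]
    congr 1
    symm
    generalize B θ x (C θ x (w θ x)) = v
    simp only [hw]
    rw [sum_inner, Complex.re_sum]
    refine Finset.sum_congr rfl fun z _ => ?_
    rw [inner_smul_left, Complex.conj_ofReal, Complex.re_ofReal_mul]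
  have h2 : ∑ z, (inner ℂ (Ω z) (Ψ z)).re ≤ Real.sqrt W * Real.sqrt (∑ z, ‖Ψ z‖ ^ 2) := by
    refine le_trans (Finset.sum_le_sum fun z _ => ?_)
      (Real.sum_mul_le_sqrt_mul_sqrt Finset.univ (fun z => ‖Ω z‖) fun z => ‖Ψ z‖)
    exact (Complex.re_le_norm _).trans (norm_inner_le_norm _ _)
  -- The sum over `x'` is at most `‖D θ x (w θ x)‖ ^ 2`, which is a single term of a sum bounded by
  -- `‖w θ x‖ ^ 2`.
  have hle : ∀ (D : Θ → X → H →ₗ[ℂ] H), (∀ θ v, ∑ x, ‖D θ x v‖ ^ 2 ≤ ‖v‖ ^ 2) → ∀ θ θ',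
      ∑ x, ∑ x', ‖D θ' x' (D θ x (w θ x))‖ ^ 2 ≤ W := by
    intro D hD θ θ'
    rw [← hwW θ]
    refine Finset.sum_le_sum fun x _ => (hD θ' _).trans ((hD θ (w θ x)).trans' ?_)
    exact Finset.single_le_sum (f := fun x' => ‖D θ x' (w θ x)‖ ^ 2) (fun _ _ => sq_nonneg _)
      (Finset.mem_univ x)
  -- By symmetry and commutation `⟨B C w, B' C' w'⟩ = ⟨C' C w, B B' w'⟩`: each side of the inner
  -- product now involves the operators of one party only, and `hle` bounds the sum of the squares
  -- over `x` and `x'`.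
  have h4 : ∀ θ x θ' x', |(inner ℂ (m θ x) (m θ' x')).re| ≤
      ‖C θ' x' (C θ x (w θ x))‖ * ‖B θ x (B θ' x' (w θ' x'))‖ := by
    intro θ x θ' x'
    have e : inner ℂ (m θ x) (m θ' x') = ((s θ x * s θ' x' : ℝ) : ℂ) *
        inner ℂ (C θ' x' (C θ x (w θ x))) (B θ x (B θ' x' (w θ' x'))) := by
      simp only [hm]
      rw [inner_smul_left, inner_smul_right, Complex.conj_ofReal, hB θ x, hBC θ' x', hBC θ x,
        ← hC θ' x', Complex.ofReal_mul, mul_assoc]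
    rw [e, Complex.re_ofReal_mul, abs_mul, abs_mul]
    have h₁ : |s θ x| * |s θ' x'| ≤ 1 :=
      mul_le_one₀ (hs _ _) (abs_nonneg _) (hs _ _)
    calc _ ≤ 1 * |(inner ℂ (C θ' x' (C θ x (w θ x))) (B θ x (B θ' x' (w θ' x')))).re| :=
          mul_le_mul_of_nonneg_right h₁ (abs_nonneg _)
      _ ≤ _ := by
          rw [one_mul]
          exact (Complex.abs_re_le_norm _).trans (norm_inner_le_norm _ _)
  have h5 : ∀ θ θ', ∑ x, ∑ x', |(inner ℂ (m θ x) (m θ' x')).re| ≤ W := by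
    intro θ θ'
    refine le_trans (Finset.sum_le_sum fun x _ => Finset.sum_le_sum fun x' _ => h4 θ x θ' x') ?_
    rw [← Fintype.sum_prod_type']
    refine sum_mul_le_of_sum_sq_le _ _ _ ?_ ?_
    · rw [Fintype.sum_prod_type' fun x x' => ‖C θ' x' (C θ x (w θ x))‖ ^ 2]
      exact hle C pC θ θ'
    · rw [Fintype.sum_prod_type' fun x x' => ‖B θ x (B θ' x' (w θ' x'))‖ ^ 2, Finset.sum_comm]
      exact hle B pB θ' θ
  -- Here the overlaps enter, as the coefficients of the inner products of `m θ x` and `m θ' x'` in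
  -- the squared norm. Their bound `κ` does not depend on `x` and `x'`, so it can be taken out
  -- before `h5` is applied.
  have h3 : ∑ z, ‖Ψ z‖ ^ 2 ≤ W * ∑ θ, ∑ θ', κ θ θ' := by
    have h : ∀ v : H, (‖v‖ ^ 2 : ℝ) = (inner ℂ v v).re := fun v => by
      rw [inner_self_eq_norm_sq_to_K]; norm_cast
    have e : ∑ z, ‖Ψ z‖ ^ 2 = ∑ θ, ∑ θ', ∑ x, ∑ x', (∑ z, φ θ x z * φ θ' x' z) *
        (inner ℂ (m θ x) (m θ' x')).re := by
      have : ∀ z, ‖Ψ z‖ ^ 2 = ∑ θ, ∑ θ', ∑ x, ∑ x', (φ θ x z * φ θ' x' z) *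
          (inner ℂ (m θ x) (m θ' x')).re := by
        intro z
        rw [h]
        have hv : Ψ z = ∑ θ, ∑ x, (φ θ x z : ℂ) • m θ x := rfl
        nth_rewrite 1 [hv]
        rw [sum_inner, Complex.re_sum]
        refine Finset.sum_congr rfl fun θ _ => ?_
        rw [sum_inner, Complex.re_sum, Finset.sum_comm]
        refine Finset.sum_congr rfl fun x _ => ?_
        rw [inner_smul_left, Complex.conj_ofReal, Complex.re_ofReal_mul, hv, inner_sum,
          Complex.re_sum, Finset.mul_sum]
        refine Finset.sum_congr rfl fun θ' _ => ?_
        rw [inner_sum, Complex.re_sum, Finset.mul_sum]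
        refine Finset.sum_congr rfl fun x' _ => ?_
        rw [inner_smul_right, Complex.re_ofReal_mul, mul_assoc]
      simp only [this]
      rw [Finset.sum_comm]
      refine Finset.sum_congr rfl fun θ _ => ?_
      rw [Finset.sum_comm]
      refine Finset.sum_congr rfl fun θ' _ => ?_
      rw [Finset.sum_comm]
      refine Finset.sum_congr rfl fun x _ => ?_
      rw [Finset.sum_comm]
      simp only [Finset.sum_mul]
    rw [e, Finset.mul_sum]
    refine Finset.sum_le_sum fun θ _ => ?_
    rw [Finset.mul_sum]
    refine Finset.sum_le_sum fun θ' _ => ?_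
    rw [mul_comm]
    refine le_trans ?_ (mul_le_mul_of_nonneg_left (h5 θ θ') (hκ' θ θ'))
    rw [Finset.mul_sum]
    refine Finset.sum_le_sum fun x _ => ?_
    rw [Finset.mul_sum]
    refine Finset.sum_le_sum fun x' _ => ?_
    refine (le_abs_self _).trans ?_
    rw [abs_mul]
    exact mul_le_mul_of_nonneg_right (hκ θ θ' x x') (abs_nonneg _)
  rw [h1]
  refine h2.trans ?_
  calc _ ≤ Real.sqrt W * Real.sqrt (W * ∑ θ, ∑ θ', κ θ θ') :=
        mul_le_mul_of_nonneg_left (Real.sqrt_le_sqrt h3) (Real.sqrt_nonneg _)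
    _ = W * Real.sqrt (∑ θ, ∑ θ', κ θ θ') := by
        rw [Real.sqrt_mul hW0, ← mul_assoc, Real.mul_self_sqrt hW0]

end Monogamy

/-! ### Characters and overlaps -/

/-- The sign of a bit. -/
def sgn (b : Bool) : ℝ := if b then -1 else 1

theorem sgn_xor (a b : Bool) : sgn (xor a b) = sgn a * sgn b := by
  cases a <;> cases b <;> simp [sgn]

theorem sgn_dot {n : ℕ} (x y : Bits n) : sgn (dot x y) = ∏ i, sgn (x i && y i) := by
  induction n with
  | zero => simp [dot_zero, sgn]
  | succ n ih => rw [dot_cons, sgn_xor, ih, Fin.prod_univ_succ]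

/-- Orthogonality of characters: the sum is a product over the bits, and a bit at which `y` and `y'`
differ gives the factor zero. -/
theorem sum_sgn_dot_mul {n : ℕ} (y y' : Bits n) :
    ∑ x : Bits n, sgn (dot x y) * sgn (dot x y') = if y = y' then 2 ^ n else 0 := by
  simp only [sgn_dot, ← Finset.prod_mul_distrib]
  rw [← Fintype.prod_sum fun (i : Fin n) (b : Bool) => sgn (b && y i) * sgn (b && y' i)]
  have h : ∀ a b : Bool, ∑ c : Bool, sgn (c && a) * sgn (c && b) = if a = b then 2 else 0 := by
    intro a b
    cases a <;> cases b <;> simp [sgn]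
    all_goals norm_num
  simp only [h]
  split_ifs with hy
  · subst hy; simp
  · obtain ⟨i, hi⟩ := Function.ne_iff.1 hy
    exact Finset.prod_eq_zero (Finset.mem_univ i) (if_neg hi)

/-- The real amplitude of a Wiesner state. -/
def wiesnerAmpReal (x θ z : Bool) : ℝ :=
  if θ then (if x && z then -1 else 1) * (Real.sqrt 2)⁻¹ else if z = x then 1 else 0

theorem wiesnerAmp_eq (x θ z : Bool) : wiesnerAmp x θ z = (wiesnerAmpReal x θ z : ℂ) := by
  unfold wiesnerAmp wiesnerAmpReal
  split_ifs <;> simp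

/-- The real amplitudes of a Wiesner state. -/
def wiesnerReal {n : ℕ} (x θ z : Bits n) : ℝ := ∏ i, wiesnerAmpReal (x i) (θ i) (z i)

theorem wiesnerVec_eq {n : ℕ} (x θ z : Bits n) : wiesnerVec x θ z = (wiesnerReal x θ z : ℂ) := by
  simp [wiesnerVec, wiesnerReal, wiesnerAmp_eq]

theorem inv_sqrt_two_mul_self_real : (Real.sqrt 2)⁻¹ * (Real.sqrt 2)⁻¹ = 1 / 2 := by
  rw [← mul_inv, Real.mul_self_sqrt (by norm_num)]
  norm_num

theorem sum_wiesnerReal_mul {n : ℕ} (θ z z' : Bits n) :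
    ∑ x, wiesnerReal x θ z * wiesnerReal x θ z' = if z = z' then 1 else 0 := by
  simp only [wiesnerReal, ← Finset.prod_mul_distrib]
  rw [← Fintype.prod_sum fun (i : Fin n) (b : Bool) =>
    wiesnerAmpReal b (θ i) (z i) * wiesnerAmpReal b (θ i) (z' i)]
  have hs := inv_sqrt_two_mul_self_real
  have h : ∀ a b c : Bool, ∑ d : Bool, wiesnerAmpReal d a b * wiesnerAmpReal d a c =
      if b = c then 1 else 0 := by
    intro a b c
    cases a <;> cases b <;> cases c <;> simp [wiesnerAmpReal, hs]
    all_goals norm_num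
  simp only [h]
  split_ifs with hz
  · subst hz; simp
  · obtain ⟨i, hi⟩ := Function.ne_iff.1 hz
    exact Finset.prod_eq_zero (Finset.mem_univ i) (if_neg hi)

/-- The largest overlap of Wiesner states for two bases. -/
def overlap {n : ℕ} (θ θ' : Bits n) : ℝ := ∏ i, if θ i = θ' i then 1 else (Real.sqrt 2)⁻¹

theorem overlap_nonneg {n : ℕ} (θ θ' : Bits n) : 0 ≤ overlap θ θ' := by
  refine Finset.prod_nonneg fun i _ => ?_
  split_ifs <;> positivity

/-- The inner product factors over the qubits. Vectors of the same basis have overlap at most one,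
and vectors of different bases have overlap exactly `1 / √2`, the two bases being mutually unbiased.
-/
theorem abs_sum_wiesnerReal_mul_le {n : ℕ} (θ θ' x x' : Bits n) :
    |∑ z, wiesnerReal x θ z * wiesnerReal x' θ' z| ≤ overlap θ θ' := by
  simp only [wiesnerReal, ← Finset.prod_mul_distrib]
  rw [← Fintype.prod_sum fun (i : Fin n) (b : Bool) =>
    wiesnerAmpReal (x i) (θ i) b * wiesnerAmpReal (x' i) (θ' i) b, Finset.abs_prod]
  refine Finset.prod_le_prod (fun i _ => abs_nonneg _) fun i _ => ?_
  have hs := inv_sqrt_two_mul_self_real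
  generalize x i = a, x' i = b, θ i = c, θ' i = d
  have h0 : (0 : ℝ) ≤ (Real.sqrt 2)⁻¹ := by positivity
  cases a <;> cases b <;> cases c <;> cases d <;> simp [wiesnerAmpReal, hs, abs_of_nonneg h0]
  all_goals norm_num

theorem sum_overlap (n : ℕ) :
    ∑ θ : Bits n, ∑ θ', overlap θ θ' = (2 * (1 + (Real.sqrt 2)⁻¹)) ^ n := by
  have : ∀ θ : Bits n, ∑ θ', overlap θ θ' = (1 + (Real.sqrt 2)⁻¹) ^ n := by
    intro θ
    unfold overlap
    rw [← Fintype.prod_sum fun (i : Fin n) (b : Bool) => if θ i = b then 1 else (Real.sqrt 2)⁻¹]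
    have h : ∀ a : Bool, ∑ b : Bool, (if a = b then (1 : ℝ) else (Real.sqrt 2)⁻¹) =
        1 + (Real.sqrt 2)⁻¹ := by
      intro a; cases a <;> simp [add_comm]
    simp only [h]
    simp
  simp only [this]
  simp [mul_pow]

end

noncomputable section

open Function (update)

/-! ### The outputs of two separated parties -/

/-- The joint distribution of the outputs of `Φ` and `Ψ`, on the classical inputs `zB` and `zC` and
the two halves of the state `σ`. -/
def jointProb {n b c : ℕ} (Φ : Op (n + b) →ₗ[ℂ] Op 1) (Ψ : Op (c + n) →ₗ[ℂ] Op 1) (zB zC : Bits n)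
    (σ : Op (b + c)) (o o' : Bool) : ℂ :=
  ∑ i : Bits b, ∑ j : Bits c, ∑ k : Bits b, ∑ l : Bits c, σ (Fin.append i j) (Fin.append k l) *
    (Φ (Matrix.single (Fin.append zB i) (Fin.append zB k) 1) (fun _ => o) (fun _ => o) *
      Ψ (Matrix.single (Fin.append j zC) (Fin.append l zC) 1) (fun _ => o') (fun _ => o'))

/-- The cast regroups the wires without permuting them: `B` receives its challenge in front of its
share, `C` behind it. -/
theorem castOp_tensorOp_apply {n b c : ℕ} (h : n + (b + c) + n = (n + b) + (c + n))
    (zB zC : Bits n) (σ : Op (b + c)) (i₀ k₀ j₀ l₀ : Bits n) (i k : Bits b) (j l : Bits c) :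
    castOp h (tensorOp (tensorOp (proj zB) σ) (proj zC))
      (Fin.append (Fin.append i₀ i) (Fin.append j j₀))
      (Fin.append (Fin.append k₀ k) (Fin.append l l₀)) =
      (if zB = i₀ ∧ zB = k₀ then 1 else 0) * σ (Fin.append i j) (Fin.append k l) *
        (if zC = j₀ ∧ zC = l₀ then 1 else 0) := by
  have h₁ : ∀ (i₀ j₀ : Bits n) (i : Bits b) (j : Bits c), (fun t : Fin n =>
      Fin.append (Fin.append i₀ i) (Fin.append j j₀)
        (Fin.cast h (Fin.castAdd n (Fin.castAdd (b + c) t)))) = i₀ := by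
    intro i₀ j₀ i j
    funext t
    have : Fin.cast h (Fin.castAdd n (Fin.castAdd (b + c) t)) =
        Fin.castAdd (c + n) (Fin.castAdd b t) := Fin.ext rfl
    rw [this, Fin.append_left, Fin.append_left]
  have h₂ : ∀ (i₀ j₀ : Bits n) (i : Bits b) (j : Bits c), (fun t : Fin (b + c) =>
      Fin.append (Fin.append i₀ i) (Fin.append j j₀)
        (Fin.cast h (Fin.castAdd n (Fin.natAdd n t)))) = Fin.append i j := by
    intro i₀ j₀ i j
    funext t
    refine Fin.addCases (fun u => ?_) (fun u => ?_) t
    · have : Fin.cast h (Fin.castAdd n (Fin.natAdd n (Fin.castAdd c u))) =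
        Fin.castAdd (c + n) (Fin.natAdd n u) := Fin.ext rfl
      rw [this, Fin.append_left, Fin.append_right, Fin.append_left]
    · have : Fin.cast h (Fin.castAdd n (Fin.natAdd n (Fin.natAdd b u))) =
        Fin.natAdd (n + b) (Fin.castAdd n u) := Fin.ext (by simp; omega)
      rw [this, Fin.append_right, Fin.append_left, Fin.append_right]
  have h₃ : ∀ (i₀ j₀ : Bits n) (i : Bits b) (j : Bits c), (fun t : Fin n =>
      Fin.append (Fin.append i₀ i) (Fin.append j j₀)
        (Fin.cast h (Fin.natAdd (n + (b + c)) t))) = j₀ := by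
    intro i₀ j₀ i j
    funext t
    have : Fin.cast h (Fin.natAdd (n + (b + c)) t) =
        Fin.natAdd (n + b) (Fin.natAdd c t) := Fin.ext (by simp; omega)
    rw [this, Fin.append_right, Fin.append_right]
  simp only [castOp, tensorOp, Matrix.of_apply, proj, Matrix.single, h₁, h₂, h₃]

/-- The four sums over challenge registers collapse to the given classical values; the sums over the
shares remain. -/
theorem tensorMap_apply_append {n b c : ℕ} (h : n + (b + c) + n = (n + b) + (c + n))
    (Φ : Op (n + b) →ₗ[ℂ] Op 1) (Ψ : Op (c + n) →ₗ[ℂ] Op 1) (zB zC : Bits n)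
    (σ : Op (b + c)) (o o' : Bool) :
    tensorMap Φ Ψ (castOp h (tensorOp (tensorOp (proj zB) σ) (proj zC)))
      (Fin.append (fun _ => o) fun _ => o') (Fin.append (fun _ => o) fun _ => o') =
      jointProb Φ Ψ zB zC σ o o' := by
  simp only [tensorMap, Matrix.sum_apply, Matrix.smul_apply, smul_eq_mul, tensorOp,
    Matrix.of_apply, Fin.append_left, Fin.append_right]
  change ∑ i, ∑ j, ∑ k, ∑ l, castOp h (tensorOp (tensorOp (proj zB) σ) (proj zC)) (Fin.append i j)
    (Fin.append k l) * (Φ (Matrix.single i k 1) (fun _ => o) (fun _ => o) *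
    Ψ (Matrix.single j l 1) (fun _ => o') (fun _ => o')) = _
  rw [jointProb, sum_bits_append, Finset.sum_eq_single zB]
  rotate_left
  · intro i₀ _ hi
    refine Finset.sum_eq_zero fun i _ => Finset.sum_eq_zero fun J _ => Finset.sum_eq_zero fun K _ =>
      Finset.sum_eq_zero fun L _ => ?_
    obtain ⟨⟨j, j₀⟩, rfl⟩ := (Fin.appendEquiv c n).surjective J
    obtain ⟨⟨k₀, k⟩, rfl⟩ := (Fin.appendEquiv n b).surjective K
    obtain ⟨⟨l, l₀⟩, rfl⟩ := (Fin.appendEquiv c n).surjective L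
    simp only [Fin.appendEquiv, Equiv.coe_fn_mk]
    rw [castOp_tensorOp_apply, if_neg (by rintro ⟨h, -⟩; exact hi h.symm)]
    simp
  · simp
  refine Finset.sum_congr rfl fun i _ => ?_
  rw [sum_bits_append]
  refine Finset.sum_congr rfl fun j _ => ?_
  rw [Finset.sum_eq_single zC]
  rotate_left
  · intro j₀ _ hj
    refine Finset.sum_eq_zero fun K _ => Finset.sum_eq_zero fun L _ => ?_
    obtain ⟨⟨k₀, k⟩, rfl⟩ := (Fin.appendEquiv n b).surjective K
    obtain ⟨⟨l, l₀⟩, rfl⟩ := (Fin.appendEquiv c n).surjective L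
    simp only [Fin.appendEquiv, Equiv.coe_fn_mk]
    rw [castOp_tensorOp_apply, if_neg (c := zC = j₀ ∧ _) (by rintro ⟨h, -⟩; exact hj h.symm)]
    simp
  · simp
  rw [sum_bits_append, Finset.sum_eq_single zB]
  rotate_left
  · intro k₀ _ hk
    refine Finset.sum_eq_zero fun k _ => Finset.sum_eq_zero fun L _ => ?_
    obtain ⟨⟨l, l₀⟩, rfl⟩ := (Fin.appendEquiv c n).surjective L
    simp only [Fin.appendEquiv, Equiv.coe_fn_mk]
    rw [castOp_tensorOp_apply, if_neg (by rintro ⟨-, h⟩; exact hk h.symm)]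
    simp
  · simp
  refine Finset.sum_congr rfl fun k _ => ?_
  rw [sum_bits_append]
  refine Finset.sum_congr rfl fun l _ => ?_
  rw [Finset.sum_eq_single zC]
  · rw [castOp_tensorOp_apply]
    simp
  · intro l₀ _ hl
    rw [castOp_tensorOp_apply, if_neg (c := zC = zC ∧ _) (by rintro ⟨-, h⟩; exact hl h.symm)]
    simp
  · simp

/-! ### Observables -/

section Euclidean

variable {m : Type*} [Fintype m] [DecidableEq m]

/-- The operator of a matrix on the Euclidean space. -/
abbrev matOp (M : Matrix m m ℂ) : EuclideanSpace ℂ m →ₗ[ℂ] EuclideanSpace ℂ m :=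
  Matrix.toEuclideanLin M

theorem inner_matOp (M : Matrix m m ℂ) (u v : EuclideanSpace ℂ m) :
    inner ℂ u (matOp M v) = ∑ i, ∑ j, star (u i) * M i j * v j := by
  simp only [PiLp.inner_apply, RCLike.inner_apply]
  refine Finset.sum_congr rfl fun i _ => ?_
  simp [Matrix.mulVec, dotProduct, Finset.sum_mul]
  exact Finset.sum_congr rfl fun j _ => by ring

theorem matOp_mul (M N : Matrix m m ℂ) (v : EuclideanSpace ℂ m) :
    matOp (M * N) v = matOp M (matOp N v) := by
  ext i
  simp [matOp]

theorem matOp_isSymmetric {M : Matrix m m ℂ} (hM : M.IsHermitian) : (matOp M).IsSymmetric :=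
  Matrix.isSymmetric_toEuclideanLin_iff.2 hM

theorem inner_matOp_nonneg {M : Matrix m m ℂ} (hM : M.PosSemidef) (v : EuclideanSpace ℂ m) :
    0 ≤ inner ℂ v (matOp M v) := by
  have e : inner ℂ v (matOp M v) = star (v : m → ℂ) ⬝ᵥ (M.mulVec v) := by
    rw [inner_matOp]
    simp [dotProduct, Matrix.mulVec, Finset.mul_sum, mul_assoc]
  rw [e]
  exact hM.dotProduct_mulVec_nonneg _

theorem norm_matOp_sq_le {M : Matrix m m ℂ} (hM : (1 - M.conjTranspose * M).PosSemidef)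
    (v : EuclideanSpace ℂ m) : ‖matOp M v‖ ^ 2 ≤ ‖v‖ ^ 2 := by
  have h := (Complex.le_def.1 (inner_matOp_nonneg hM v)).1
  have h1 : matOp (1 - M.conjTranspose * M) v = v - matOp (M.conjTranspose * M) v := by
    simp [matOp]
  have h2 : inner ℂ v (matOp (M.conjTranspose * M) v) = inner ℂ (matOp M v) (matOp M v) := by
    rw [matOp_mul, matOp, Matrix.toEuclideanLin_conjTranspose_eq_adjoint,
      LinearMap.adjoint_inner_right]
  have h3 : ∀ v : EuclideanSpace ℂ m, (‖v‖ ^ 2 : ℝ) = (inner ℂ v v).re := fun v => by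
    rw [inner_self_eq_norm_sq_to_K]; norm_cast
  rw [h1, inner_sub_right, h2, Complex.zero_re, Complex.sub_re, ← h3, ← h3] at h
  linarith

/-- The difference of two complementary effects is a contraction. -/
theorem posSemidef_one_sub_sq {P Q : Matrix m m ℂ} (hP : P.PosSemidef) (hQ : Q.PosSemidef)
    (h : P + Q = 1) : (1 - (P - Q).conjTranspose * (P - Q)).PosSemidef := by
  obtain rfl : Q = 1 - P := eq_sub_of_add_eq' h
  -- The left side is `1 - (2P - 1)² = 4P(1 - P)`. The right side writes this as a sum of two
  -- visibly positive terms, using `P(1 - P) = P(1 - P)P + (1 - P)P(1 - P)`.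
  have e : 1 - (P - (1 - P)).conjTranspose * (P - (1 - P)) =
      (4 : ℕ) • (P.conjTranspose * (1 - P) * P + (1 - P).conjTranspose * P * (1 - P)) := by
    rw [Matrix.conjTranspose_sub, hP.1.eq, hQ.1.eq]
    noncomm_ring
  rw [e]
  exact Matrix.PosSemidef.smul ((hQ.conjTranspose_mul_mul_same P).add
    (hP.conjTranspose_mul_mul_same (1 - P))) (Nat.zero_le 4)

end Euclidean

/-- Parseval's identity for the characters of `{0,1}^n`. Half of the normalization, `r = 2 ^ (-n /
2)`, makes them orthonormal; the other half is absorbed into the vectors. -/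
theorem sum_norm_sq_character {n : ℕ} {H : Type*} [NormedAddCommGroup H] [InnerProductSpace ℂ H]
    (u : Bits n → H) :
    ∑ x : Bits n, ‖∑ y : Bits n, (((2 ^ n)⁻¹ * sgn (dot x y) : ℝ) : ℂ) • u y‖ ^ 2 =
      (2 ^ n)⁻¹ * ∑ y, ‖u y‖ ^ 2 := by
  set r : ℝ := (Real.sqrt (2 ^ n))⁻¹ with hr
  have hrr : r * r = (2 ^ n)⁻¹ := by
    rw [hr, ← mul_inv, Real.mul_self_sqrt (by positivity)]
  have h := sum_norm_sq_rotate (fun y => (r : ℂ) • u y) (fun x y => r * sgn (dot x y))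
    (fun y y' => by
      have : ∀ x, r * sgn (dot x y) * (r * sgn (dot x y')) =
          (2 ^ n)⁻¹ * (sgn (dot x y) * sgn (dot x y')) := by
        intro x; rw [← hrr]; ring
      simp only [this]
      rw [← Finset.mul_sum, sum_sgn_dot_mul]
      split_ifs
      · rw [inv_mul_cancel₀ (by positivity)]
      · rw [mul_zero])
  have h1 : ∀ x y, (((r * sgn (dot x y) : ℝ) : ℂ) • (r : ℂ) • u y) =
      (((2 ^ n)⁻¹ * sgn (dot x y) : ℝ) : ℂ) • u y := by
    intro x y
    rw [smul_smul, ← Complex.ofReal_mul, ← hrr]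
    congr 2
    ring
  simp only [h1] at h
  rw [h, Finset.mul_sum]
  refine Finset.sum_congr rfl fun y _ => ?_
  rw [norm_smul, mul_pow, ← hrr, Complex.norm_real, Real.norm_eq_abs, sq_abs, pow_two]

/-! ### The game -/

section Game

variable {l b c : ℕ}

/-- The observable of a channel with one output qubit, for classical inputs. -/
theorem IsChannel.exists_observables {n b : ℕ} {Φ : Op n →ₗ[ℂ] Op 1} (hΦ : IsChannel Φ)
    {ι : Type*} (f : ι → Bits b → Bits n) (hf : ∀ z, (f z).Injective) :
    ∃ E : Bool → ι → Op b, (∀ o z, (E o z).PosSemidef) ∧ (∀ z, E false z + E true z = 1) ∧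
      ∀ o z i k, Φ (Matrix.single (f z i) (f z k) 1) (fun _ => o) (fun _ => o) = E o z k i := by
  obtain ⟨E, h₁, h₂, h₃⟩ := hΦ.exists_effect
  refine ⟨fun o z => (E fun _ => o).submatrix (f z) (f z), fun o z => (h₁ _).submatrix _,
    fun z => ?_, fun o z i k => h₃ _ _ _⟩
  rw [sum_bits_one, Fintype.sum_bool] at h₂
  ext i k
  have h := congrFun (congrFun h₂ (f z i)) (f z k)
  simp only [Matrix.add_apply, Matrix.one_apply, (hf z).eq_iff] at h
  simpa [Matrix.one_apply, add_comm] using h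

/-- The operator `|x^θ⟩⟨x^θ|`. -/
def wiesnerOp (x θ : Bits l) : Op l :=
  Matrix.vecMulVec (wiesnerVec x θ) (star (wiesnerVec x θ))

/-- The joint distribution of the outputs on the Wiesner state `|x^θ⟩`, split by `Γ`. -/
def gameProb (Γ : Op l →ₗ[ℂ] Op (b + c)) (Φ : Op (l + l + b) →ₗ[ℂ] Op 1)
    (Ψ : Op (c + (l + l)) →ₗ[ℂ] Op 1) (x θ y y' : Bits l) (o₁ o₂ : Bool) : ℂ :=
  jointProb Φ Ψ (Fin.append θ y) (Fin.append θ y') (Γ (wiesnerOp x θ)) o₁ o₂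

/-- The advantage of the two parties, on the Wiesner state `|x^θ⟩`. -/
def gameBias (Γ : Op l →ₗ[ℂ] Op (b + c)) (Φ : Op (l + l + b) →ₗ[ℂ] Op 1)
    (Ψ : Op (c + (l + l)) →ₗ[ℂ] Op 1) (x θ : Bits l) : ℝ :=
  ∑ y, ∑ y', ((2 ^ l)⁻¹ * sgn (dot x y)) * ((2 ^ l)⁻¹ * sgn (dot x y')) *
    ∑ o, ∑ o', sgn o * sgn o' * (gameProb Γ Φ Ψ x θ y y' o o').re

variable {Γ : Op l →ₗ[ℂ] Op (b + c)} {Φ : Op (l + l + b) →ₗ[ℂ] Op 1}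
  {Ψ : Op (c + (l + l)) →ₗ[ℂ] Op 1}

/-- The joint distribution in terms of vectors. -/
theorem exists_gameProb_eq (hΓ : IsChannel Γ) (hΦ : IsChannel Φ) (hΨ : IsChannel Ψ) :
    ∃ (ι : Type) (_ : Fintype ι) (Ω : ι → Bits l → EuclideanSpace ℂ (Bits b × Bits c))
      (E : Bool → Bits (l + l) → Op b) (F : Bool → Bits (l + l) → Op c),
      (∑ κ, ∑ z, ‖Ω κ z‖ ^ 2 = 2 ^ l) ∧
      (∀ x θ, ∑ κ, ‖∑ z, (wiesnerReal x θ z : ℂ) • Ω κ z‖ ^ 2 = 1) ∧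
      (∀ o z, (E o z).PosSemidef) ∧ (∀ z, E false z + E true z = 1) ∧
      (∀ o z, (F o z).PosSemidef) ∧ (∀ z, F false z + F true z = 1) ∧
      ∀ x θ y y' o o', gameProb Γ Φ Ψ x θ y y' o o' =
        ∑ κ, inner ℂ (∑ z, (wiesnerReal x θ z : ℂ) • Ω κ z)
          (matOp (Matrix.kronecker (E o (Fin.append θ y)) (F o' (Fin.append θ y')))
            (∑ z, (wiesnerReal x θ z : ℂ) • Ω κ z)) := by
  obtain ⟨ι, _, K, hK, hK'⟩ := hΓ
  obtain ⟨E, hE, hE1, hE2⟩ := hΦ.exists_observables (fun z (i : Bits b) => Fin.append z i) (by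
    intro z i k h
    funext t
    simpa using congrFun h (Fin.natAdd _ t))
  obtain ⟨F, hF, hF1, hF2⟩ := hΨ.exists_observables (fun z (i : Bits c) => Fin.append i z) (by
    intro z i k h
    funext t
    simpa using congrFun h (Fin.castAdd _ t))
  -- The vector `Ω κ z` is the Kraus operator applied to `|z⟩`, so the combination with Wiesner
  -- amplitudes is that operator applied to `|x^θ⟩`. One family `Ω` serves all bases, as
  -- `monogamy_bound` requires.
  set Ω : ι → Bits l → EuclideanSpace ℂ (Bits b × Bits c) := fun κ z =>
    WithLp.toLp 2 fun p => K κ (Fin.append p.1 p.2) z with hΩ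
  have hΩapp : ∀ κ x θ p, (∑ z, (wiesnerReal x θ z : ℂ) • Ω κ z : EuclideanSpace ℂ _) p =
      (K κ).mulVec (wiesnerVec x θ) (Fin.append p.1 p.2) := by
    intro κ x θ p
    simp [hΩ, Matrix.mulVec, dotProduct, wiesnerVec_eq, mul_comm]
  have hnorm : ∀ v : EuclideanSpace ℂ (Bits b × Bits c), ∀ u : Bits (b + c) → ℂ,
      (∀ p, v p = u (Fin.append p.1 p.2)) → (‖v‖ ^ 2 : ℂ) = star u ⬝ᵥ u := by
    intro v u h
    have : ‖v‖ ^ 2 = ∑ p, ‖v p‖ ^ 2 := EuclideanSpace.norm_sq_eq v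
    rw [← Complex.ofReal_pow, this, Fintype.sum_prod_type, dotProduct, sum_bits_append,
      Complex.ofReal_sum]
    refine Finset.sum_congr rfl fun i _ => ?_
    rw [Complex.ofReal_sum]
    refine Finset.sum_congr rfl fun j _ => ?_
    rw [h, Pi.star_apply, Complex.star_def, Complex.conj_mul', Complex.ofReal_pow]
  have hvec : ∀ u : Bits l → ℂ, ∑ κ, star ((K κ).mulVec u) ⬝ᵥ (K κ).mulVec u = star u ⬝ᵥ u := by
    intro u
    have : ∀ κ, star ((K κ).mulVec u) ⬝ᵥ (K κ).mulVec u =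
        star u ⬝ᵥ ((K κ).conjTranspose * K κ).mulVec u := by
      intro κ
      rw [Matrix.star_mulVec, Matrix.dotProduct_mulVec, Matrix.vecMul_vecMul,
        ← Matrix.dotProduct_mulVec]
    simp only [this]
    rw [← dotProduct_sum, ← Matrix.sum_mulVec, hK', Matrix.one_mulVec]
  refine ⟨ι, inferInstance, Ω, E, F, ?_, ?_, hE, hE1, hF, hF1, ?_⟩
  · rw [Finset.sum_comm]
    have : ∀ z, ∑ κ, ‖Ω κ z‖ ^ 2 = 1 := by
      intro z
      have h := hvec (Pi.single z 1)
      simp only [Matrix.mulVec_single_one] at h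
      have h' : (((∑ κ, ‖Ω κ z‖ ^ 2 : ℝ)) : ℂ) = ((1 : ℝ) : ℂ) := by
        rw [Complex.ofReal_sum]
        simp only [Complex.ofReal_pow]
        rw [Finset.sum_congr rfl fun κ _ => hnorm (Ω κ z) ((K κ).col z) fun p => rfl, h]
        simp
      exact Complex.ofReal_injective h'
    simp [this]
  · intro x θ
    have h : (((∑ κ, ‖∑ z, (wiesnerReal x θ z : ℂ) • Ω κ z‖ ^ 2 : ℝ)) : ℂ) = ((1 : ℝ) : ℂ) := by
      rw [Complex.ofReal_sum]
      simp only [Complex.ofReal_pow]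
      rw [Finset.sum_congr rfl fun κ _ => hnorm _ _ (hΩapp κ x θ), hvec, dotProduct_comm]
      have : ∑ z, wiesnerVec x θ z * star (wiesnerVec x θ z) = 1 := (wiesner x θ).trace_eq_one
      simpa [dotProduct] using this
    exact Complex.ofReal_injective h
  · intro x θ y y' o o'
    have hσ : ∀ p q, Γ (wiesnerOp x θ) p q = ∑ κ, (K κ).mulVec (wiesnerVec x θ) p *
        star ((K κ).mulVec (wiesnerVec x θ) q) := by
      intro p q
      rw [hK, Matrix.sum_apply]
      refine Finset.sum_congr rfl fun κ _ => ?_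
      have : K κ * wiesnerOp x θ * (K κ).conjTranspose =
          Matrix.vecMulVec ((K κ).mulVec (wiesnerVec x θ))
            (star ((K κ).mulVec (wiesnerVec x θ))) := by
        rw [Matrix.star_mulVec, ← Matrix.vecMulVec_mul, ← Matrix.mul_vecMulVec]
        rfl
      rw [this, Matrix.vecMulVec_apply, Pi.star_apply]
    have hin : ∀ κ, inner ℂ (∑ z, (wiesnerReal x θ z : ℂ) • Ω κ z)
        (matOp (Matrix.kronecker (E o (Fin.append θ y)) (F o' (Fin.append θ y')))
          (∑ z, (wiesnerReal x θ z : ℂ) • Ω κ z)) = ∑ p : Bits b × Bits c, ∑ q : Bits b × Bits c,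
        ((K κ).mulVec (wiesnerVec x θ) (Fin.append q.1 q.2) *
          star ((K κ).mulVec (wiesnerVec x θ) (Fin.append p.1 p.2))) *
          (E o (Fin.append θ y) p.1 q.1 * F o' (Fin.append θ y') p.2 q.2) := by
      intro κ
      rw [inner_matOp]
      refine Finset.sum_congr rfl fun p _ => Finset.sum_congr rfl fun q _ => ?_
      rw [hΩapp, hΩapp, Matrix.kronecker, Matrix.kroneckerMap_apply]
      ring
    simp only [hin, gameProb, jointProb, hE2, hF2, hσ]
    symm
    rw [Finset.sum_comm, Finset.sum_congr rfl fun p _ => Finset.sum_comm, Finset.sum_comm,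
      Fintype.sum_prod_type]
    refine Finset.sum_congr rfl fun i _ => Finset.sum_congr rfl fun j _ => ?_
    rw [Fintype.sum_prod_type]
    refine Finset.sum_congr rfl fun k _ => Finset.sum_congr rfl fun l _ => ?_
    rw [Finset.sum_mul]

theorem gameProb_nonneg (hΓ : IsChannel Γ) (hΦ : IsChannel Φ) (hΨ : IsChannel Ψ)
    (x θ y y' : Bits l) (o o' : Bool) : 0 ≤ gameProb Γ Φ Ψ x θ y y' o o' := by
  obtain ⟨ι, _, Ω, E, F, -, -, hE, -, hF, -, h⟩ := exists_gameProb_eq hΓ hΦ hΨ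
  rw [h]
  exact Finset.sum_nonneg fun κ _ => inner_matOp_nonneg ((hE _ _).kronecker (hF _ _)) _

theorem sum_gameProb (hΓ : IsChannel Γ) (hΦ : IsChannel Φ) (hΨ : IsChannel Ψ)
    (x θ y y' : Bits l) : ∑ o, ∑ o', gameProb Γ Φ Ψ x θ y y' o o' = 1 := by
  obtain ⟨ι, _, Ω, E, F, -, h1, -, hE, -, hF, h⟩ := exists_gameProb_eq hΓ hΦ hΨ
  have e : ∀ o o', gameProb Γ Φ Ψ x θ y y' o o' = ∑ κ,
    inner ℂ (∑ z, (wiesnerReal x θ z : ℂ) • Ω κ z)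
      (matOp (Matrix.kronecker (E o (Fin.append θ y)) (F o' (Fin.append θ y')))
        (∑ z, (wiesnerReal x θ z : ℂ) • Ω κ z)) := h x θ y y'
  have hs : Matrix.kronecker (E true (Fin.append θ y)) (F true (Fin.append θ y')) +
      Matrix.kronecker (E true (Fin.append θ y)) (F false (Fin.append θ y')) +
      (Matrix.kronecker (E false (Fin.append θ y)) (F true (Fin.append θ y')) +
      Matrix.kronecker (E false (Fin.append θ y)) (F false (Fin.append θ y'))) = 1 := by
    unfold Matrix.kronecker
    rw [← Matrix.kroneckerMap_add_right _ mul_add, ← Matrix.kroneckerMap_add_right _ mul_add,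
      ← Matrix.kroneckerMap_add_left _ add_mul, add_comm (F true _), hF, add_comm (E true _), hE]
    exact Matrix.one_kronecker_one
  have hone : ∀ v : EuclideanSpace ℂ (Bits b × Bits c), matOp 1 v = v := by
    intro v; simp [matOp]
  simp only [Fintype.sum_bool, e, ← Finset.sum_add_distrib, ← inner_add_right,
    ← LinearMap.add_apply, ← map_add, hs, hone]
  have h2 := congrArg (fun r : ℝ => (r : ℂ)) (h1 x θ)
  simp only [Complex.ofReal_sum] at h2
  rw [Complex.ofReal_one] at h2
  rw [← h2]
  refine Finset.sum_congr rfl fun κ _ => ?_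
  rw [inner_self_eq_norm_sq_to_K]
  norm_cast

/-- For each Kraus index of the splitting channel the bias at `(x, θ)` is `⟨w, B C w⟩`, where `B`
and `C` are the Fourier coefficients at `x` of the observables for basis `θ`. Hence `monogamy_bound`
applies; the squared norms of all `Ω κ z` sum to `2 ^ l`, and the overlaps to `(2 * (1 + 1 / √2)) ^
l`. -/
theorem sum_abs_gameBias_le (hΓ : IsChannel Γ) (hΦ : IsChannel Φ) (hΨ : IsChannel Ψ) :
    ∑ θ, ∑ x, |gameBias Γ Φ Ψ x θ| ≤
      2 ^ l * Real.sqrt ((2 * (1 + (Real.sqrt 2)⁻¹)) ^ l) := by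
  obtain ⟨ι, _, Ω, E, F, hΩ, -, hE, hE1, hF, hF1, h⟩ := exists_gameProb_eq hΓ hΦ hΨ
  -- Observables with value `1` for the answer `false` and `-1` for `true`. Those of the two parties
  -- act on different tensor factors and therefore commute.
  set B₁ : Bits (l + l) → Matrix (Bits b × Bits c) (Bits b × Bits c) ℂ := fun z =>
    Matrix.kronecker (E false z - E true z) 1 with hB₁
  set C₁ : Bits (l + l) → Matrix (Bits b × Bits c) (Bits b × Bits c) ℂ := fun z =>
    Matrix.kronecker 1 (F false z - F true z) with hC₁
  have hBh : ∀ z, (B₁ z).IsHermitian := fun z => by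
    rw [Matrix.IsHermitian, hB₁]
    simp only [Matrix.kronecker]
    rw [Matrix.conjTranspose_kronecker, Matrix.conjTranspose_sub, (hE _ _).1.eq, (hE _ _).1.eq,
      Matrix.conjTranspose_one]
  have hCh : ∀ z, (C₁ z).IsHermitian := fun z => by
    rw [Matrix.IsHermitian, hC₁]
    simp only [Matrix.kronecker]
    rw [Matrix.conjTranspose_kronecker, Matrix.conjTranspose_sub, (hF _ _).1.eq, (hF _ _).1.eq,
      Matrix.conjTranspose_one]
  have hBc : ∀ z, (1 - (B₁ z).conjTranspose * B₁ z).PosSemidef := fun z => by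
    have e : 1 - (B₁ z).conjTranspose * B₁ z = Matrix.kronecker
        (1 - (E false z - E true z).conjTranspose * (E false z - E true z)) (1 : Op c) := by
      simp only [hB₁, Matrix.kronecker]
      rw [Matrix.conjTranspose_kronecker, ← Matrix.mul_kronecker_mul, Matrix.conjTranspose_one,
        Matrix.one_mul, ← Matrix.one_kronecker_one, sub_eq_iff_eq_add,
        ← Matrix.kroneckerMap_add_left _ add_mul, sub_add_cancel]
    rw [e]
    exact (posSemidef_one_sub_sq (hE _ _) (hE _ _) (hE1 z)).kronecker Matrix.PosSemidef.one
  have hCc : ∀ z, (1 - (C₁ z).conjTranspose * C₁ z).PosSemidef := fun z => by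
    have e : 1 - (C₁ z).conjTranspose * C₁ z = Matrix.kronecker (1 : Op b)
        (1 - (F false z - F true z).conjTranspose * (F false z - F true z)) := by
      simp only [hC₁, Matrix.kronecker]
      rw [Matrix.conjTranspose_kronecker, ← Matrix.mul_kronecker_mul, Matrix.conjTranspose_one,
        Matrix.one_mul, ← Matrix.one_kronecker_one, sub_eq_iff_eq_add,
        ← Matrix.kroneckerMap_add_right _ mul_add, sub_add_cancel]
    rw [e]
    exact Matrix.PosSemidef.one.kronecker (posSemidef_one_sub_sq (hF _ _) (hF _ _) (hF1 z))
  have hprod : ∀ z z', B₁ z * C₁ z' =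
      Matrix.kronecker (E false z - E true z) (F false z' - F true z') := fun z z' => by
    simp only [hB₁, hC₁, Matrix.kronecker]
    rw [← Matrix.mul_kronecker_mul, Matrix.one_mul, Matrix.mul_one]
  have hcomm : ∀ z z', B₁ z * C₁ z' = C₁ z' * B₁ z := fun z z' => by
    rw [hprod]
    simp only [hB₁, hC₁, Matrix.kronecker]
    rw [← Matrix.mul_kronecker_mul, Matrix.one_mul, Matrix.mul_one]
  have hfour : ∀ M : Bits (l + l) → Matrix (Bits b × Bits c) (Bits b × Bits c) ℂ,
      ∀ (hh : ∀ z, (M z).IsHermitian) (θ x : Bits l), (∑ y, (((2 ^ l)⁻¹ * sgn (dot x y) : ℝ) : ℂ) •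
        matOp (M (Fin.append θ y))).IsSymmetric := by
    intro M hh θ x u v
    simp only [LinearMap.sum_apply, LinearMap.smul_apply, sum_inner, inner_sum, inner_smul_left,
      inner_smul_right, Complex.conj_ofReal]
    exact Finset.sum_congr rfl fun y _ => by rw [matOp_isSymmetric (hh _)]
  -- Parseval turns the sum over `x` into the mean of `‖M v‖ ^ 2` over the challenges, and every
  -- observable is a contraction.
  have hpars : ∀ M : Bits (l + l) → Matrix (Bits b × Bits c) (Bits b × Bits c) ℂ,
      ∀ (hh : ∀ z, (1 - (M z).conjTranspose * M z).PosSemidef) (θ : Bits l)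
        (v : EuclideanSpace ℂ (Bits b × Bits c)),
        ∑ x : Bits l, ‖(∑ y, (((2 ^ l)⁻¹ * sgn (dot x y) : ℝ) : ℂ) •
          matOp (M (Fin.append θ y))) v‖ ^ 2 ≤ ‖v‖ ^ 2 := by
    intro M hh θ v
    simp only [LinearMap.sum_apply, LinearMap.smul_apply]
    rw [sum_norm_sq_character fun y => matOp (M (Fin.append θ y)) v]
    calc _ ≤ (2 ^ l)⁻¹ * ∑ _y : Bits l, ‖v‖ ^ 2 :=
          mul_le_mul_of_nonneg_left (Finset.sum_le_sum fun y _ => norm_matOp_sq_le (hh _) v)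
            (by positivity)
      _ = ‖v‖ ^ 2 := by simp
  -- The weights admitted by `monogamy_bound` are used to produce absolute values.
  set s : Bits l → Bits l → ℝ := fun θ x => SignType.sign (gameBias Γ Φ Ψ x θ) with hs
  have key := fun κ => monogamy_bound (Ω κ) (fun (θ x z : Bits l) => wiesnerReal x θ z)
    (fun θ z z' => sum_wiesnerReal_mul θ z z') overlap
    (fun θ θ' x x' => abs_sum_wiesnerReal_mul_le θ θ' x x') overlap_nonneg
    (fun θ x => ∑ y, (((2 ^ l)⁻¹ * sgn (dot x y) : ℝ) : ℂ) • matOp (B₁ (Fin.append θ y)))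
    (fun θ x => ∑ y, (((2 ^ l)⁻¹ * sgn (dot x y) : ℝ) : ℂ) • matOp (C₁ (Fin.append θ y)))
    (fun θ x => hfour _ hBh θ x) (fun θ x => hfour _ hCh θ x)
    (fun θ x θ' x' v => by
      simp only [LinearMap.sum_apply, LinearMap.smul_apply, map_sum, map_smul, Finset.smul_sum]
      rw [Finset.sum_comm]
      refine Finset.sum_congr rfl fun y' _ => Finset.sum_congr rfl fun y _ => ?_
      rw [← matOp_mul, ← matOp_mul, hcomm, smul_comm])
    (fun θ v => hpars _ hBc θ v) (fun θ v => hpars _ hCc θ v) s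
    (fun θ x => by
      simp only [hs]
      cases SignType.sign (gameBias Γ Φ Ψ x θ) <;> simp)
  have hbias : ∀ x θ, gameBias Γ Φ Ψ x θ = ∑ κ, (inner ℂ (∑ z, (wiesnerReal x θ z : ℂ) • Ω κ z)
      ((∑ y, (((2 ^ l)⁻¹ * sgn (dot x y) : ℝ) : ℂ) • matOp (B₁ (Fin.append θ y)))
        ((∑ y, (((2 ^ l)⁻¹ * sgn (dot x y) : ℝ) : ℂ) • matOp (C₁ (Fin.append θ y)))
          (∑ z, (wiesnerReal x θ z : ℂ) • Ω κ z)))).re := by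
    intro x θ
    have e := h x θ
    obtain ⟨w, hw⟩ : ∃ w : ι → EuclideanSpace ℂ (Bits b × Bits c),
      ∀ κ, w κ = ∑ z, (wiesnerReal x θ z : ℂ) • Ω κ z := ⟨_, fun _ => rfl⟩
    simp only [← hw] at e ⊢
    have h₁ : ∀ y y', ∑ o, ∑ o', sgn o * sgn o' * (gameProb Γ Φ Ψ x θ y y' o o').re =
        ∑ κ, (inner ℂ (w κ) (matOp (B₁ (Fin.append θ y))
          (matOp (C₁ (Fin.append θ y')) (w κ)))).re := by
      intro y y'
      have hk : B₁ (Fin.append θ y) * C₁ (Fin.append θ y') =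
          Matrix.kronecker (E true (Fin.append θ y)) (F true (Fin.append θ y')) -
          Matrix.kronecker (E true (Fin.append θ y)) (F false (Fin.append θ y')) -
          (Matrix.kronecker (E false (Fin.append θ y)) (F true (Fin.append θ y')) -
          Matrix.kronecker (E false (Fin.append θ y)) (F false (Fin.append θ y'))) := by
        rw [hprod]
        ext p q
        simp only [Matrix.kronecker, Matrix.kroneckerMap_apply, Matrix.sub_apply]
        ring
      simp only [← matOp_mul, hk, e, Fintype.sum_bool, sgn, map_sub, LinearMap.sub_apply,
        inner_sub_right, Complex.sub_re, Complex.re_sum, Finset.sum_sub_distrib, if_true,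
        Bool.false_eq_true, if_false]
      ring
    have h₂ : ∀ κ, (inner ℂ (w κ)
        ((∑ y, (((2 ^ l)⁻¹ * sgn (dot x y) : ℝ) : ℂ) • matOp (B₁ (Fin.append θ y)))
          ((∑ y, (((2 ^ l)⁻¹ * sgn (dot x y) : ℝ) : ℂ) • matOp (C₁ (Fin.append θ y))) (w κ)))).re =
        ∑ y, ∑ y', ((2 ^ l)⁻¹ * sgn (dot x y)) * ((2 ^ l)⁻¹ * sgn (dot x y')) *
          (inner ℂ (w κ) (matOp (B₁ (Fin.append θ y))
            (matOp (C₁ (Fin.append θ y')) (w κ)))).re := by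
      intro κ
      rw [LinearMap.sum_apply, inner_sum, Complex.re_sum]
      refine Finset.sum_congr rfl fun y _ => ?_
      rw [LinearMap.smul_apply, inner_smul_right, Complex.re_ofReal_mul, LinearMap.sum_apply,
        map_sum, inner_sum, Complex.re_sum, Finset.mul_sum]
      refine Finset.sum_congr rfl fun y' _ => ?_
      rw [LinearMap.smul_apply, map_smul, inner_smul_right, Complex.re_ofReal_mul]
      ring
    simp only [gameBias, h₁, h₂, Finset.mul_sum]
    symm
    rw [Finset.sum_comm]
    exact Finset.sum_congr rfl fun y _ => Finset.sum_comm
  calc ∑ θ, ∑ x, |gameBias Γ Φ Ψ x θ|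
      = ∑ κ, ∑ θ, ∑ x, s θ x * (inner ℂ (∑ z, (wiesnerReal x θ z : ℂ) • Ω κ z)
      ((∑ y, (((2 ^ l)⁻¹ * sgn (dot x y) : ℝ) : ℂ) • matOp (B₁ (Fin.append θ y)))
        ((∑ y, (((2 ^ l)⁻¹ * sgn (dot x y) : ℝ) : ℂ) • matOp (C₁ (Fin.append θ y)))
          (∑ z, (wiesnerReal x θ z : ℂ) • Ω κ z)))).re := by
        symm
        rw [Finset.sum_comm]
        refine Finset.sum_congr rfl fun θ _ => ?_
        rw [Finset.sum_comm]
        refine Finset.sum_congr rfl fun x _ => ?_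
        rw [← Finset.mul_sum, ← hbias, hs, sign_mul_self]
    _ ≤ ∑ κ, (∑ z, ‖Ω κ z‖ ^ 2) * Real.sqrt (∑ θ : Bits l, ∑ θ', overlap θ θ') :=
        Finset.sum_le_sum fun κ _ => key κ
    _ = _ := by rw [← Finset.sum_mul, hΩ, sum_overlap]

end Game

end

noncomputable section

open Function (update)

/-! ### From splitting the advice to the game -/

theorem dot_comm {n : ℕ} (x y : Bits n) : dot x y = dot y x := by
  simp only [dot, Bool.and_comm]

theorem sum_sgn_dot {n : ℕ} (x : Bits n) :
    ∑ y : Bits n, sgn (dot x y) = if x = fun _ => false then 2 ^ n else 0 := by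
  rw [← sum_sgn_dot_mul x fun _ => false]
  refine Finset.sum_congr rfl fun y _ => ?_
  rw [dot_comm x y, dot_comm y fun _ => false]
  simp [dot, sgn]

/-- The difference of the two counts is a character sum, which vanishes unless `x = 0`; in that case
the only answer is `false`. -/
theorem card_dot_eq {n : ℕ} (x : Bits n) (b : Bool) (hb : ∃ y, dot x y = b) :
    ((Finset.univ.filter fun y => dot x y = b).card : ℝ) =
      if (∃ y, dot x y = true) then 2 ^ n / 2 else 2 ^ n := by
  have h₁ : ((Finset.univ.filter fun y => dot x y = true).card : ℝ) +
      (Finset.univ.filter fun y => dot x y = false).card = 2 ^ n := by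
    have : Finset.univ.filter (fun y => dot x y = false) =
        Finset.univ.filter fun y => ¬ dot x y = true := by simp
    rw [this, ← Nat.cast_add, Finset.card_filter_add_card_filter_not]
    simp
  have h₂ : ((Finset.univ.filter fun y => dot x y = false).card : ℝ) -
      (Finset.univ.filter fun y => dot x y = true).card =
      if x = fun _ => false then 2 ^ n else 0 := by
    rw [← sum_sgn_dot, Finset.natCast_card_filter, Finset.natCast_card_filter,
      ← Finset.sum_sub_distrib]
    refine Finset.sum_congr rfl fun y _ => ?_
    cases dot x y <;> simp [sgn]
  by_cases h : ∃ y, dot x y = true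
  · rw [if_pos h]
    have hx : x ≠ fun _ => false := by
      rintro rfl
      obtain ⟨y, hy⟩ := h
      simp [dot] at hy
    rw [if_neg hx] at h₂
    cases b <;> linarith
  · rw [if_neg h]
    have h0 : Finset.univ.filter (fun y => dot x y = true) = ∅ := by
      simpa [Finset.filter_eq_empty_iff] using h
    rw [h0] at h₁
    cases b
    · simpa using h₁
    · exact absurd hb h

theorem append_injective {l : ℕ} (θ : Bits l) :
    Function.Injective fun y : Bits l => (Fin.append θ y : Bits (l + l)) := by
  intro y y' h
  funext t
  have ht : Fin.append θ y (Fin.natAdd l t) = Fin.append θ y' (Fin.natAdd l t) := congrFun h _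
  rwa [Fin.append_right, Fin.append_right] at ht

theorem mem_slice_ipProblem (s : ∀ l : ℕ, Bits (l + l)) (l : ℕ) (b : Bool) (z : Bits (l + l)) :
    z ∈ (ipProblem s).slice b (l + l) ↔
      ∃ y, dot (fstHalf (s l)) y = b ∧ Fin.append (sndHalf (s l)) y = z := by
  have h : z ∈ (ipProblem s).slice b (l + l) ↔ (⟨l + l, z⟩ : BitString) ∈ halfInstances s b := by
    cases b <;> rfl
  rw [h]
  constructor
  · rintro ⟨m, y, hy, e⟩
    obtain rfl : l = m := by have := congrArg Sigma.fst e; simp only at this; omega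
    exact ⟨y, hy, (eq_of_heq (Sigma.mk.inj e).2).symm⟩
  · rintro ⟨y, hy, rfl⟩
    exact ⟨l, y, hy, rfl⟩

theorem ncard_slice_ipProblem (s : ∀ l : ℕ, Bits (l + l)) (l : ℕ) (b : Bool) :
    ((ipProblem s).slice b (l + l)).ncard =
      (Finset.univ.filter fun y => dot (fstHalf (s l)) y = b).card := by
  have : (ipProblem s).slice b (l + l) = (fun y => Fin.append (sndHalf (s l)) y) ''
      (Finset.univ.filter fun y => dot (fstHalf (s l)) y = b : Finset (Bits l)) := by
    ext z
    rw [mem_slice_ipProblem]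
    simp
  rw [this, Set.ncard_image_of_injective _ (append_injective _), Set.ncard_coe_finset]

theorem balance_ipProblem (s : ∀ l : ℕ, Bits (l + l)) (l : ℕ) :
    (ipProblem s).balance (l + l) = if (∃ y, dot (fstHalf (s l)) y = true) then 1 / 2 else 1 := by
  -- The string `y = 0` is always a no instance, so only the yes instances can be missing, namely
  -- when `x = 0`.
  have h0 : (ipProblem s).slice false (l + l) ≠ ∅ :=
    Set.nonempty_iff_ne_empty.1 ⟨Fin.append (sndHalf (s l)) fun _ => false,
      (mem_slice_ipProblem s l false _).2 ⟨fun _ => false, by simp [dot], rfl⟩⟩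
  have h1 : (ipProblem s).slice true (l + l) = ∅ ↔ ¬ ∃ y, dot (fstHalf (s l)) y = true := by
    rw [Set.eq_empty_iff_forall_notMem]
    simp only [mem_slice_ipProblem]
    constructor
    · rintro h ⟨y, hy⟩
      exact h _ ⟨y, hy, rfl⟩
    · rintro h z ⟨y, hy, -⟩
      exact h ⟨y, hy⟩
  unfold PromiseProblem.balance
  by_cases h : ∃ y, dot (fstHalf (s l)) y = true
  · rw [if_neg, if_pos h]
    rintro (h' | h')
    · exact h0 h'
    · exact h1.1 h' h
  · rw [if_pos (Or.inr (h1.2 h)), if_neg h]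

/-- The challenges are uniform. -/
theorem challenge_append (s : ∀ l : ℕ, Bits (l + l)) (l : ℕ) (y : Bits l) :
    (ipProblem s).challenge (l + l) (Fin.append (sndHalf (s l)) y) = (2 ^ l)⁻¹ := by
  -- Either both answers occur, with weight `1 / 2` spread over `2 ^ l / 2` strings each, or only
  -- one does, with weight `1` on `2 ^ l` strings. Both give `2 ^ (-l)`.
  have key : ∀ b, dot (fstHalf (s l)) y = b → (ipProblem s).balance (l + l) *
      (1 / (((ipProblem s).slice b (l + l)).ncard : ℝ)) = (2 ^ l)⁻¹ := by
    intro b hb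
    rw [balance_ipProblem, ncard_slice_ipProblem, card_dot_eq _ b ⟨y, hb⟩]
    split_ifs
    · field_simp
    · simp
  have hmem : ∀ b, Fin.append (sndHalf (s l)) y ∈ (ipProblem s).slice b (l + l) ↔
      dot (fstHalf (s l)) y = b := by
    intro b
    rw [mem_slice_ipProblem]
    constructor
    · rintro ⟨y', hy', e⟩
      rwa [← append_injective _ e]
    · exact fun h => ⟨y, h, rfl⟩
  unfold PromiseProblem.challenge
  simp only [hmem]
  rcases h : dot (fstHalf (s l)) y
  · rw [if_pos rfl, key false h]
  · rw [if_neg (by simp), if_pos rfl, key true h]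

theorem challenge_eq_zero (s : ∀ l : ℕ, Bits (l + l)) (l : ℕ) (z : Bits (l + l))
    (hz : ∀ y, Fin.append (sndHalf (s l)) y ≠ z) : (ipProblem s).challenge (l + l) z = 0 := by
  have hmem : ∀ b, ¬ z ∈ (ipProblem s).slice b (l + l) := by
    intro b
    rw [mem_slice_ipProblem]
    rintro ⟨y, -, e⟩
    exact hz y e
  unfold PromiseProblem.challenge
  rw [if_neg (hmem false), if_neg (hmem true)]

theorem sum_challenge_mul (s : ∀ l : ℕ, Bits (l + l)) (l : ℕ) (F : Bits (l + l) → ℝ) :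
    ∑ z, (ipProblem s).challenge (l + l) z * F z =
      ∑ y : Bits l, (2 ^ l)⁻¹ * F (Fin.append (sndHalf (s l)) y) := by
  symm
  refine Fintype.sum_of_injective _ (append_injective (sndHalf (s l))) _ _ ?_ ?_
  · intro z hz
    rw [challenge_eq_zero s l z fun y hy => hz ⟨y, hy⟩, zero_mul]
  · intro y
    rw [challenge_append]

theorem answerBit_append (s : ∀ l : ℕ, Bits (l + l)) (l : ℕ) (y : Bits l) :
    (ipProblem s).answerBit (Fin.append (sndHalf (s l)) y) = fun _ => dot (fstHalf (s l)) y := by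
  funext _
  have hmem : (⟨l + l, Fin.append (sndHalf (s l)) y⟩ : BitString) ∈ (ipProblem s).yes ↔
      dot (fstHalf (s l)) y = true := by
    have := mem_slice_ipProblem s l true (Fin.append (sndHalf (s l)) y)
    refine this.trans ⟨?_, fun h => ⟨y, h, rfl⟩⟩
    rintro ⟨y', hy', e⟩
    rwa [← append_injective _ e]
  unfold PromiseProblem.answerBit PromiseProblem.answer
  rw [Bool.eq_iff_iff, @decide_eq_true_iff _ (Classical.propDecidable _), hmem]

section Game

variable {l b c : ℕ} {Γ : Op l →ₗ[ℂ] Op (b + c)} {Φ : Op (l + l + b) →ₗ[ℂ] Op 1}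
  {Ψ : Op (c + (l + l)) →ₗ[ℂ] Op 1}

/-- The signed sum is the expectation of a sign that is `1` if both answers are as in `(d, d')` or
both differ, and `-1` otherwise. It is at least the probability of the first event minus that of its
complement. -/
theorem gameBias_term (hΓ : IsChannel Γ) (hΦ : IsChannel Φ) (hΨ : IsChannel Ψ) (x θ y y' : Bits l)
    (d d' : Bool) :
    |sgn d * sgn d' * ∑ o, ∑ o', sgn o * sgn o' * (gameProb Γ Φ Ψ x θ y y' o o').re| ≤ 1 ∧
    2 * (gameProb Γ Φ Ψ x θ y y' d d').re - 1 ≤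
      sgn d * sgn d' * ∑ o, ∑ o', sgn o * sgn o' * (gameProb Γ Φ Ψ x θ y y' o o').re := by
  have h0 := fun o o' => (Complex.le_def.1 (gameProb_nonneg hΓ hΦ hΨ x θ y y' o o')).1
  have h1 := congrArg Complex.re (sum_gameProb hΓ hΦ hΨ x θ y y')
  simp only [Fintype.sum_bool, Complex.add_re, Complex.one_re, Complex.zero_re] at h0 h1 ⊢
  have h00 := h0 false false
  have h01 := h0 false true
  have h10 := h0 true false
  have h11 := h0 true true
  rw [abs_le]
  cases d <;> cases d' <;> simp only [sgn, if_true, Bool.false_eq_true, if_false] <;>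
    refine ⟨⟨?_, ?_⟩, ?_⟩ <;> linarith

theorem sum_const_inv_pow (l : ℕ) : ∑ _y : Bits l, ∑ _y' : Bits l,
    ((2 : ℝ) ^ l)⁻¹ * ((2 : ℝ) ^ l)⁻¹ = 1 := by
  simp

theorem abs_gameBias_le_one (hΓ : IsChannel Γ) (hΦ : IsChannel Φ) (hΨ : IsChannel Ψ)
    (x θ : Bits l) : |gameBias Γ Φ Ψ x θ| ≤ 1 := by
  rw [← sum_const_inv_pow l, gameBias]
  refine (Finset.abs_sum_le_sum_abs _ _).trans (Finset.sum_le_sum fun y _ => ?_)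
  refine (Finset.abs_sum_le_sum_abs _ _).trans (Finset.sum_le_sum fun y' _ => ?_)
  have h := (gameBias_term hΓ hΦ hΨ x θ y y' (dot x y) (dot x y')).1
  have e : (2 ^ l)⁻¹ * sgn (dot x y) * ((2 ^ l)⁻¹ * sgn (dot x y')) *
      (∑ o, ∑ o', sgn o * sgn o' * (gameProb Γ Φ Ψ x θ y y' o o').re) =
      ((2 ^ l)⁻¹ * (2 ^ l)⁻¹) * (sgn (dot x y) * sgn (dot x y') *
      ∑ o, ∑ o', sgn o * sgn o' * (gameProb Γ Φ Ψ x θ y y' o o').re) := by ring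
  have hp : (0 : ℝ) ≤ (2 ^ l)⁻¹ * (2 ^ l)⁻¹ := by positivity
  rw [e, abs_mul, abs_of_nonneg hp]
  exact mul_le_of_le_one_right hp h

/-- Splitting the advice gives an advantage in the game. -/
theorem splitSuccess_le {G : GateSet} (s : ∀ l : ℕ, Bits (l + l)) {ρ : QState}
    (hρ : ρ = wiesner (fstHalf (s l)) (sndHalf (s l))) (A : Circuit G ρ.qubits (b + c))
    (A' : Circuit G l (b + c)) (hA : A'.raw = A.raw)
    (B : Circuit G (l + l + b) 1) (C : Circuit G (c + (l + l)) 1) :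
    2 * splitSuccess (ipProblem s) ρ (l + l) b c A B C - 1 ≤
      gameBias A'.eval B.eval C.eval (fstHalf (s l)) (sndHalf (s l)) := by
  subst hρ
  -- The types agree now, and circuits with the same gates and the same number of input wires have
  -- the same description.
  obtain rfl : A' = A := by
    have h : A'.encode = A.encode := by
      rw [Circuit.encode_eq, Circuit.encode_eq, hA]
      rfl
    exact eq_of_heq (Circuit.encode_inj A' A h).2.2
  have e : splitSuccess (ipProblem s) (wiesner (fstHalf (s l)) (sndHalf (s l))) (l + l) b c A' B C =
      ∑ y : Bits l, ∑ y' : Bits l, (2 ^ l)⁻¹ * (2 ^ l)⁻¹ * (gameProb A'.eval B.eval C.eval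
        (fstHalf (s l)) (sndHalf (s l)) y y' (dot (fstHalf (s l)) y)
        (dot (fstHalf (s l)) y')).re := by
    unfold splitSuccess
    simp only [mul_assoc, ← Finset.mul_sum]
    rw [sum_challenge_mul, ← Finset.mul_sum]
    congr 1
    rw [Finset.mul_sum]
    refine Finset.sum_congr rfl fun y _ => ?_
    rw [sum_challenge_mul, ← Finset.mul_sum]
    congr 1
    refine Finset.sum_congr rfl fun y' _ => ?_
    rw [answerBit_append, answerBit_append, prob, tensorMap_apply_append]
    rfl
  rw [e, gameBias]
  have h1 := sum_const_inv_pow l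
  rw [← h1, Finset.mul_sum, ← Finset.sum_sub_distrib]
  refine Finset.sum_le_sum fun y _ => ?_
  rw [Finset.mul_sum, ← Finset.sum_sub_distrib]
  refine Finset.sum_le_sum fun y' _ => ?_
  have h := (gameBias_term A'.isChannel_eval B.isChannel_eval C.isChannel_eval (fstHalf (s l))
    (sndHalf (s l)) y y' (dot (fstHalf (s l)) y) (dot (fstHalf (s l)) y')).2
  have hp : (0 : ℝ) ≤ (2 ^ l)⁻¹ * (2 ^ l)⁻¹ := by positivity
  have := mul_le_mul_of_nonneg_left h hp
  refine le_trans (le_of_eq ?_) (this.trans (le_of_eq ?_))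
  · ring
  · ring

end Game

end

noncomputable section

open Function (update)

/-! ### The gate set of the generator -/

theorem getD_append_add (u t : List Bool) {k i : ℕ} (h : k = u.length + i) :
    (u ++ t).getD k false = t.getD i false := by
  subst h
  rw [List.getD_append_right _ _ _ _ (by omega), Nat.add_sub_cancel_left]

theorem set_append_add (u t : List Bool) {k i : ℕ} (h : k = u.length + i) (a : Bool) :
    (u ++ t).set k a = u ++ t.set i a := by
  subst h
  rw [List.set_append_right _ _ (by omega), Nat.add_sub_cancel_left]

theorem insertIdx_append_length (u t : List Bool) {k : ℕ} (h : k = u.length) (a : Bool) :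
    (u ++ t).insertIdx k a = u ++ a :: t := by
  subst h
  induction u with
  | nil => rfl
  | cons b u ih => simpa using ih

theorem eraseIdx_append_length (u t : List Bool) {k : ℕ} (h : k = u.length) (a : Bool) :
    (u ++ a :: t).eraseIdx k = u ++ t := by
  subst h
  rw [List.eraseIdx_append_of_length_le (by omega), Nat.sub_self, List.eraseIdx_cons_zero]

theorem getElem?_append_length (u t : List Bool) {k : ℕ} (h : k = u.length) (a : Bool) :
    (u ++ a :: t)[k]? = some a := by
  subst h
  rw [List.getElem?_append_right (by omega), Nat.sub_self, List.getElem?_cons_zero]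

/-- The NOT gate. -/
def notGate : UnitaryGate := involutionGate 1 (fun x _ => !x 0) (by decide)

/-- The controlled NOT gate. -/
def cnot : UnitaryGate := involutionGate 2 (fun x => update x 1 (xor (x 1) (x 0))) (by decide)

/-- The controlled swap gate. -/
def fredkin : UnitaryGate :=
  involutionGate 3 (fun x => if x 0 then ![x 0, x 2, x 1] else x) (by decide)

theorem gateKet_notGate (i : ℕ) (x y : List Bool) : gateKet notGate [i] (ket x y) =
    ket (x.set i (!x.getD i false)) (y.set i (!y.getD i false)) := by
  rw [notGate, gateKet_involutionGate]
  simp [writeWires, readWires, List.ofFn_succ]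

theorem gateKet_cnot (i j : ℕ) (x y : List Bool) : gateKet cnot [i, j] (ket x y) =
    ket (x.set j (xor (x.getD j false) (x.getD i false)))
      (y.set j (xor (y.getD j false) (y.getD i false))) := by
  rw [cnot, gateKet_involutionGate]
  have h : ∀ x : List Bool, writeWires x [i, j] (update (readWires x [i, j] 2) 1
      (xor (readWires x [i, j] 2 1) (readWires x [i, j] 2 0))) =
      x.set j (xor (x.getD j false) (x.getD i false)) := by
    intro x
    have h₀ := set_getD_self x i
    simp only [List.getD_eq_getElem?_getD] at h₀
    simp [writeWires, readWires, List.ofFn_succ, h₀, Function.update]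
  rw [h, h]

/-- Exchange two bits. -/
def swapBits (x : List Bool) (i j : ℕ) : List Bool :=
  (x.set i (x.getD j false)).set j (x.getD i false)

theorem gateKet_fredkin (i j k : ℕ) (x y : List Bool) : gateKet fredkin [i, j, k] (ket x y) =
    ket (if x.getD i false then swapBits x j k else x)
      (if y.getD i false then swapBits y j k else y) := by
  rw [fredkin, gateKet_involutionGate]
  have h : ∀ x : List Bool, writeWires x [i, j, k] (if readWires x [i, j, k] 3 0 then
      ![readWires x [i, j, k] 3 0, readWires x [i, j, k] 3 2, readWires x [i, j, k] 3 1] else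
      readWires x [i, j, k] 3) = if x.getD i false then swapBits x j k else x := by
    intro x
    have h₀ := set_getD_self x i
    have h₁ := set_getD_self x j
    have h₂ := set_getD_self x k
    simp only [List.getD_eq_getElem?_getD] at h₀ h₁ h₂
    rcases h : x[i]?.getD false
    · rw [h] at h₀
      simp [writeWires, readWires, List.ofFn_succ, h₀, h₁, h₂, h]
    · rw [h] at h₀
      simp [writeWires, readWires, List.ofFn_succ, h₀, h, swapBits]
  rw [h, h]

theorem sum_bits_two {M : Type*} [AddCommMonoid M] (F : Bits 2 → M) :
    ∑ u, F u = ∑ a : Bool, ∑ b : Bool, F ![a, b] := by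
  rw [sum_bits_succ]
  refine Finset.sum_congr rfl fun a _ => ?_
  rw [sum_bits_one]
  refine Finset.sum_congr rfl fun b _ => ?_
  congr 1
  funext i
  fin_cases i <;> rfl

/-- The controlled Hadamard gate. -/
def controlledHadamard : UnitaryGate where
  arity := 2
  mat := Matrix.of fun x y => if x 0 = y 0 then wiesnerAmp (y 1) (y 0) (x 1) else 0
  unitary := by
    rw [Matrix.mem_unitaryGroup_iff']
    ext x y
    have hs := inv_sqrt_two_mul_self
    have hxy : x = y ↔ x 0 = y 0 ∧ x 1 = y 1 := by simp [funext_iff, Fin.forall_fin_two]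
    rw [Matrix.mul_apply, sum_bits_two]
    simp only [Matrix.star_apply, Matrix.of_apply, Matrix.one_apply, hxy, Fintype.sum_bool,
      Matrix.cons_val_zero, Matrix.cons_val_one]
    rcases x 0 <;> rcases x 1 <;> rcases y 0 <;> rcases y 1 <;> simp [wiesnerAmp, hs]
    all_goals norm_num
  algebraic := by
    intro x y
    rw [Matrix.of_apply, wiesnerAmp]
    split_ifs
    · exact isAlgebraic_one.neg.mul isAlgebraic_inv_sqrt_two
    · exact isAlgebraic_one.mul isAlgebraic_inv_sqrt_two
    · exact isAlgebraic_one
    · exact isAlgebraic_zero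
    · exact isAlgebraic_zero

theorem gateKet_controlledHadamard (i j : ℕ) (x y : List Bool) :
    gateKet controlledHadamard [i, j] (ket x y) =
      ∑ a : Bool, ∑ b : Bool, (wiesnerAmp (x.getD j false) (x.getD i false) a *
        star (wiesnerAmp (y.getD j false) (y.getD i false) b)) • ket (x.set j a) (y.set j b) := by
  have h : ∀ x : List Bool, ∀ a b, writeWires x [i, j] (![a, b] : Bits 2) =
      (x.set i a).set j b := by
    intro x a b
    simp [writeWires, List.ofFn_succ]
  have hx := set_getD_self x i
  have hy := set_getD_self y i
  rw [gateKet, liftKet_ket]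
  refine (sum_bits_two _).trans ?_
  rw [Finset.sum_eq_single (x.getD i false)]
  · refine Finset.sum_congr rfl fun a _ => ?_
    refine (sum_bits_two _).trans ?_
    rw [Finset.sum_eq_single (y.getD i false)]
    · refine Finset.sum_congr rfl fun b _ => ?_
      have hx' : writeWires x [i, j] (![x.getD i false, a] : Bits 2) = x.set j a := by rw [h, hx]
      have hy' : writeWires y [i, j] (![y.getD i false, b] : Bits 2) = y.set j b := by rw [h, hy]
      refine congrArg₂ (· • ·) ?_ (congrArg₂ ket hx' hy')
      simp [controlledHadamard, readWires]
    · intro b _ hb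
      have hb' : ¬ b = y[i]?.getD false := by simpa using hb
      refine Finset.sum_eq_zero fun d _ => ?_
      simp [controlledHadamard, readWires, hb']
    · simp
  · intro a _ ha
    have ha' : ¬ a = x[i]?.getD false := by simpa using ha
    refine Finset.sum_eq_zero fun d _ => Finset.sum_eq_zero fun v _ => ?_
    simp [controlledHadamard, readWires, ha']
  · simp

/-- The gate set of the generator. -/
def genGates : GateSet where
  unitaries := [toffoli, hadamard, phaseShift, notGate, cnot, fredkin, controlledHadamard]
  hasPrep := True
  hasTrace := True

/-- The standard gates keep their indices, so the encoded gates of `A`, `B` and `C` can be copied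
into the generator literally, with the same meaning. -/
theorem genGates_extends : genGates.Extends stdGates where
  unitaries := by
    rintro (_ | _ | _ | g) U h
    · exact h
    · exact h
    · exact h
    · simp [stdGates] at h
  prep := id
  trace := id

section Gates

variable (x y : List Bool)

theorem eval_toffoli (i j k : ℕ) : (RawGate.gate 0 [i, j, k]).eval genGates (ket x y) =
    ket (x.set k (xor (x.getD k false) (x.getD i false && x.getD j false)))
      (y.set k (xor (y.getD k false) (y.getD i false && y.getD j false))) :=
  gateKet_toffoli i j k x y

theorem eval_hadamard (i : ℕ) : (RawGate.gate 1 [i]).eval genGates (ket x y) =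
    ∑ a : Bool, ∑ b : Bool, (wiesnerAmp (x.getD i false) true a *
      star (wiesnerAmp (y.getD i false) true b)) • ket (x.set i a) (y.set i b) :=
  gateKet_hadamard i x y

theorem eval_not (i : ℕ) : (RawGate.gate 3 [i]).eval genGates (ket x y) =
    ket (x.set i (!x.getD i false)) (y.set i (!y.getD i false)) :=
  gateKet_notGate i x y

theorem eval_cnot (i j : ℕ) : (RawGate.gate 4 [i, j]).eval genGates (ket x y) =
    ket (x.set j (xor (x.getD j false) (x.getD i false)))
      (y.set j (xor (y.getD j false) (y.getD i false))) :=
  gateKet_cnot i j x y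

theorem eval_fredkin (i j k : ℕ) : (RawGate.gate 5 [i, j, k]).eval genGates (ket x y) =
    ket (if x.getD i false then swapBits x j k else x)
      (if y.getD i false then swapBits y j k else y) :=
  gateKet_fredkin i j k x y

theorem eval_controlledHadamard (i j : ℕ) : (RawGate.gate 6 [i, j]).eval genGates (ket x y) =
    ∑ a : Bool, ∑ b : Bool, (wiesnerAmp (x.getD j false) (x.getD i false) a *
      star (wiesnerAmp (y.getD j false) (y.getD i false) b)) • ket (x.set j a) (y.set j b) :=
  gateKet_controlledHadamard i j x y

theorem eval_prep (p : ℕ) : (RawGate.prep p).eval genGates (ket x y) =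
    ket (x.insertIdx p false) (y.insertIdx p false) := by
  rw [RawGate.eval, liftKet_ket]

theorem eval_trace (p : ℕ) : (RawGate.trace p).eval genGates (ket x y) =
    if x[p]? = y[p]? then ket (x.eraseIdx p) (y.eraseIdx p) else 0 := by
  rw [RawGate.eval, liftKet_ket]

end Gates

/-! ### Random bits -/

/-- Insert a uniformly random bit at position `p`. -/
def randomBit (p : ℕ) : List RawGate :=
  [.prep p, .prep p, .gate 1 [p], .gate 4 [p, p + 1], .trace p]

/-- The CNOT gate copies the superposition `H|0⟩` to a second wire. Tracing out the first one
destroys the coherences and leaves a fair coin. -/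
theorem rawEval_randomBit {p : ℕ} (u u' t t' : List Bool) (hu : u.length = p) (hu' : u'.length = p) :
    rawEval genGates (randomBit p) (ket (u ++ t) (u' ++ t')) =
      ∑ a : Bool, (2 : ℂ)⁻¹ • ket (u ++ a :: t) (u' ++ a :: t') := by
  have g : ∀ (v : List Bool) (a b : Bool) (w : List Bool), v.length = p →
      (v ++ a :: w).getD p false = a := fun v a b w hv => by
    rw [getD_append_add (i := 0) _ _ (by omega)]; rfl
  have g1 : ∀ (v : List Bool) (a b : Bool) (w : List Bool), v.length = p →
      (v ++ a :: b :: w).getD (p + 1) false = b := fun v a b w hv => by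
    rw [getD_append_add (i := 1) _ _ (by omega)]; rfl
  have s0 : ∀ (v : List Bool) (a b : Bool) (w : List Bool), v.length = p →
      (v ++ a :: w).set p b = v ++ b :: w := fun v a b w hv => by
    rw [set_append_add (i := 0) _ _ (by omega)]; rfl
  have s1 : ∀ (v : List Bool) (a b d : Bool) (w : List Bool), v.length = p →
      (v ++ a :: b :: w).set (p + 1) d = v ++ a :: d :: w := fun v a b d w hv => by
    rw [set_append_add (i := 1) _ _ (by omega)]; rfl
  have hs := inv_sqrt_two_mul_self
  simp only [randomBit, rawEval_cons, rawEval_nil, eval_prep, eval_hadamard, map_sum, map_smul,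
    insertIdx_append_length _ _ hu.symm, insertIdx_append_length _ _ hu'.symm,
    g _ _ false _ hu, g _ _ false _ hu', s0 _ _ _ _ hu, s0 _ _ _ _ hu', eval_cnot,
    g1 _ _ _ _ hu, g1 _ _ _ _ hu', s1 _ _ _ _ _ hu, s1 _ _ _ _ _ hu', eval_trace,
    getElem?_append_length _ _ hu.symm, getElem?_append_length _ _ hu'.symm,
    eraseIdx_append_length _ _ hu.symm, eraseIdx_append_length _ _ hu'.symm, Bool.false_xor]
  simp [wiesnerAmp, hs]

/-- Insert `n` random bits at the front. -/
theorem rawEval_randomBits (n : ℕ) (t t' : List Bool) :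
    rawEval genGates ((List.range n).flatMap fun _ => randomBit 0) (ket t t') =
      ∑ y : Bits n, ((2 : ℂ) ^ n)⁻¹ • ket (List.ofFn y ++ t) (List.ofFn y ++ t') := by
  induction n with
  | zero => simp
  | succ n ih =>
    rw [List.range_succ, List.flatMap_append, rawEval_append, ih]
    simp only [List.flatMap_cons, List.flatMap_nil, List.append_nil, map_sum, map_smul]
    have h : ∀ y : Bits n, rawEval genGates (randomBit 0) (ket (List.ofFn y ++ t)
        (List.ofFn y ++ t')) = ∑ a : Bool, (2 : ℂ)⁻¹ • ket (a :: List.ofFn y ++ t)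
        (a :: List.ofFn y ++ t') := fun y =>
      rawEval_randomBit [] [] _ _ rfl rfl
    simp only [h, Finset.smul_sum, smul_smul]
    rw [Finset.sum_comm, sum_bits_succ]
    refine Finset.sum_congr rfl fun a _ => Finset.sum_congr rfl fun y _ => ?_
    rw [List.ofFn_succ, pow_succ, mul_inv]
    rfl

end

noncomputable section

open Function (update)

/-! ### One play of the splitting game -/

/-- Insert a copy of `l` wires in front, where `k` is the position of the wire that follows the
original plus `1`. -/
def copyBits (l k : ℕ) : List RawGate :=
  (List.range l).flatMap fun _ => [.prep 0, .gate 4 [k, 0]]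

/-- Every insertion in front shifts the original by one, so the fixed wire `k` shows its bits from
the last to the first. Put in front in this order, they form a copy in the original order. -/
theorem rawEval_copyBits (n : ℕ) {k m : ℕ} (w : Bits n) (t t' : List Bool) (hk : k = m + n)
    (h : ∀ i : Fin n, t.getD (m + i) false = w i)
    (h' : ∀ i : Fin n, t'.getD (m + i) false = w i) :
    rawEval genGates (copyBits n k) (ket t t') = ket (List.ofFn w ++ t) (List.ofFn w ++ t') := by
  induction n generalizing m with
  | zero => simp [copyBits]
  | succ n ih =>
    have e := ih (m := m + 1) (fun i => w i.succ) (by omega)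
      (fun i => by rw [← h i.succ, Fin.val_succ]; congr 1; omega)
      (fun i => by rw [← h' i.succ, Fin.val_succ]; congr 1; omega)
    rw [copyBits] at e ⊢
    rw [List.range_succ, List.flatMap_append, rawEval_append, e]
    have g : ∀ s : List Bool, (∀ i : Fin (n + 1), s.getD (m + i) false = w i) →
        (false :: (List.ofFn (fun i : Fin n => w i.succ) ++ s)).getD k false = w 0 := by
      intro s hs
      rw [← List.cons_append, getD_append_add (i := m) _ _ (by simp; omega), ← hs 0]
      rfl
    simp only [List.flatMap_cons, List.flatMap_nil, List.append_nil, rawEval_cons, rawEval_nil,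
      eval_prep, List.insertIdx_zero, eval_cnot, g t h, g t' h', List.ofFn_succ (f := w)]
    simp

/-- Insert `l` random bits `y` in front, and add `x ⬝ y` to the bit at position `p`, where `k` is
the position of the wire that follows `x` plus `1`. -/
def randomDot (l k p : ℕ) : List RawGate :=
  (List.range l).flatMap fun j => randomBit 0 ++ [.gate 0 [0, k, p + j + 1]]

/-- As with copying, the bits of `x` pass by the fixed wire `k` from the last to the first, one for
each new random bit. The target does not pass by: it has to be followed to `p + j + 1`. -/
theorem rawEval_randomDot (n : ℕ) {k p m : ℕ} (x : Bits n) (u u' v v' : List Bool) (f f' : Bool)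
    (hu : u.length = p) (hu' : u'.length = p) (hk : k = p + 1 + m + n)
    (h : ∀ i : Fin n, v.getD (m + i) false = x i)
    (h' : ∀ i : Fin n, v'.getD (m + i) false = x i) :
    rawEval genGates (randomDot n k p) (ket (u ++ f :: v) (u' ++ f' :: v')) =
      ∑ y : Bits n, ((2 : ℂ) ^ n)⁻¹ • ket (List.ofFn y ++ (u ++ (xor f (dot x y)) :: v))
        (List.ofFn y ++ (u' ++ (xor f' (dot x y)) :: v')) := by
  induction n generalizing m with
  | zero => simp [randomDot, dot_zero]
  | succ n ih =>
    have e := ih (m := m + 1) (fun i => x i.succ) (by omega)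
      (fun i => by rw [← h i.succ, Fin.val_succ]; congr 1; omega)
      (fun i => by rw [← h' i.succ, Fin.val_succ]; congr 1; omega)
    rw [randomDot] at e ⊢
    rw [List.range_succ, List.flatMap_append, rawEval_append, e]
    have gx : ∀ (a : Bool) (y : Bits n) (u v : List Bool) (f : Bool), u.length = p →
        (∀ i : Fin (n + 1), v.getD (m + i) false = x i) →
        (a :: (List.ofFn y ++ (u ++ f :: v))).getD k false = x 0 := by
      intro a y u v f hu hv
      rw [show a :: (List.ofFn y ++ (u ++ f :: v)) = (a :: (List.ofFn y ++ (u ++ [f]))) ++ v by simp,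
        getD_append_add (i := m) _ _ (by simp; omega), ← hv 0]
      rfl
    have gf : ∀ (a : Bool) (y : Bits n) (u v : List Bool) (f : Bool), u.length = p →
        (a :: (List.ofFn y ++ (u ++ f :: v))).getD (p + n + 1) false = f := by
      intro a y u v f hu
      rw [show a :: (List.ofFn y ++ (u ++ f :: v)) = (a :: (List.ofFn y ++ u)) ++ f :: v by simp,
        getD_append_add (i := 0) _ _ (by simp; omega)]
      rfl
    have gs : ∀ (a : Bool) (y : Bits n) (u v : List Bool) (f d : Bool), u.length = p →
        (a :: (List.ofFn y ++ (u ++ f :: v))).set (p + n + 1) d =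
          a :: (List.ofFn y ++ (u ++ d :: v)) := by
      intro a y u v f d hu
      rw [show a :: (List.ofFn y ++ (u ++ f :: v)) = (a :: (List.ofFn y ++ u)) ++ f :: v by simp,
        set_append_add (i := 0) _ _ (by simp; omega)]
      simp
    have hr := fun s s' => rawEval_randomBit (p := 0) [] [] s s' rfl rfl
    simp only [List.nil_append] at hr
    simp only [List.flatMap_cons, List.flatMap_nil, List.append_nil, map_sum, map_smul,
      rawEval_append, hr, rawEval_cons, rawEval_nil, eval_toffoli, gx _ _ _ _ _ hu h,
      gx _ _ _ _ _ hu' h', gf _ _ _ _ _ hu, gf _ _ _ _ _ hu', gs _ _ _ _ _ _ hu,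
      gs _ _ _ _ _ _ hu', List.getD_cons_zero, Finset.smul_sum, smul_smul]
    rw [Finset.sum_comm, sum_bits_succ]
    refine Finset.sum_congr rfl fun a _ => Finset.sum_congr rfl fun y _ => ?_
    have hd : dot x (Fin.cons a y) = xor (dot (fun i => x i.succ) y) (a && x 0) := by
      rw [dot_cons, Bool.xor_comm, Bool.and_comm]
      rfl
    rw [hd, List.ofFn_succ, pow_succ, mul_inv, Bool.xor_assoc, Bool.xor_assoc]
    rfl

/-- Prepare the Wiesner state `|x^θ⟩` in front, where `k` and `k'` are the positions of the wires
that follow `x` and `θ` plus `1`. -/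
def prepWiesner (l k k' : ℕ) : List RawGate :=
  (List.range l).flatMap fun _ => [.prep 0, .gate 4 [k, 0], .gate 6 [k', 0]]

/-- For each qubit, a CNOT gate writes the bit of `x` and a Hadamard gate controlled by the bit of
`θ` rotates it. As the basis is held in a wire, this needs the controlled gate among the gates. -/
theorem rawEval_prepWiesner (n : ℕ) {k m k' m' : ℕ} (x θ : Bits n) (t : List Bool)
    (hk : k = m + n) (hk' : k' = m' + n) (hx : ∀ i : Fin n, t.getD (m + i) false = x i)
    (hθ : ∀ i : Fin n, t.getD (m' + i) false = θ i) :
    rawEval genGates (prepWiesner n k k') (ket t t) =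
      wiesnerSum x θ fun u v => ket (u ++ t) (v ++ t) := by
  induction n generalizing m m' with
  | zero => simp [prepWiesner, wiesnerSum_zero]
  | succ n ih =>
    have e := ih (m := m + 1) (m' := m' + 1) (fun i => x i.succ) (fun i => θ i.succ) (by omega)
      (by omega) (fun i => by rw [← hx i.succ, Fin.val_succ]; congr 1; omega)
      (fun i => by rw [← hθ i.succ, Fin.val_succ]; congr 1; omega)
    rw [prepWiesner] at e ⊢
    rw [List.range_succ, List.flatMap_append, rawEval_append, e, map_wiesnerSum, wiesnerSum_succ]
    refine wiesnerSum_congr _ _ fun u v hu hv => ?_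
    have g : ∀ {z : Bits (n + 1)} {k m : ℕ} (a : Bool) (u : List Bool), k = m + (n + 1) →
        u.length = n → (∀ i : Fin (n + 1), t.getD (m + i) false = z i) →
        (a :: (u ++ t)).getD k false = z 0 := by
      intro z k m a u hk hu hz
      rw [← List.cons_append, getD_append_add (i := m) _ _ (by simp; omega), ← hz 0]
      rfl
    simp only [List.flatMap_cons, List.flatMap_nil, List.append_nil, rawEval_cons, rawEval_nil,
      eval_prep, List.insertIdx_zero, eval_cnot, g _ _ hk hu hx, g _ _ hk hv hx, List.set_cons_zero,
      List.getD_cons_zero, Bool.false_xor, eval_controlledHadamard, g _ _ hk' hu hθ,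
      g _ _ hk' hv hθ, List.cons_append]

/-- Apply a circuit with one output wire, and add its output to the bit at position `p` of the
other wires. -/
def addOutput (c : List RawGate) (p : ℕ) : List RawGate :=
  c ++ [.gate 4 [0, p + 1], .trace 0]

theorem rawEval_raw_std {a b : ℕ} (C : Circuit stdGates a b) (t t' : List Bool) (ρ : Op a) :
    rawEval genGates C.raw (toFree t t' ρ) = toFree t t' (C.eval ρ) := by
  rw [rawEval_extends genGates_extends C.rawValid, C.rawEval_raw]

/-- The output is traced out after it has been copied, so only the diagonal entries survive: the
output behaves like a classical answer even on a matrix unit that is not diagonal. -/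
theorem rawEval_addOutput {a p : ℕ} (C : Circuit stdGates a 1) (z z' : Bits a)
    (u u' v v' : List Bool) (f f' : Bool) (hu : u.length = p) (hu' : u'.length = p) :
    rawEval genGates (addOutput C.raw p)
      (ket (List.ofFn z ++ (u ++ f :: v)) (List.ofFn z' ++ (u' ++ f' :: v'))) =
      ∑ o : Bool, C.eval (Matrix.single z z' 1) (fun _ => o) (fun _ => o) •
        ket (u ++ (xor f o) :: v) (u' ++ (xor f' o) :: v') := by
  have h := rawEval_raw_std C (u ++ f :: v) (u' ++ f' :: v') (Matrix.single z z' 1)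
  rw [toFree_single, one_smul] at h
  have gf : ∀ (a : Bool) (u v : List Bool) (f : Bool), u.length = p →
      (a :: (u ++ f :: v)).getD (p + 1) false = f := by
    intro a u v f hu
    rw [← List.cons_append, getD_append_add (i := 0) _ _ (by simp; omega)]
    rfl
  have gs : ∀ (a : Bool) (u v : List Bool) (f d : Bool), u.length = p →
      (a :: (u ++ f :: v)).set (p + 1) d = a :: (u ++ d :: v) := by
    intro a u v f d hu
    rw [← List.cons_append, set_append_add (i := 0) _ _ (by simp; omega)]
    simp
  rw [addOutput, rawEval_append, h, toFree_apply]
  simp only [sum_bits_one, List.ofFn_succ, List.ofFn_zero, List.cons_append, List.nil_append,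
    map_sum, map_smul, rawEval_cons, rawEval_nil, eval_cnot, gf _ _ _ _ hu, gf _ _ _ _ hu',
    gs _ _ _ _ _ hu, gs _ _ _ _ _ hu', List.getD_cons_zero, eval_trace, List.eraseIdx_cons_zero,
    List.getElem?_cons_zero, Option.some.injEq, smul_ite, smul_zero]
  exact Finset.sum_congr rfl fun o _ => by simp

theorem rawEval_prepZeros (n : ℕ) (t t' : List Bool) :
    rawEval genGates ((List.range n).flatMap fun _ => [.prep 0, .prep 0]) (ket t t') =
      ket (List.replicate (n + n) false ++ t) (List.replicate (n + n) false ++ t') := by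
  induction n generalizing t t' with
  | zero => simp
  | succ n ih =>
    rw [List.range_succ, List.flatMap_append, rawEval_append, ih,
      show n + 1 + (n + 1) = n + n + 1 + 1 by omega]
    simp [eval_prep, List.replicate_succ]

theorem rawEval_traceFront (n : ℕ) (u t : List Bool) (hu : u.length = n + n) :
    rawEval genGates ((List.range n).flatMap fun _ => [.trace 0, .trace 0])
      (ket (u ++ t) (u ++ t)) = ket t t := by
  induction n generalizing u with
  | zero => simp [List.length_eq_zero_iff.1 hu]
  | succ n ih =>
    match u, hu with
    | a :: b :: u, hu =>
      rw [flatMap_range_succ_const, rawEval_append]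
      simp only [List.cons_append, rawEval_cons, eval_trace, if_true, List.eraseIdx_cons_zero,
        rawEval_nil]
      exact ih u (by simp at hu; omega)
    | [_], h => simp at h; omega
    | [], h => simp at h

/-- One play of the game for the state and the basis given by the wires `1, …, l` and
`l + 1, …, l + l`. The wire `0` receives whether the play is lost; the numbers of wires of the
circuits `cB` and `cC` are `aB` and `aC`. -/
def play (l aB aC : ℕ) (cA cB cC : List RawGate) : List RawGate :=
  ((List.range l).flatMap fun _ => [.prep 0, .prep 0]) ++
  (randomDot l (l + l + l + 1) (l + l) ++
  (copyBits l (l + l + l + l + l + 1) ++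
  (prepWiesner l (l + l + l + l + l + 1) (l + l + l + l + l + l + 1) ++
  (cA ++
  (randomDot l (aB + aC + l + 1) (aB + aC) ++
  (copyBits l (aB + aC + l + l + l + 1) ++
  (addOutput cB (aC + l + l) ++
  (addOutput cC (l + l) ++
  (List.range l).flatMap fun _ => [.trace 0, .trace 0]))))))))

variable {l b c : ℕ}

theorem getD_ofFn_append (w : Bits l) (u t : List Bool) {m : ℕ} (hm : u.length = m) (i : Fin l) :
    (u ++ (List.ofFn w ++ t)).getD (m + i) false = w i := by
  rw [getD_append_add (i := i) _ _ (by omega), List.getD_append _ _ _ _ (by simp),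
    List.getD_eq_getElem _ _ (by simp), List.getElem_ofFn]

theorem getD_append_cons_ofFn (x θ : Bits l) (u r : List Bool) (f : Bool) {m : ℕ}
    (hm : u.length + 1 = m) (i : Fin l) :
    (u ++ f :: (List.ofFn x ++ (List.ofFn θ ++ r))).getD (m + i) false = x i := by
  rw [show u ++ f :: (List.ofFn x ++ (List.ofFn θ ++ r)) =
    (u ++ [f]) ++ (List.ofFn x ++ (List.ofFn θ ++ r)) by simp]
  exact getD_ofFn_append x _ _ (by simp; omega) i

theorem getD_append_cons_ofFn_append (x θ : Bits l) (u r : List Bool) (f : Bool) {m : ℕ}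
    (hm : u.length + 1 + l = m) (i : Fin l) :
    (u ++ f :: (List.ofFn x ++ (List.ofFn θ ++ r))).getD (m + i) false = θ i := by
  rw [show u ++ f :: (List.ofFn x ++ (List.ofFn θ ++ r)) =
    (u ++ (f :: List.ofFn x)) ++ (List.ofFn θ ++ r) by simp]
  exact getD_ofFn_append θ _ _ (by simp; omega) i

/-- The first part of a play, up to the splitting of the state. -/
theorem rawEval_playSplit (A : Circuit stdGates l (b + c)) (x θ : Bits l) (r : List Bool)
    (f : Bool) :
    rawEval genGates (((List.range l).flatMap fun _ => [.prep 0, .prep 0]) ++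
      (randomDot l (l + l + l + 1) (l + l) ++ (copyBits l (l + l + l + l + l + 1) ++
      (prepWiesner l (l + l + l + l + l + 1) (l + l + l + l + l + l + 1) ++ A.raw))))
      (ket (f :: (List.ofFn x ++ (List.ofFn θ ++ r)))
        (f :: (List.ofFn x ++ (List.ofFn θ ++ r)))) =
      ∑ y : Bits l, ((2 : ℂ) ^ l)⁻¹ • toFree
        (List.ofFn (Fin.append θ y) ++ (List.replicate (l + l) false ++
          xor f (dot x y) :: (List.ofFn x ++ (List.ofFn θ ++ r))))
        (List.ofFn (Fin.append θ y) ++ (List.replicate (l + l) false ++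
          xor f (dot x y) :: (List.ofFn x ++ (List.ofFn θ ++ r)))) (A.eval (wiesnerOp x θ)) := by
  have hx : ∀ i : Fin l, (List.ofFn x ++ (List.ofFn θ ++ r)).getD (0 + i) false = x i :=
    getD_ofFn_append x [] _ rfl
  -- The challenge drawn here stays behind the state and is that of `C`; the challenge of `B` is put
  -- in front after the splitting. This produces the order of wires that the two circuits expect.
  rw [rawEval_append, rawEval_prepZeros, rawEval_append,
    rawEval_randomDot (m := 0) l x _ _ _ _ f f (by simp) (by simp) (by omega) hx hx, map_sum]
  refine Finset.sum_congr rfl fun y _ => ?_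
  have hθ := getD_append_cons_ofFn_append x θ
    (List.ofFn y ++ List.replicate (l + l) false) r (xor f (dot x y)) rfl
  rw [List.append_assoc] at hθ
  rw [map_smul, rawEval_append, rawEval_copyBits (m := l + (l + l) + 1 + l) l θ _ _ (by omega)
    (by simpa using hθ) (by simpa using hθ), rawEval_append]
  set u := List.ofFn θ ++ (List.ofFn y ++ List.replicate (l + l) false) with hu
  have hul : u.length = l + l + l + l := by simp [hu]; omega
  have e : List.ofFn θ ++ (List.ofFn y ++ (List.replicate (l + l) false ++
      xor f (dot x y) :: (List.ofFn x ++ (List.ofFn θ ++ r)))) =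
      u ++ xor f (dot x y) :: (List.ofFn x ++ (List.ofFn θ ++ r)) := by simp [hu]
  have e' : List.ofFn (Fin.append θ y) ++ (List.replicate (l + l) false ++
      xor f (dot x y) :: (List.ofFn x ++ (List.ofFn θ ++ r))) =
      u ++ xor f (dot x y) :: (List.ofFn x ++ (List.ofFn θ ++ r)) := by
    rw [List.ofFn_fin_append]; simp [hu]
  rw [e, e', rawEval_prepWiesner (m := l + l + l + l + 1) (m' := l + l + l + l + 1 + l) l x θ _
    (by omega) (by omega) (getD_append_cons_ofFn x θ _ _ _ (by omega))
    (getD_append_cons_ofFn_append x θ _ _ _ (by omega)), ← toFree_wiesner]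
  exact congrArg _ (rawEval_raw_std A _ _ (wiesnerOp x θ))

/-- The second part of a play, for a matrix unit. -/
theorem rawEval_playAnswer (B : Circuit stdGates (l + l + b) 1)
    (C : Circuit stdGates (c + (l + l)) 1) (x θ y' : Bits l) (i k : Bits b) (j j' : Bits c)
    (r : List Bool) (f : Bool) :
    rawEval genGates (randomDot l (l + l + b + (c + (l + l)) + l + 1)
        (l + l + b + (c + (l + l))) ++
      (copyBits l (l + l + b + (c + (l + l)) + l + l + l + 1) ++
      (addOutput B.raw (c + (l + l) + l + l) ++ (addOutput C.raw (l + l) ++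
      (List.range l).flatMap fun _ => [.trace 0, .trace 0]))))
      (ket (List.ofFn (Fin.append i j) ++ (List.ofFn (Fin.append θ y') ++
          (List.replicate (l + l) false ++ f :: (List.ofFn x ++ (List.ofFn θ ++ r)))))
        (List.ofFn (Fin.append k j') ++ (List.ofFn (Fin.append θ y') ++
          (List.replicate (l + l) false ++ f :: (List.ofFn x ++ (List.ofFn θ ++ r)))))) =
      ∑ y : Bits l, ((2 : ℂ) ^ l)⁻¹ • ∑ o : Bool, ∑ o' : Bool,
        (B.eval (Matrix.single (Fin.append (Fin.append θ y) i) (Fin.append (Fin.append θ y) k) 1)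
            (fun _ => o) (fun _ => o) *
          C.eval (Matrix.single (Fin.append j (Fin.append θ y')) (Fin.append j' (Fin.append θ y')) 1)
            (fun _ => o') (fun _ => o')) •
        ket (xor (xor (xor f (dot x y)) o) o' :: (List.ofFn x ++ (List.ofFn θ ++ r)))
          (xor (xor (xor f (dot x y)) o) o' :: (List.ofFn x ++ (List.ofFn θ ++ r))) := by
  set D : List Bool := List.replicate (l + l) false with hD
  have hDl : D.length = l + l := by simp [hD]
  set z := List.ofFn (Fin.append θ y') with hz
  have hzl : z.length = l + l := by simp [hz]
  set t : List Bool := List.ofFn x ++ (List.ofFn θ ++ r) with ht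
  set v := List.ofFn (Fin.append i j) with hv
  set v' := List.ofFn (Fin.append k j') with hv'
  have hvl : v.length = b + c := by simp [hv]
  have hvl' : v'.length = b + c := by simp [hv']
  have e : ∀ v : List Bool, v ++ (z ++ (D ++ f :: t)) = (v ++ (z ++ D)) ++ f :: t := by simp
  have hx : ∀ i : Fin l, t.getD (0 + i) false = x i := getD_ofFn_append x [] _ rfl
  rw [e, e, rawEval_append, rawEval_randomDot (m := 0) l x _ _ _ _ f f
    (by simp [hDl, hzl, hvl]; omega) (by simp [hDl, hzl, hvl']; omega) (by omega)
    hx hx, map_sum]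
  refine Finset.sum_congr rfl fun y _ => ?_
  have hθ : ∀ v : List Bool, v.length = b + c → ∀ i : Fin l,
      (List.ofFn y ++ ((v ++ (z ++ D)) ++ xor f (dot x y) :: t)).getD
        (l + (b + c + (l + l + (l + l))) + 1 + l + i) false = θ i := by
    intro v hv i
    rw [← List.append_assoc]
    exact getD_append_cons_ofFn_append x θ _ r _ (by simp [hv, hzl, hDl]) i
  rw [map_smul, rawEval_append, rawEval_copyBits (m := l + (b + c + (l + l + (l + l))) + 1 + l) l θ
    _ _ (by omega) (hθ v hvl) (hθ v' hvl'), rawEval_append]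
  -- The string starts with `θ`, `y` and the first share, the input of `B`. It goes on with the
  -- second share, `θ` and `y'`, the input of `C` once `B` has consumed its own wires.
  have e' : ∀ (i : Bits b) (j : Bits c), List.ofFn θ ++ (List.ofFn y ++
      (List.ofFn (Fin.append i j) ++ (z ++ D) ++ xor f (dot x y) :: t)) =
      List.ofFn (Fin.append (Fin.append θ y) i) ++ ((List.ofFn j ++ (z ++ D)) ++
        xor f (dot x y) :: t) := by
    intro i j
    simp only [List.ofFn_fin_append, List.append_assoc]
  rw [hv, hv', e', e', rawEval_addOutput B _ _ _ _ _ _ _ _ (by simp [hzl, hDl]; omega)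
    (by simp [hzl, hDl]; omega), map_sum]
  congr 1
  refine Finset.sum_congr rfl fun o _ => ?_
  have e'' : ∀ (j : Bits c) (g : Bool), (List.ofFn j ++ (z ++ D)) ++ g :: t =
      List.ofFn (Fin.append j (Fin.append θ y')) ++ (D ++ g :: t) := by
    intro j g
    rw [hz]
    simp only [List.ofFn_fin_append, List.append_assoc]
  rw [map_smul, rawEval_append, e'', e'', rawEval_addOutput C _ _ _ _ _ _ _ _ hDl hDl, map_sum,
    Finset.smul_sum]
  refine Finset.sum_congr rfl fun o' _ => ?_
  rw [map_smul, rawEval_traceFront l D _ hDl, smul_smul]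

/-- The effect of a play as a sum over the challenges and the answers. -/
theorem rawEval_play_eq_sum (A : Circuit stdGates l (b + c)) (B : Circuit stdGates (l + l + b) 1)
    (C : Circuit stdGates (c + (l + l)) 1) (x θ : Bits l) (r : List Bool) :
    rawEval genGates (play l (l + l + b) (c + (l + l)) A.raw B.raw C.raw)
      (ket (false :: (List.ofFn x ++ (List.ofFn θ ++ r)))
        (false :: (List.ofFn x ++ (List.ofFn θ ++ r)))) =
      ∑ y : Bits l, ∑ y' : Bits l, ∑ o : Bool, ∑ o' : Bool,
        (((2 : ℂ) ^ l)⁻¹ * ((2 : ℂ) ^ l)⁻¹ * gameProb A.eval B.eval C.eval x θ y y' o o') •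
        ket (xor (xor (xor (dot x y') (dot x y)) o) o' :: (List.ofFn x ++ (List.ofFn θ ++ r)))
          (xor (xor (xor (dot x y') (dot x y)) o) o' :: (List.ofFn x ++ (List.ofFn θ ++ r))) := by
  set t : List Bool := List.ofFn x ++ (List.ofFn θ ++ r) with ht
  set K : Bool → FreeOp := fun a => ket (a :: t) (a :: t) with hK
  have hplay : ∀ cA cB cC : List RawGate, ∀ aB aC, play l aB aC cA cB cC =
      (((List.range l).flatMap fun _ => [.prep 0, .prep 0]) ++
      (randomDot l (l + l + l + 1) (l + l) ++ (copyBits l (l + l + l + l + l + 1) ++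
      (prepWiesner l (l + l + l + l + l + 1) (l + l + l + l + l + l + 1) ++ cA)))) ++
      (randomDot l (aB + aC + l + 1) (aB + aC) ++ (copyBits l (aB + aC + l + l + l + 1) ++
      (addOutput cB (aC + l + l) ++ (addOutput cC (l + l) ++
      (List.range l).flatMap fun _ => [.trace 0, .trace 0])))) := by
    intros
    simp only [play, List.append_assoc]
  rw [hplay, rawEval_append, rawEval_playSplit, map_sum, Finset.sum_comm]
  refine Finset.sum_congr rfl fun y' _ => ?_
  rw [map_smul, toFree_apply]
  simp only [sum_bits_append, map_sum, map_smul, rawEval_playAnswer, Bool.false_xor]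
  set β : Bits l → Bits b → Bits b → Bool → ℂ := fun y i k o => B.eval (Matrix.single
    (Fin.append (Fin.append θ y) i) (Fin.append (Fin.append θ y) k) 1) (fun _ => o) (fun _ => o)
  set γ : Bits c → Bits c → Bool → ℂ := fun j j' o' => C.eval (Matrix.single
    (Fin.append j (Fin.append θ y')) (Fin.append j' (Fin.append θ y')) 1) (fun _ => o') (fun _ => o')
  set σ := A.eval (wiesnerOp x θ)
  change ((2 : ℂ) ^ l)⁻¹ • ∑ i : Bits b, ∑ j : Bits c, ∑ k : Bits b, ∑ j' : Bits c,
    σ (Fin.append i j) (Fin.append k j') • ∑ y : Bits l, ((2 : ℂ) ^ l)⁻¹ • ∑ o : Bool, ∑ o' : Bool,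
      (β y i k o * γ j j' o') • K (xor (xor (xor (dot x y') (dot x y)) o) o') =
    ∑ y : Bits l, ∑ o : Bool, ∑ o' : Bool, (((2 : ℂ) ^ l)⁻¹ * ((2 : ℂ) ^ l)⁻¹ *
      ∑ i : Bits b, ∑ j : Bits c, ∑ k : Bits b, ∑ j' : Bits c,
        σ (Fin.append i j) (Fin.append k j') * (β y i k o * γ j j' o')) •
      K (xor (xor (xor (dot x y') (dot x y)) o) o')
  have hc : ∀ (S : Type) [Fintype S] (F : Bits b → Bits c → Bits b → Bits c → S → FreeOp),
      ∑ i, ∑ j, ∑ k, ∑ j', ∑ s, F i j k j' s = ∑ s, ∑ i, ∑ j, ∑ k, ∑ j', F i j k j' s :=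
    fun S _ F => (Finset.sum_congr rfl fun i _ => (Finset.sum_congr rfl fun j _ =>
      (Finset.sum_congr rfl fun k _ => Finset.sum_comm).trans Finset.sum_comm).trans
        Finset.sum_comm).trans Finset.sum_comm
  simp only [Finset.mul_sum, Finset.sum_smul, Finset.smul_sum, smul_smul]
  rw [hc]
  refine Finset.sum_congr rfl fun y _ => ?_
  rw [hc]
  refine Finset.sum_congr rfl fun o _ => ?_
  rw [hc]
  refine Finset.sum_congr rfl fun o' _ => Finset.sum_congr rfl fun i _ =>
    Finset.sum_congr rfl fun j _ => Finset.sum_congr rfl fun k _ =>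
    Finset.sum_congr rfl fun j' _ => ?_
  congr 1
  ring

/-- A function of a bit is an even part plus the sign times an odd part, so its mean depends only on
the mean sign. -/
theorem sum_smul_bool {ι V : Type*} [Fintype ι] [AddCommGroup V] [Module ℂ V] (w : ι → ℝ)
    (g : ι → Bool) (K : Bool → V) (hw : ∑ i, w i = 1) :
    ∑ i, (w i : ℂ) • K (g i) = (((1 + ∑ i, w i * sgn (g i)) / 2 : ℝ) : ℂ) • K false +
      (((1 - ∑ i, w i * sgn (g i)) / 2 : ℝ) : ℂ) • K true := by
  have h : ∀ a, K a = (2 : ℂ)⁻¹ • (K false + K true) + ((2 : ℂ)⁻¹ * (sgn a : ℂ)) •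
      (K false - K true) := by
    intro a
    cases a <;> simp only [sgn] <;> push_cast <;> simp <;> module
  have hw' : ∑ i, (w i : ℂ) = 1 := by exact_mod_cast hw
  rw [Finset.sum_congr rfl fun i _ => by rw [h (g i)]]
  simp only [smul_add, Finset.sum_add_distrib, smul_smul, ← Finset.sum_smul, ← Finset.sum_mul,
    hw']
  have hs : ∑ i, (w i : ℂ) * (2⁻¹ * (sgn (g i) : ℂ)) =
      2⁻¹ * ((∑ i, w i * sgn (g i) : ℝ) : ℂ) := by
    push_cast
    rw [Finset.mul_sum]
    exact Finset.sum_congr rfl fun i _ => by ring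
  rw [hs]
  push_cast
  module

/-- A play is lost with probability `(1 - gameBias) / 2`. -/
theorem rawEval_play (A : Circuit stdGates l (b + c)) (B : Circuit stdGates (l + l + b) 1)
    (C : Circuit stdGates (c + (l + l)) 1) (x θ : Bits l) (r : List Bool) :
    rawEval genGates (play l (l + l + b) (c + (l + l)) A.raw B.raw C.raw)
      (ket (false :: (List.ofFn x ++ (List.ofFn θ ++ r)))
        (false :: (List.ofFn x ++ (List.ofFn θ ++ r)))) =
      (((1 + gameBias A.eval B.eval C.eval x θ) / 2 : ℝ) : ℂ) •
        ket (false :: (List.ofFn x ++ (List.ofFn θ ++ r)))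
          (false :: (List.ofFn x ++ (List.ofFn θ ++ r))) +
      (((1 - gameBias A.eval B.eval C.eval x θ) / 2 : ℝ) : ℂ) •
        ket (true :: (List.ofFn x ++ (List.ofFn θ ++ r)))
          (true :: (List.ofFn x ++ (List.ofFn θ ++ r))) := by
  rw [rawEval_play_eq_sum]
  set t : List Bool := List.ofFn x ++ (List.ofFn θ ++ r) with ht
  have hre : ∀ y y' o o', gameProb A.eval B.eval C.eval x θ y y' o o' =
      ((gameProb A.eval B.eval C.eval x θ y y' o o').re : ℂ) := fun y y' o o' =>
    Complex.ext rfl (Complex.nonneg_iff.1 (gameProb_nonneg A.isChannel_eval B.isChannel_eval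
      C.isChannel_eval x θ y y' o o')).2.symm
  have key := sum_smul_bool (ι := Bits l × Bits l × Bool × Bool)
    (fun q => (2 ^ l)⁻¹ * (2 ^ l)⁻¹ * (gameProb A.eval B.eval C.eval x θ q.1 q.2.1 q.2.2.1
      q.2.2.2).re) (fun q => xor (xor (xor (dot x q.2.1) (dot x q.1)) q.2.2.1) q.2.2.2)
    (fun a => ket (a :: t) (a :: t)) (by
      have h1 : ∀ y y', ∑ o, ∑ o', (gameProb A.eval B.eval C.eval x θ y y' o o').re = 1 := by
        intro y y'
        simpa using congrArg Complex.re (sum_gameProb A.isChannel_eval B.isChannel_eval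
          C.isChannel_eval x θ y y')
      simp only [Fintype.sum_prod_type, ← Finset.mul_sum, h1]
      simp
      field_simp)
  have hbias : ∑ q : Bits l × Bits l × Bool × Bool, (2 ^ l)⁻¹ * (2 ^ l)⁻¹ *
      (gameProb A.eval B.eval C.eval x θ q.1 q.2.1 q.2.2.1 q.2.2.2).re *
      sgn (xor (xor (xor (dot x q.2.1) (dot x q.1)) q.2.2.1) q.2.2.2) =
      gameBias A.eval B.eval C.eval x θ := by
    simp only [Fintype.sum_prod_type, gameBias, Finset.mul_sum, sgn_xor]
    refine Finset.sum_congr rfl fun y _ => Finset.sum_congr rfl fun y' _ =>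
      Finset.sum_congr rfl fun o _ => Finset.sum_congr rfl fun o' _ => ?_
    ring
  rw [hbias] at key
  rw [← key]
  simp only [Fintype.sum_prod_type]
  refine Finset.sum_congr rfl fun y _ => Finset.sum_congr rfl fun y' _ =>
      Finset.sum_congr rfl fun o _ => Finset.sum_congr rfl fun o' _ => ?_
  rw [hre]
  push_cast
  rfl

/-! ### Numbers of wires in a play. -/

theorem rawValid_randomBit {a p : ℕ} (hp : p ≤ a) : RawValid genGates a (randomBit p) (a + 1) := by
  refine ⟨⟨trivial, hp⟩, ⟨trivial, by omega⟩, ⟨⟨hadamard, rfl, rfl, by simp, ?_⟩,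
    ⟨cnot, rfl, rfl, by simp, ?_⟩, ⟨trivial, by omega⟩, ?_⟩⟩
  · simp; omega
  · simp; omega
  · show a + 1 + 1 - 1 = a + 1
    omega

theorem rawValid_cnot {a i j : ℕ} (hij : i ≠ j) (hi : i < a) (hj : j < a) :
    RawValid genGates a [.gate 4 [i, j]] a :=
  ⟨⟨cnot, rfl, rfl, by simpa using hij, by simp [hi, hj]⟩, rfl⟩

theorem rawValid_toffoli {a i j k : ℕ} (hij : i ≠ j) (hik : i ≠ k) (hjk : j ≠ k) (hi : i < a)
    (hj : j < a) (hk : k < a) : RawValid genGates a [.gate 0 [i, j, k]] a :=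
  ⟨⟨toffoli, rfl, rfl, by simp [hij, hik, hjk], by simp [hi, hj, hk]⟩, rfl⟩

theorem rawValid_prepZeros (l a : ℕ) :
    RawValid genGates a ((List.range l).flatMap fun _ => [.prep 0, .prep 0]) (a + (l + l)) := by
  have h := rawValid_flatMap_range (G := genGates) (c := fun _ => [.prep 0, .prep 0])
    (a := fun i => a + (i + i)) l (fun i _ => ⟨⟨trivial, by omega⟩, ⟨trivial, by omega⟩, by
      show a + (i + i) + 1 + 1 = a + (i + 1 + (i + 1))
      omega⟩)
  exact h

theorem rawValid_traceFront (l a : ℕ) :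
    RawValid genGates (a + (l + l)) ((List.range l).flatMap fun _ => [.trace 0, .trace 0]) a := by
  have h := rawValid_flatMap_range (G := genGates) (c := fun _ => [.trace 0, .trace 0])
    (a := fun i => a + ((l - i) + (l - i))) l (fun i _ => ⟨⟨trivial, by omega⟩,
      ⟨trivial, by omega⟩, by
      show a + ((l - i) + (l - i)) - 1 - 1 = a + ((l - (i + 1)) + (l - (i + 1)))
      omega⟩)
  simpa using h

theorem rawValid_copyBits {l k a : ℕ} (hk : l ≤ k) (hka : k ≤ a) :
    RawValid genGates a (copyBits l k) (a + l) :=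
  rawValid_flatMap_range (G := genGates) (c := fun _ => [.prep 0, .gate 4 [k, 0]])
    (a := fun i => a + i) l fun i _ => ⟨⟨trivial, by omega⟩,
      rawValid_cnot (by omega) (by omega) (by omega)⟩

theorem rawValid_randomDot {l k p a : ℕ} (hk : p + l < k) (hka : k ≤ a) :
    RawValid genGates a (randomDot l k p) (a + l) :=
  rawValid_flatMap_range (G := genGates)
    (c := fun j => randomBit 0 ++ [RawGate.gate 0 [0, k, p + j + 1]]) (a := fun i => a + i) l
    fun i hi => (rawValid_randomBit (by omega)).append
      (rawValid_toffoli (by omega) (by omega) (by omega) (by omega) (by omega) (by omega))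

theorem rawValid_prepWiesner {l k k' a : ℕ} (hk : l ≤ k) (hka : k ≤ a) (hk' : l ≤ k')
    (hka' : k' ≤ a) : RawValid genGates a (prepWiesner l k k') (a + l) :=
  rawValid_flatMap_range (G := genGates)
    (c := fun _ => [.prep 0, .gate 4 [k, 0], .gate 6 [k', 0]]) (a := fun i => a + i) l
    fun i _ => ⟨⟨trivial, by omega⟩, ⟨cnot, rfl, rfl, by simp; omega, by simp; omega⟩,
      ⟨controlledHadamard, rfl, rfl, by simp; omega, by simp; omega⟩, rfl⟩

theorem rawValid_addOutput {a p r : ℕ} (C : Circuit stdGates a 1) (hp : p < r) :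
    RawValid genGates (a + r) (addOutput C.raw p) r :=
  ((C.rawValid.extends genGates_extends).add_right r).append
    ⟨⟨cnot, rfl, rfl, by simp, by simp; omega⟩, ⟨trivial, by omega⟩, Nat.add_sub_cancel_left 1 r⟩

theorem rawValid_play (A : Circuit stdGates l (b + c)) (B : Circuit stdGates (l + l + b) 1)
    (C : Circuit stdGates (c + (l + l)) 1) {r : ℕ} (hr : l + l + 1 ≤ r) :
    RawValid genGates r (play l (l + l + b) (c + (l + l)) A.raw B.raw C.raw) r := by
  have hA := (A.rawValid.extends genGates_extends).add_right (r + (l + l) + l + l)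
  have hB := rawValid_addOutput (r := c + (r + (l + l) + l + l)) B
    (p := c + (l + l) + l + l) (by omega)
  have hC := rawValid_addOutput (r := r + (l + l)) C (p := l + l) (by omega)
  refine (rawValid_prepZeros l r).append ((rawValid_randomDot (by omega) (by omega)).append
    ((rawValid_copyBits (by omega) (by omega)).append
    ((rawValid_prepWiesner (by omega) (by omega) (by omega) (by omega)).append
    (RawValid.append (b := b + c + (r + (l + l) + l + l)) ?_
    ((rawValid_randomDot (by omega) (by omega)).append
    ((rawValid_copyBits (by omega) (by omega)).append
    (RawValid.append (b := c + (r + (l + l) + l + l)) ?_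
    (RawValid.append (b := r + (l + l)) ?_ (rawValid_traceFront l r)))))))))
  · rwa [Nat.add_comm] at hA
  · convert hB using 1
    omega
  · convert hC using 1
    omega

end

noncomputable section

open Function (update)

/-! ### Estimating the winning probability of a candidate -/

/-- The state `|t⟩⟨t|`. -/
def basisState (t : List Bool) : FreeOp := ket t t

theorem eval_prep_zero (t : List Bool) :
    (RawGate.prep 0).eval genGates (basisState t) = basisState (false :: t) := by
  rw [basisState, eval_prep, List.insertIdx_zero]
  rfl

theorem eval_trace_zero (a : Bool) (t : List Bool) :
    (RawGate.trace 0).eval genGates (basisState (a :: t)) = basisState t := by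
  rw [basisState, eval_trace]
  simp [basisState]

theorem eval_fredkin_basisState (i j k : ℕ) (t : List Bool) :
    (RawGate.gate 5 [i, j, k]).eval genGates (basisState t) =
      basisState (if t.getD i false then swapBits t j k else t) := by
  rw [basisState, eval_fredkin]
  rfl

theorem swapBits_append (u v w : List Bool) (a b : Bool) {i j : ℕ} (hi : i = u.length)
    (hj : j = u.length + 1 + v.length) :
    swapBits (u ++ a :: (v ++ b :: w)) i j = u ++ b :: (v ++ a :: w) := by
  have e : ∀ a b : Bool, u ++ a :: (v ++ b :: w) = (u ++ a :: v) ++ b :: w := by simp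
  have h₁ : (u ++ a :: (v ++ b :: w)).getD j false = b := by
    rw [e, getD_append_add (i := 0) _ _ (by simp; omega)]
    rfl
  have h₂ : (u ++ a :: (v ++ b :: w)).getD i false = a := by
    rw [getD_append_add (i := 0) _ _ (by omega)]
    rfl
  have h₃ : (u ++ a :: (v ++ b :: w)).set i b = u ++ b :: (v ++ b :: w) := by
    rw [set_append_add (i := 0) _ _ (by omega)]
    rfl
  rw [swapBits, h₁, h₂, h₃, e, set_append_add (i := 0) _ _ (by simp; omega)]
  simp

/-- Move the wire at position `p` behind the following `n` wires, if wire `0` is set. -/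
def rotate (p n : ℕ) : List RawGate :=
  (List.range n).flatMap fun j => [.gate 5 [0, p + j, p + j + 1]]

/-- The wire travels by controlled swaps of neighbours, one place per gate. Hence the induction adds
a bit at the end of `w`. -/
theorem rawEval_rotate {p : ℕ} (f a : Bool) (u w v : List Bool) (hp : p = u.length + 1) :
    rawEval genGates (rotate p w.length) (basisState (f :: (u ++ a :: (w ++ v)))) =
      basisState (f :: (u ++ if f then w ++ a :: v else a :: (w ++ v))) := by
  induction w using List.reverseRecOn generalizing v with
  | nil => cases f <;> rfl
  | append_singleton w b ih =>
    have h := ih (b :: v)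
    rw [rotate] at h ⊢
    rw [List.length_append, List.length_singleton, List.range_succ, List.flatMap_append,
      rawEval_append, List.append_assoc, List.singleton_append, h]
    simp only [List.flatMap_cons, List.flatMap_nil, List.append_nil, rawEval_cons, rawEval_nil,
      eval_fredkin_basisState, List.getD_cons_zero]
    cases f
    · simp
    · have := swapBits_append (true :: (u ++ w)) [] v a b (i := p + w.length)
        (j := p + w.length + 1) (by simp; omega) (by simp; omega)
      simp only [if_true]
      congr 1
      simpa using this

/-! ### A unary counter with one mark, and the binomial distribution. -/

/-- The string `0^p 1 0^s`. -/
def oneHot (p s : ℕ) : List Bool := List.replicate p false ++ true :: List.replicate s false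

theorem length_oneHot (p s : ℕ) : (oneHot p s).length = p + s + 1 := by
  simp [oneHot]; omega

theorem getD_oneHot (p s i : ℕ) : (oneHot p s).getD i false = decide (i = p) := by
  rw [oneHot]
  rcases lt_trichotomy i p with h | rfl | h
  · rw [List.getD_append _ _ _ _ (by simpa using h), List.getD_replicate _ h]
    simp [h.ne]
  · rw [getD_append_add (i := 0) _ _ (by simp)]
    simp
  · obtain ⟨k, rfl⟩ : ∃ k, i = p + 1 + k := ⟨i - p - 1, by omega⟩
    rw [getD_append_add (i := k + 1) _ _ (by simp; omega), List.getD_cons_succ]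
    rcases lt_or_ge k s with hk | hk
    · rw [List.getD_replicate _ hk]
      simp; omega
    · rw [List.getD_eq_default _ _ (by simpa using hk)]
      simp; omega

/-- The expectation of `F` of the number of successes in `n` trials with success probability
`q`. -/
def binomMean {V : Type*} [AddCommGroup V] [Module ℝ V] (q : ℝ) : ℕ → (ℕ → V) → V
  | 0, F => F 0
  | n + 1, F => (1 - q) • binomMean q n F + q • binomMean q n fun i => F (i + 1)

section BinomMean

variable {V W : Type*} [AddCommGroup V] [Module ℝ V] [AddCommGroup W] [Module ℝ W] (q : ℝ)

theorem binomMean_congr (n : ℕ) {F F' : ℕ → V} (h : ∀ i ≤ n, F i = F' i) :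
    binomMean q n F = binomMean q n F' := by
  induction n generalizing F F' with
  | zero => exact h 0 le_rfl
  | succ n ih =>
    rw [binomMean, binomMean, ih fun i hi => h i (by omega),
      ih (F := fun i => F (i + 1)) fun i hi => h (i + 1) (by omega)]

theorem map_binomMean (Φ : V →ₗ[ℝ] W) (n : ℕ) (F : ℕ → V) :
    Φ (binomMean q n F) = binomMean q n fun i => Φ (F i) := by
  induction n generalizing F with
  | zero => rfl
  | succ n ih => simp only [binomMean, map_add, map_smul, ih]

theorem binomMean_const (n : ℕ) (v : V) : binomMean q n (fun _ => v) = v := by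
  induction n with
  | zero => rfl
  | succ n ih => rw [binomMean, ih]; module

theorem binomMean_ite (n : ℕ) (p : ℕ → Prop) [DecidablePred p] (v w : V) :
    binomMean q n (fun i => if p i then v else w) =
      binomMean q n (fun i => if p i then (1 : ℝ) else 0) • v +
        (1 - binomMean q n fun i => if p i then (1 : ℝ) else 0) • w := by
  have h := map_binomMean q (LinearMap.toSpanSingleton ℝ V (v - w)) n
    fun i => if p i then (1 : ℝ) else 0
  have h' : ∀ i, (if p i then v else w) = (LinearMap.toSpanSingleton ℝ V (v - w)
      (if p i then (1 : ℝ) else 0)) + w := by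
    intro i
    split_ifs <;> simp
  have hadd : ∀ (n : ℕ) (F : ℕ → V), binomMean q n (fun i => F i + w) = binomMean q n F + w := by
    intro n
    induction n with
    | zero => intro F; rfl
    | succ n ih =>
      intro F
      rw [binomMean, ih, ih fun i => F (i + 1), binomMean]
      module
  rw [funext h', hadd, ← h, LinearMap.toSpanSingleton_apply]
  module

end BinomMean

variable {l b c : ℕ}

/-- Play once, and shift the mark among the `k + 1` wires of the counter if the play is lost. -/
def countPlay (l k aB aC : ℕ) (cA cB cC : List RawGate) : List RawGate :=
  [.prep 0] ++ (play l aB aC cA cB cC ++ (rotate (l + l + 1) k ++ [.trace 0]))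

theorem ofReal_smul_freeOp (r : ℝ) (v : FreeOp) : (r : ℂ) • v = r • v := by
  ext; simp

/-- Moving the first wire of the counter to its end brings the mark one place forward. This is a
shift and not a wrap-around because the first wire is `false`, the mark being at a positive place.
-/
theorem rawEval_countPlay (A : Circuit stdGates l (b + c)) (B : Circuit stdGates (l + l + b) 1)
    (C : Circuit stdGates (c + (l + l)) 1) {k p s : ℕ} (hk : k = p + 1 + s) (x θ : Bits l)
    (o : List Bool) :
    rawEval genGates (countPlay l k (l + l + b) (c + (l + l)) A.raw B.raw C.raw)
      (basisState (List.ofFn (Fin.append x θ) ++ (oneHot (p + 1) s ++ o))) =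
      (1 - (1 - gameBias A.eval B.eval C.eval x θ) / 2) •
        basisState (List.ofFn (Fin.append x θ) ++ (oneHot (p + 1) s ++ o)) +
      ((1 - gameBias A.eval B.eval C.eval x θ) / 2) •
        basisState (List.ofFn (Fin.append x θ) ++ (oneHot p (s + 1) ++ o)) := by
  set u := List.ofFn (Fin.append x θ) with hu
  have hul : u.length = l + l := by simp [hu]
  set w := oneHot p s with hw
  have hwl : w.length = k := by rw [hw, length_oneHot]; omega
  have e₁ : oneHot (p + 1) s ++ o = false :: (w ++ o) := by
    simp [hw, oneHot, List.replicate_succ]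
  have e₂ : oneHot p (s + 1) ++ o = w ++ false :: o := by
    have : List.replicate (s + 1) false = List.replicate s false ++ [false] := by
      rw [List.replicate_succ']
    simp [hw, oneHot, this]
  have hrot := fun f => rawEval_rotate (p := l + l + 1) f false u w o (by omega)
  rw [hwl] at hrot
  have hplay := rawEval_play A B C x θ (false :: (w ++ o))
  have eu : ∀ t, List.ofFn x ++ (List.ofFn θ ++ t) = u ++ t := by
    intro t
    rw [hu, List.ofFn_fin_append, List.append_assoc]
  simp only [eu] at hplay
  rw [countPlay, rawEval_append, e₁, e₂]
  simp only [rawEval_cons, rawEval_nil, eval_prep_zero, rawEval_append]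
  have hplay' := hplay
  change rawEval _ _ (basisState _) = _ • basisState _ + _ • basisState _ at hplay'
  rw [hplay', map_add, map_add, map_smul, map_smul, map_smul, map_smul, hrot, hrot,
    eval_trace_zero, eval_trace_zero, ofReal_smul_freeOp, ofReal_smul_freeOp]
  simp only [Bool.false_eq_true, if_false, if_true]
  congr 2
  ring

/-- The candidate is classical and returned unchanged by a play, so the losses are independent. The
condition `n ≤ p` keeps the mark from reaching the front too early. -/
theorem rawEval_countPlays (A : Circuit stdGates l (b + c)) (B : Circuit stdGates (l + l + b) 1)
    (C : Circuit stdGates (c + (l + l)) 1) {k : ℕ} (n : ℕ) {p s : ℕ} (hn : n ≤ p)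
    (hk : k = p + s) (x θ : Bits l) (o : List Bool) :
    rawEval genGates ((List.range n).flatMap fun _ =>
        countPlay l k (l + l + b) (c + (l + l)) A.raw B.raw C.raw)
      (basisState (List.ofFn (Fin.append x θ) ++ (oneHot p s ++ o))) =
      binomMean ((1 - gameBias A.eval B.eval C.eval x θ) / 2) n fun i =>
        basisState (List.ofFn (Fin.append x θ) ++ (oneHot (p - i) (s + i) ++ o)) := by
  induction n generalizing p s with
  | zero => simp [binomMean]
  | succ n ih =>
    obtain ⟨p, rfl⟩ : ∃ p', p = p' + 1 := ⟨p - 1, by omega⟩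
    rw [flatMap_range_succ_const, rawEval_append, rawEval_countPlay A B C (by omega), map_add,
      ← ofReal_smul_freeOp, ← ofReal_smul_freeOp, map_smul, map_smul, ofReal_smul_freeOp,
      ofReal_smul_freeOp, ih (by omega) (by omega), ih (by omega) (by omega), binomMean]
    congr 3
    funext i
    rw [show p + 1 - (i + 1) = p - i by omega, show s + 1 + i = s + (i + 1) by omega]

/-- Exchange the first `n` wires with `n` wires from position `q` on, if wire `p` is set. -/
def exchange (n p q : ℕ) : List RawGate :=
  (List.range n).flatMap fun i => [.gate 5 [p, i, q + i]]

/-- The control wire lies in the middle segment, which is never moved, so its value is the same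
before every swap whatever the first segment holds. -/
theorem rawEval_exchange {p q : ℕ} (w m o : List Bool) (a : Bool) (hwo : w.length = o.length)
    (ha : ∀ w : List Bool, w.length = o.length → ∀ t : List Bool, (w ++ (m ++ t)).getD p false = a)
    (hq : q = w.length + m.length) :
    rawEval genGates (exchange w.length p q) (basisState (w ++ (m ++ o))) =
      basisState (if a then o ++ (m ++ w) else w ++ (m ++ o)) := by
  suffices h : ∀ n ≤ w.length, rawEval genGates (exchange n p q) (basisState (w ++ (m ++ o))) =
      basisState (if a then (o.take n ++ w.drop n) ++ (m ++ (w.take n ++ o.drop n))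
        else w ++ (m ++ o)) by
    rw [h _ le_rfl, List.drop_length, List.take_length, hwo, List.take_length, List.drop_length]
    simp
  intro n hn
  induction n with
  | zero => simp [exchange]
  | succ n ih =>
    have e := ih (by omega)
    rw [exchange] at e ⊢
    rw [List.range_succ, List.flatMap_append, rawEval_append, e]
    simp only [List.flatMap_cons, List.flatMap_nil, List.append_nil, rawEval_cons, rawEval_nil,
      eval_fredkin_basisState]
    cases a
    · simp only [Bool.false_eq_true, if_false]
      rw [ha w hwo]
      simp
    · simp only [if_true]
      rw [ha (o.take n ++ w.drop n) (by simp; omega), if_pos rfl]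
      have hw : w.drop n = w[n] :: w.drop (n + 1) := List.drop_eq_getElem_cons (by omega)
      have ho : o.drop n = o[n] :: o.drop (n + 1) := List.drop_eq_getElem_cons (by omega)
      have hw' : w.take (n + 1) = w.take n ++ [w[n]] := by simp
      have ho' : o.take (n + 1) = o.take n ++ [o[n]] := by simp
      rw [hw', ho', hw, ho]
      have := swapBits_append (o.take n) (w.drop (n + 1) ++ (m ++ w.take n)) (o.drop (n + 1))
        (w[n]) (o[n]) (i := n) (j := q + n) (by simp; omega) (by simp; omega)
      congr 1
      simpa only [List.append_assoc, List.cons_append, List.nil_append] using this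

/-- Exchange the candidate with the output if the mark of the counter is at least `T`. -/
def accept (l k T U : ℕ) : List RawGate :=
  (List.range U).flatMap fun j => exchange (l + l) (l + l + T + j) (l + l + k + 1)

/-- All places from `T` to `T + U - 1` are tried, but the counter carries a single mark, so the
exchange happens at most once and is not undone. -/
theorem rawEval_accept {k T : ℕ} (U p s : ℕ) (hps : p + s = k) (hTU : T + U ≤ k + 1) (w o : List Bool)
    (hw : w.length = l + l) (ho : o.length = l + l) :
    rawEval genGates (accept l k T U) (basisState (w ++ (oneHot p s ++ o))) =
      basisState (if T ≤ p ∧ p < T + U then o ++ (oneHot p s ++ w) else w ++ (oneHot p s ++ o)) := by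
  induction U with
  | zero => rw [if_neg (by omega)]; rfl
  | succ U ih =>
    have ih := ih (by omega)
    rw [accept] at ih ⊢
    rw [List.range_succ, List.flatMap_append, rawEval_append, ih]
    simp only [List.flatMap_cons, List.flatMap_nil, List.append_nil]
    have ha : ∀ w : List Bool, w.length = l + l → ∀ t : List Bool,
        (w ++ (oneHot p s ++ t)).getD (l + l + T + U) false = decide (T + U = p) := by
      intro w hw t
      rw [getD_append_add (i := T + U) _ _ (by omega),
        List.getD_append _ _ _ _ (by rw [length_oneHot]; omega), getD_oneHot]
    have hx : ∀ w o : List Bool, w.length = l + l → o.length = l + l →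
        rawEval genGates (exchange (l + l) (l + l + T + U) (l + l + k + 1))
          (basisState (w ++ (oneHot p s ++ o))) =
        basisState (if T + U = p then o ++ (oneHot p s ++ w) else w ++ (oneHot p s ++ o)) := by
      intro w o hw ho
      have := rawEval_exchange (p := l + l + T + U) (q := l + l + k + 1) w (oneHot p s) o
        (decide (T + U = p)) (by omega) (fun w hw => ha w (by omega))
        (by rw [length_oneHot]; omega)
      rw [hw] at this
      simpa using this
    rcases lt_trichotomy p (T + U) with h | h | h
    · by_cases hT : T ≤ p
      · rw [if_pos ⟨hT, h⟩, if_pos (by omega), hx o w ho hw, if_neg (by omega)]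
      · rw [if_neg (by omega), if_neg (by omega), hx w o hw ho, if_neg (by omega)]
    · rw [if_neg (by omega), if_pos (by omega), hx w o hw ho, if_pos (by omega)]
    · rw [if_neg (by omega), if_neg (by omega), hx w o hw ho, if_neg (by omega)]

/-- One round of the generator: a random candidate replaces the output if at most `k - T` of `k`
plays are lost. -/
def genRound (l k T U aB aC : ℕ) (cA cB cC : List RawGate) : List RawGate :=
  [.prep 0, .gate 3 [0]] ++ (((List.range k).flatMap fun _ => [.prep 0]) ++
  (((List.range (l + l)).flatMap fun _ => randomBit 0) ++
  (((List.range k).flatMap fun _ => countPlay l k aB aC cA cB cC) ++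
  (accept l k T U ++ (((List.range (l + l)).flatMap fun _ => [.trace 0]) ++
  (((List.range k).flatMap fun _ => [.trace 0]) ++ [.trace 0]))))))

theorem rawEval_prepFalse (n : ℕ) (t : List Bool) :
    rawEval genGates ((List.range n).flatMap fun _ => [.prep 0]) (basisState t) =
      basisState (List.replicate n false ++ t) := by
  induction n with
  | zero => simp
  | succ n ih =>
    rw [List.range_succ, List.flatMap_append, rawEval_append, ih]
    simp [eval_prep_zero, List.replicate_succ]

theorem rawEval_traceAll (n : ℕ) (u t : List Bool) (hu : u.length = n) :
    rawEval genGates ((List.range n).flatMap fun _ => [.trace 0]) (basisState (u ++ t)) =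
      basisState t := by
  induction n generalizing u with
  | zero => simp [List.length_eq_zero_iff.1 hu]
  | succ n ih =>
    match u, hu with
    | a :: u, hu =>
      rw [flatMap_range_succ_const, rawEval_append]
      simp only [List.cons_append, rawEval_cons, eval_trace_zero, rawEval_nil]
      exact ih u (by simpa using hu)

/-- The probability that a round accepts the candidate `(x, θ)`. -/
def acceptProb (Γ : Op l →ₗ[ℂ] Op (b + c)) (Φ : Op (l + l + b) →ₗ[ℂ] Op 1)
    (Ψ : Op (c + (l + l)) →ₗ[ℂ] Op 1) (k t : ℕ) (z : Bits (l + l)) : ℝ :=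
  binomMean ((1 - gameBias Γ Φ Ψ (fstHalf z) (sndHalf z)) / 2) k fun i =>
    if i ≤ t then (1 : ℝ) else 0

theorem append_fstHalf_sndHalf (z : Bits (l + l)) : Fin.append (fstHalf z) (sndHalf z) = z := by
  have : ∀ z : Bits (l + l), Fin.append (fstHalf z) (sndHalf z) = z := by
    intro z
    exact Fin.append_castAdd_natAdd
  exact this z

/-- The mark starts at place `k` and moves forward once per loss, so after `i` losses it is at a
place at least `T` exactly if `i ≤ k - T`. Since `T + U = k + 1`, acceptance covers all such places.
The candidate wires are traced out at the end; after an exchange they hold the old output. -/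
theorem rawEval_genRound (A : Circuit stdGates l (b + c)) (B : Circuit stdGates (l + l + b) 1)
    (C : Circuit stdGates (c + (l + l)) 1) {k T U : ℕ} (hTU : T + U = k + 1) (hT : T ≤ k)
    (o : List Bool) (ho : o.length = l + l) :
    rawEval genGates (genRound l k T U (l + l + b) (c + (l + l)) A.raw B.raw C.raw)
      (basisState o) =
      ∑ z : Bits (l + l), ((2 : ℝ) ^ (l + l))⁻¹ •
        (acceptProb A.eval B.eval C.eval k (k - T) z • basisState (List.ofFn z) +
          (1 - acceptProb A.eval B.eval C.eval k (k - T) z) • basisState o) := by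
  have h0 : rawEval genGates [.prep 0, .gate 3 [0]] (basisState o) = basisState (true :: o) := by
    simp only [rawEval_cons, eval_prep_zero, rawEval_nil]
    rw [basisState, eval_not]
    rfl
  have e : List.replicate k false ++ true :: o = oneHot k 0 ++ o := by simp [oneHot]
  rw [genRound, rawEval_append, h0, rawEval_append, rawEval_prepFalse, e, rawEval_append,
    basisState, rawEval_randomBits, map_sum]
  refine Finset.sum_congr rfl fun z _ => ?_
  have hc : ((2 : ℂ) ^ (l + l))⁻¹ = ((((2 : ℝ) ^ (l + l))⁻¹ : ℝ) : ℂ) := by push_cast; rfl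
  rw [map_smul, hc, ofReal_smul_freeOp]
  congr 1
  change rawEval genGates _ (basisState _) = _
  obtain ⟨x, θ, rfl⟩ : ∃ x θ : Bits l, z = Fin.append x θ :=
    ⟨_, _, (append_fstHalf_sndHalf z).symm⟩
  have hx : fstHalf (Fin.append x θ) = x := funext fun i => Fin.append_left _ _ _
  have hθ : sndHalf (Fin.append x θ) = θ := funext fun i => Fin.append_right _ _ _
  rw [rawEval_append, rawEval_countPlays A B C k le_rfl (by omega), acceptProb, hx, hθ]
  set Φ := (rawEval genGates (accept l k T U ++ (((List.range (l + l)).flatMap fun _ =>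
    [.trace 0]) ++ (((List.range k).flatMap fun _ => [.trace 0]) ++ [.trace 0])))).restrictScalars ℝ
    with hΦ
  refine (map_binomMean _ Φ _ _).trans ?_
  rw [← binomMean_ite]
  refine binomMean_congr _ _ fun i hi => ?_
  rw [hΦ, LinearMap.restrictScalars_apply, rawEval_append, rawEval_accept U (k - i) (0 + i)
    (by omega) (by omega) _ _ (by simp) ho]
  -- The wires in front and the counter of `k + 1` wires are traced out, whatever they contain.
  have htr : ∀ w o : List Bool, w.length = l + l → rawEval genGates (((List.range (l + l)).flatMap
      fun _ => [.trace 0]) ++ (((List.range k).flatMap fun _ => [.trace 0]) ++ [.trace 0]))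
      (basisState (w ++ (oneHot (k - i) (0 + i) ++ o))) = basisState o := by
    intro w o hw
    rw [rawEval_append, rawEval_traceAll _ _ _ hw, rawEval_append]
    have hk : (oneHot (k - i) (0 + i)).length = k + 1 := by rw [length_oneHot]; omega
    obtain ⟨v, a, hv⟩ : ∃ v a, oneHot (k - i) (0 + i) = v ++ [a] :=
      ⟨_, _, (List.dropLast_append_getLast (List.ne_nil_of_length_eq_add_one hk)).symm⟩
    rw [hv] at hk ⊢
    rw [List.append_assoc, rawEval_traceAll _ _ _ (by simpa using hk)]
    simp [eval_trace_zero]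
  by_cases hik : i ≤ k - T
  · rw [if_pos ⟨by omega, by omega⟩, if_pos hik, htr _ _ ho]
  · rw [if_neg (by omega), if_neg hik, htr _ _ (by simp)]

end

noncomputable section

open Function (update)

/-! ### The generator -/

theorem binomMean_mono {q : ℝ} (h₀ : 0 ≤ q) (h₁ : q ≤ 1) (n : ℕ) {F F' : ℕ → ℝ}
    (h : ∀ i, F i ≤ F' i) : binomMean q n F ≤ binomMean q n F' := by
  induction n generalizing F F' with
  | zero => exact h 0
  | succ n ih =>
    simp only [binomMean, smul_eq_mul]
    exact add_le_add (mul_le_mul_of_nonneg_left (ih h) (by linarith))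
      (mul_le_mul_of_nonneg_left (ih fun i => h (i + 1)) h₀)

variable {l b c : ℕ}

section AcceptProb

variable {Γ : Op l →ₗ[ℂ] Op (b + c)} {Φ : Op (l + l + b) →ₗ[ℂ] Op 1}
  {Ψ : Op (c + (l + l)) →ₗ[ℂ] Op 1}

theorem lossProb_mem (hΓ : IsChannel Γ) (hΦ : IsChannel Φ) (hΨ : IsChannel Ψ)
    (x θ : Bits l) :
    0 ≤ (1 - gameBias Γ Φ Ψ x θ) / 2 ∧ (1 - gameBias Γ Φ Ψ x θ) / 2 ≤ 1 := by
  have h := abs_le.1 (abs_gameBias_le_one hΓ hΦ hΨ x θ)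
  constructor <;> linarith

theorem acceptProb_nonneg (hΓ : IsChannel Γ) (hΦ : IsChannel Φ) (hΨ : IsChannel Ψ)
    (k t : ℕ) (z : Bits (l + l)) : 0 ≤ acceptProb Γ Φ Ψ k t z := by
  obtain ⟨h₀, h₁⟩ := lossProb_mem hΓ hΦ hΨ (fstHalf z) (sndHalf z)
  refine (binomMean_const _ k (0 : ℝ)).symm.le.trans (binomMean_mono h₀ h₁ k fun i => ?_)
  split_ifs <;> norm_num

theorem acceptProb_le_one (hΓ : IsChannel Γ) (hΦ : IsChannel Φ) (hΨ : IsChannel Ψ)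
    (k t : ℕ) (z : Bits (l + l)) : acceptProb Γ Φ Ψ k t z ≤ 1 := by
  obtain ⟨h₀, h₁⟩ := lossProb_mem hΓ hΦ hΨ (fstHalf z) (sndHalf z)
  refine (binomMean_mono h₀ h₁ k fun i => ?_).trans (binomMean_const _ k (1 : ℝ)).le
  split_ifs <;> norm_num

end AcceptProb

/-- The circuit that outputs a random string among those for which many plays are won. -/
def generator (l N k T U aB aC : ℕ) (cA cB cC : List RawGate) : List RawGate :=
  ((List.range (l + l)).flatMap fun _ => [.prep 0]) ++
    (List.range N).flatMap fun _ => genRound l k T U aB aC cA cB cC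

/-- A further round replaces the output by a fresh accepted candidate or, with probability `1 - Q`,
keeps it. The weights therefore obey `w' z = κ * p z + (1 - Q) * w z`, and the bound is a convenient
minorant of the solution: `N` chances to accept `z`, less the risk of a later replacement. -/
theorem rawEval_genRounds (A : Circuit stdGates l (b + c)) (B : Circuit stdGates (l + l + b) 1)
    (C : Circuit stdGates (c + (l + l)) 1) {k T U : ℕ} (hTU : T + U = k + 1) (hT : T ≤ k)
    (o : Bits (l + l)) (Q : ℝ) (hQ : Q = ∑ z : Bits (l + l), ((2 : ℝ) ^ (l + l))⁻¹ *
      acceptProb A.eval B.eval C.eval k (k - T) z) (N : ℕ) :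
    ∃ w : Bits (l + l) → ℝ, rawEval genGates ((List.range N).flatMap fun _ =>
        genRound l k T U (l + l + b) (c + (l + l)) A.raw B.raw C.raw) (basisState (List.ofFn o)) =
        ∑ z, w z • basisState (List.ofFn z) ∧ ∑ z, w z = 1 ∧
      ∀ z, ((2 : ℝ) ^ (l + l))⁻¹ * acceptProb A.eval B.eval C.eval k (k - T) z *
        (N * (1 - N * Q)) ≤ w z := by
  set p := acceptProb A.eval B.eval C.eval k (k - T) with hp
  have hp0 : ∀ z, 0 ≤ p z := acceptProb_nonneg A.isChannel_eval B.isChannel_eval C.isChannel_eval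
    k (k - T)
  have hp1 : ∀ z, p z ≤ 1 := acceptProb_le_one A.isChannel_eval B.isChannel_eval C.isChannel_eval
    k (k - T)
  set κ : ℝ := ((2 : ℝ) ^ (l + l))⁻¹ with hκ
  have hκ0 : 0 ≤ κ := by positivity
  have hκ1 : ∑ _z : Bits (l + l), κ = 1 := by simp [hκ]
  have hQ0 : 0 ≤ Q := hQ ▸ Finset.sum_nonneg fun z _ => mul_nonneg hκ0 (hp0 z)
  have hQ1 : Q ≤ 1 := by
    rw [hQ, ← hκ1]
    exact Finset.sum_le_sum fun z _ => mul_le_of_le_one_right hκ0 (hp1 z)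
  induction N with
  | zero =>
    refine ⟨fun z => if z = o then 1 else 0, ?_, by simp, fun z => ?_⟩
    · simp [ite_smul]
    · simp only [CharP.cast_eq_zero, zero_mul, mul_zero]
      split_ifs <;> norm_num
  | succ N ih =>
    obtain ⟨w, hw, hw1, hwz⟩ := ih
    refine ⟨fun z => κ * p z + (1 - Q) * w z, ?_, ?_, fun z => ?_⟩
    · rw [List.range_succ, List.flatMap_append, rawEval_append, hw]
      simp only [List.flatMap_cons, List.flatMap_nil, List.append_nil, map_sum,
        ← ofReal_smul_freeOp, map_smul]
      simp only [ofReal_smul_freeOp]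
      have h := fun z : Bits (l + l) => rawEval_genRound A B C hTU hT (List.ofFn z) (by simp)
      simp only [h, ← hp, ← hκ]
      have h' : ∀ y : Bits (l + l), (∑ z, κ • (p z • basisState (List.ofFn z) +
          (1 - p z) • basisState (List.ofFn y))) =
          (∑ z, (κ * p z) • basisState (List.ofFn z)) + (1 - Q) • basisState (List.ofFn y) := by
        intro y
        have : 1 - Q = ∑ z, κ * (1 - p z) := by
          simp only [mul_sub, mul_one, Finset.sum_sub_distrib, hκ1, hQ]
        rw [this, Finset.sum_smul, ← Finset.sum_add_distrib]
        refine Finset.sum_congr rfl fun z _ => ?_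
        rw [smul_add, smul_smul, smul_smul]
      simp only [h']
      simp only [smul_add, Finset.sum_add_distrib, ← Finset.sum_smul, hw1, one_smul, add_smul,
        smul_smul, mul_comm (1 - Q)]
    · rw [Finset.sum_add_distrib, ← hQ, ← Finset.mul_sum, hw1]
      ring
    · have hm : 0 ≤ κ * p z := mul_nonneg hκ0 (hp0 z)
      have h1 := mul_le_mul_of_nonneg_left (hwz z) (by linarith : (0 : ℝ) ≤ 1 - Q)
      have hN : (0 : ℝ) ≤ N := Nat.cast_nonneg N
      have h2 : κ * p z * ((↑(N + 1) : ℝ) * (1 - (↑(N + 1) : ℝ) * Q)) ≤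
          κ * p z + (1 - Q) * (κ * p z * (N * (1 - N * Q))) := by
        push_cast
        have : κ * p z + (1 - Q) * (κ * p z * (N * (1 - N * Q))) -
            κ * p z * ((N + 1) * (1 - (N + 1) * Q)) = κ * p z * (Q * (N + 1) + Q * Q * N * N) := by
          ring
        have h3 : 0 ≤ κ * p z * (Q * (N + 1) + Q * Q * N * N) := by positivity
        linarith
      linarith

/-- A lower bound on the probability that the generator outputs `z`. -/
theorem le_prob_generator (A : Circuit stdGates l (b + c)) (B : Circuit stdGates (l + l + b) 1)
    (C : Circuit stdGates (c + (l + l)) 1) {k T U : ℕ} (hTU : T + U = k + 1) (hT : T ≤ k) (N : ℕ)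
    (g : Circuit genGates 0 (l + l))
    (hg : g.raw = generator l N k T U (l + l + b) (c + (l + l)) A.raw B.raw C.raw)
    (z : Bits (l + l)) :
    ((2 : ℝ) ^ (l + l))⁻¹ * acceptProb A.eval B.eval C.eval k (k - T) z * (N * (1 - N *
      ∑ z : Bits (l + l), ((2 : ℝ) ^ (l + l))⁻¹ * acceptProb A.eval B.eval C.eval k (k - T) z)) ≤
      prob (g.eval (proj (Fin.elim0 : Bits 0))) z := by
  obtain ⟨w, hw, -, hwz⟩ := rawEval_genRounds A B C hTU hT (fun _ => false) _ rfl N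
  refine (hwz z).trans_eq ?_
  have h := g.rawEval_raw [] [] (proj (Fin.elim0 : Bits 0))
  rw [hg, proj, toFree_single, one_smul, generator, rawEval_append] at h
  have h0 := rawEval_prepFalse (l + l) []
  have e : List.replicate (l + l) false ++ [] = List.ofFn fun _ : Fin (l + l) => false := by
    rw [List.append_nil, List.ofFn_const]
  rw [e] at h0
  simp only [List.ofFn_zero, List.append_nil] at h
  rw [show ket ([] : List Bool) [] = basisState [] from rfl, h0, hw] at h
  have h2 := DFunLike.congr_fun h (List.ofFn z, List.ofFn z)
  rw [toFree_coeff] at h2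
  rw [prob, proj, ← h2, Finsupp.finsetSum_apply]
  simp [basisState, ket, Finsupp.single_apply, List.ofFn_injective.eq_iff]

/-! ### Numbers of wires in the generator. -/

theorem rawValid_fredkin {a i j k : ℕ} (hij : i ≠ j) (hik : i ≠ k) (hjk : j ≠ k) (hi : i < a)
    (hj : j < a) (hk : k < a) : RawValid genGates a [.gate 5 [i, j, k]] a :=
  ⟨⟨fredkin, rfl, rfl, by simp [hij, hik, hjk], by simp [hi, hj, hk]⟩, rfl⟩

theorem rawValid_prepFalse (n a : ℕ) :
    RawValid genGates a ((List.range n).flatMap fun _ => [.prep 0]) (a + n) :=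
  rawValid_flatMap_range (c := fun _ => [RawGate.prep 0]) (a := fun i => a + i) n
    fun i _ => ⟨⟨trivial, by omega⟩, rfl⟩

theorem rawValid_traceAll (n a : ℕ) :
    RawValid genGates (a + n) ((List.range n).flatMap fun _ => [.trace 0]) a := by
  have h := rawValid_flatMap_range (G := genGates) (c := fun _ => [RawGate.trace 0])
    (a := fun i => a + (n - i)) n fun i _ => ⟨⟨trivial, by omega⟩, by
      show a + (n - i) - 1 = a + (n - (i + 1))
      omega⟩
  simpa using h

theorem rawValid_genRound (A : Circuit stdGates l (b + c)) (B : Circuit stdGates (l + l + b) 1)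
    (C : Circuit stdGates (c + (l + l)) 1) {k T U : ℕ} (hTU : T + U = k + 1) :
    RawValid genGates (l + l) (genRound l k T U (l + l + b) (c + (l + l)) A.raw B.raw C.raw)
      (l + l) := by
  have hrot : RawValid genGates (l + l + 1 + k + (l + l) + 1) (rotate (l + l + 1) k)
      (l + l + 1 + k + (l + l) + 1) :=
    rawValid_flatMap_range (c := fun j => [RawGate.gate 5 [0, l + l + 1 + j, l + l + 1 + j + 1]])
      (a := fun _ => l + l + 1 + k + (l + l) + 1) k fun i hi =>
      rawValid_fredkin (by omega) (by omega) (by omega) (by omega) (by omega) (by omega)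
  have hcount : RawValid genGates (l + l + 1 + k + (l + l))
      (countPlay l k (l + l + b) (c + (l + l)) A.raw B.raw C.raw) (l + l + 1 + k + (l + l)) :=
    RawValid.append (b := l + l + 1 + k + (l + l) + 1) ⟨⟨trivial, by omega⟩, rfl⟩
      ((rawValid_play A B C (by omega)).append (hrot.append ⟨⟨trivial, by omega⟩, rfl⟩))
  have hacc : RawValid genGates (l + l + 1 + k + (l + l)) (accept l k T U)
      (l + l + 1 + k + (l + l)) :=
    rawValid_flatMap_range (c := fun j => exchange (l + l) (l + l + T + j) (l + l + k + 1))
      (a := fun _ => l + l + 1 + k + (l + l)) U fun j hj =>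
      rawValid_flatMap_range (c := fun i => [RawGate.gate 5 [l + l + T + j, i, l + l + k + 1 + i]])
        (a := fun _ => l + l + 1 + k + (l + l)) (l + l) fun i hi =>
        rawValid_fredkin (by omega) (by omega) (by omega) (by omega) (by omega) (by omega)
  have hrand : RawValid genGates (l + l + 1 + k) ((List.range (l + l)).flatMap fun _ => randomBit 0)
      (l + l + 1 + k + (l + l)) :=
    rawValid_flatMap_range (c := fun _ => randomBit 0) (a := fun i => l + l + 1 + k + i) (l + l)
      fun i _ => rawValid_randomBit (by omega)
  refine RawValid.append (b := l + l + 1) ⟨⟨trivial, by omega⟩, ⟨⟨notGate, rfl, rfl, by simp, by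
    simp⟩, rfl⟩⟩ ((rawValid_prepFalse k _).append (hrand.append (RawValid.append ?_
    (hacc.append ((rawValid_traceAll _ _).append ((rawValid_traceAll _ _).append
    ⟨⟨trivial, by omega⟩, rfl⟩))))))
  exact rawValid_flatMap_range (c := fun _ => countPlay l k (l + l + b) (c + (l + l)) A.raw B.raw
    C.raw) (a := fun _ => l + l + 1 + k + (l + l)) k fun _ _ => hcount

theorem rawValid_generator (A : Circuit stdGates l (b + c)) (B : Circuit stdGates (l + l + b) 1)
    (C : Circuit stdGates (c + (l + l)) 1) {k T U : ℕ} (hTU : T + U = k + 1) (N : ℕ) :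
    RawValid genGates 0 (generator l N k T U (l + l + b) (c + (l + l)) A.raw B.raw C.raw)
      (l + l) := by
  have h := rawValid_prepFalse (l + l) 0
  rw [Nat.zero_add] at h
  exact h.append (rawValid_flatMap_range (c := fun _ => genRound l k T U (l + l + b) (c + (l + l))
    A.raw B.raw C.raw) (a := fun _ => l + l) N fun _ _ => rawValid_genRound A B C hTU)

end

noncomputable section

open Function (update)

/-! ### Concentration and the choice of the parameters -/

theorem binomMean_affine (q : ℝ) (n : ℕ) (x y : ℝ) (F : ℕ → ℝ) :
    binomMean q n (fun i => x + y * F i) = x + y * binomMean q n F := by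
  induction n generalizing F with
  | zero => rfl
  | succ n ih =>
    simp only [binomMean, smul_eq_mul, ih F, ih fun i => F (i + 1)]
    ring

/-- A success shifts the argument by one, which is the same as shifting `x`. A general centre `x`
thus makes the induction close; `x = n * q` gives the variance. -/
theorem binomMean_sq (q : ℝ) (n : ℕ) (x : ℝ) :
    binomMean q n (fun i => ((i : ℝ) - x) ^ 2) = n * (q * (1 - q)) + (n * q - x) ^ 2 := by
  induction n generalizing x with
  | zero => simp [binomMean]
  | succ n ih =>
    have h : (fun i : ℕ => ((↑(i + 1) : ℝ) - x) ^ 2) = fun i : ℕ => ((i : ℝ) - (x - 1)) ^ 2 := by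
      funext i
      push_cast
      ring
    simp only [binomMean, smul_eq_mul, h, ih]
    push_cast
    ring

theorem binomMean_sq_le (q : ℝ) (n : ℕ) :
    binomMean q n (fun i => ((i : ℝ) - n * q) ^ 2) ≤ n / 4 := by
  rw [binomMean_sq, sub_self]
  have h : q * (1 - q) ≤ 1 / 4 := by nlinarith [sq_nonneg (q - 1 / 2)]
  have := mul_le_mul_of_nonneg_left h (Nat.cast_nonneg (α := ℝ) n)
  linarith

/-- Chebyshev's inequality: where the indicator is one, the deviation from the mean is at least `s`,
so the indicator is at most the squared deviation over `s ^ 2`; the variance is at most `n / 4`. -/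
theorem binomMean_le_of_add_le {q : ℝ} (h₀ : 0 ≤ q) (h₁ : q ≤ 1) {n t : ℕ} {s : ℝ} (hs : 0 < s)
    (h : t + s ≤ n * q) :
    binomMean q n (fun i => if i ≤ t then (1 : ℝ) else 0) ≤ n / (4 * s ^ 2) := by
  have key : binomMean q n (fun i => if i ≤ t then (1 : ℝ) else 0) ≤
      binomMean q n fun i => 0 + (s ^ 2)⁻¹ * ((i : ℝ) - n * q) ^ 2 := by
    refine binomMean_mono h₀ h₁ n fun i => ?_
    split_ifs with hi
    · have hi' : (i : ℝ) ≤ t := by exact_mod_cast hi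
      rw [zero_add, inv_mul_eq_div, one_le_div (by positivity)]
      nlinarith
    · positivity
  rw [binomMean_affine, zero_add] at key
  refine key.trans ((mul_le_mul_of_nonneg_left (binomMean_sq_le q n) (by positivity)).trans_eq ?_)
  field_simp

theorem le_binomMean_of_le_sub {q : ℝ} (h₀ : 0 ≤ q) (h₁ : q ≤ 1) {n t : ℕ} {s : ℝ} (hs : 0 < s)
    (h : n * q ≤ t - s) :
    1 - n / (4 * s ^ 2) ≤ binomMean q n (fun i => if i ≤ t then (1 : ℝ) else 0) := by
  have key : binomMean q n (fun i => 1 + (-(s ^ 2)⁻¹) * ((i : ℝ) - n * q) ^ 2) ≤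
      binomMean q n (fun i => if i ≤ t then (1 : ℝ) else 0) := by
    refine binomMean_mono h₀ h₁ n fun i => ?_
    split_ifs with hi
    · have : 0 ≤ (s ^ 2)⁻¹ * ((i : ℝ) - n * q) ^ 2 := by positivity
      linarith
    · have hi' : (t : ℝ) < i := by exact_mod_cast not_le.1 hi
      have : 1 ≤ (s ^ 2)⁻¹ * ((i : ℝ) - n * q) ^ 2 := by
        rw [inv_mul_eq_div, one_le_div (by positivity)]
        nlinarith
      linarith
  rw [binomMean_affine] at key
  have h2 := mul_le_mul_of_nonneg_left (binomMean_sq_le q n) (by positivity : 0 ≤ (s ^ 2)⁻¹)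
  have h3 : (s ^ 2)⁻¹ * ((n : ℝ) / 4) = n / (4 * s ^ 2) := by field_simp
  linarith

variable {l b c : ℕ}

section Parameters

variable {Γ : Op l →ₗ[ℂ] Op (b + c)} {Φ : Op (l + l + b) →ₗ[ℂ] Op 1}
  {Ψ : Op (c + (l + l)) →ₗ[ℂ] Op 1} {M R : ℕ} {D : ℝ}

/-- The rate at which the advantage decreases with the number of qubits. -/
def decayRate : ℝ := Real.sqrt ((1 + (Real.sqrt 2)⁻¹) / 2)

theorem decayRate_nonneg : 0 ≤ decayRate := Real.sqrt_nonneg _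

theorem decayRate_lt_one : decayRate < 1 := by
  rw [decayRate, Real.sqrt_lt' one_pos]
  have h : (Real.sqrt 2)⁻¹ < 1 := inv_lt_one_of_one_lt₀ (by
    rw [Real.lt_sqrt (by norm_num)]; norm_num)
  linarith

/-- With bias `e` the expected number of losses is `(2 * M + R) * (1 - e)`. For `e ≥ 1 / D` and `M =
R * D` this is at most `2 * M - R`, a distance `R` below the threshold, and Chebyshev's error `(2 *
D + 1) / (2 * R)` is at most `1 / 2`. -/
theorem half_le_acceptProb (hΓ : IsChannel Γ) (hΦ : IsChannel Φ) (hΨ : IsChannel Ψ)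
    (z : Bits (l + l)) (hR : 0 < R) (hD : 0 < D) (hM : (M : ℝ) = R * D)
    (hRD : 2 * D + 1 ≤ R) (hz : D⁻¹ ≤ gameBias Γ Φ Ψ (fstHalf z) (sndHalf z)) :
    1 / 2 ≤ acceptProb Γ Φ Ψ (4 * M + 2 * R) (2 * M) z := by
  obtain ⟨h₀, h₁⟩ := lossProb_mem hΓ hΦ hΨ (fstHalf z) (sndHalf z)
  have hR' : (0 : ℝ) < R := by exact_mod_cast hR
  refine le_trans ?_ (le_binomMean_of_le_sub h₀ h₁ hR' ?_)
  · push_cast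
    rw [hM]
    have : (4 * (R * D) + 2 * (R : ℝ)) / (4 * (R : ℝ) ^ 2) ≤ 1 / 2 := by
      rw [div_le_iff₀ (by positivity)]
      nlinarith
    linarith
  · set e := gameBias Γ Φ Ψ (fstHalf z) (sndHalf z)
    push_cast
    rw [hM]
    have h1 : 1 ≤ D * e := by
      have := mul_le_mul_of_nonneg_left hz hD.le
      rwa [mul_inv_cancel₀ hD.ne'] at this
    have h2 : 0 ≤ e := (inv_nonneg.2 hD.le).trans hz
    nlinarith [mul_nonneg hR'.le h2, mul_le_mul_of_nonneg_left h1 hR'.le]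

/-- For `e ≤ 1 / (8 * D)` the expected number of losses is at least `2 * M + R / 2`. Chebyshev's
inequality at distance `R / 2` gives `(4 * D + 2) / R`. -/
theorem acceptProb_le (hΓ : IsChannel Γ) (hΦ : IsChannel Φ) (hΨ : IsChannel Ψ)
    (z : Bits (l + l)) (hR : 0 < R) (hD : 1 ≤ D) (hM : (M : ℝ) = R * D)
    (hz : gameBias Γ Φ Ψ (fstHalf z) (sndHalf z) ≤ D⁻¹ / 8) :
    acceptProb Γ Φ Ψ (4 * M + 2 * R) (2 * M) z ≤ 6 * D / R := by
  obtain ⟨h₀, h₁⟩ := lossProb_mem hΓ hΦ hΨ (fstHalf z) (sndHalf z)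
  have hR' : (0 : ℝ) < R := by exact_mod_cast hR
  have hD0 : 0 < D := by linarith
  refine (binomMean_le_of_add_le h₀ h₁ (half_pos hR') ?_).trans ?_
  · set e := gameBias Γ Φ Ψ (fstHalf z) (sndHalf z)
    push_cast
    rw [hM]
    have h1 : D * e ≤ 1 / 8 := by
      have := mul_le_mul_of_nonneg_left hz hD0.le
      rw [mul_div_assoc', mul_inv_cancel₀ hD0.ne'] at this
      linarith
    have h2 : e ≤ 1 / 8 := hz.trans (by
      have := inv_le_one_of_one_le₀ hD
      linarith)
    nlinarith [mul_le_mul_of_nonneg_left h1 hR'.le, mul_le_mul_of_nonneg_left h2 hR'.le]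
  · push_cast
    rw [hM, div_le_div_iff₀ (by positivity) hR']
    nlinarith [mul_nonneg hR'.le (mul_nonneg hR'.le (sub_nonneg.2 hD))]

/-- Markov's inequality in pointwise form: a string of small bias is accepted with probability at
most `6 * D / R`, and for any other string `8 * D * |bias|` exceeds one. The mean of `|bias|` is
bounded by `sum_abs_gameBias_le`. -/
theorem mean_acceptProb_le (hΓ : IsChannel Γ) (hΦ : IsChannel Φ) (hΨ : IsChannel Ψ)
    (hR : 0 < R) (hD : 1 ≤ D) (hM : (M : ℝ) = R * D) :
    ∑ z : Bits (l + l), ((2 : ℝ) ^ (l + l))⁻¹ * acceptProb Γ Φ Ψ (4 * M + 2 * R) (2 * M) z ≤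
      6 * D / R + 8 * D * decayRate ^ l := by
  have hD0 : 0 < D := by linarith
  have hle : ∀ z : Bits (l + l), acceptProb Γ Φ Ψ (4 * M + 2 * R) (2 * M) z ≤
      6 * D / R + 8 * D * |gameBias Γ Φ Ψ (fstHalf z) (sndHalf z)| := by
    intro z
    rcases le_or_gt (gameBias Γ Φ Ψ (fstHalf z) (sndHalf z)) (D⁻¹ / 8) with h | h
    · have := acceptProb_le hΓ hΦ hΨ z hR hD hM h
      have : 0 ≤ 8 * D * |gameBias Γ Φ Ψ (fstHalf z) (sndHalf z)| := by positivity
      linarith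
    · have h1 := acceptProb_le_one hΓ hΦ hΨ (4 * M + 2 * R) (2 * M) z
      have h2 : 1 ≤ 8 * D * |gameBias Γ Φ Ψ (fstHalf z) (sndHalf z)| := by
        have h3 := mul_le_mul_of_nonneg_left (h.le.trans (le_abs_self _))
          (by positivity : 0 ≤ 8 * D)
        have h4 : 8 * D * (D⁻¹ / 8) = 1 := by field_simp
        linarith
      have h5 : 0 ≤ 6 * D / R := by positivity
      linarith
  have hsum : ∑ z : Bits (l + l), |gameBias Γ Φ Ψ (fstHalf z) (sndHalf z)| ≤
      2 ^ l * Real.sqrt ((2 * (1 + (Real.sqrt 2)⁻¹)) ^ l) := by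
    refine le_trans (le_of_eq ?_) (sum_abs_gameBias_le hΓ hΦ hΨ)
    rw [sum_bits_append, Finset.sum_comm]
    refine Finset.sum_congr rfl fun θ _ => Finset.sum_congr rfl fun x _ => ?_
    have hx : fstHalf (Fin.append x θ) = x := funext fun i => Fin.append_left _ _ _
    have hθ : sndHalf (Fin.append x θ) = θ := funext fun i => Fin.append_right _ _ _
    rw [hx, hθ]
  have hrate : ((2 : ℝ) ^ (l + l))⁻¹ * (2 ^ l * Real.sqrt ((2 * (1 + (Real.sqrt 2)⁻¹)) ^ l)) =
      decayRate ^ l := by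
    have h1 : (2 * (1 + (Real.sqrt 2)⁻¹)) = 2 ^ 2 * ((1 + (Real.sqrt 2)⁻¹) / 2) := by ring
    have h2 : Real.sqrt ((2 * (1 + (Real.sqrt 2)⁻¹)) ^ l) = 2 ^ l * decayRate ^ l := by
      rw [h1, decayRate, ← mul_pow, Real.sqrt_eq_iff_mul_self_eq (by positivity) (by positivity),
        ← mul_pow]
      congr 1
      have := Real.mul_self_sqrt (show 0 ≤ (1 + (Real.sqrt 2)⁻¹) / 2 by positivity)
      linear_combination -4 * this
    rw [h2, pow_add]
    field_simp
  calc _ ≤ ∑ z : Bits (l + l), ((2 : ℝ) ^ (l + l))⁻¹ * (6 * D / R + 8 * D *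
        |gameBias Γ Φ Ψ (fstHalf z) (sndHalf z)|) :=
        Finset.sum_le_sum fun z _ => mul_le_mul_of_nonneg_left (hle z) (by positivity)
    _ = 6 * D / R + 8 * D * (((2 : ℝ) ^ (l + l))⁻¹ *
        ∑ z : Bits (l + l), |gameBias Γ Φ Ψ (fstHalf z) (sndHalf z)|) := by
        simp only [mul_add, Finset.sum_add_distrib, ← Finset.mul_sum]
        congr 1
        · simp
        · ring
    _ ≤ _ := by
        rw [← hrate]
        gcongr

end Parameters

/-- For these parameters, the generator outputs every string of large advantage with a probability
that exceeds that of a random guess by more than any given polynomial of degree at most `d`. -/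
theorem eventually_le_generator (a d : ℕ) (p : Polynomial ℝ) (hp : p.natDegree ≤ d) :
    ∀ᶠ l : ℕ in Filter.atTop, ∀ (b c : ℕ) (Γ : Op l →ₗ[ℂ] Op (b + c))
      (Φ : Op (l + l + b) →ₗ[ℂ] Op 1) (Ψ : Op (c + (l + l)) →ₗ[ℂ] Op 1), IsChannel Γ →
      IsChannel Φ → IsChannel Ψ → ∀ (z : Bits (l + l)) (M R N : ℕ),
      M = l ^ (a + (a + (d + 2))) → R = l ^ (a + (d + 2)) → N = l ^ (d + 1) →
      ((l : ℝ) ^ a)⁻¹ ≤ gameBias Γ Φ Ψ (fstHalf z) (sndHalf z) →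
      p.eval (l : ℝ) * ((2 : ℝ) ^ (l + l))⁻¹ ≤
        ((2 : ℝ) ^ (l + l))⁻¹ * acceptProb Γ Φ Ψ (4 * M + 2 * R) (2 * M) z *
          (N * (1 - N * ∑ z : Bits (l + l), ((2 : ℝ) ^ (l + l))⁻¹ *
            acceptProb Γ Φ Ψ (4 * M + 2 * R) (2 * M) z)) := by
  -- The exponential decay of the mean bias beats every power of `l`; this is the only place where
  -- `decayRate < 1` is used.
  have h₁ : ∀ᶠ l : ℕ in Filter.atTop, 8 * ((l : ℝ) ^ (a + (d + 2)) * decayRate ^ l) ≤ 1 := by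
    have := (tendsto_pow_const_mul_const_pow_of_abs_lt_one (a + (d + 2)) (r := decayRate)
      (by rw [abs_of_nonneg decayRate_nonneg]; exact decayRate_lt_one)).const_mul 8
    rw [mul_zero] at this
    exact this.eventually_le_const one_pos
  have h₂ : ∀ᶠ l : ℕ in Filter.atTop, p.eval (l : ℝ) / (l : ℝ) ^ (d + 1) ≤ 1 / 4 := by
    have := p.div_tendsto_atTop_zero_of_degree_lt (Polynomial.X ^ (d + 1)) (by
      rw [Polynomial.degree_X_pow]
      exact lt_of_le_of_lt Polynomial.degree_le_natDegree (by exact_mod_cast Nat.lt_succ_of_le hp))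
    have := (this.comp (tendsto_natCast_atTop_atTop (R := ℝ))).eventually_le_const
      (by norm_num : (0 : ℝ) < 1 / 4)
    simpa using this
  -- The number `14` makes `7 / l ≤ 1 / 2`, which bounds `N * Q` below.
  filter_upwards [h₁, h₂, Filter.eventually_ge_atTop 14] with l h₁ h₂ hl b c Γ Φ Ψ hΓ hΦ hΨ z M R N
    hM hR hN hz
  have hl0 : (14 : ℝ) ≤ l := by exact_mod_cast hl
  have hlp : (0 : ℝ) < l := by linarith
  set D : ℝ := (l : ℝ) ^ a with hD
  have hD1 : 1 ≤ D := one_le_pow₀ (by linarith)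
  have hRr : (R : ℝ) = D * (l : ℝ) ^ (d + 2) := by rw [hR, hD]; push_cast; ring
  have hMr : (M : ℝ) = R * D := by rw [hM, hRr, hD]; push_cast; ring
  have hR0 : 0 < R := by rw [hR]; positivity
  have hE : (14 : ℝ) ≤ (l : ℝ) ^ (d + 2) := hl0.trans (le_self_pow₀ (by linarith) (by omega))
  have hacc := half_le_acceptProb hΓ hΦ hΨ z hR0 (by linarith) hMr
    (by rw [hRr]; nlinarith) hz
  have hQ := mean_acceptProb_le hΓ hΦ hΨ hR0 hD1 hMr
  set Q := ∑ z : Bits (l + l), ((2 : ℝ) ^ (l + l))⁻¹ *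
    acceptProb Γ Φ Ψ (4 * M + 2 * R) (2 * M) z
  have hNr : (N : ℝ) = (l : ℝ) ^ (d + 1) := by rw [hN]; push_cast; rfl
  have hNl : (N : ℝ) * l = (l : ℝ) ^ (d + 2) := by rw [hNr]; ring
  have hN0 : (0 : ℝ) < N := by rw [hNr]; positivity
  -- The choice `R = D * l ^ (d + 2)` turns `6 * D / R` into `6 / l ^ (d + 2)`; the exponential term
  -- contributes at most one more unit by `h₁`.
  have hQ7 : Q * (l : ℝ) ^ (d + 2) ≤ 7 := by
    refine (mul_le_mul_of_nonneg_right hQ (by positivity)).trans ?_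
    rw [hRr, add_mul]
    have e1 : 6 * D / (D * (l : ℝ) ^ (d + 2)) * (l : ℝ) ^ (d + 2) = 6 := by field_simp
    have e2 : 8 * D * decayRate ^ l * (l : ℝ) ^ (d + 2) =
        8 * ((l : ℝ) ^ (a + (d + 2)) * decayRate ^ l) := by rw [hD]; ring
    rw [e1, e2]
    linarith
  have hNQ : N * Q ≤ 1 / 2 := by
    rw [← hNl] at hQ7
    nlinarith
  have hp' : p.eval (l : ℝ) ≤ N / 4 := by
    rw [div_le_iff₀ (by positivity), ← hNr] at h₂
    linarith
  set κ : ℝ := ((2 : ℝ) ^ (l + l))⁻¹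
  have hκ : 0 ≤ κ := by positivity
  rw [mul_comm, mul_assoc]
  refine mul_le_mul_of_nonneg_left (hp'.trans ?_) hκ
  have h4 : (N : ℝ) / 2 ≤ N * (1 - N * Q) := by nlinarith
  calc (N : ℝ) / 4 = 1 / 2 * (N / 2) := by ring
    _ ≤ _ := mul_le_mul hacc h4 (by positivity) (by linarith)

end

noncomputable section

open Function (update)

/-! ### The description of the generator -/

namespace StrExpr

variable {X : Type} [DecidableEq X]

/-- The unary representation of a power of the length of `v`; its loops use the variables `is`. -/
def power (v : X) : List X → StrExpr X
  | [] => .bit true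
  | i :: is => .forIn i v (power v is)

/-- Nested loops over the length of `v` multiply. The loop variables are not read and need only
differ from `v`, whose value they would otherwise overwrite. -/
theorem val_power (v : X) (is : List X) (hv : v ∉ is) (e : X → List Bool) :
    (power v is).val e = List.replicate ((e v).length ^ is.length) true := by
  induction is generalizing e with
  | nil => rfl
  | cons i is ih =>
    simp only [List.mem_cons, not_or] at hv
    have h : ∀ j : ℕ, (power v is).val (update e i (List.replicate j true)) =
        List.replicate ((e v).length ^ is.length) true := by
      intro j
      rw [ih hv.2, Function.update_of_ne hv.1]
    have hf : ∀ n m : ℕ, ((List.range n).flatMap fun _ => List.replicate m true) =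
        List.replicate (n * m) true := by
      intro n m
      induction n with
      | zero => simp
      | succ n ih => rw [List.range_succ, List.flatMap_append, ih]; simp [Nat.add_mul]
    simp only [power, val, h, hf, List.length_cons, pow_succ']

theorem wf_power (v : X) (is R F : List X) (hv : v ∈ R) (hd : is.Nodup) (hF : ∀ i ∈ is, i ∉ F) :
    (power v is).WF R F := by
  induction is generalizing R F with
  | nil => trivial
  | cons i is ih =>
    rw [List.nodup_cons] at hd
    refine ⟨hv, hF i (by simp), ih _ _ (List.mem_cons_of_mem _ hv) hd.2 fun j hj => ?_⟩
    rw [List.mem_cons, not_or]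
    exact ⟨fun h => hd.1 (h ▸ hj), hF j (List.mem_cons_of_mem _ hj)⟩

end StrExpr

section Expr

variable {m : ℕ}

/-- Numeric variables: the parameters, and auxiliary variables for powers. -/
abbrev GenVar (m : ℕ) : Type := Fin 15 ⊕ Fin m

/-- A linear expression in the parameters. -/
def lin (c : ℕ) (vs : List (Fin 15)) : LinExpr (GenVar m) := ⟨c, vs.map Sum.inl⟩

/-- The expression for `randomBit 0`. -/
def randomBitExpr : CircExpr (GenVar m) :=
  .seq (.prep (lin 0 [])) (.seq (.prep (lin 0 [])) (.seq (.gate 1 [lin 0 []])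
    (.seq (.gate 4 [lin 0 [], lin 1 []]) (.trace (lin 0 [])))))

/-- The expression for `randomDot`. -/
def randomDotExpr (k p : List (Fin 15)) : CircExpr (GenVar m) :=
  .rep (.inl 13) (.inl 0) (.seq randomBitExpr (.gate 0 [lin 0 [], lin 1 k, lin 1 (p ++ [13])]))

/-- The expression for `copyBits`. -/
def copyBitsExpr (k : List (Fin 15)) : CircExpr (GenVar m) :=
  .rep (.inl 13) (.inl 0) (.seq (.prep (lin 0 [])) (.gate 4 [lin 1 k, lin 0 []]))

/-- The expression for `prepWiesner`. -/
def prepWiesnerExpr (k k' : List (Fin 15)) : CircExpr (GenVar m) :=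
  .rep (.inl 13) (.inl 0) (.seq (.prep (lin 0 [])) (.seq (.gate 4 [lin 1 k, lin 0 []])
    (.gate 6 [lin 1 k', lin 0 []])))

/-- The expression for `addOutput`. -/
def addOutputExpr (j : Fin 3) (p : List (Fin 15)) : CircExpr (GenVar m) :=
  .seq (.code j) (.seq (.gate 4 [lin 0 [], lin 1 p]) (.trace (lin 0 [])))

/-- The expression for `play`; the variables `0`, `2` and `3` are `l`, `aB` and `aC`. -/
def playExpr : CircExpr (GenVar m) :=
  .seq (.rep (.inl 13) (.inl 0) (.seq (.prep (lin 0 [])) (.prep (lin 0 []))))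
  (.seq (randomDotExpr [0, 0, 0] [0, 0])
  (.seq (copyBitsExpr [0, 0, 0, 0, 0])
  (.seq (prepWiesnerExpr [0, 0, 0, 0, 0] [0, 0, 0, 0, 0, 0])
  (.seq (.code 0)
  (.seq (randomDotExpr [2, 3, 0] [2, 3])
  (.seq (copyBitsExpr [2, 3, 0, 0, 0])
  (.seq (addOutputExpr 1 [3, 0, 0])
  (.seq (addOutputExpr 2 [0, 0])
  (.rep (.inl 13) (.inl 0) (.seq (.trace (lin 0 [])) (.trace (lin 0 []))))))))))))

/-- The expression for `countPlay`; the variable `8` is `k`. -/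
def countPlayExpr : CircExpr (GenVar m) :=
  .seq (.prep (lin 0 [])) (.seq playExpr (.seq
    (.rep (.inl 13) (.inl 8) (.gate 5 [lin 0 [], lin 1 [0, 0, 13], lin 2 [0, 0, 13]]))
    (.trace (lin 0 []))))

/-- The expression for `genRound`; the variables `4`, `9` and `10` are `l + l`, `T` and `U`. -/
def genRoundExpr : CircExpr (GenVar m) :=
  .seq (.seq (.prep (lin 0 [])) (.gate 3 [lin 0 []]))
  (.seq (.rep (.inl 12) (.inl 8) (.prep (lin 0 [])))
  (.seq (.rep (.inl 12) (.inl 4) randomBitExpr)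
  (.seq (.rep (.inl 12) (.inl 8) countPlayExpr)
  (.seq (.rep (.inl 12) (.inl 10) (.rep (.inl 13) (.inl 4)
    (.gate 5 [lin 0 [0, 0, 9, 12], lin 0 [13], lin 1 [0, 0, 8, 13]])))
  (.seq (.rep (.inl 12) (.inl 4) (.trace (lin 0 [])))
  (.seq (.rep (.inl 12) (.inl 8) (.trace (lin 0 []))) (.trace (lin 0 []))))))))

/-- The expression for `generator`; the variable `7` is `N`. -/
def generatorExpr : CircExpr (GenVar m) :=
  .seq (.rep (.inl 11) (.inl 4) (.prep (lin 0 []))) (.rep (.inl 11) (.inl 7) genRoundExpr)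

theorem val_lin (c : ℕ) (vs : List (Fin 15)) (e : GenVar m → ℕ) :
    (lin c vs).val e = (vs.map fun v => e (.inl v)).sum + c := by
  simp [lin, LinExpr.val, Function.comp_def]

theorem val_playExpr (κ : Fin 3 → List RawGate) (e : GenVar m → ℕ) :
    playExpr.val κ e = play (e (.inl 0)) (e (.inl 2)) (e (.inl 3)) (κ 0) (κ 1) (κ 2) := by
  simp [playExpr, randomDotExpr, copyBitsExpr, prepWiesnerExpr, addOutputExpr, randomBitExpr,
    CircExpr.val, val_lin, play, randomDot, copyBits, prepWiesner, addOutput, randomBit, add_assoc]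

theorem val_countPlayExpr (κ : Fin 3 → List RawGate) (e : GenVar m → ℕ) :
    countPlayExpr.val κ e =
      countPlay (e (.inl 0)) (e (.inl 8)) (e (.inl 2)) (e (.inl 3)) (κ 0) (κ 1) (κ 2) := by
  have h : ∀ j, 1 + (j + 1) = j + 2 := fun j => by omega
  simp [countPlayExpr, CircExpr.val, val_lin, val_playExpr, countPlay, rotate, add_assoc,
    Nat.add_comm 1, h]

theorem val_genRoundExpr (κ : Fin 3 → List RawGate) (e : GenVar m → ℕ)
    (h : e (.inl 4) = e (.inl 0) + e (.inl 0)) :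
    genRoundExpr.val κ e = genRound (e (.inl 0)) (e (.inl 8)) (e (.inl 9)) (e (.inl 10))
      (e (.inl 2)) (e (.inl 3)) (κ 0) (κ 1) (κ 2) := by
  simp [genRoundExpr, CircExpr.val, val_lin, val_countPlayExpr, genRound, randomBitExpr, randomBit,
    accept, exchange, add_assoc, Nat.add_comm 1, h]

theorem val_generatorExpr (κ : Fin 3 → List RawGate) (e : GenVar m → ℕ)
    (h : e (.inl 4) = e (.inl 0) + e (.inl 0)) :
    generatorExpr.val κ e = generator (e (.inl 0)) (e (.inl 7)) (e (.inl 8)) (e (.inl 9))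
      (e (.inl 10)) (e (.inl 2)) (e (.inl 3)) (κ 0) (κ 1) (κ 2) := by
  simp [generatorExpr, CircExpr.val, val_lin, val_genRoundExpr, generator, h]

end Expr

end

noncomputable section

open Function (update)

/-! ### Uncloneability -/

section Description

variable {m : ℕ}

/-- A parameter as a variable for strings. -/
abbrev strVar (v : Fin 15) : GenVar m ⊕ Fin 3 := .inl (.inl v)

/-- Auxiliary variables for the loops of a power. -/
def powerVars (m q : ℕ) : List (GenVar m ⊕ Fin 3) :=
  ((List.finRange m).take q).map fun i => .inl (.inr i)

theorem length_powerVars {q : ℕ} (hq : q ≤ m) : (powerVars m q).length = q := by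
  simp [powerVars, hq]

theorem strVar_notMem_powerVars (v : Fin 15) (q : ℕ) : strVar v ∉ powerVars m q := by
  intro h
  obtain ⟨i, -, h⟩ := List.mem_map.1 h
  simp at h

theorem nodup_powerVars (q : ℕ) : (powerVars m q).Nodup := by
  refine List.Nodup.map (fun i j h => ?_) ((List.nodup_finRange m).sublist (List.take_sublist _ _))
  simpa using h

/-- The description of the generator with `N = l ^ q₀`, `R = l ^ q₁`, `M = l ^ q₂`,
`k = 4 * M + 2 * R`, `T = 2 * M + 2 * R` and `U = 2 * M + 1`. -/
def generatorStr (m q₀ q₁ q₂ : ℕ) : StrExpr (GenVar m ⊕ Fin 3) :=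
  .letIn (strVar 4) (.app (.var (strVar 0)) (.var (strVar 0)))
  (.letIn (strVar 7) (.power (strVar 0) (powerVars m q₀))
  (.letIn (strVar 5) (.power (strVar 0) (powerVars m q₁))
  (.letIn (strVar 6) (.power (strVar 0) (powerVars m q₂))
  (.letIn (strVar 8) (.app (.var (strVar 6)) (.app (.var (strVar 6)) (.app (.var (strVar 6))
    (.app (.var (strVar 6)) (.app (.var (strVar 5)) (.var (strVar 5)))))))
  (.letIn (strVar 9) (.app (.var (strVar 6)) (.app (.var (strVar 6))
    (.app (.var (strVar 5)) (.var (strVar 5)))))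
  (.letIn (strVar 10) (.app (.var (strVar 6)) (.app (.var (strVar 6)) (.bit true)))
  (.app (.bit false) (.app generatorExpr.toStr (.bit false)))))))))

theorem wf_generatorStr (m q₀ q₁ q₂ : ℕ) : (generatorStr m q₀ q₁ q₂).WF
    [.inr 2, strVar 3, .inr 1, strVar 2, .inr 0, strVar 1, strVar 0]
    [.inr 2, strVar 3, .inr 1, strVar 2, .inr 0, strVar 1, strVar 0] := by
  have hp : ∀ (q : ℕ) (R F : List (GenVar m ⊕ Fin 3)), strVar 0 ∈ R →
      (∀ i, .inl (.inr i) ∉ F) → (StrExpr.power (strVar 0) (powerVars m q)).WF R F := by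
    intro q R F hR hF
    refine StrExpr.wf_power _ _ _ _ hR (nodup_powerVars q) fun i hi => ?_
    obtain ⟨j, -, rfl⟩ := List.mem_map.1 hi
    exact hF j
  refine ⟨by simp, by simp [StrExpr.WF], by simp, hp _ _ _ (by simp) (by simp), by simp,
    hp _ _ _ (by simp) (by simp), by simp, hp _ _ _ (by simp) (by simp), by simp,
    by simp [StrExpr.WF], by simp, by simp [StrExpr.WF], by simp, by simp [StrExpr.WF], ?_⟩
  -- The powers, whose loops depend on the exponents, are dealt with; the rest uses only parameters
  -- and codes, and its well-formedness is evaluated.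
  exact of_decide_eq_true rfl

/-- The values of the variables before the parameters are computed. -/
def headerEnv (l aA aB aC : ℕ) : GenVar m → ℕ :=
  Sum.elim ![l, aA, aB, aC, 0, 0, 0, 0, 0, 0, 0, 0, 0, 0, 0] fun _ => 0

theorem val_generatorStr {m q₀ q₁ q₂ : ℕ} (h₀ : q₀ ≤ m) (h₁ : q₁ ≤ m) (h₂ : q₂ ≤ m)
    (κ : Fin 3 → List RawGate) (l aA aB aC : ℕ) :
    (generatorStr m q₀ q₁ q₂).val (CircExpr.strEnv κ (headerEnv l aA aB aC)) =
      false :: ((generator l (l ^ q₀) (4 * l ^ q₂ + 2 * l ^ q₁) (2 * l ^ q₂ + 2 * l ^ q₁)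
        (2 * l ^ q₂ + 1) aB aC (κ 0) (κ 1) (κ 2)).flatMap RawGate.encode ++ [false]) := by
  have hlet : ∀ (i : Fin 15) (g h : StrExpr (GenVar m ⊕ Fin 3)) (e : GenVar m → ℕ) (n : ℕ),
      g.val (CircExpr.strEnv κ e) = List.replicate n true →
      (StrExpr.letIn (strVar i) g h).val (CircExpr.strEnv κ e) =
        h.val (CircExpr.strEnv κ (update e (.inl i) n)) := by
    intro i g h e n hg
    rw [StrExpr.val, hg, CircExpr.update_strEnv]
  have hpow : ∀ (q : ℕ) (e : GenVar m → ℕ), q ≤ m → e (.inl 0) = l →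
      (StrExpr.power (strVar 0) (powerVars m q)).val (CircExpr.strEnv κ e) =
        List.replicate (l ^ q) true := by
    intro q e hq he
    rw [StrExpr.val_power _ _ (strVar_notMem_powerVars _ _), length_powerVars hq]
    simp [CircExpr.strEnv, he]
  rw [generatorStr]
  have hrep : ∀ x y : ℕ, List.replicate x true ++ List.replicate y true =
      List.replicate (x + y) true := fun x y => by simp
  rw [hlet 4 _ _ _ (l + l) (by exact hrep _ _),
    hlet 7 _ _ _ (l ^ q₀) (by exact hpow _ _ h₀ rfl),
    hlet 5 _ _ _ (l ^ q₁) (by exact hpow _ _ h₁ rfl),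
    hlet 6 _ _ _ (l ^ q₂) (by exact hpow _ _ h₂ rfl),
    hlet 8 _ _ _ (4 * l ^ q₂ + 2 * l ^ q₁) (by
      change List.replicate (l ^ q₂) true ++ (List.replicate (l ^ q₂) true ++
        (List.replicate (l ^ q₂) true ++ (List.replicate (l ^ q₂) true ++
        (List.replicate (l ^ q₁) true ++ List.replicate (l ^ q₁) true)))) = _
      simp only [hrep]
      congr 1
      ring),
    hlet 9 _ _ _ (2 * l ^ q₂ + 2 * l ^ q₁) (by
      change List.replicate (l ^ q₂) true ++ (List.replicate (l ^ q₂) true ++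
        (List.replicate (l ^ q₁) true ++ List.replicate (l ^ q₁) true)) = _
      simp only [hrep]
      congr 1
      ring),
    hlet 10 _ _ _ (2 * l ^ q₂ + 1) (by
      change List.replicate (l ^ q₂) true ++ (List.replicate (l ^ q₂) true ++
        List.replicate 1 true) = _
      simp only [hrep]
      congr 1
      ring)]
  have happ : ∀ (g h : StrExpr (GenVar m ⊕ Fin 3)) e, (g.app h).val e = g.val e ++ h.val e :=
    fun _ _ _ => rfl
  rw [happ, happ, CircExpr.val_toStr, val_generatorExpr _ _ rfl]
  rfl

end Description

theorem PolyTime.expTime {G : GateSet} {a b : ℕ → ℕ} {C : ∀ n, Circuit G (a n) (b n)}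
    (h : PolyTime C) : ExpTime C := by
  obtain ⟨M⟩ := h
  exact ⟨M.time, M.toTM2ComputableInTime, fun n => Nat.lt_two_pow_self.le⟩

/-- The generator for polynomial-time families of circuits is polynomial-time. -/
theorem exists_expTime_generator {b c a : ℕ → ℕ} {A : ∀ n, Circuit stdGates (a n) (b n + c n)}
    {B : ∀ n, Circuit stdGates (n + b n) 1} {C : ∀ n, Circuit stdGates (c n + n) 1}
    (hA : PolyTime A) (hB : PolyTime B) (hC : PolyTime C)
    (A' : ∀ l, Circuit stdGates l (b (l + l) + c (l + l)))
    (hA' : ∀ l, (A' l).raw = (A (l + l)).raw) (q₀ q₁ q₂ : ℕ) :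
    ∃ g : ∀ l, Circuit genGates 0 (l + l), ExpTime g ∧ ∀ l, (g l).raw =
      generator l (l ^ q₀) (4 * l ^ q₂ + 2 * l ^ q₁) (2 * l ^ q₂ + 2 * l ^ q₁) (2 * l ^ q₂ + 1)
        (l + l + b (l + l)) (c (l + l) + (l + l)) (A' l).raw (B (l + l)).raw (C (l + l)).raw := by
  choose g hg using fun l => (rawValid_generator (A' l) (B (l + l)) (C (l + l))
    (k := 4 * l ^ q₂ + 2 * l ^ q₁) (T := 2 * l ^ q₂ + 2 * l ^ q₁) (U := 2 * l ^ q₂ + 1) (by omega)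
    (l ^ q₀)).exists_circuit
  refine ⟨g, PolyTime.expTime ?_, hg⟩
  obtain ⟨MA⟩ := hA
  obtain ⟨MB⟩ := hB
  obtain ⟨MC⟩ := hC
  let f : Fin 3 → ℕ → List Bool := fun i n =>
    match i with
    | 0 => (A n).encode
    | 1 => (B n).encode
    | 2 => (C n).encode
  let M : ∀ i, TM2ComputableInPolyTime Computability.unaryEncodeNat id (f i) := fun i =>
    match i with
    | 0 => MA
    | 1 => MB
    | 2 => MC
  let κ : Fin 3 → ℕ → List RawGate := fun i n =>
    match i with
    | 0 => (A n).raw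
    | 1 => (B n).raw
    | 2 => (C n).raw
  -- A supply of `q₀ + q₁ + q₂` loop variables suffices for each of the three powers, which may
  -- share them since their loops are not nested in one another.
  have h := StrExpr.polyTime_val_fetch (X := GenVar (q₀ + q₁ + q₂) ⊕ Fin 3) (n := strVar 0)
    (a₀ := strVar 1) (s₀ := .inr 0) (a₁ := strVar 2) (s₁ := .inr 1) (a₂ := strVar 3) (s₂ := .inr 2)
    (by simp) M ![a, fun n => n + b n, fun n => c n + n]
    (fun i n => (κ i n).flatMap RawGate.encode) (fun i n => by
      fin_cases i
      · exact (A n).encode_eq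
      · exact (B n).encode_eq
      · exact (C n).encode_eq) _ (wf_generatorStr (q₀ + q₁ + q₂) q₀ q₁ q₂)
  have he : ∀ l : ℕ, (StrExpr.fetchedEnv (strVar 0) (strVar 1) (.inr 0) (strVar 2) (.inr 1)
      (strVar 3) (.inr 2) ![a, fun n => n + b n, fun n => c n + n]
      (fun i n => (κ i n).flatMap RawGate.encode) l : GenVar (q₀ + q₁ + q₂) ⊕ Fin 3 → List Bool) =
      CircExpr.strEnv (fun i => κ i (l + l))
        (headerEnv l (a (l + l)) (l + l + b (l + l)) (c (l + l) + (l + l))) := by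
    intro l
    funext v
    rcases v with (v | v) | k
    · fin_cases v <;> simp [CircExpr.strEnv, headerEnv, StrExpr.fetchedEnv]
    · simp [CircExpr.strEnv, headerEnv, StrExpr.fetchedEnv]
    · fin_cases k <;> simp [CircExpr.strEnv, StrExpr.fetchedEnv]
  simp only [he, val_generatorStr (m := q₀ + q₁ + q₂) (q₀ := q₀) (q₁ := q₁) (q₂ := q₂) (by omega)
    (by omega) (by omega)] at h
  have hval : (fun l => (g l).encode) = fun l => false :: ((generator l (l ^ q₀)
      (4 * l ^ q₂ + 2 * l ^ q₁) (2 * l ^ q₂ + 2 * l ^ q₁) (2 * l ^ q₂ + 1) (l + l + b (l + l))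
      (c (l + l) + (l + l)) (κ 0 (l + l)) (κ 1 (l + l)) (κ 2 (l + l))).flatMap
        RawGate.encode ++ [false]) := by
    funext l
    rw [Circuit.encode_eq, hg, hA']
    rfl
  rw [PolyTime, hval]
  exact h

theorem eventually_gameBias_lt (s : ∀ l : ℕ, Bits (l + l))
    (hs : ExpTimeIngenerable (fun l => l + l) s) {b c a : ℕ → ℕ}
    {A : ∀ n, Circuit stdGates (a n) (b n + c n)} {B : ∀ n, Circuit stdGates (n + b n) 1}
    {C : ∀ n, Circuit stdGates (c n + n) 1} (hA : PolyTime A) (hB : PolyTime B) (hC : PolyTime C)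
    (A' : ∀ l, Circuit stdGates l (b (l + l) + c (l + l)))
    (hA' : ∀ l, (A' l).raw = (A (l + l)).raw) (r : ℕ) :
    ∀ᶠ l : ℕ in Filter.atTop, gameBias (A' l).eval (B (l + l)).eval (C (l + l)).eval
      (fstHalf (s l)) (sndHalf (s l)) < ((l : ℝ) ^ r)⁻¹ := by
  -- The polynomial is tied to the gate set alone and not to the circuits, so the exponents of the
  -- generator may depend on its degree.
  obtain ⟨p, hp⟩ := hs genGates
  obtain ⟨g, hg, hgraw⟩ := exists_expTime_generator hA hB hC A' hA' (p.natDegree + 1)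
    (r + (p.natDegree + 2)) (r + (r + (p.natDegree + 2)))
  filter_upwards [hp g hg, eventually_le_generator r p.natDegree p le_rfl] with l h₁ h₂
  by_contra! hle
  have h₃ := h₂ _ _ _ _ _ (A' l).isChannel_eval (B (l + l)).isChannel_eval
    (C (l + l)).isChannel_eval (s l) _ _ _ rfl rfl rfl hle
  have h₄ := le_prob_generator (A' l) (B (l + l)) (C (l + l)) (by omega) (by omega) _ (g l)
    (hgraw l) (s l)
  have e : ∀ M R : ℕ, 4 * M + 2 * R - (2 * M + 2 * R) = 2 * M := fun M R => by omega
  rw [e] at h₄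
  exact absurd h₁ (not_lt.2 (h₃.trans h₄))

theorem uncloneable_wiesnerAdvice (s : ∀ l : ℕ, Bits (l + l))
    (hs : ExpTimeIngenerable (fun l => l + l) s) (b c : ℕ → ℕ)
    (A : ∀ n, Circuit stdGates (wiesnerAdvice s n).qubits (b n + c n))
    (B : ∀ n, Circuit stdGates (n + b n) 1) (C : ∀ n, Circuit stdGates (c n + n) 1)
    (hA : PolyTime A) (hB : PolyTime B) (hC : PolyTime C) :
    ∃ η : ℕ → ℝ, Negligible η ∧ ∀ n : ℕ, (∃ x : Bits n, (⟨n, x⟩ : BitString) ∈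
      (ipProblem s).instances) → splitSuccess (ipProblem s) (wiesnerAdvice s n) n (b n) (c n) (A n)
        (B n) (C n) ≤ 1 / 2 + η n := by
  have hq : ∀ l, (wiesnerAdvice s (l + l)).qubits = l := fun l => by
    rw [wiesnerAdvice_double]; rfl
  -- The advice has `l` qubits only up to a propositional equality; passing through the list of
  -- gates gives circuits whose type says so.
  choose A' hA' using fun l => (show RawValid stdGates l (A (l + l)).raw (b (l + l) + c (l + l))
    from (congrArg (fun k => RawValid stdGates k (A (l + l)).raw (b (l + l) + c (l + l)))
      (hq l)).mp (A (l + l)).rawValid).exists_circuit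
  classical
  -- The excess over `1 / 2` itself serves as the error function; only its negligibility has to be
  -- proved.
  refine ⟨fun n => if ∃ x : Bits n, (⟨n, x⟩ : BitString) ∈ (ipProblem s).instances then
    splitSuccess (ipProblem s) (wiesnerAdvice s n) n (b n) (c n) (A n) (B n) (C n) - 1 / 2 else 0,
    fun r => ?_, fun n hn => ?_⟩
  -- Instances have length `2 * l`, and `(2 * l) ^ r ≤ l ^ (2 * r)` for `l ≥ 2`; the doubled
  -- exponent absorbs the factor two.
  · have h := eventually_gameBias_lt s hs hA hB hC A' hA' (2 * r)
    have hhalf : Filter.Tendsto (fun n : ℕ => n / 2) Filter.atTop Filter.atTop :=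
      Filter.tendsto_atTop_atTop.2 fun m => ⟨2 * m, fun n hn => by omega⟩
    filter_upwards [hhalf.eventually h, Filter.eventually_ge_atTop 4] with n hbias hn
    by_cases hx : ∃ x : Bits n, (⟨n, x⟩ : BitString) ∈ (ipProblem s).instances
    · rw [if_pos hx]
      obtain ⟨l, rfl⟩ : ∃ l, n = l + l := by
        obtain ⟨x, ⟨l, y, -, e⟩ | ⟨l, y, -, e⟩⟩ := hx <;> exact ⟨l, congrArg Sigma.fst e⟩
      rw [show (l + l) / 2 = l by omega] at hbias
      have h₁ := splitSuccess_le s (wiesnerAdvice_double s l) (A (l + l)) (A' l) (hA' l) (B (l + l))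
        (C (l + l))
      have hl : (2 : ℝ) ≤ l := by exact_mod_cast (by omega : 2 ≤ l)
      have h₂ : ((l : ℝ) ^ (2 * r))⁻¹ ≤ ((↑(l + l) : ℝ) ^ r)⁻¹ := by
        rw [pow_mul]
        push_cast
        refine inv_anti₀ (by positivity) (pow_le_pow_left₀ (by positivity) (by nlinarith) r)
      have h₃ : (0 : ℝ) ≤ ((↑(l + l) : ℝ) ^ r)⁻¹ := by positivity
      linarith
    · rw [if_neg hx]
      positivity
  · simp only [if_pos hn]
    linarith

theorem isUncloneableAdvice_wiesnerAdvice (s : ∀ l : ℕ, Bits (l + l))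
    (hs : ExpTimeIngenerable (fun l => l + l) s) :
    IsUncloneableAdvice (ipProblem s) (wiesnerAdvice s) where
  poly_size := by
    refine ⟨Polynomial.X, fun n => ?_⟩
    rw [Polynomial.eval_X]
    obtain ⟨l, rfl | rfl⟩ : ∃ l, n = l + l ∨ n = l + l + 1 := ⟨n / 2, by omega⟩
    · rw [wiesnerAdvice_double]
      exact Nat.le_add_left l l
    · rw [wiesnerAdvice_qubits_odd]
      exact Nat.zero_le _
  correct := correct_wiesnerAdvice s
  uncloneable := uncloneable_wiesnerAdvice s hs

end

end QAdvice

theorem mainTheorem1 (s : ∀ l : ℕ, QAdvice.Bits (l + l))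
    (hs : QAdvice.ExpTimeIngenerable (fun l => l + l) s) :
    QAdvice.ipProblem s ∈ QAdvice.NeglQPUpoly ∧
      QAdvice.IsUncloneableAdvice (QAdvice.ipProblem s) (QAdvice.wiesnerAdvice s) :=
  ⟨⟨_, QAdvice.isUncloneableAdvice_wiesnerAdvice s hs⟩,
    QAdvice.isUncloneableAdvice_wiesnerAdvice s hs⟩
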